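/- \textbf{Setting.} Let $\Bbbk$ be a field and let $(H,R)$ be a quasitriangular Hopf algebra over $\Bbbk$: $R=R^1\otimes R^2\in H\otimes H$ satisfies $\Delta(R^1)\otimes R^2=R^1\otimes r^1\otimes R^2r^2$, $R^1\otimes\Delta(R^2)=R^1r^1\otimes r^2\otimes R^2$, $\varepsilon(R^1)R^2=1=R^1\varepsilon(R^2)$ and $\Delta^{cop}(h)R=R\Delta(h)$ for all $h\in H$ (where $r=R$). Let $V$ be a finite-dimensional $H$-module, regarded as a Yetter--Drinfeld module over $H$ with coaction $x_{(-1)}\otimes x_{(0)}=R^2\otimes R^1x$. Let $\overline V=V^*$ be the Yetter--Drinfeld module with action $\langle hy,x\rangle=\langle y,\mathcal S(h)x\rangle$ and coaction $y_{(-1)}\otimes y_{(0)}=\mathcal S(R^1)\otimes R^2y$. For a Yetter--Drinfeld module $W$, the Nichols algebra is $\mathfrak B(W)=T(W)/\mathcal J(W)$, where $\mathcal J(W)$ is the largest Hopf ideal of the braided Hopf algebra $T(W)$ (with $\Delta(w)=w\otimes1+1\otimes w$ for $w\in W$) generated as an ideal by homogeneous elements of degree $\ge2$. Let $R_{(l)}=\{R^1f(R^2)\mid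 f\in H^*\}$ and $R_{(r)}=\{f(R^1)R^2\mid f\in H^*\}$, and let $\langle a,b\rangle$, for $a\in R_{(l)}$ and $b\in R_{(r)}$, be the pairing with $\langle a,p(R^1)R^2\rangle=p(a)$ for all $p\in H^*$. The algebra $\mathfrak u=\mathfrak u_{(H,R)}(V)$ is the quotient of the smash product $T(V\oplus\overline V)\#H$ by the relations $\mathcal J(V)=0$, $\mathcal J(\overline V)=0$ and, for all $y\in\overline V$ and $x\in V$, $$yx-(y_{(-1)}\cdot x)\,y_{(0)}-\langle y,x\rangle+\langle y_{(-2)},x_{(-3)}\rangle\,\langle y_{(0)},\mathcal S(x_{(-1)})\cdot x_{(0)}\rangle\;x_{(-2)}\,y_{(-1)}=0 .$$ It is $\mathbb Z$-graded by $\deg V=-1$, $\deg H=0$, $\deg\overline V=1$. Graded modules are finite-dimensional $\mathbb Z$-graded left modules, with the homomorphisms of degree $0$ as morphisms; the shift is $(N[d])_n=N_{n-d}$. Let $B^+\subseteq\mathfrak u$ be the subalgebra generated by $\overline V$ and $H$. For a simple $H$-module $\lambda$, the proper standard module is $\overline{M}(\lambda)=\mathfrak u\otimes_{B^+}\lambda$,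 where $B^+$ acts on $\lambda$ through the projection $B^+\to H$ killing the elements of positive degree, graded with $1\otimes\lambda$ in degree $0$. Its head (the quotient by its Jacobson radical, the intersection of all maximal submodules) is denoted by $L(\lambda)$. \textbf{Theorem.} Assume that $H$ and $\mathfrak B(V)$ are finite-dimensional and let $\Lambda$ be a complete set of non-isomorphic simple $H$-modules. Assume that $H$ is split, i.e. $\operatorname{End}_H(\lambda)=\Bbbk$ for all $\lambda\in\Lambda$. Then $\overline M(\lambda)$ and $L(\lambda)$ are finite-dimensional graded $\mathfrak u$-modules, and the modules $L(\lambda)[d]$, $(\lambda,d)\in\Lambda\times\mathbb Z$, form a complete set of non-isomorphic simple graded $\mathfrak u$-modules. If moreover $H$ is semisimple, then the category of graded $\mathfrak u$-modules is a highest weight category with set of weights $\Lambda\times\mathbb Z$, ordered by $(\lambda,i)<(\mu,j)$ if and only if $i<j$, and standard objects $\overline M(\lambda)[d]$. That is: it is an abelian $\Bbbk$-linear category with enough projectives, with finite-dimensional spaces of morphisms and all objects of finite length; the poset of weights is interval finite; and for each weight $w=(\lambda,d)$, writing $L(w)=L(\lambda)[d]$ and $\Delta(w)=\overline M(\lambda)[d]$: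 (a) $\Delta(w)$ has $L(w)$ as a quotient, and the composition factors $L(v)$ of the kernel satisfy $v<w$; (b) $L(w)$ has a projective cover $P(w)$, whose covering map factors through an epimorphism $P(w)\to\Delta(w)$ the kernel of which has a finite filtration with subquotients of the form $\Delta(v)$, $v>w$. -/

import Mathlib

open scoped TensorProduct
open CategoryTheory

universe u v

namespace QTDouble

noncomputable section

/-! ### Quasitriangular Hopf algebras -/

section Quasitriangular

variable {k H : Type u} [Field k] [Ring H] [HopfAlgebra k H]

/-- `a ⊗ b ↦ a ⊗ b ⊗ 1`. -/
def leg12 : H ⊗[k] H →ₐ[k] H ⊗[k] (H ⊗[k] H) :=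
  Algebra.TensorProduct.map (AlgHom.id k H) Algebra.TensorProduct.includeLeft

/-- `a ⊗ b ↦ a ⊗ 1 ⊗ b`. -/
def leg13 : H ⊗[k] H →ₐ[k] H ⊗[k] (H ⊗[k] H) :=
  Algebra.TensorProduct.map (AlgHom.id k H) Algebra.TensorProduct.includeRight

/-- `a ⊗ b ↦ 1 ⊗ a ⊗ b`. -/
def leg23 : H ⊗[k] H →ₐ[k] H ⊗[k] (H ⊗[k] H) :=
  Algebra.TensorProduct.includeRight

/-- `R = R¹ ⊗ R²` is an `R`-matrix of the Hopf algebra `H`, i.e. `(H, R)` is quasitriangular. -/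
structure IsQuasitriangular (R : H ⊗[k] H) : Prop where
  /-- `Δ(R¹) ⊗ R² = R¹ ⊗ r¹ ⊗ R² r²` -/
  comul_left : TensorProduct.assoc k H H H (LinearMap.rTensor H Coalgebra.comul R)
    = leg13 R * leg23 R
  /-- `ε(R¹) R² = 1` -/
  counit_left : TensorProduct.lid k H (LinearMap.rTensor H Coalgebra.counit R) = 1
  /-- `R¹ ⊗ Δ(R²) = R¹ r¹ ⊗ r² ⊗ R²` -/
  comul_right : LinearMap.lTensor H Coalgebra.comul R = leg13 R * leg12 R
  /-- `R¹ ε(R²) = 1` -/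
  counit_right : TensorProduct.rid k H (LinearMap.lTensor H Coalgebra.counit R) = 1
  /-- `Δᶜᵒᵖ(h) R = R Δ(h)` -/
  comul_op_mul : ∀ h : H,
    TensorProduct.comm k H H (Coalgebra.comul (R := k) h) * R = R * Coalgebra.comul (R := k) h

/-- The map `H* → H`, `p ↦ p(R¹) R²`. It factors through a bijection from the dual of
`R_(l) = {R¹ f(R²)}` onto its image `R_(r) = {f(R¹) R²}`. -/
def evalLeft (R : H ⊗[k] H) : Module.Dual k H →ₗ[k] H where
  toFun p := TensorProduct.lid k H (LinearMap.rTensor H p R)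
  map_add' p q := by simp [LinearMap.rTensor_add]
  map_smul' c p := by simp [LinearMap.rTensor_smul]

theorem exists_evalLeft_section (R : H ⊗[k] H) :
    ∃ σ : H →ₗ[k] Module.Dual k H, ∀ p, evalLeft R (σ (evalLeft R p)) = evalLeft R p := by
  obtain ⟨s, hs⟩ := (evalLeft R).rangeRestrict.exists_rightInverse_of_surjective
    (LinearMap.range_rangeRestrict _)
  obtain ⟨π, hπ⟩ := (LinearMap.range (evalLeft R)).subtype.exists_leftInverse_of_injective
    (Submodule.ker_subtype _)
  refine ⟨s ∘ₗ π, fun p => ?_⟩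
  have h1 : π (evalLeft R p) = (evalLeft R).rangeRestrict p :=
    LinearMap.congr_fun hπ ((evalLeft R).rangeRestrict p)
  have h2 := LinearMap.congr_fun hs ((evalLeft R).rangeRestrict p)
  have h3 := congrArg Subtype.val h2
  simpa [h1] using h3

/-- The pairing `R_(l) ⊗ R_(r) → k`, `⟨a, b⟩ = ψ(b)(a)`, where `ψ : R_(r) → R_(l)*` is the
inverse of `p ↦ p(R¹) R²`. It is written as a bilinear form on `H` by means of a linear section of
`p ↦ p(R¹) R²`; for `a ∈ R_(l)` and `b = p(R¹) R² ∈ R_(r)` its value is `p(a)`, whatever the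
section is, and it is only used on such pairs. -/
def pairing (R : H ⊗[k] H) : H →ₗ[k] H →ₗ[k] k :=
  LinearMap.flip (exists_evalLeft_section R).choose

/-- The independence of the section that the definition of `pairing` rests on. -/
theorem pairing_eq (R : H ⊗[k] H) (p f : Module.Dual k H) :
    pairing R (TensorProduct.rid k H (LinearMap.lTensor H f R)) (evalLeft R p)
      = p (TensorProduct.rid k H (LinearMap.lTensor H f R)) := by
  have key : ∀ q : Module.Dual k H,
      q (TensorProduct.rid k H (LinearMap.lTensor H f R)) = f (evalLeft R q) := by
    intro q
    simp only [evalLeft, LinearMap.coe_mk, AddHom.coe_mk]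
    induction R using TensorProduct.induction_on with
    | zero => simp
    | tmul a b => simp [mul_comm]
    | add a b ha hb => simp only [map_add, ha, hb]
  have h := (exists_evalLeft_section R).choose_spec p
  simp only [pairing, LinearMap.flip_apply]
  rw [key, key, h]

end Quasitriangular

/-! ### Module algebras and smash products -/

section Smash

/-- A left `H`-module algebra structure on the algebra `A`. -/
structure ModuleAlgebra (k H A : Type u) [Field k] [Ring H] [HopfAlgebra k H]
    [Ring A] [Algebra k A] where
  /-- the action of `H` -/
  act : H →ₐ[k] Module.End k A
  /-- `h · 1 = ε(h) 1` -/
  act_one : ∀ h, act h 1 = algebraMap k A (Coalgebra.counit h)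
  /-- `h · (a b) = (h₁ · a) (h₂ · b)` -/
  act_mul : ∀ h a b, act h (a * b) = LinearMap.mul' k A
    (TensorProduct.map (act.toLinearMap.flip a) (act.toLinearMap.flip b) (Coalgebra.comul h))

variable {k H A : Type u} [Field k] [Ring H] [HopfAlgebra k H] [Ring A] [Algebra k A]

/-- The smash product `A # H`: the space `A ⊗ H` with
`(x # h) (x' # h') = x (h₁ · x') # h₂ h'`. -/
@[nolint unusedArguments]
def Smash (_α : ModuleAlgebra k H A) : Type u := A ⊗[k] H

namespace Smash

variable (α : ModuleAlgebra k H A)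

instance : AddCommGroup (Smash α) := inferInstanceAs (AddCommGroup (A ⊗[k] H))
instance : Module k (Smash α) := inferInstanceAs (Module k (A ⊗[k] H))

/-- `h ↦ (x' ⊗ h' ↦ h₁ · x' ⊗ h₂ h')`. -/
def hAct : H →ₐ[k] Module.End k (A ⊗[k] H) :=
  (Module.endTensorEndAlgHom (R := k) (S := k) (A := k) (M := A) (N := H)).comp
    ((Algebra.TensorProduct.map α.act (Algebra.lmul k H)).comp (Bialgebra.comulAlgHom k H))

/-- `x ↦ (x' ⊗ h' ↦ x x' ⊗ h')`. -/
def aAct : A →ₐ[k] Module.End k (A ⊗[k] H) :=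
  (Module.endTensorEndAlgHom (R := k) (S := k) (A := k) (M := A) (N := H)).comp
    (Algebra.TensorProduct.includeLeft.comp (Algebra.lmul k A))

/-- The product of `A # H` as a bilinear map:
`x # h` acts on `x' # h'` by `x (h₁ · x') # h₂ h'`. -/
def mulMap : A ⊗[k] H →ₗ[k] Module.End k (A ⊗[k] H) :=
  LinearMap.mul' k _ ∘ₗ TensorProduct.map (aAct (k := k) (H := H) (A := A)).toLinearMap
    (hAct α).toLinearMap

theorem hAct_tmul (h : H) (x : A) (g : H) :
    hAct α h (x ⊗ₜ g) =
      TensorProduct.map (α.act.toLinearMap.flip x) ((LinearMap.mul k H).flip g)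
        (Coalgebra.comul (R := k) h) := by
  simp only [hAct, AlgHom.comp_apply, Bialgebra.comulAlgHom_apply]
  induction (Coalgebra.comul (R := k) h) using TensorProduct.induction_on with
  | zero => simp
  | tmul a b =>
    rw [Algebra.TensorProduct.map_tmul, Module.endTensorEndAlgHom_apply]
    simp
  | add a b ha hb => simp only [map_add, LinearMap.add_apply, ha, hb]

theorem aAct_tmul (x y : A) (g : H) :
    aAct (k := k) x (y ⊗ₜ[k] g) = (x * y) ⊗ₜ g := by
  rw [aAct, AlgHom.comp_apply, AlgHom.comp_apply, Algebra.TensorProduct.includeLeft_apply,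
    Module.endTensorEndAlgHom_apply]
  simp

theorem mulMap_tmul (x : A) (h : H) :
    mulMap α (x ⊗ₜ h) = aAct x * hAct α h := by
  simp [mulMap]

theorem hAct_one_tmul_one (h : H) : hAct α h (1 ⊗ₜ 1) = 1 ⊗ₜ h := by
  rw [hAct_tmul]
  have e1 : α.act.toLinearMap.flip 1 = Algebra.linearMap k A ∘ₗ Coalgebra.counit := by
    ext h; simp [α.act_one]
  have e2 : (LinearMap.mul k H).flip 1 = LinearMap.id := by ext; simp
  rw [e1, e2]
  have := congrArg (TensorProduct.map (Algebra.linearMap k A) (LinearMap.id (M := H)))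
    (Coalgebra.rTensor_counit_comul (R := k) h)
  rw [LinearMap.rTensor, ← LinearMap.comp_apply, ← TensorProduct.map_comp] at this
  simpa using this

theorem hAct_mul_aAct (h : H) (x : A) :
    hAct α h * aAct x =
      LinearMap.mul' k _ (TensorProduct.map
        ((aAct (k := k) (H := H)).toLinearMap ∘ₗ α.act.toLinearMap.flip x)
        (hAct α).toLinearMap (Coalgebra.comul (R := k) h)) := by
  apply TensorProduct.ext'
  intro y g
  rw [Module.End.mul_apply, aAct_tmul, hAct_tmul]
  set G : H ⊗[k] (H ⊗[k] H) →ₗ[k] A ⊗[k] H :=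
    TensorProduct.map (LinearMap.mul' k A ∘ₗ
      TensorProduct.map (α.act.toLinearMap.flip x) (α.act.toLinearMap.flip y))
      ((LinearMap.mul k H).flip g) ∘ₗ (TensorProduct.assoc k H H H).symm.toLinearMap with hG
  have hL : ∀ t : H ⊗[k] H,
      TensorProduct.map (α.act.toLinearMap.flip (x * y)) ((LinearMap.mul k H).flip g) t =
        G (TensorProduct.assoc k H H H (LinearMap.rTensor H Coalgebra.comul t)) := by
    intro t
    induction t using TensorProduct.induction_on with
    | zero => simp
    | tmul a b => simp [hG, α.act_mul]
    | add a b ha hb => simp only [map_add, ha, hb]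
  have hR : ∀ t : H ⊗[k] H,
      (LinearMap.mul' k _ (TensorProduct.map
        ((aAct (k := k) (H := H)).toLinearMap ∘ₗ α.act.toLinearMap.flip x)
        (hAct α).toLinearMap t)) (y ⊗ₜ g) = G (LinearMap.lTensor H Coalgebra.comul t) := by
    intro t
    induction t using TensorProduct.induction_on with
    | zero => simp
    | tmul a b =>
      simp only [TensorProduct.map_tmul, LinearMap.mul'_apply, Module.End.mul_apply,
        AlgHom.toLinearMap_apply, LinearMap.comp_apply, LinearMap.lTensor_tmul, hAct_tmul]
      induction (Coalgebra.comul (R := k) b) using TensorProduct.induction_on with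
      | zero => simp
      | tmul c d => simp [hG, aAct_tmul]
      | add c d hc hd => simp only [map_add, TensorProduct.tmul_add, hc, hd]
    | add a b ha hb => simp only [map_add, LinearMap.add_apply, ha, hb]
  rw [hL, hR, Coalgebra.coassoc_apply]

theorem mulMap_mulMap (s t : A ⊗[k] H) :
    mulMap α (mulMap α s t) = mulMap α s * mulMap α t := by
  have key : ∀ (h : H) (t : A ⊗[k] H),
      mulMap α (hAct α h t) = hAct α h * mulMap α t := by
    intro h t
    induction t using TensorProduct.induction_on with
    | zero => simp
    | tmul y g =>
      rw [mulMap_tmul, ← mul_assoc, hAct_mul_aAct, hAct_tmul]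
      induction (Coalgebra.comul (R := k) h) using TensorProduct.induction_on with
      | zero => simp
      | tmul c d => simp [mulMap_tmul, mul_assoc]
      | add c d hc hd => simp only [map_add, add_mul, hc, hd]
    | add a b ha hb => simp only [map_add, mul_add, ha, hb]
  have key2 : ∀ (x : A) (t : A ⊗[k] H), mulMap α (aAct x t) = aAct x * mulMap α t := by
    intro x t
    induction t using TensorProduct.induction_on with
    | zero => simp
    | tmul y g => rw [aAct_tmul, mulMap_tmul, mulMap_tmul, map_mul, mul_assoc]
    | add a b ha hb => simp only [map_add, mul_add, ha, hb]
  induction s using TensorProduct.induction_on with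
  | zero => simp
  | tmul x h => rw [mulMap_tmul, Module.End.mul_apply, key2, key, mul_assoc]
  | add a b ha hb => simp only [map_add, LinearMap.add_apply, add_mul, ha, hb]

theorem mulMap_apply_one (s : A ⊗[k] H) : mulMap α s (1 ⊗ₜ 1) = s := by
  induction s using TensorProduct.induction_on with
  | zero => simp
  | tmul x h =>
    rw [mulMap_tmul, Module.End.mul_apply, hAct_one_tmul_one, aAct_tmul, mul_one]
  | add a b ha hb => simp only [map_add, LinearMap.add_apply, ha, hb]

instance : Mul (Smash α) := ⟨fun s t => mulMap α s t⟩
instance : One (Smash α) := ⟨((1 : A) ⊗ₜ[k] (1 : H) : A ⊗[k] H)⟩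

theorem mul_def (s t : Smash α) : s * t = mulMap α s t := rfl
theorem one_def : (1 : Smash α) = ((1 : A) ⊗ₜ[k] (1 : H) : A ⊗[k] H) := rfl

instance : Ring (Smash α) where
  __ := (inferInstance : AddCommGroup (Smash α))
  mul_assoc s t r := LinearMap.congr_fun (mulMap_mulMap α s t) r
  one_mul s := by
    have h : mulMap α ((1 : A) ⊗ₜ[k] (1 : H)) = 1 := by
      rw [mulMap_tmul, map_one, map_one, one_mul]
    exact LinearMap.congr_fun h s
  mul_one s := mulMap_apply_one α s
  left_distrib s t r := map_add (mulMap α s) t r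
  right_distrib s t r := LinearMap.congr_fun (map_add (mulMap α) s t) r
  zero_mul s := LinearMap.congr_fun (map_zero (mulMap α)) s
  mul_zero s := map_zero (mulMap α s)

instance : Algebra k (Smash α) :=
  Algebra.ofModule
    (fun r s t => LinearMap.congr_fun (map_smul (mulMap α) r s) t)
    (fun r s t => map_smul (mulMap α s) r t)

/-- `x ↦ x # 1`. -/
def inA : A →ₐ[k] Smash α :=
  AlgHom.ofLinearMap ((TensorProduct.mk k A H).flip 1) rfl (by
    intro x y
    change (x * y) ⊗ₜ[k] (1 : H) = mulMap α (x ⊗ₜ 1) (y ⊗ₜ 1)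
    rw [mulMap_tmul, map_one, mul_one, aAct_tmul])

/-- `h ↦ 1 # h`. -/
def inH : H →ₐ[k] Smash α :=
  AlgHom.ofLinearMap (TensorProduct.mk k A H 1) rfl (by
    intro g h
    change (1 : A) ⊗ₜ[k] (g * h) = mulMap α (1 ⊗ₜ g) (1 ⊗ₜ h)
    rw [mulMap_tmul, map_one, one_mul, ← hAct_one_tmul_one α h, ← Module.End.mul_apply,
      ← map_mul, hAct_one_tmul_one])

end Smash

end Smash

/-! ### Yetter-Drinfeld data and Nichols algebras

A Yetter-Drinfeld module over `H` is given by a space `W`, an action `ρ` and a coaction `δ`. -/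

section Nichols

variable {k H W : Type u} [Field k] [Ring H] [HopfAlgebra k H] [AddCommGroup W] [Module k W]

open TensorAlgebra (ι)

/-- The action of `H` on `T(W)` induced by an action on `W`, as a map
`t ↦ (h ↦ h · t)`. It is the algebra map into the convolution algebra of linear maps `H → T(W)`
that extends `w ↦ (h ↦ h · w)`, which says that `h · 1 = ε(h)` and
`h · (s t) = (h₁ · s) (h₂ · t)`. -/
def tensorActAux (ρ : H →ₐ[k] Module.End k W) :
    TensorAlgebra k W →ₐ[k] WithConv (H →ₗ[k] TensorAlgebra k W) :=
  TensorAlgebra.lift k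
    { toFun := fun w => WithConv.toConv (ι k ∘ₗ ρ.toLinearMap.flip w)
      map_add' := fun x y => by
        apply WithConv.ofConv_injective
        ext h; simp
      map_smul' := fun c x => by
        apply WithConv.ofConv_injective
        ext h; simp }

/-- The value `h · t` of the induced action of `H` on `T(W)`. -/
def tensorActFun (ρ : H →ₐ[k] Module.End k W) (h : H) (t : TensorAlgebra k W) :
    TensorAlgebra k W :=
  (tensorActAux ρ t).ofConv h

section
variable (ρ : H →ₐ[k] Module.End k W)

theorem tensorActFun_ι (h : H) (w : W) : tensorActFun ρ h (ι k w) = ι k (ρ h w) := by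
  simp [tensorActFun, tensorActAux]

theorem tensorActFun_algebraMap (h : H) (r : k) :
    tensorActFun ρ h (algebraMap k _ r) = algebraMap k _ (r * Coalgebra.counit h) := by
  rw [tensorActFun, AlgHom.commutes, Algebra.algebraMap_eq_smul_one]
  simp [Algebra.smul_def]

theorem tensorActFun_one (h : H) :
    tensorActFun ρ h 1 = algebraMap k _ (Coalgebra.counit h) := by
  simpa using tensorActFun_algebraMap ρ h 1

theorem tensorActFun_add (h : H) (s t : TensorAlgebra k W) :
    tensorActFun ρ h (s + t) = tensorActFun ρ h s + tensorActFun ρ h t := by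
  simp [tensorActFun]

theorem tensorActFun_mul (h : H) (s t : TensorAlgebra k W) :
    tensorActFun ρ h (s * t) = LinearMap.mul' k _
      (TensorProduct.map (tensorActAux ρ s).ofConv (tensorActAux ρ t).ofConv
        (Coalgebra.comul h)) := by
  rw [tensorActFun, map_mul, LinearMap.convMul_apply]

theorem one_tensorActFun (t : TensorAlgebra k W) : tensorActFun ρ 1 t = t := by
  induction t using TensorAlgebra.induction with
  | algebraMap r => simp [tensorActFun_algebraMap]
  | ι w => simp [tensorActFun_ι]
  | mul a b ha hb =>
    rw [tensorActFun_mul, Bialgebra.comul_one]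
    change tensorActFun ρ 1 a * tensorActFun ρ 1 b = a * b
    rw [ha, hb]
  | add a b ha hb => rw [tensorActFun_add, ha, hb]

theorem mul_tensorActFun (g h : H) (t : TensorAlgebra k W) :
    tensorActFun ρ (g * h) t = tensorActFun ρ g (tensorActFun ρ h t) := by
  induction t using TensorAlgebra.induction generalizing g h with
  | algebraMap r =>
    rw [tensorActFun_algebraMap, tensorActFun_algebraMap, tensorActFun_algebraMap,
      Bialgebra.counit_mul]
    congr 1
    ring
  | ι w => simp [tensorActFun_ι]
  | mul a b ha hb =>
    rw [tensorActFun_mul, tensorActFun_mul, Bialgebra.comul_mul]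
    induction (Coalgebra.comul (R := k) h) using TensorProduct.induction_on with
    | zero => simp [tensorActFun]
    | tmul c d =>
      simp only [TensorProduct.map_tmul, LinearMap.mul'_apply]
      change _ = tensorActFun ρ g (tensorActFun ρ c a * tensorActFun ρ d b)
      rw [tensorActFun_mul]
      induction (Coalgebra.comul (R := k) g) using TensorProduct.induction_on with
      | zero => simp
      | tmul e f =>
        simp only [Algebra.TensorProduct.tmul_mul_tmul, TensorProduct.map_tmul,
          LinearMap.mul'_apply]
        exact congrArg₂ (· * ·) (ha e c) (hb f d)
      | add x y hx hy => simp only [add_mul, map_add, hx, hy]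
    | add x y hx hy => simp only [mul_add, map_add, tensorActFun_add, hx, hy]
  | add a b ha hb => simp only [tensorActFun_add, ha, hb]

/-- `T(W)` as an `H`-module algebra. -/
def tensorModuleAlgebra : ModuleAlgebra k H (TensorAlgebra k W) where
  act := AlgHom.ofLinearMap
    { toFun := fun h =>
        { toFun := fun t => tensorActFun ρ h t
          map_add' := fun s t => tensorActFun_add ρ h s t
          map_smul' := fun c t => by simp [tensorActFun] }
      map_add' := fun g h => by ext t; simp [tensorActFun]
      map_smul' := fun c h => by ext t; simp [tensorActFun] }
    (LinearMap.ext fun t => one_tensorActFun ρ t)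
    (fun g h => LinearMap.ext fun t => mul_tensorActFun ρ g h t)
  act_one := tensorActFun_one ρ
  act_mul := tensorActFun_mul ρ

/-- The action of `H` on `T(W)`. -/
abbrev tensorAct : H →ₐ[k] Module.End k (TensorAlgebra k W) := (tensorModuleAlgebra ρ).act

variable (δ : W →ₗ[k] H ⊗[k] W)

/-- The coaction on `T(W)`, the algebra map that extends `w ↦ w₍₋₁₎ ⊗ w₍₀₎`. -/
def tensorCoact : TensorAlgebra k W →ₐ[k] H ⊗[k] TensorAlgebra k W :=
  TensorAlgebra.lift k (LinearMap.lTensor H (ι k) ∘ₗ δ)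

/-- Left multiplication by `Δ(w) = w ⊗ 1 + 1 ⊗ w` in the braided tensor product algebra
`T(W) ⊗ T(W)`, whose product is `(a ⊗ b) (c ⊗ d) = a (b₍₋₁₎ · c) ⊗ b₍₀₎ d`:
`c ⊗ d ↦ w c ⊗ d + (w₍₋₁₎ · c) ⊗ w₍₀₎ d`. -/
def mulComul : W →ₗ[k] Module.End k (TensorAlgebra k W ⊗[k] TensorAlgebra k W) :=
  LinearMap.rTensorHom (TensorAlgebra k W) ∘ₗ LinearMap.mul k (TensorAlgebra k W) ∘ₗ ι k +
  TensorProduct.homTensorHomMap (RingHom.id k) (TensorAlgebra k W) (TensorAlgebra k W)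
      (TensorAlgebra k W) (TensorAlgebra k W) ∘ₗ
    TensorProduct.map (tensorAct ρ).toLinearMap (LinearMap.mul k (TensorAlgebra k W) ∘ₗ ι k) ∘ₗ δ

/-- The comultiplication of the braided Hopf algebra `T(W)`: `Δ(1) = 1 ⊗ 1` and
`Δ(w t) = Δ(w) Δ(t)` for `w ∈ W`. -/
def braidedComul : TensorAlgebra k W →ₗ[k] TensorAlgebra k W ⊗[k] TensorAlgebra k W :=
  (TensorAlgebra.lift k (mulComul ρ δ)).toLinearMap.flip (1 ⊗ₜ 1)

/-- `s ↦ - (w₍₋₁₎ · s) w₍₀₎`. -/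
def mulAntipode : W →ₗ[k] Module.End k (TensorAlgebra k W) :=
  -(LinearMap.mul' k (Module.End k (TensorAlgebra k W)) ∘ₗ
    TensorProduct.map ((LinearMap.mul k (TensorAlgebra k W)).flip ∘ₗ ι k)
      (tensorAct ρ).toLinearMap ∘ₗ (TensorProduct.comm k H W).toLinearMap ∘ₗ δ)

/-- The antipode of the braided Hopf algebra `T(W)`: `S(1) = 1` and
`S(w t) = - (w₍₋₁₎ · S(t)) w₍₀₎` for `w ∈ W`. -/
def braidedAntipode : TensorAlgebra k W →ₗ[k] TensorAlgebra k W :=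
  (TensorAlgebra.lift k (mulAntipode ρ δ)).toLinearMap.flip 1

/-- `I` is a Hopf ideal of the braided Hopf algebra `T(W)` (in the category of Yetter-Drinfeld
modules) which is generated, as an ideal, by homogeneous elements of degree at least two. -/
structure IsNicholsIdeal (I : TwoSidedIdeal (TensorAlgebra k W)) : Prop where
  generated : ∃ X : Set (TensorAlgebra k W),
    (∀ x ∈ X, ∃ n : ℕ, 2 ≤ n ∧ x ∈ LinearMap.range (ι k (M := W)) ^ n) ∧ I = TwoSidedIdeal.span X
  /-- `H · I ⊆ I` -/
  act_mem : ∀ h, ∀ t ∈ I, tensorAct ρ h t ∈ I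
  /-- `I` is a subcomodule -/
  coact_mem : ∀ t ∈ I, tensorCoact δ t ∈
    LinearMap.range (LinearMap.lTensor H (I.asIdeal.restrictScalars k).subtype)
  /-- `Δ(I) ⊆ I ⊗ T(W) + T(W) ⊗ I` -/
  comul_mem : ∀ t ∈ I, braidedComul ρ δ t ∈
    LinearMap.range (LinearMap.rTensor (TensorAlgebra k W)
      (I.asIdeal.restrictScalars k).subtype) ⊔
    LinearMap.range (LinearMap.lTensor (TensorAlgebra k W)
      (I.asIdeal.restrictScalars k).subtype)
  /-- `ε(I) = 0` -/
  counit_eq : ∀ t ∈ I, TensorAlgebra.algebraMapInv t = 0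
  antipode_mem : ∀ t ∈ I, braidedAntipode ρ δ t ∈ I

/-- The defining ideal `J(W)` of the Nichols algebra: the largest Hopf ideal of `T(W)` generated by
homogeneous elements of degree at least two. -/
def nicholsIdeal : TwoSidedIdeal (TensorAlgebra k W) := sSup {I | IsNicholsIdeal ρ δ I}

/-- The Nichols algebra `B(W) = T(W) / J(W)`. -/
abbrev Nichols : Type u := (nicholsIdeal ρ δ).ringCon.Quotient

end

end Nichols

/-! ### The algebra `u_(H,R)(V)` -/

section SmallAlgebra

variable (k : Type u) {H : Type u} [Field k] [Ring H] [HopfAlgebra k H] (R : H ⊗[k] H)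
  (V : Type u) [AddCommGroup V] [Module k V] [Module H V] [IsScalarTower k H V]

/-- The action of `H` on `V`. -/
def repV : H →ₐ[k] Module.End k V := Algebra.lsmul k k V

/-- The action of `H` on `V* `: `⟨h y, x⟩ = ⟨y, S(h) x⟩`. -/
def repVbar : H →ₐ[k] Module.End k (Module.Dual k V) :=
  AlgHom.ofLinearMap
    ((Module.Dual.transpose (R := k) (M := V) (M' := V)) ∘ₗ
      (repV k V).toLinearMap ∘ₗ HopfAlgebra.antipode k)
    (by ext; simp [repV, Module.Dual.transpose])
    (fun g h => by
      ext y x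
      simp [repV, HopfAlgebra.antipode_mul_antidistrib, Module.Dual.transpose])

/-- The coaction `x ↦ C¹ ⊗ C² x` on an `H`-module defined by `C = C¹ ⊗ C² ∈ H ⊗ H`. -/
def coactOf {W : Type u} [AddCommGroup W] [Module k W] (ρ : H →ₐ[k] Module.End k W)
    (C : H ⊗[k] H) : W →ₗ[k] H ⊗[k] W where
  toFun w := LinearMap.lTensor H (ρ.toLinearMap.flip w) C
  map_add' x y := by simp [LinearMap.lTensor_add]
  map_smul' c x := by simp [LinearMap.lTensor_smul]

/-- The coaction of `V`: `x₍₋₁₎ ⊗ x₍₀₎ = R² ⊗ R¹ x`. -/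
def coactV : V →ₗ[k] H ⊗[k] V := coactOf k (repV k V) (TensorProduct.comm k H H R)

/-- The coaction of `V̄ = V*`: `y₍₋₁₎ ⊗ y₍₀₎ = S(R¹) ⊗ R² y`. -/
def coactVbar : Module.Dual k V →ₗ[k] H ⊗[k] Module.Dual k V :=
  coactOf k (repVbar k V) (LinearMap.rTensor H (HopfAlgebra.antipode k) R)

/-- The Nichols algebra `B(V)`. -/
abbrev NicholsV : Type u := Nichols (repV k V) (coactV k R V)

/-- The action of `H` on `V ⊕ V̄`. -/
def repSum : H →ₐ[k] Module.End k (V × Module.Dual k V) :=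
  (LinearMap.prodMapAlgHom k V (Module.Dual k V)).comp ((repV k V).prod (repVbar k V))

variable (H) in
/-- `T(V ⊕ V̄) # H` -/
abbrev BigSmash : Type u := Smash (tensorModuleAlgebra (repSum (H := H) k V))

/-- `T(V) → T(V ⊕ V̄) # H` -/
def tV : TensorAlgebra k V →ₐ[k] BigSmash k H V :=
  (Smash.inA _).comp
    (TensorAlgebra.lift k (TensorAlgebra.ι k ∘ₗ LinearMap.inl k V (Module.Dual k V)))

/-- `T(V̄) → T(V ⊕ V̄) # H` -/
def tVbar : TensorAlgebra k (Module.Dual k V) →ₐ[k] BigSmash k H V :=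
  (Smash.inA _).comp
    (TensorAlgebra.lift k (TensorAlgebra.ι k ∘ₗ LinearMap.inr k V (Module.Dual k V)))

/-- `V → T(V ⊕ V̄) # H` -/
def eV : V →ₗ[k] BigSmash k H V := (tV k V).toLinearMap ∘ₗ TensorAlgebra.ι k

/-- `V̄ → T(V ⊕ V̄) # H` -/
def eVbar : Module.Dual k V →ₗ[k] BigSmash k H V := (tVbar k V).toLinearMap ∘ₗ TensorAlgebra.ι k

/-- `H → T(V ⊕ V̄) # H` -/
def eH : H →ₐ[k] BigSmash k H V := Smash.inH _

/-- `(y₍₋₁₎ · x) y₍₀₎` -/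
def crossTerm (y : Module.Dual k V) (x : V) : BigSmash k H V :=
  LinearMap.mul' k _ (TensorProduct.map (eV k V ∘ₗ (repV k V).toLinearMap.flip x) (eVbar k V)
    (coactVbar k R V y))

/-- `(y₍₋₂₎ ⊗ y₍₋₁₎) ⊗ y₍₀₎` -/
def iterVbar (y : Module.Dual k V) : (H ⊗[k] H) ⊗[k] Module.Dual k V :=
  LinearMap.rTensor _ Coalgebra.comul (coactVbar k R V y)

/-- `((x₍₋₃₎ ⊗ x₍₋₂₎) ⊗ x₍₋₁₎) ⊗ x₍₀₎` -/
def iterV (x : V) : ((H ⊗[k] H) ⊗[k] H) ⊗[k] V :=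
  LinearMap.rTensor V (LinearMap.rTensor H Coalgebra.comul)
    (LinearMap.rTensor V Coalgebra.comul (coactV k R V x))

/-- `(x₍₋₃₎ ⊗ x₍₋₂₎) ⊗ S(x₍₋₁₎) · x₍₀₎` -/
def iterVact (x : V) : (H ⊗[k] H) ⊗[k] V :=
  LinearMap.lTensor (H ⊗[k] H)
    (TensorProduct.lift ((repV k V).toLinearMap ∘ₗ HopfAlgebra.antipode k))
    (TensorProduct.assoc k (H ⊗[k] H) H V (iterV k R V x))

/-- `⟨y₍₋₂₎, x₍₋₃₎⟩ ⟨y₍₀₎, S(x₍₋₁₎) · x₍₀₎⟩ x₍₋₂₎ y₍₋₁₎ ∈ H`, obtained from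
`((a ⊗ b) ⊗ η) ⊗ ((c ⊗ d) ⊗ ξ) ↦ ⟨a, c⟩ ⟨η, ξ⟩ d b`. -/
def pairTerm (y : Module.Dual k V) (x : V) : H :=
  TensorProduct.rid k H (TensorProduct.map
    ((TensorProduct.lid k H).toLinearMap ∘ₗ
      TensorProduct.map (TensorProduct.lift (pairing R))
        (LinearMap.mul' k H ∘ₗ (TensorProduct.comm k H H).toLinearMap) ∘ₗ
      (TensorProduct.tensorTensorTensorComm k H H H H).toLinearMap)
    (contractLeft k V)
    (TensorProduct.tensorTensorTensorComm k (H ⊗[k] H) (Module.Dual k V) (H ⊗[k] H) V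
      (iterVbar k R V y ⊗ₜ iterVact k R V x)))

/-- `⟦y, x⟧ = y x - (y₍₋₁₎ · x) y₍₀₎ - ⟨y, x⟩
+ ⟨y₍₋₂₎, x₍₋₃₎⟩ ⟨y₍₀₎, S(x₍₋₁₎) · x₍₀₎⟩ x₍₋₂₎ y₍₋₁₎`. -/
def bracket (y : Module.Dual k V) (x : V) : BigSmash k H V :=
  eVbar k V y * eV k V x - crossTerm k R V y x - algebraMap k _ (y x) + eH k V (pairTerm k R V y x)

/-- The relations `⟦y, x⟧ = 0`. -/
inductive BigRel : BigSmash k H V → BigSmash k H V → Prop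
  | bracket (y : Module.Dual k V) (x : V) : BigRel (bracket k R V y x) 0

/-- `U_(H,R)(V) = T(V ⊕ V̄) # H / ⟨⟦y, x⟧⟩` -/
def BigU : Type u := RingQuot (BigRel k R V)

instance : Ring (BigU k R V) := inferInstanceAs (Ring (RingQuot (BigRel k R V)))
instance : Algebra k (BigU k R V) := inferInstanceAs (Algebra k (RingQuot (BigRel k R V)))

/-- `T(V ⊕ V̄) # H → U_(H,R)(V)` -/
def projBig : BigSmash k H V →ₐ[k] BigU k R V := RingQuot.mkAlgHom k (BigRel k R V)

/-- The relations `J(V) = 0` and `J(V̄) = 0`. -/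
inductive SmallRel : BigU k R V → BigU k R V → Prop
  | left (t : TensorAlgebra k V) (ht : t ∈ nicholsIdeal (repV k V) (coactV k R V)) :
      SmallRel (projBig k R V (tV k V t)) 0
  | right (t : TensorAlgebra k (Module.Dual k V))
      (ht : t ∈ nicholsIdeal (repVbar k V) (coactVbar k R V)) :
      SmallRel (projBig k R V (tVbar k V t)) 0

/-- `u_(H,R)(V) = U_(H,R)(V) / ⟨J(V), J(V̄)⟩` -/
def SmallU : Type u := RingQuot (SmallRel k R V)

instance : Ring (SmallU k R V) := inferInstanceAs (Ring (RingQuot (SmallRel k R V)))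
instance : Algebra k (SmallU k R V) := inferInstanceAs (Algebra k (RingQuot (SmallRel k R V)))

/-- `U_(H,R)(V) → u_(H,R)(V)` -/
def projSmall : BigU k R V →ₐ[k] SmallU k R V := RingQuot.mkAlgHom k (SmallRel k R V)

/-- `T(V ⊕ V̄) # H → u_(H,R)(V)` -/
def proj : BigSmash k H V →ₐ[k] SmallU k R V :=
  (projSmall k R V).comp (projBig k R V)

/-- `H → u_(H,R)(V)` -/
def ofH : H →ₐ[k] SmallU k R V := (proj k R V).comp (eH k V)

/-- `V → u_(H,R)(V)` -/
def ofV : V →ₗ[k] SmallU k R V := (proj k R V).toLinearMap ∘ₗ eV k V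

/-- `V̄ → u_(H,R)(V)` -/
def ofVbar : Module.Dual k V →ₗ[k] SmallU k R V := (proj k R V).toLinearMap ∘ₗ eVbar k V

/-- The generators of `u_(H,R)(V)`. -/
inductive Gen (H : Type u) : Type u
  | v (x : V)
  | h (a : H)
  | vbar (y : Module.Dual k V)

/-- `deg V = -1`, `deg H = 0`, `deg V̄ = 1` -/
def Gen.deg : Gen k V H → ℤ
  | Gen.v _ => -1
  | Gen.h _ => 0
  | Gen.vbar _ => 1

/-- The image of a generator in `u_(H,R)(V)`. -/
def Gen.val : Gen k V H → SmallU k R V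
  | Gen.v x => ofV k R V x
  | Gen.h a => ofH k R V a
  | Gen.vbar y => ofVbar k R V y

/-- The component of degree `n` of `u_(H,R)(V)`: the span of the products of generators of total
degree `n`. -/
def smallGrading (n : ℤ) : Submodule k (SmallU k R V) :=
  Submodule.span k {a | ∃ l : List (Gen k V H),
    (l.map (Gen.deg k V)).sum = n ∧ (l.map (Gen.val k R V)).prod = a}

/-- `B⁺`, the subalgebra generated by `V̄` and `H`. -/
def Bplus : Subalgebra k (SmallU k R V) :=
  Algebra.adjoin k (Set.range (ofVbar k R V) ∪ Set.range (ofH k R V))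

end SmallAlgebra

/-! ### Graded modules -/

section Graded

variable (k : Type u) [Field k] {A : Type u} [Ring A] [Algebra k A] (𝒜 : ℤ → Submodule k A)

/-- A finite-dimensional `ℤ`-graded left module over the algebra `A`, whose component of degree `n`
is `𝒜 n`. -/
structure GrMod where
  /-- the underlying module -/
  carrier : Type u
  [addCommGroup : AddCommGroup carrier]
  [module : Module k carrier]
  [moduleA : Module A carrier]
  [tower : IsScalarTower k A carrier]
  [finite : Module.Finite k carrier]
  /-- the component of degree `n` -/
  deg : ℤ → Submodule k carrier
  internal : DirectSum.IsInternal deg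
  smul_mem : ∀ (i j : ℤ) (a : A) (m : carrier), a ∈ 𝒜 i → m ∈ deg j → a • m ∈ deg (i + j)

namespace GrMod

attribute [instance] addCommGroup module moduleA tower finite

instance : CoeSort (GrMod k 𝒜) (Type u) := ⟨carrier⟩

variable {k 𝒜}

/-- The `A`-linear maps of degree zero. -/
def homSubmodule (M N : GrMod k 𝒜) : Submodule k (M →ₗ[A] N) where
  carrier := {f | ∀ n, ∀ m ∈ M.deg n, f m ∈ N.deg n}
  add_mem' hf hg n m hm := (N.deg n).add_mem (hf n m hm) (hg n m hm)
  zero_mem' n _ _ := (N.deg n).zero_mem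
  smul_mem' c _ hf n m hm := (N.deg n).smul_mem c (hf n m hm)

instance : Category (GrMod k 𝒜) where
  Hom M N := homSubmodule M N
  id M := ⟨LinearMap.id, fun _ _ hm => hm⟩
  comp f g := ⟨g.1 ∘ₗ f.1, fun n _ hm => g.2 n _ (f.2 n _ hm)⟩

/-- The linear map underlying a morphism. -/
def Hom.lin {M N : GrMod k 𝒜} (f : M ⟶ N) : M →ₗ[A] N := Subtype.val (p := (· ∈ homSubmodule M N)) f

instance : Preadditive (GrMod k 𝒜) where
  homGroup M N := inferInstanceAs (AddCommGroup (homSubmodule M N))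
  add_comp _ _ _ _ _ _ := Subtype.ext (LinearMap.comp_add _ _ _)
  comp_add _ _ _ _ _ _ := Subtype.ext (LinearMap.add_comp _ _ _)

instance : Linear k (GrMod k 𝒜) where
  homModule M N := inferInstanceAs (Module k (homSubmodule M N))
  smul_comp _ _ _ r f g := Subtype.ext (LinearMap.ext fun m =>
    (Hom.lin g).map_smul_of_tower r (Hom.lin f m))
  comp_smul _ _ _ _ _ _ := Subtype.ext rfl

/-- The shift `N[i]`, `(N[i])ₙ = Nₙ₋ᵢ`. -/
def shift (N : GrMod k 𝒜) (i : ℤ) : GrMod k 𝒜 where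
  carrier := N
  deg n := N.deg (n - i)
  internal := by
    have h := (DirectSum.isInternal_submodule_iff_iSupIndep_and_iSup_eq_top _).1 N.internal
    refine (DirectSum.isInternal_submodule_iff_iSupIndep_and_iSup_eq_top _).2 ⟨?_, ?_⟩
    · exact h.1.comp (Equiv.subRight i).injective
    · rw [← h.2]
      exact (Equiv.subRight i).iSup_comp (g := N.deg)
  smul_mem p q a m ha hm := by
    have := N.smul_mem p (q - i) a m ha hm
    rwa [← add_sub_assoc] at this

/-- `L` is the head of `M`: the quotient of `M` by its radical (the intersection of all maximal
submodules), with the grading induced from `M`. -/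
def IsHead (M L : GrMod k 𝒜) : Prop :=
  ∃ π : M ⟶ L, Function.Surjective (Hom.lin π) ∧
    LinearMap.ker (Hom.lin π) = Module.jacobson A M

end GrMod

end Graded

/-! ### Proper standard modules of `u_(H,R)(V)` -/

section Standard

variable (k : Type u) {H : Type u} [Field k] [Ring H] [HopfAlgebra k H] (R : H ⊗[k] H)
  (V : Type u) [AddCommGroup V] [Module k V] [Module H V] [IsScalarTower k H V]
  (S : Type u) [AddCommGroup S] [Module k S] [Module H S]

/-- The relations `a b ⊗ v = a ⊗ b · v`, `b ∈ B⁺`, in `u ⊗ S`, where `B⁺` acts on the `H`-module `S`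
through the projection `B⁺ → H` that kills the component of positive degree. -/
def stdRel : Submodule (SmallU k R V) (SmallU k R V ⊗[k] S) :=
  Submodule.span _
    ({z | ∃ (a : SmallU k R V) (h : H) (v : S),
        z = (a * ofH k R V h) ⊗ₜ[k] v - a ⊗ₜ[k] (h • v)} ∪
      {z | ∃ (a b : SmallU k R V) (n : ℤ) (v : S), b ∈ Bplus k R V ∧ b ∈ smallGrading k R V n ∧
        0 < n ∧ z = (a * b) ⊗ₜ[k] v})

/-- The proper standard module `M̄(S) = u ⊗_{B⁺} Inf(S)`. -/
abbrev ProperStandard : Type u := (SmallU k R V ⊗[k] S) ⧸ stdRel k R V S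

/-- The component of degree `n` of `M̄(S)`, where `S` is placed in degree zero. -/
def properStandardDeg (n : ℤ) : Submodule k (ProperStandard k R V S) :=
  Submodule.span k {z | ∃ a ∈ smallGrading k R V n, ∃ v : S,
    (stdRel k R V S).mkQ (a ⊗ₜ[k] v) = z}

/-- The category of finite-dimensional graded `u_(H,R)(V)`-modules. -/
abbrev SmallGrMod : Type (u + 1) := GrMod k (smallGrading k R V)

/-- The graded module `M` is (a copy of) the proper standard module `M̄(S)` with its grading. -/
def IsProperStandard (M : SmallGrMod k R V) : Prop :=
  ∃ e : ProperStandard k R V S ≃ₗ[SmallU k R V] M,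
    ∀ n, M.deg n = (properStandardDeg k R V S n).map (e.toLinearMap.restrictScalars k)

end Standard

/-! ### Highest weight categories -/

section HighestWeight

variable {C : Type*} [Category* C] [Preadditive C] {W : Type*} [PartialOrder W]

/-- `X` has a finite filtration `0 = N₀ ⊂ N₁ ⊂ ⋯ ⊂ Nₙ = X` whose subquotients are isomorphic to
objects `Δ μ` with `P μ`. -/
inductive HasFiltration (Δ : W → C) (P : W → Prop) : C → Prop
  | zero (X : C) (h : Limits.IsZero X) : HasFiltration Δ P X
  | step (S : ShortComplex C) (hS : S.ShortExact) (h : HasFiltration Δ P S.X₁) (μ : W) (hμ : P μ)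
      (e : S.X₃ ≅ Δ μ) : HasFiltration Δ P S.X₂

/-- The object `L` is a subquotient of `X`. For simple `L` and `X` of finite length this means
that `L` is a composition factor of `X`. -/
def IsSubquotient (L X : C) : Prop :=
  ∃ (Y : C) (i : Y ⟶ X) (p : Y ⟶ L), Mono i ∧ Epi p

/-- `L` is a complete family of non-isomorphic simple objects. -/
structure IsCompleteSimple {ι : Type*} (L : ι → C) : Prop where
  simple : ∀ i, Simple (L i)
  eq_of_iso : ∀ i j, Nonempty (L i ≅ L j) → i = j
  exists_iso : ∀ X : C, Simple X → ∃ i, Nonempty (X ≅ L i)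

/-- `π : P ⟶ X` is a projective cover. -/
structure IsProjectiveCover {P X : C} (π : P ⟶ X) : Prop where
  projective : Projective P
  epi : Epi π
  essential : ∀ (Y : C) (g : Y ⟶ P), Epi (g ≫ π) → Epi g

/-- The `k`-linear category `C` is a highest weight category with weights `W`, simple objects `L`
and standard objects `Δ`. -/
structure IsHighestWeightCategory (k : Type*) [Field k] [Linear k C] (L Δ : W → C) : Prop where
  /-- `C` is abelian -/
  hasFiniteProducts : Limits.HasFiniteProducts C
  hasKernels : Limits.HasKernels C
  hasCokernels : Limits.HasCokernels C
  normalMono : IsNormalMonoCategory C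
  normalEpi : IsNormalEpiCategory C
  /-- all objects have finite length -/
  finiteLength : ∀ X : C, IsArtinianObject X ∧ IsNoetherianObject X
  /-- the spaces of morphisms are finite-dimensional -/
  finiteHom : ∀ X Y : C, Module.Finite k (X ⟶ Y)
  enoughProjectives : EnoughProjectives C
  /-- the poset of weights is interval finite -/
  intervalFinite : ∀ a b : W, (Set.Icc a b).Finite
  completeSimple : IsCompleteSimple L
  /-- `L(w)` is a quotient of `Δ(w)` and the composition factors `L(v)` of the kernel satisfy
  `v < w`; `Δ(w)` is a quotient of the projective cover `P(w)` of `L(w)` and the kernel has a finite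
  filtration by objects `Δ(v)` with `w < v` -/
  standard : ∀ w : W, ∃ (K P Q : C) (i : K ⟶ Δ w) (p : Δ w ⟶ L w) (j : Q ⟶ P) (q : P ⟶ Δ w)
    (zero_ip : i ≫ p = 0) (zero_jq : j ≫ q = 0),
    (ShortComplex.mk i p zero_ip).ShortExact ∧ (∀ v : W, IsSubquotient (L v) K → v < w) ∧
    (ShortComplex.mk j q zero_jq).ShortExact ∧ HasFiltration Δ (fun v => w < v) Q ∧
    IsProjectiveCover (q ≫ p)

end HighestWeight

/-- The set of weights `Λ × ℤ`, with the partial order `λ[i] < μ[j] ↔ i < j`. -/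
@[ext]
structure Weight (Λ : Type v) where
  /-- the simple module -/
  wt : Λ
  /-- the degree -/
  deg : ℤ

instance (Λ : Type v) : PartialOrder (Weight Λ) where
  le a b := a = b ∨ a.deg < b.deg
  lt a b := a.deg < b.deg
  le_refl a := Or.inl rfl
  le_trans a b c := by
    rintro (rfl | h) (rfl | h')
    · exact Or.inl rfl
    · exact Or.inr h'
    · exact Or.inr h
    · exact Or.inr (h.trans h')
  lt_iff_le_not_ge a b := by
    constructor
    · intro h
      refine ⟨Or.inr h, ?_⟩
      rintro (rfl | h')
      · exact lt_irrefl _ h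
      · exact lt_asymm h h'
    · rintro ⟨rfl | h, h'⟩
      · exact absurd (Or.inl rfl) h'
      · exact h
  le_antisymm a b := by
    rintro (rfl | h) (h' | h')
    · rfl
    · rfl
    · exact h'.symm
    · exact absurd h' (lt_asymm h)

end
end QTDouble

open QTDouble

/-! Fix a basis of V with matrix coefficients ρᵢⱼ and put m = R¹ρ(R²), l = ρ(R¹)R² and z = m·l,
matrices over H (`mMat`, `lMat`, `zMat`). The coactions of V and of V̄ are given by l and by m. The
long last term of the defining relation collapses to z by `pairTerm_basis`, so 𝔲 is generated by H,
xⱼ and yᵢ, with the smash product relations, the Nichols relations on both sides and yᵢxⱼ = Σ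
ρₚⱼ(mᵢ_q) xₚy_q + δᵢⱼ − zᵢⱼ (`IsURep`, `isURep_ofH`).

In place of a triangular decomposition of 𝔲, induced modules are constructed by formulas. If H and
V̄ act on N, then on 𝔅(V) ⊗ N let H act diagonally, V by left multiplication, and yᵢ by Σ mᵢₚ ⊗ yₚ +
∂ᴸᵢ ⊗ 1 − Σ mᵢₚ∂ᴿ_q ⊗ zₚ_q, where ∂ᴸ and ∂ᴿ are the left and right skew derivations of 𝔅(V). The
mixed relations are `indY_mul_indMap` and `indY_mul_nicholsX`. The relations 𝒥(V̄) = 0 hold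
(`IsPosRep.right_ind`) because moving an element of T(V̄) past xⱼ only changes it by skew
derivations and by H, and 𝒥(V̄) is stable under both. Frobenius reciprocity is
`PosMod.exists_desc_linear`; the dimension of the induced module is dim 𝔅(V) · dim N by
construction.

𝔅(V̄) is also finite-dimensional. Iterated left skew derivations pair T(V̄) with T(V), and the left
radical of this pairing is a Hopf ideal (`isNicholsIdeal_dualRadical`), hence contained in 𝒥(V̄). If
𝔅(V) vanishes in degree n, all of degree n of T(V̄) lies in the radical.

The module induced from a simple λ with zero action of V̄ is the proper standard module. It lives in
degrees ≤ 0 and has λ in degree 0. V acts nilpotently, so there is a Nakayama lemma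
(`eq_top_of_sup_vSub_eq_top`); with it, the largest submodule without degree-zero part contains
every proper submodule, which determines the head. Conversely, the top component of a simple graded
module is killed by V̄, so the simple module is a quotient of a shifted standard module.

Let H be semisimple. Inducing 𝔅(V̄) ⊗ W from a graded H-module W gives projectives, and the
projective cover of a head is a direct summand of such a module. Freeness over 𝔅(V) is handled by
dimensions: dim X ≤ dim 𝔅(V) · dim X/VX always holds, equality means freeness (`IsVFree`), and it
passes to direct summands. Let X be free, d the lowest degree in which X/VX is nonzero and S a
simple quotient of that component. The submodule Y generated by the higher degrees and by the kernel
of the projection to S has a quotient X/Y onto which the standard module of S in degree d maps.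
Counting dimensions makes this map bijective and Y free (`isVFree_topMod`), so X has a filtration by
standard modules. For a projective cover the lowest layer of X/VX is S alone, so all other factors
have larger degree. -/

namespace QTDouble

noncomputable section

/-! ### Contracting tensor legs of elements of H with functionals. -/

section Slices

variable {k H : Type u} [Field k] [Ring H] [HopfAlgebra k H]

local notation "Δ" => Coalgebra.comul (R := k) (A := H)
local notation "ε" => Coalgebra.counit (R := k) (A := H)
local notation "𝒮" => HopfAlgebra.antipode k (A := H)

/-- `a ⊗ b ↦ f(a) b`. -/
def sliceL {M : Type*} [AddCommGroup M] [Module k M] (f : H →ₗ[k] k) : H ⊗[k] M →ₗ[k] M :=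
  (TensorProduct.lid k M).toLinearMap ∘ₗ LinearMap.rTensor M f

/-- `a ⊗ b ↦ f(b) a`. -/
def sliceR {M : Type*} [AddCommGroup M] [Module k M] (f : H →ₗ[k] k) : M ⊗[k] H →ₗ[k] M :=
  (TensorProduct.rid k M).toLinearMap ∘ₗ LinearMap.lTensor M f

@[simp] theorem sliceL_tmul {M : Type*} [AddCommGroup M] [Module k M] (f : H →ₗ[k] k) (a : H)
    (b : M) : sliceL f (a ⊗ₜ[k] b) = f a • b := by simp [sliceL]

@[simp] theorem sliceR_tmul {M : Type*} [AddCommGroup M] [Module k M] (f : H →ₗ[k] k) (a : M)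
    (b : H) : sliceR f (a ⊗ₜ[k] b) = f b • a := by simp [sliceR]

/-- `h ↦ f(h₁) h₂`. -/
def hitL (f : H →ₗ[k] k) : H →ₗ[k] H := sliceL f ∘ₗ Coalgebra.comul

/-- `h ↦ h₁ f(h₂)`. -/
def hitR (f : H →ₗ[k] k) : H →ₗ[k] H := sliceR f ∘ₗ Coalgebra.comul

/-- The convolution `h ↦ f(h₁) g(h₂)`. -/
def conv (f g : H →ₗ[k] k) : H →ₗ[k] k := g ∘ₗ hitL f

theorem conv_apply' (f g : H →ₗ[k] k) (h : H) : conv f g h = f (hitR g h) := by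
  simp only [conv, hitL, hitR, LinearMap.comp_apply]
  induction Δ h using TensorProduct.induction_on with
  | zero => simp
  | tmul a b => simp [mul_comm]
  | add a b ha hb => simp only [map_add, ha, hb]

/-- Coassociativity with `f` applied to the first of three legs; the contracted leg does not meet
the coproduct on the right. -/
theorem comul_hitL (f : H →ₗ[k] k) (h : H) :
    Δ (hitL f h) = LinearMap.rTensor H (hitL f) (Δ h) := by
  have key := congrArg (sliceL f) (Coalgebra.coassoc_apply (R := k) h)
  have h1 : ∀ t : H ⊗[k] H, sliceL f (TensorProduct.assoc k H H H (LinearMap.rTensor H Δ t)) =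
      LinearMap.rTensor H (hitL f) t := by
    intro t
    induction t using TensorProduct.induction_on with
    | zero => simp
    | tmul a b =>
      simp only [LinearMap.rTensor_tmul, hitL, LinearMap.comp_apply]
      induction Δ a using TensorProduct.induction_on with
      | zero => simp
      | tmul c d => simp [TensorProduct.smul_tmul']
      | add c d hc hd => simp only [map_add, TensorProduct.add_tmul, hc, hd]
    | add a b ha hb => simp only [map_add, ha, hb]
  have h2 : ∀ t : H ⊗[k] H, sliceL f (LinearMap.lTensor H Δ t) = Δ (sliceL f t) := by
    intro t
    induction t using TensorProduct.induction_on with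
    | zero => simp
    | tmul a b => simp
    | add a b ha hb => simp only [map_add, ha, hb]
  rw [h1, h2] at key
  exact key.symm

theorem comul_hitR (f : H →ₗ[k] k) (h : H) :
    Δ (hitR f h) = LinearMap.lTensor H (hitR f) (Δ h) := by
  have key := congrArg (sliceR f) (Coalgebra.coassoc_symm_apply (R := k) h)
  have h1 : ∀ t : H ⊗[k] H, sliceR f ((TensorProduct.assoc k H H H).symm
      (LinearMap.lTensor H Δ t)) = LinearMap.lTensor H (hitR f) t := by
    intro t
    induction t using TensorProduct.induction_on with
    | zero => simp
    | tmul a b =>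
      simp only [LinearMap.lTensor_tmul, hitR, LinearMap.comp_apply]
      induction Δ b using TensorProduct.induction_on with
      | zero => simp
      | tmul c d => simp
      | add c d hc hd => simp only [map_add, TensorProduct.tmul_add, hc, hd]
    | add a b ha hb => simp only [map_add, ha, hb]
  have h2 : ∀ t : H ⊗[k] H, sliceR f (LinearMap.rTensor H Δ t) = Δ (sliceR f t) := by
    intro t
    induction t using TensorProduct.induction_on with
    | zero => simp
    | tmul a b => simp
    | add a b ha hb => simp only [map_add, ha, hb]
  rw [h1, h2] at key
  exact key.symm

/-- Both sides are h₁ ⊗ f(h₂) h₃, the middle leg being read off from either bracketing. This is how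
a contraction is passed from one tensor factor of an induced module to the other. -/
theorem lTensor_hitL_comul (f : H →ₗ[k] k) (h : H) :
    LinearMap.lTensor H (hitL f) (Δ h) = LinearMap.rTensor H (hitR f) (Δ h) := by
  have key := congrArg (LinearMap.lTensor H (sliceL f)) (Coalgebra.coassoc_apply (R := k) h)
  have h1 : ∀ t : H ⊗[k] H, LinearMap.lTensor H (sliceL f) (TensorProduct.assoc k H H H
      (LinearMap.rTensor H Δ t)) = LinearMap.rTensor H (hitR f) t := by
    intro t
    induction t using TensorProduct.induction_on with
    | zero => simp
    | tmul a b =>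
      simp only [LinearMap.rTensor_tmul, hitR, LinearMap.comp_apply]
      induction Δ a using TensorProduct.induction_on with
      | zero => simp
      | tmul c d => simp [TensorProduct.smul_tmul']
      | add c d hc hd => simp only [map_add, TensorProduct.add_tmul, hc, hd]
    | add a b ha hb => simp only [map_add, ha, hb]
  rw [h1, ← LinearMap.lTensor_comp_apply] at key
  exact key.symm

/-- Both sides are g(h₁) f(h₂) h₃, so composition reverses the order of convolution. -/
theorem hitL_hitL (f g : H →ₗ[k] k) (h : H) : hitL f (hitL g h) = hitL (conv g f) h := by
  have := comul_hitL g h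
  rw [hitL, LinearMap.comp_apply, this]
  simp only [hitL, LinearMap.comp_apply]
  induction Δ h using TensorProduct.induction_on with
  | zero => simp
  | tmul c d => simp [conv, hitL]
  | add c d hc hd => simp only [map_add, hc, hd]

theorem hitL_hitR (f g : H →ₗ[k] k) (h : H) : hitL f (hitR g h) = hitR g (hitL f h) := by
  have h1 := comul_hitR g h
  rw [hitL, LinearMap.comp_apply, h1, LinearMap.comp_apply]
  induction Δ h using TensorProduct.induction_on with
  | zero => simp
  | tmul c d => simp
  | add c d hc hd => simp only [map_add, hc, hd]

theorem hitL_counit (h : H) : hitL ε h = h := by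
  simp [hitL, sliceL, Coalgebra.rTensor_counit_comul]

theorem hitR_counit (h : H) : hitR ε h = h := by
  simp [hitR, sliceR, Coalgebra.lTensor_counit_comul]

theorem hitL_add (f g : H →ₗ[k] k) (h : H) : hitL (f + g) h = hitL f h + hitL g h := by
  simp [hitL, sliceL, LinearMap.rTensor_add]

theorem hitL_smul (c : k) (f : H →ₗ[k] k) (h : H) : hitL (c • f) h = c • hitL f h := by
  simp [hitL, sliceL, LinearMap.rTensor_smul]

theorem hitL_sum {ι : Type*} (s : Finset ι) (f : ι → H →ₗ[k] k) (h : H) :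
    hitL (∑ i ∈ s, f i) h = ∑ i ∈ s, hitL (f i) h := by
  induction s using Finset.cons_induction with
  | empty => simp [hitL, sliceL]
  | cons a s _ ih => rw [Finset.sum_cons, hitL_add, Finset.sum_cons, ih]

end Slices

/-! ### The R-matrix through the matrix coefficients of a representation. -/

section RMatrix

variable {k H : Type u} [Field k] [Ring H] [HopfAlgebra k H]

local notation "Δ" => Coalgebra.comul (R := k) (A := H)
local notation "ε" => Coalgebra.counit (R := k) (A := H)
local notation "𝒮" => HopfAlgebra.antipode k (A := H)

theorem mul'_lTensor_antipode_comul (h : H) :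
    LinearMap.mul' k H (LinearMap.lTensor H 𝒮 (Δ h)) = algebraMap k H (ε h) :=
  HopfAlgebra.mul_antipode_lTensor_comul_apply h

theorem mul'_rTensor_antipode_comul (h : H) :
    LinearMap.mul' k H (LinearMap.rTensor H 𝒮 (Δ h)) = algebraMap k H (ε h) :=
  HopfAlgebra.mul_antipode_rTensor_comul_apply h

/-- Induction on two elements of `H ⊗ H` for the proof of bilinear identities. -/
theorem bilin_ext {M : Type*} [AddCommGroup M] [Module k M]
    {F G : H ⊗[k] H →ₗ[k] H ⊗[k] H →ₗ[k] M}
    (h : ∀ a b c d, F (a ⊗ₜ b) (c ⊗ₜ d) = G (a ⊗ₜ b) (c ⊗ₜ d)) (s t : H ⊗[k] H) :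
    F s t = G s t := by
  have : F = G := by
    ext a b c d
    exact h a b c d
  rw [this]

variable {R : H ⊗[k] H} (hR : IsQuasitriangular R)

include hR

/-- Contract the first two legs of (Δ ⊗ 1)R = R₁₃R₂₃ by a ⊗ b ↦ a𝒮(b): the right side becomes R·(𝒮 ⊗
1)R and the left side becomes 1 by the antipode and counit axioms. -/
theorem IsQuasitriangular.mul_inv : R * LinearMap.rTensor H 𝒮 R = 1 := by
  have key := congrArg (LinearMap.rTensor H (LinearMap.mul' k H ∘ₗ LinearMap.lTensor H 𝒮) ∘
    (TensorProduct.assoc k H H H).symm) hR.comul_left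
  have h1 := bilin_ext
    (F := ((LinearMap.mul k (H ⊗[k] (H ⊗[k] H))).compl₁₂ leg13.toLinearMap
      leg23.toLinearMap).compr₂
      (LinearMap.rTensor H (LinearMap.mul' k H ∘ₗ LinearMap.lTensor H 𝒮) ∘ₗ
      (TensorProduct.assoc k H H H).symm.toLinearMap))
    (G := (LinearMap.mul k (H ⊗[k] H)).compl₂ (LinearMap.rTensor H 𝒮))
    (fun a b c d => by simp [leg13, leg23]) R R
  simp only [LinearMap.compr₂_apply, LinearMap.compl₁₂_apply, LinearMap.compl₂_apply,
    LinearMap.mul_apply', LinearMap.comp_apply, AlgHom.toLinearMap_apply,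
    LinearEquiv.coe_coe] at h1
  simp only [Function.comp_apply, LinearEquiv.symm_apply_apply] at key
  rw [h1, ← LinearMap.rTensor_comp_apply] at key
  rw [← key]
  have h2 : (LinearMap.mul' k H ∘ₗ LinearMap.lTensor H 𝒮) ∘ₗ Δ = Algebra.linearMap k H ∘ₗ ε :=
    LinearMap.ext mul'_lTensor_antipode_comul
  rw [h2, LinearMap.rTensor_comp_apply]
  have h3 := hR.counit_left
  rw [LinearEquiv.eq_symm_apply (TensorProduct.lid k H) |>.2 h3]
  simp [Algebra.TensorProduct.one_def]

/-- The other hexagon axiom, treated in the same way, gives (𝒮 ⊗ 1)R · (𝒮 ⊗ 𝒮)R = 1. Since R·(𝒮 ⊗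
1)R = 1 as well, the left and right inverses of (𝒮 ⊗ 1)R agree. -/
theorem IsQuasitriangular.map_antipode : TensorProduct.map 𝒮 𝒮 R = R := by
  have key := congrArg (TensorProduct.map 𝒮 (LinearMap.mul' k H ∘ₗ LinearMap.lTensor H 𝒮))
    hR.comul_right
  have h1 := bilin_ext
    (F := ((LinearMap.mul k (H ⊗[k] (H ⊗[k] H))).compl₁₂ leg13.toLinearMap
      leg12.toLinearMap).compr₂
      (TensorProduct.map 𝒮 (LinearMap.mul' k H ∘ₗ LinearMap.lTensor H 𝒮)))
    (G := (LinearMap.mul k (H ⊗[k] H)).flip.compl₁₂ (TensorProduct.map 𝒮 𝒮)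
      (LinearMap.rTensor H 𝒮))
    (fun a b c d => by simp [leg13, leg12, HopfAlgebra.antipode_mul_antidistrib]) R R
  simp only [LinearMap.compr₂_apply, LinearMap.compl₁₂_apply, LinearMap.flip_apply,
    LinearMap.mul_apply', AlgHom.toLinearMap_apply] at h1
  rw [h1, ← LinearMap.comp_apply, LinearMap.map_comp_lTensor] at key
  have h2 : (LinearMap.mul' k H ∘ₗ LinearMap.lTensor H 𝒮) ∘ₗ Δ = Algebra.linearMap k H ∘ₗ ε :=
    LinearMap.ext mul'_lTensor_antipode_comul
  rw [h2, ← LinearMap.map_comp_lTensor, LinearMap.comp_apply] at key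
  have h3 := hR.counit_right
  have h4 := LinearEquiv.eq_symm_apply (TensorProduct.rid k H) |>.2 h3
  rw [h4] at key
  have key' : LinearMap.rTensor H 𝒮 R * TensorProduct.map 𝒮 𝒮 R = 1 := by
    rw [← key]; simp [Algebra.TensorProduct.one_def]
  calc TensorProduct.map 𝒮 𝒮 R = R * LinearMap.rTensor H 𝒮 R * TensorProduct.map 𝒮 𝒮 R := by
        rw [hR.mul_inv, one_mul]
    _ = R := by rw [mul_assoc, key', mul_one]

omit hR

variable {ι : Type} [Fintype ι] [DecidableEq ι]

/-- The functionals `ρ i j` are the matrix coefficients of a representation. -/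
structure IsMatrixRep (ρ : ι → ι → H →ₗ[k] k) : Prop where
  one : ∀ i j, ρ i j 1 = if i = j then 1 else 0
  mul : ∀ i j g h, ρ i j (g * h) = ∑ p, ρ i p g * ρ p j h

variable {ρ : ι → ι → H →ₗ[k] k} (hρ : IsMatrixRep ρ)

theorem conv_apply_tmul (f g : H →ₗ[k] k) (h : H) :
    conv f g h = LinearMap.mul' k k (TensorProduct.map f g (Δ h)) := by
  simp only [conv, hitL, LinearMap.comp_apply]
  induction Δ h using TensorProduct.induction_on with
  | zero => simp
  | tmul a b => simp
  | add a b ha hb => simp only [map_add, ha, hb]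

include hρ

/-- Apply ρᵢⱼ to the antipode axiom and expand by multiplicativity: the matrix ρ ∘ 𝒮 is the
convolution inverse of ρ. -/
theorem IsMatrixRep.sum_conv_antipode_left (i j : ι) :
    ∑ p, conv (ρ i p ∘ₗ 𝒮) (ρ p j) = if i = j then ε else 0 := by
  ext h
  have key := congrArg (ρ i j) (mul'_rTensor_antipode_comul (k := k) h)
  rw [LinearMap.sum_apply]
  have h1 : ∀ t : H ⊗[k] H, ρ i j (LinearMap.mul' k H (LinearMap.rTensor H 𝒮 t)) =
      ∑ p, LinearMap.mul' k k (TensorProduct.map (ρ i p ∘ₗ 𝒮) (ρ p j) t) := by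
    intro t
    induction t using TensorProduct.induction_on with
    | zero => simp
    | tmul a b => simp [hρ.mul]
    | add a b ha hb => simp only [map_add, ha, hb, Finset.sum_add_distrib]
  rw [h1] at key
  simp only [conv_apply_tmul, key, Algebra.algebraMap_eq_smul_one, map_smul, hρ.one]
  split_ifs <;> simp

theorem IsMatrixRep.sum_conv_antipode_right (i j : ι) :
    ∑ p, conv (ρ i p) (ρ p j ∘ₗ 𝒮) = if i = j then ε else 0 := by
  ext h
  have key := congrArg (ρ i j) (mul'_lTensor_antipode_comul (k := k) h)
  rw [LinearMap.sum_apply]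
  have h1 : ∀ t : H ⊗[k] H, ρ i j (LinearMap.mul' k H (LinearMap.lTensor H 𝒮 t)) =
      ∑ p, LinearMap.mul' k k (TensorProduct.map (ρ i p) (ρ p j ∘ₗ 𝒮) t) := by
    intro t
    induction t using TensorProduct.induction_on with
    | zero => simp
    | tmul a b => simp [hρ.mul]
    | add a b ha hb => simp only [map_add, ha, hb, Finset.sum_add_distrib]
  rw [h1] at key
  simp only [conv_apply_tmul, key, Algebra.algebraMap_eq_smul_one, map_smul, hρ.one]
  split_ifs <;> simp

/-- With its companion below, this inverts the matrix of operators by which H passes V̄; see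
`mul_y_iff`. -/
theorem IsMatrixRep.sum_hitL_hitL_antipode (i j : ι) (h : H) :
    ∑ p, hitL (ρ p j) (hitL (ρ i p ∘ₗ 𝒮) h) = if i = j then h else 0 := by
  simp only [hitL_hitL]
  rw [← hitL_sum, hρ.sum_conv_antipode_left]
  split_ifs
  · rw [hitL_counit]
  · simp [hitL, sliceL]

theorem IsMatrixRep.sum_hitL_antipode_hitL (i j : ι) (h : H) :
    ∑ p, hitL (ρ p j ∘ₗ 𝒮) (hitL (ρ i p) h) = if i = j then h else 0 := by
  simp only [hitL_hitL]
  rw [← hitL_sum, hρ.sum_conv_antipode_right]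
  split_ifs
  · rw [hitL_counit]
  · simp [hitL, sliceL]

theorem IsMatrixRep.sliceR_mul (i j : ι) (s t : H ⊗[k] H) :
    sliceR (ρ i j) (s * t) = ∑ p, sliceR (ρ i p) s * sliceR (ρ p j) t := by
  have := bilin_ext (F := (LinearMap.mul k (H ⊗[k] H)).compr₂ (sliceR (ρ i j)))
    (G := ∑ p, (LinearMap.mul k H).compl₁₂ (sliceR (ρ i p)) (sliceR (ρ p j)))
    (fun a b c d => by simp [hρ.mul, Finset.sum_smul, LinearMap.sum_apply, smul_smul, mul_comm]) s t
  simpa using this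

theorem IsMatrixRep.sliceL_mul (i j : ι) (s t : H ⊗[k] H) :
    sliceL (ρ i j) (s * t) = ∑ p, sliceL (ρ i p) s * sliceL (ρ p j) t := by
  have := bilin_ext (F := (LinearMap.mul k (H ⊗[k] H)).compr₂ (sliceL (ρ i j)))
    (G := ∑ p, (LinearMap.mul k H).compl₁₂ (sliceL (ρ i p)) (sliceL (ρ p j)))
    (fun a b c d => by simp [hρ.mul, Finset.sum_smul, LinearMap.sum_apply, smul_smul, mul_comm]) s t
  simpa using this

omit hρ

variable (R ρ)

/-- `R¹ ρᵢⱼ(R²)` -/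
def mMat (i j : ι) : H := sliceR (ρ i j) R

/-- `ρᵢⱼ(R¹) R²` -/
def lMat (i j : ι) : H := sliceL (ρ i j) R

/-- `ρᵢⱼ(S(R¹)) R²` -/
def nMat (i j : ι) : H := sliceL (ρ i j ∘ₗ 𝒮) R

/-- The product of the matrices `mMat` and `lMat`. -/
def zMat (i j : ι) : H := ∑ p, mMat R ρ i p * lMat R ρ p j

variable {R ρ}

omit [Fintype ι] [DecidableEq ι] in
theorem apply_mMat (i j : ι) (f : H →ₗ[k] k) : f (mMat R ρ i j) = ρ i j (sliceL f R) := by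
  simp only [mMat]
  induction R using TensorProduct.induction_on with
  | zero => simp
  | tmul a b => simp [mul_comm]
  | add a b ha hb => simp only [map_add, ha, hb]

omit [Fintype ι] [DecidableEq ι] in
theorem apply_lMat (i j : ι) (f : H →ₗ[k] k) : f (lMat R ρ i j) = ρ i j (sliceR f R) := by
  simp only [lMat]
  induction R using TensorProduct.induction_on with
  | zero => simp
  | tmul a b => simp [mul_comm]
  | add a b ha hb => simp only [map_add, ha, hb]

omit [Fintype ι] [DecidableEq ι] in
-- Both sides are ρₚⱼ(R¹) ρᵢ_q(R²). This exchange of m and l under the matrix coefficients recurs in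
-- all computations below.
theorem rho_mMat (i j p q : ι) : ρ p j (mMat R ρ i q) = ρ i q (lMat R ρ p j) := apply_mMat _ _ _

include hR hρ

/-- The relation Δᶜᵒᵖ(h)R = RΔ(h), contracted with ρᵢⱼ in its second leg. -/
theorem sum_hitL_mul_mMat (i j : ι) (h : H) :
    ∑ p, hitL (ρ i p) h * mMat R ρ p j = ∑ p, mMat R ρ i p * hitR (ρ p j) h := by
  have key := congrArg (sliceR (ρ i j)) (hR.comul_op_mul h)
  rw [hρ.sliceR_mul, hρ.sliceR_mul] at key
  have h1 : ∀ (f : H →ₗ[k] k) (t : H ⊗[k] H),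
      sliceR f (TensorProduct.comm k H H t) = sliceL f t := by
    intro f t
    induction t using TensorProduct.induction_on with
    | zero => simp
    | tmul a b => simp
    | add a b ha hb => simp only [map_add, ha, hb]
  simp only [h1] at key
  exact key

/-- The same relation contracted in its first leg; the roles of `hitL` and `hitR` are interchanged.
-/
theorem sum_hitR_mul_lMat (i j : ι) (h : H) :
    ∑ p, hitR (ρ i p) h * lMat R ρ p j = ∑ p, lMat R ρ i p * hitL (ρ p j) h := by
  have key := congrArg (sliceL (ρ i j)) (hR.comul_op_mul h)
  rw [hρ.sliceL_mul, hρ.sliceL_mul] at key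
  have h1 : ∀ (f : H →ₗ[k] k) (t : H ⊗[k] H),
      sliceL f (TensorProduct.comm k H H t) = sliceR f t := by
    intro f t
    induction t using TensorProduct.induction_on with
    | zero => simp
    | tmul a b => simp
    | add a b ha hb => simp only [map_add, ha, hb]
  simp only [h1] at key
  exact key

/-- Passing m turns `hitL` into `hitR`, and passing l turns it back. So z behaves towards H like a
scalar matrix, which makes the z-term of the defining relation compatible with H. -/
theorem sum_hitL_mul_zMat (i j : ι) (h : H) :
    ∑ p, hitL (ρ i p) h * zMat R ρ p j = ∑ p, zMat R ρ i p * hitL (ρ p j) h := by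
  simp only [zMat, Finset.mul_sum, Finset.sum_mul, ← mul_assoc]
  rw [Finset.sum_comm]
  simp only [← Finset.sum_mul, sum_hitL_mul_mMat hR hρ]
  simp only [Finset.sum_mul, mul_assoc]
  rw [Finset.sum_comm]
  simp only [← Finset.mul_sum, sum_hitR_mul_lMat hR hρ]
  simp only [Finset.mul_sum]
  rw [Finset.sum_comm]

theorem comul_mMat (i j : ι) :
    Δ (mMat R ρ i j) = ∑ p, mMat R ρ i p ⊗ₜ[k] mMat R ρ p j := by
  have key := congrArg (LinearMap.lTensor H (sliceR (ρ i j))) hR.comul_left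
  have h1 := bilin_ext
    (F := ((LinearMap.mul k (H ⊗[k] (H ⊗[k] H))).compl₁₂ leg13.toLinearMap
      leg23.toLinearMap).compr₂ (LinearMap.lTensor H (sliceR (ρ i j))))
    (G := ∑ p, (TensorProduct.mk k H H).compl₁₂ (sliceR (ρ i p)) (sliceR (ρ p j)))
    (fun a b c d => by simp [leg13, leg23, hρ.mul, Finset.sum_smul, LinearMap.sum_apply,
      smul_smul, TensorProduct.tmul_smul, TensorProduct.smul_tmul', mul_comm,
      TensorProduct.tmul_sum]) R R
  simp only [LinearMap.compr₂_apply, LinearMap.compl₁₂_apply, LinearMap.sum_apply,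
    LinearMap.mul_apply', AlgHom.toLinearMap_apply, TensorProduct.mk_apply] at h1
  rw [h1] at key
  rw [mMat, ← LinearMap.comp_apply]
  refine Eq.trans ?_ key
  rw [LinearMap.comp_apply]
  generalize R = t
  induction t using TensorProduct.induction_on with
  | zero => simp
  | tmul a b =>
    simp only [LinearMap.rTensor_tmul, sliceR_tmul, map_smul]
    induction Δ a using TensorProduct.induction_on with
    | zero => simp
    | tmul c d => simp
    | add c d hc hd => simp only [map_add, TensorProduct.add_tmul, smul_add, hc, hd]
  | add a b ha hb => simp only [map_add, ha, hb]

omit hρ in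
theorem sliceL_comul (f : H →ₗ[k] k) :
    Δ (sliceL f R) = sliceL f (leg13 R * leg12 R) := by
  rw [← hR.comul_right]
  generalize R = t
  induction t using TensorProduct.induction_on with
  | zero => simp
  | tmul a b => simp
  | add a b ha hb => simp only [map_add, ha, hb]

/-- In R¹ ⊗ Δ(R²) = R¹r¹ ⊗ r² ⊗ R² the legs come out in reverse order, hence the order of the
indices opposite to that for m. -/
theorem comul_lMat (i j : ι) :
    Δ (lMat R ρ i j) = ∑ p, lMat R ρ p j ⊗ₜ[k] lMat R ρ i p := by
  rw [lMat, sliceL_comul hR]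
  have h1 := bilin_ext
    (F := ((LinearMap.mul k (H ⊗[k] (H ⊗[k] H))).compl₁₂ leg13.toLinearMap
      leg12.toLinearMap).compr₂ (sliceL (ρ i j)))
    (G := ∑ p, (TensorProduct.mk k H H).flip.compl₁₂ (sliceL (ρ i p)) (sliceL (ρ p j)))
    (fun a b c d => by simp [leg13, leg12, hρ.mul, Finset.sum_smul, LinearMap.sum_apply,
      smul_smul, TensorProduct.smul_tmul', mul_comm]) R R
  simpa [lMat] using h1

/-- The antipode reverses the product R¹r¹ once more, which restores the usual order of the indices.
-/
theorem comul_nMat (i j : ι) :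
    Δ (nMat R ρ i j) = ∑ p, nMat R ρ i p ⊗ₜ[k] nMat R ρ p j := by
  rw [nMat, sliceL_comul hR]
  have h1 := bilin_ext
    (F := ((LinearMap.mul k (H ⊗[k] (H ⊗[k] H))).compl₁₂ leg13.toLinearMap
      leg12.toLinearMap).compr₂ (sliceL (ρ i j ∘ₗ 𝒮)))
    (G := ∑ p, (TensorProduct.mk k H H).flip.compl₁₂ (sliceL (ρ p j ∘ₗ 𝒮))
      (sliceL (ρ i p ∘ₗ 𝒮)))
    (fun a b c d => by simp [leg13, leg12, hρ.mul, Finset.sum_smul, LinearMap.sum_apply,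
      smul_smul, TensorProduct.smul_tmul', mul_comm,
      HopfAlgebra.antipode_mul_antidistrib]) R R
  simpa [nMat] using h1

theorem counit_mMat (i j : ι) : ε (mMat R ρ i j) = if i = j then 1 else 0 := by
  rw [apply_mMat, ← hρ.one]
  exact congrArg _ hR.counit_left

theorem counit_lMat (i j : ι) : ε (lMat R ρ i j) = if i = j then 1 else 0 := by
  rw [apply_lMat, ← hρ.one]
  exact congrArg _ hR.counit_right

omit hρ in
theorem counit_sliceL (f : H →ₗ[k] k) : ε (sliceL f R) = f 1 := by
  rw [← hR.counit_right]
  generalize R = t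
  induction t using TensorProduct.induction_on with
  | zero => simp
  | tmul a b => simp [mul_comm]
  | add a b ha hb => simp only [map_add, ha, hb]

theorem counit_nMat (i j : ι) : ε (nMat R ρ i j) = if i = j then 1 else 0 := by
  rw [nMat, counit_sliceL hR, ← hρ.one]
  simp

/-- The identity R·(𝒮 ⊗ 1)R = 1 contracted with ρᵢⱼ in its first leg. -/
theorem sum_lMat_mul_nMat (i j : ι) :
    ∑ p, lMat R ρ i p * nMat R ρ p j = if i = j then 1 else 0 := by
  have key := congrArg (sliceL (ρ i j)) hR.mul_inv
  rw [hρ.sliceL_mul, Algebra.TensorProduct.one_def, sliceL_tmul, hρ.one] at key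
  have h1 : ∀ p, sliceL (ρ p j) (LinearMap.rTensor H 𝒮 R) = nMat R ρ p j := by
    intro p
    rw [nMat]
    generalize R = t
    induction t using TensorProduct.induction_on with
    | zero => simp
    | tmul a b => simp
    | add a b ha hb => simp only [map_add, ha, hb]
  simp only [h1] at key
  refine key.trans ?_
  split_ifs <;> simp

omit hρ [Fintype ι] [DecidableEq ι] in
-- The left side contracts (𝒮 ⊗ 𝒮)R, which equals R by `IsQuasitriangular.map_antipode`.
theorem rho_antipode_nMat (i p q r : ι) :
    ρ i p (𝒮 (nMat R ρ q r)) = ρ q r (mMat R ρ i p) := by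
  have key : ρ q r (mMat R ρ i p) = LinearMap.mul' k k (TensorProduct.map (ρ q r) (ρ i p) R) := by
    rw [mMat]
    generalize R = t
    induction t using TensorProduct.induction_on with
    | zero => simp
    | tmul a b => simp [mul_comm]
    | add a b ha hb => simp only [map_add, ha, hb]
  rw [key, ← hR.map_antipode, nMat, hR.map_antipode]
  conv_rhs => rw [← hR.map_antipode]
  generalize R = t
  induction t using TensorProduct.induction_on with
  | zero => simp
  | tmul a b => simp
  | add a b ha hb => simp only [map_add, ha, hb]

theorem sum_antipode_mMat_mul_mMat (i j : ι) :
    ∑ p, 𝒮 (mMat R ρ i p) * mMat R ρ p j = if i = j then 1 else 0 := by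
  have := mul'_rTensor_antipode_comul (k := k) (mMat R ρ i j)
  rw [comul_mMat hR hρ, counit_mMat hR hρ] at this
  simp only [map_sum, LinearMap.rTensor_tmul, LinearMap.mul'_apply] at this
  rw [this]; split_ifs <;> simp

theorem sum_lMat_mul_antipode_lMat (i j : ι) :
    ∑ p, lMat R ρ p j * 𝒮 (lMat R ρ i p) = if i = j then 1 else 0 := by
  have := mul'_lTensor_antipode_comul (k := k) (lMat R ρ i j)
  rw [comul_lMat hR hρ, counit_lMat hR hρ] at this
  simp only [map_sum, LinearMap.lTensor_tmul, LinearMap.mul'_apply] at this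
  rw [this]; split_ifs <;> simp

/-- Because m and l comultiply in opposite orders, the summation index of z = m·l stays inside the
second leg, where it assembles to z again. -/
theorem comul_zMat (i j : ι) : Δ (zMat R ρ i j) =
    ∑ p, ∑ q, (mMat R ρ i p * lMat R ρ q j) ⊗ₜ[k] zMat R ρ p q := by
  simp only [zMat, map_sum, Bialgebra.comul_mul, comul_mMat hR hρ, comul_lMat hR hρ,
    Finset.sum_mul_sum, Algebra.TensorProduct.tmul_mul_tmul, TensorProduct.tmul_sum]
  rw [Finset.sum_comm]
  refine Finset.sum_congr rfl fun p _ => ?_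
  rw [Finset.sum_comm]

omit hρ [Fintype ι] [DecidableEq ι] in
-- A hexagon axiom with ρᵢⱼ applied to one of the legs produced by Δ. Together with `rTensor_hitR_R`
-- it carries right skew derivations through the twist by R in `dualPair_mul`.
theorem lTensor_hitR_R (i j : ι) :
    LinearMap.lTensor H (hitR (ρ i j)) R = (mMat R ρ i j ⊗ₜ 1) * R := by
  have key := congrArg (LinearMap.lTensor H (sliceR (ρ i j))) hR.comul_right
  have h1 := bilin_ext
    (F := ((LinearMap.mul k (H ⊗[k] (H ⊗[k] H))).compl₁₂ leg13.toLinearMap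
      leg12.toLinearMap).compr₂ (LinearMap.lTensor H (sliceR (ρ i j))))
    (G := (LinearMap.mul k (H ⊗[k] H)).compl₁₂
      ((TensorProduct.mk k H H).flip 1 ∘ₗ sliceR (ρ i j)) LinearMap.id)
    (fun a b c d => by simp [leg13, leg12, TensorProduct.smul_tmul']) R R
  simp only [LinearMap.compr₂_apply, LinearMap.compl₁₂_apply, LinearMap.comp_apply,
    LinearMap.mul_apply', AlgHom.toLinearMap_apply, TensorProduct.mk_apply, LinearMap.flip_apply,
    LinearMap.id_apply] at h1
  rw [h1, ← LinearMap.lTensor_comp_apply] at key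
  exact key

omit hρ [Fintype ι] [DecidableEq ι] in
theorem rTensor_hitR_R (i j : ι) :
    LinearMap.rTensor H (hitR (ρ i j)) R = R * (1 ⊗ₜ lMat R ρ i j) := by
  have key := congrArg (LinearMap.lTensor H (sliceL (ρ i j))) hR.comul_left
  have h1 := bilin_ext
    (F := ((LinearMap.mul k (H ⊗[k] (H ⊗[k] H))).compl₁₂ leg13.toLinearMap
      leg23.toLinearMap).compr₂ (LinearMap.lTensor H (sliceL (ρ i j))))
    (G := (LinearMap.mul k (H ⊗[k] H)).compl₁₂ LinearMap.id
      (TensorProduct.mk k H H 1 ∘ₗ sliceL (ρ i j)))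
    (fun a b c d => by simp [leg13, leg23]) R R
  simp only [LinearMap.compr₂_apply, LinearMap.compl₁₂_apply, LinearMap.comp_apply,
    LinearMap.mul_apply', AlgHom.toLinearMap_apply, TensorProduct.mk_apply,
    LinearMap.id_apply] at h1
  rw [h1] at key
  refine Eq.trans ?_ key
  generalize R = t
  induction t using TensorProduct.induction_on with
  | zero => simp
  | tmul a b =>
    simp only [LinearMap.rTensor_tmul, hitR, LinearMap.comp_apply]
    induction Δ a using TensorProduct.induction_on with
    | zero => simp
    | tmul c d => simp [TensorProduct.smul_tmul']
    | add c d hc hd => simp only [map_add, TensorProduct.add_tmul, hc, hd]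
  | add a b ha hb => simp only [map_add, ha, hb]

end RMatrix

/-! ### Skew derivations of the braided Hopf algebra `T(W)` -/

section SkewDerivations

variable {k H W : Type u} [Field k] [Ring H] [HopfAlgebra k H] [AddCommGroup W] [Module k W]
  {ι : Type} [Fintype ι]

local notation "𝐓" => TensorAlgebra k W
local notation "ε" => Coalgebra.counit (R := k) (A := H)

open TensorAlgebra (algebraMapInv ιInv)

/-- Induction over left multiplication by basis vectors fits the coproduct, the antipode and the
skew derivations, all of which are governed by their values on products w·t. -/
theorem tensorAlgebra_induction (w : Module.Basis ι k W) {C : TensorAlgebra k W → Prop}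
    (one : C 1) (add : ∀ s t, C s → C t → C (s + t)) (smul : ∀ (c : k) t, C t → C (c • t))
    (mul : ∀ j t, C t → C (TensorAlgebra.ι k (w j) * t)) (t : TensorAlgebra k W) : C t := by
  have zero : C 0 := by simpa using smul 0 1 one
  -- The claim is strengthened to all left multiples, so that the induction on a factor can pass
  -- through products.
  have key : ∀ a : TensorAlgebra k W, ∀ t, C t → C (a * t) := by
    intro a
    induction a using TensorAlgebra.induction with
    | algebraMap r =>
      intro t ht
      rw [← Algebra.smul_def]
      exact smul r t ht
    | ι x =>
      intro t ht
      rw [← w.sum_repr x]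
      simp only [map_sum, map_smul, Finset.sum_mul, smul_mul_assoc]
      exact Finset.sum_induction _ C add zero fun j _ => smul _ _ (mul j t ht)
    | mul a b ha hb =>
      intro t ht
      rw [mul_assoc]
      exact ha _ (hb t ht)
    | add a b ha hb =>
      intro t ht
      rw [add_mul]
      exact add _ _ (ha t ht) (hb t ht)
  simpa using key t 1 one

theorem ιInv_one : ιInv (1 : 𝐓) = 0 := by
  -- `ιInv` factors through the trivial square-zero extension, whose product needs a right action of
  -- k on W.
  let : Module kᵐᵒᵖ W := Module.compHom _ ((RingHom.id k).fromOpposite mul_comm)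
  have : IsCentralScalar k W := ⟨fun r m => rfl⟩
  simp only [ιInv, LinearMap.comp_apply, AlgHom.toLinearMap_apply, map_one]
  exact TrivSqZeroExt.snd_one (R := k) (M := W)

/-- Only the degree-zero part of t contributes to the degree-one part of x·t. -/
theorem ιInv_ι_mul (x : W) (t : 𝐓) :
    ιInv (TensorAlgebra.ι k x * t) = algebraMapInv t • x := by
  let : Module kᵐᵒᵖ W := Module.compHom _ ((RingHom.id k).fromOpposite mul_comm)
  have : IsCentralScalar k W := ⟨fun r m => rfl⟩
  have h : (TrivSqZeroExt.fstHom k k W).comp TensorAlgebra.toTrivSqZeroExt =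
      (algebraMapInv : 𝐓 →ₐ[k] k) := by
    apply TensorAlgebra.hom_ext
    ext y
    simp [algebraMapInv]
  have h' : TrivSqZeroExt.fst (TensorAlgebra.toTrivSqZeroExt t) = algebraMapInv t :=
    DFunLike.congr_fun h t
  simp only [ιInv, LinearMap.comp_apply, AlgHom.toLinearMap_apply, map_mul,
    TensorAlgebra.toTrivSqZeroExt_ι]
  rw [← h']
  simp

theorem algebraMapInv_ι_mul (x : W) (t : 𝐓) : algebraMapInv (TensorAlgebra.ι k x * t) = 0 := by
  simp [algebraMapInv]

variable (ρ : H →ₐ[k] Module.End k W) (δ : W →ₗ[k] H ⊗[k] W)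

theorem tensorAct_one (h : H) : tensorAct ρ h 1 = ε h • 1 := by
  rw [tensorAct, (tensorModuleAlgebra ρ).act_one, Algebra.algebraMap_eq_smul_one]

theorem tensorAct_ι (h : H) (x : W) :
    tensorAct ρ h (TensorAlgebra.ι k x) = TensorAlgebra.ι k (ρ h x) := tensorActFun_ι ρ h x

theorem tensorAct_mul_of_comul_eq {κ : Type*} (s : Finset κ) (h : H) (f g : κ → H)
    (hh : Coalgebra.comul (R := k) h = ∑ i ∈ s, f i ⊗ₜ g i) (a b : 𝐓) :
    tensorAct ρ h (a * b) = ∑ i ∈ s, tensorAct ρ (f i) a * tensorAct ρ (g i) b := by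
  rw [tensorAct, (tensorModuleAlgebra ρ).act_mul, hh]
  simp

theorem algebraMapInv_tensorAct (h : H) (t : 𝐓) :
    algebraMapInv (tensorAct ρ h t) = ε h * algebraMapInv t := by
  induction t using TensorAlgebra.induction generalizing h with
  | algebraMap r =>
    rw [Algebra.algebraMap_eq_smul_one, map_smul, tensorAct_one]
    simp [mul_comm]
  | ι x => rw [tensorAct_ι]; simp [algebraMapInv]
  | mul a b ha hb =>
    rw [tensorAct, (tensorModuleAlgebra ρ).act_mul, map_mul]
    conv_rhs => rw [← Coalgebra.sum_counit_smul (Coalgebra.Repr.arbitrary k h)]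
    rw [← (Coalgebra.Repr.arbitrary k h).eq]
    simp only [map_sum, TensorProduct.map_tmul, LinearMap.mul'_apply, LinearMap.flip_apply,
      AlgHom.toLinearMap_apply, map_mul, Finset.sum_mul]
    refine Finset.sum_congr rfl fun i _ => ?_
    rw [ha, hb, map_smul, smul_eq_mul]
    ring
  | add a b ha hb => simp only [map_add, ha, hb, mul_add]

theorem tensorAct_ι_mul_of_matrix (w : Module.Basis ι k W) (τ : ι → ι → H →ₗ[k] k)
    (hτ : ∀ h j, ρ h (w j) = ∑ i, τ i j h • w i) (h : H) (j : ι) (t : 𝐓) :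
    tensorAct ρ h (TensorAlgebra.ι k (w j) * t) =
      ∑ i, TensorAlgebra.ι k (w i) * tensorAct ρ (hitL (τ i j) h) t := by
  rw [tensorAct, (tensorModuleAlgebra ρ).act_mul]
  simp only [hitL, LinearMap.comp_apply]
  induction Coalgebra.comul (R := k) h using TensorProduct.induction_on with
  | zero => simp
  | tmul a b =>
    simp only [TensorProduct.map_tmul, LinearMap.flip_apply, AlgHom.toLinearMap_apply,
      LinearMap.mul'_apply, sliceL_tmul, map_smul, LinearMap.smul_apply]
    rw [tensorAct_ι, hτ]
    simp [Finset.sum_mul]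
  | add a b ha hb => simp only [map_add, ha, hb, LinearMap.add_apply, mul_add,
      Finset.sum_add_distrib]

theorem counit_hitL (f : H →ₗ[k] k) (h : H) : ε (hitL f h) = f h := by
  have := conv_apply' f ε h
  rwa [hitR_counit] at this

theorem ιInv_tensorAct (w : Module.Basis ι k W) (h : H) (t : 𝐓) :
    ιInv (tensorAct ρ h t) = ρ h (ιInv t) := by
  classical
  have hτ : ∀ h j, ρ h (w j) = ∑ i, (w.coord i ∘ₗ ρ.toLinearMap.flip (w j)) h • w i := by
    intro h j
    conv_lhs => rw [← w.sum_repr (ρ h (w j))]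
    rfl
  induction t using tensorAlgebra_induction w generalizing h with
  | one => rw [tensorAct_one, map_smul, ιInv_one]; simp
  | add s t hs ht => simp only [map_add, hs, ht]
  | smul c t ht => simp only [map_smul, ht]
  | mul j t ht =>
    rw [tensorAct_ι_mul_of_matrix ρ w _ hτ, ιInv_ι_mul, map_smul, hτ, map_sum]
    simp only [ιInv_ι_mul, algebraMapInv_tensorAct, Finset.smul_sum, smul_smul]
    refine Finset.sum_congr rfl fun i _ => ?_
    rw [counit_hitL, mul_comm]

theorem braidedComul_one : braidedComul ρ δ 1 = 1 ⊗ₜ 1 := by simp [braidedComul]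

theorem braidedComul_ι_mul (x : W) (t : 𝐓) : braidedComul ρ δ (TensorAlgebra.ι k x * t) =
    mulComul ρ δ x (braidedComul ρ δ t) := by simp [braidedComul]

variable (w : Module.Basis ι k W) (c : ι → ι → H)

/-- The coaction `δ` is given by the matrix `c` of elements of `H`. -/
structure IsCoactMatrix [DecidableEq ι] (δ : W →ₗ[k] H ⊗[k] W) (w : Module.Basis ι k W)
    (c : ι → ι → H) : Prop where
  coact : ∀ j, δ (w j) = ∑ i, c i j ⊗ₜ w i
  counit : ∀ i j, ε (c i j) = if i = j then 1 else 0

variable [DecidableEq ι] {w c δ} (hc : IsCoactMatrix δ w c)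

include hc

theorem braidedComul_basis_mul (j : ι) (t : 𝐓) :
    braidedComul ρ δ (TensorAlgebra.ι k (w j) * t) =
      LinearMap.rTensor 𝐓 (LinearMap.mulLeft k (TensorAlgebra.ι k (w j))) (braidedComul ρ δ t) +
      ∑ i, TensorProduct.map (tensorAct ρ (c i j))
        (LinearMap.mulLeft k (TensorAlgebra.ι k (w i))) (braidedComul ρ δ t) := by
  rw [braidedComul_ι_mul, mulComul]
  simp only [LinearMap.add_apply, LinearMap.comp_apply, hc.coact, map_sum, TensorProduct.map_tmul,
    LinearMap.sum_apply]
  rfl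

omit hc in
theorem sum_counit_smul_eq (hc : IsCoactMatrix δ w c) (j : ι) (F : ι → 𝐓) :
    ∑ i, ε (c i j) • F i = F j := by
  simp [hc.counit]

/-- The left counit axiom. It supplies the term φ(wⱼ)t in the Leibniz rule `leftDer_basis_mul`. -/
theorem lid_rTensor_braidedComul (t : 𝐓) :
    TensorProduct.lid k 𝐓 (LinearMap.rTensor 𝐓 algebraMapInv.toLinearMap
      (braidedComul ρ δ t)) = t := by
  induction t using tensorAlgebra_induction w with
  | one => simp [braidedComul_one]
  | add s t hs ht => simp only [map_add, hs, ht]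
  | smul c t ht => simp only [map_smul, ht]
  | mul j t ht =>
    rw [braidedComul_basis_mul ρ hc]
    conv_rhs => rw [← ht]
    generalize braidedComul ρ δ t = u
    induction u using TensorProduct.induction_on with
    | zero => simp
    | tmul a b =>
      simp only [map_add, map_sum, LinearMap.rTensor_tmul, TensorProduct.map_tmul,
        TensorProduct.lid_tmul, LinearMap.mulLeft_apply, AlgHom.toLinearMap_apply,
        algebraMapInv_ι_mul, algebraMapInv_tensorAct, zero_smul, zero_add, mul_smul]
      rw [sum_counit_smul_eq hc]
      simp
    | add a b ha hb =>
      simp only [map_add, mul_add, Finset.sum_add_distrib] at ha hb ⊢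
      rw [← ha, ← hb]
      abel

theorem rid_lTensor_braidedComul (t : 𝐓) :
    TensorProduct.rid k 𝐓 (LinearMap.lTensor 𝐓 algebraMapInv.toLinearMap
      (braidedComul ρ δ t)) = t := by
  induction t using tensorAlgebra_induction w with
  | one => simp [braidedComul_one]
  | add s t hs ht => simp only [map_add, hs, ht]
  | smul c t ht => simp only [map_smul, ht]
  | mul j t ht =>
    rw [braidedComul_basis_mul ρ hc]
    conv_rhs => rw [← ht]
    generalize braidedComul ρ δ t = u
    induction u using TensorProduct.induction_on with
    | zero => simp
    | tmul a b => simp [algebraMapInv_ι_mul]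
    | add a b ha hb =>
      simp only [map_add, mul_add, Finset.sum_add_distrib] at ha hb ⊢
      rw [← ha, ← hb]
      abel

omit hc

variable (δ)

/-- `t ↦ φ(t₁) t₂`, where `t₁` is projected to its component in `W`. -/
def leftDer (φ : W →ₗ[k] k) : 𝐓 →ₗ[k] 𝐓 :=
  (TensorProduct.lid k 𝐓).toLinearMap ∘ₗ LinearMap.rTensor 𝐓 (φ ∘ₗ ιInv) ∘ₗ braidedComul ρ δ

/-- `t ↦ t₁ φ(t₂)`, where `t₂` is projected to its component in `W`. -/
def rightDer (φ : W →ₗ[k] k) : 𝐓 →ₗ[k] 𝐓 :=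
  (TensorProduct.rid k 𝐓).toLinearMap ∘ₗ LinearMap.lTensor 𝐓 (φ ∘ₗ ιInv) ∘ₗ braidedComul ρ δ

variable {δ}

omit [DecidableEq ι] in
theorem leftDer_one (φ : W →ₗ[k] k) : leftDer ρ δ φ 1 = 0 := by
  simp [leftDer, braidedComul_one, ιInv_one]

theorem rightDer_one (φ : W →ₗ[k] k) : rightDer ρ δ φ 1 = 0 := by
  simp [rightDer, braidedComul_one, ιInv_one]

theorem leftDer_sum {κ : Type*} (s : Finset κ) (a : κ → k) (φ : κ → W →ₗ[k] k) (t : 𝐓) :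
    leftDer ρ δ (∑ q ∈ s, a q • φ q) t = ∑ q ∈ s, a q • leftDer ρ δ (φ q) t := by
  simp only [leftDer, LinearMap.comp_apply]
  generalize braidedComul ρ δ t = u
  induction u using TensorProduct.induction_on with
  | zero => simp
  | tmul a b => simp [Finset.sum_smul, smul_smul]
  | add a b ha hb => simp only [map_add, ha, hb, smul_add, Finset.sum_add_distrib]

include hc

/-- A twisted Leibniz rule. The degree-one left leg of Δ(wⱼt) is either wⱼ itself, with t entirely
on the right, or it comes from t after the action of cᵢⱼ, and that action is absorbed into the
functional φ. -/
theorem leftDer_basis_mul (φ : W →ₗ[k] k) (j : ι) (t : 𝐓) :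
    leftDer ρ δ φ (TensorAlgebra.ι k (w j) * t) =
      φ (w j) • t + ∑ i, TensorAlgebra.ι k (w i) * leftDer ρ δ (φ ∘ₗ ρ (c i j)) t := by
  have h1 := lid_rTensor_braidedComul ρ hc t
  conv_rhs => lhs; rw [← h1]
  simp only [leftDer, LinearMap.comp_apply, braidedComul_basis_mul ρ hc]
  generalize braidedComul ρ δ t = u
  induction u using TensorProduct.induction_on with
  | zero => simp
  | tmul a b =>
    simp [ιInv_ι_mul, ιInv_tensorAct ρ w, smul_smul, mul_comm]
  | add a b ha hb =>
    simp only [map_add, mul_add, smul_add, Finset.sum_add_distrib] at ha hb ⊢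
    rw [add_add_add_comm, ha, hb]
    abel

/-- Now the right leg has degree one. Either it comes from t and wⱼ stays on the left, or it is some
wᵢ and all of t stays on the left, acted on by cᵢⱼ. -/
theorem rightDer_basis_mul (φ : W →ₗ[k] k) (j : ι) (t : 𝐓) :
    rightDer ρ δ φ (TensorAlgebra.ι k (w j) * t) =
      TensorAlgebra.ι k (w j) * rightDer ρ δ φ t + ∑ i, φ (w i) • tensorAct ρ (c i j) t := by
  have h1 := rid_lTensor_braidedComul ρ hc t
  conv_rhs => enter [2, 2, i]; rw [← h1]
  simp only [rightDer, LinearMap.comp_apply, braidedComul_basis_mul ρ hc]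
  generalize braidedComul ρ δ t = u
  induction u using TensorProduct.induction_on with
  | zero => simp
  | tmul a b =>
    simp [ιInv_ι_mul, smul_smul, mul_comm]
  | add a b ha hb =>
    simp only [map_add, mul_add, smul_add, Finset.sum_add_distrib] at ha hb ⊢
    rw [add_add_add_comm, ha, hb]
    abel

end SkewDerivations

/-! ### The Yetter-Drinfeld modules `V` and `V̄` in coordinates -/

section Coordinates

variable {k : Type u} {H : Type u} [Field k] [Ring H] [HopfAlgebra k H] {R : H ⊗[k] H}
  {V : Type u} [AddCommGroup V] [Module k V] [Module H V] [IsScalarTower k H V]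
  {ι : Type} [Fintype ι] [DecidableEq ι] (b : Module.Basis ι k V)

local notation "ε" => Coalgebra.counit (R := k) (A := H)
local notation "𝒮" => HopfAlgebra.antipode k (A := H)

/-- The matrix coefficients of the `H`-module `V`. -/
def matCoeff (i j : ι) : H →ₗ[k] k := b.coord i ∘ₗ (repV k V).toLinearMap.flip (b j)

local notation "𝛒" => matCoeff (H := H) b

omit [DecidableEq ι] in
theorem repV_basis (h : H) (j : ι) : repV k V h (b j) = ∑ i, 𝛒 i j h • b i := by
  conv_lhs => rw [← b.sum_repr (repV k V h (b j))]
  rfl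

theorem isMatrixRep_matCoeff : IsMatrixRep (𝛒) where
  one i j := by
    simp [matCoeff, Finsupp.single_apply, eq_comm]
  mul i j g h := by
    have h1 : 𝛒 i j (g * h) = b.coord i (repV k V g (repV k V h (b j))) := by simp [matCoeff]
    rw [h1, repV_basis b h j]
    simp only [map_sum, map_smul, smul_eq_mul]
    exact Finset.sum_congr rfl fun p _ => mul_comm _ _

theorem repVbar_basis (h : H) (i : ι) :
    repVbar k V h (b.dualBasis i) = ∑ p, 𝛒 i p (𝒮 h) • b.dualBasis p := by
  apply b.ext
  intro j
  have : repVbar k V h (b.dualBasis i) (b j) = b.coord i (repV k V (𝒮 h) (b j)) := by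
    simp [repVbar, Module.Dual.transpose]
  rw [this]
  simp [matCoeff, Finsupp.single_apply]

theorem coord_comp_repV (h : H) (i : ι) :
    b.coord i ∘ₗ repV k V h = ∑ q, 𝛒 i q h • b.coord q := by
  apply b.ext
  intro j
  simp [matCoeff, Finsupp.single_apply]

theorem eval_comp_repVbar (h : H) (j : ι) :
    Module.Dual.eval k V (b j) ∘ₗ repVbar k V h =
      ∑ p, 𝛒 p j (𝒮 h) • Module.Dual.eval k V (b p) := by
  apply b.dualBasis.ext
  intro i
  rw [LinearMap.comp_apply, repVbar_basis]
  simp [Finsupp.single_apply]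

omit [DecidableEq ι] in
theorem coactOf_basis {W : Type u} [AddCommGroup W] [Module k W] (w : Module.Basis ι k W)
    (ρ : H →ₐ[k] Module.End k W) (τ : ι → ι → H →ₗ[k] k)
    (hτ : ∀ h j, ρ h (w j) = ∑ i, τ i j h • w i) (C : H ⊗[k] H) (j : ι) :
    coactOf k ρ C (w j) = ∑ i, sliceR (τ i j) C ⊗ₜ w i := by
  simp only [coactOf, LinearMap.coe_mk, AddHom.coe_mk]
  induction C using TensorProduct.induction_on with
  | zero => simp
  | tmul a c => simp [hτ, TensorProduct.tmul_sum, TensorProduct.smul_tmul']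
  | add a c ha hc => simp only [map_add, TensorProduct.add_tmul, Finset.sum_add_distrib, ha, hc]

omit [DecidableEq ι] in
theorem sum_perm (F : ι → ι → ι → ι → ι → H) :
    ∑ p, ∑ q, ∑ r, ∑ s, ∑ t, F p q r s t = ∑ s, ∑ p, ∑ q, ∑ t, ∑ r, F p q r s t := by
  have h1 : ∑ p, ∑ q, ∑ r, ∑ s, ∑ t, F p q r s t =
      ∑ x : ι × ι × ι × ι × ι, F x.1 x.2.1 x.2.2.1 x.2.2.2.1 x.2.2.2.2 := by
    simp only [Fintype.sum_prod_type]
  have h2 : ∑ s, ∑ p, ∑ q, ∑ t, ∑ r, F p q r s t =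
      ∑ x : ι × ι × ι × ι × ι, F x.2.1 x.2.2.1 x.2.2.2.2 x.1 x.2.2.2.1 := by
    simp only [Fintype.sum_prod_type]
  rw [h1, h2]
  exact Fintype.sum_equiv ⟨fun x => (x.2.2.2.1, x.1, x.2.1, x.2.2.2.2, x.2.2.1),
    fun x => (x.2.1, x.2.2.1, x.2.2.2.2, x.1, x.2.2.2.1), fun _ => rfl, fun _ => rfl⟩ _ _
    fun _ => rfl

omit [DecidableEq ι] in
theorem sum_perm' (F : ι → ι → ι → ι → ι → H) :
    ∑ p, ∑ q, ∑ r, ∑ s, ∑ t, F p q r s t = ∑ s, ∑ t, ∑ p, ∑ q, ∑ r, F p q r s t := by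
  have h1 : ∑ p, ∑ q, ∑ r, ∑ s, ∑ t, F p q r s t =
      ∑ x : ι × ι × ι × ι × ι, F x.1 x.2.1 x.2.2.1 x.2.2.2.1 x.2.2.2.2 := by
    simp only [Fintype.sum_prod_type]
  have h2 : ∑ s, ∑ t, ∑ p, ∑ q, ∑ r, F p q r s t =
      ∑ x : ι × ι × ι × ι × ι, F x.2.2.1 x.2.2.2.1 x.2.2.2.2 x.1 x.2.1 := by
    simp only [Fintype.sum_prod_type]
  rw [h1, h2]
  exact Fintype.sum_equiv ⟨fun x => (x.2.2.2.1, x.2.2.2.2, x.1, x.2.1, x.2.2.1),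
    fun x => (x.2.2.1, x.2.2.2.1, x.2.2.2.2, x.1, x.2.1), fun _ => rfl, fun _ => rfl⟩ _ _
    fun _ => rfl

variable (hR : IsQuasitriangular R)

include hR

theorem isCoactMatrix_coactV : IsCoactMatrix (coactV k R V) b (lMat R (𝛒)) where
  coact j := by
    rw [coactV, coactOf_basis b _ _ (repV_basis b)]
    refine Finset.sum_congr rfl fun i _ => ?_
    congr 1
    rw [lMat]
    generalize R = t
    induction t using TensorProduct.induction_on with
    | zero => simp
    | tmul a c => simp
    | add a c ha hc => simp only [map_add, ha, hc]
  counit := counit_lMat hR (isMatrixRep_matCoeff b)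

/-- The coefficients of V̄ involve 𝒮, so the coaction is 𝒮(R¹) ⊗ ρ(𝒮(R²)). The invariance of R under
𝒮 ⊗ 𝒮 removes both antipodes and leaves m. -/
theorem isCoactMatrix_coactVbar :
    IsCoactMatrix (coactVbar k R V) b.dualBasis (fun p i => mMat R (𝛒) i p) where
  coact j := by
    rw [coactVbar, coactOf_basis b.dualBasis _ (fun p i => 𝛒 i p ∘ₗ 𝒮) (repVbar_basis b)]
    refine Finset.sum_congr rfl fun i _ => ?_
    congr 1
    rw [mMat]
    conv_rhs => rw [← hR.map_antipode]
    generalize R = t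
    induction t using TensorProduct.induction_on with
    | zero => simp
    | tmul a c => simp
    | add a c ha hc => simp only [map_add, ha, hc]
  counit i j := by
    rw [counit_mMat hR (isMatrixRep_matCoeff b)]
    simp [eq_comm]

omit hR [Fintype ι] [DecidableEq ι] in
theorem pairing_mMat_lMat (i j p q : ι) :
    pairing R (mMat R (𝛒) i j) (lMat R (𝛒) p q) = 𝛒 p q (mMat R (𝛒) i j) :=
  pairing_eq R (𝛒 p q) (𝛒 i j)

/-- Expanded, the term is Σ ρᵣⱼ(mᵢₜ) ρₛₚ(𝒮(lₚ_q)) l_qᵣ mₜₛ. The exchange relation for h = mᵢₛ turns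
the products l·m into m·l at the cost of other scalar coefficients, and those coefficients contract
with ρ(𝒮(l)) to a Kronecker delta, so that only m·l = z remains. -/
theorem pairTerm_basis (i j : ι) :
    pairTerm k R V (b.dualBasis i) (b j) = zMat R (𝛒) i j := by
  have hρ := isMatrixRep_matCoeff (H := H) b
  have e1 : iterVbar k R V (b.dualBasis i) = ∑ s, ∑ t,
      (mMat R (𝛒) i t ⊗ₜ[k] mMat R (𝛒) t s) ⊗ₜ[k] b.dualBasis s := by
    rw [iterVbar, (isCoactMatrix_coactVbar b hR).coact]
    simp only [map_sum, LinearMap.rTensor_tmul, comul_mMat hR hρ, TensorProduct.sum_tmul]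
  have e2 : iterVact k R V (b j) = ∑ p, ∑ q, ∑ r,
      (lMat R (𝛒) r j ⊗ₜ[k] lMat R (𝛒) q r) ⊗ₜ[k] repV k V (𝒮 (lMat R (𝛒) p q)) (b p) := by
    rw [iterVact, iterV, (isCoactMatrix_coactV b hR).coact]
    simp only [map_sum, LinearMap.rTensor_tmul, comul_lMat hR hρ, TensorProduct.sum_tmul,
      TensorProduct.assoc_tmul, LinearMap.lTensor_tmul, TensorProduct.lift.tmul,
      LinearMap.comp_apply, AlgHom.toLinearMap_apply]
  have e3 : pairTerm k R V (b.dualBasis i) (b j) = ∑ p, ∑ q, ∑ r, ∑ s, ∑ t,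
      (𝛒 r j (mMat R (𝛒) i t) * 𝛒 s p (𝒮 (lMat R (𝛒) p q))) •
        (lMat R (𝛒) q r * mMat R (𝛒) t s) := by
    rw [pairTerm, e1, e2]
    simp only [TensorProduct.sum_tmul, TensorProduct.tmul_sum, map_sum,
      TensorProduct.tensorTensorTensorComm_tmul, TensorProduct.map_tmul, LinearMap.comp_apply,
      LinearEquiv.coe_coe, TensorProduct.comm_tmul, LinearMap.mul'_apply, TensorProduct.lid_tmul,
      TensorProduct.rid_tmul, TensorProduct.lift.tmul, contractLeft_apply, pairing_mMat_lMat]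
    refine Finset.sum_congr rfl fun p _ => Finset.sum_congr rfl fun q _ =>
      Finset.sum_congr rfl fun r _ => Finset.sum_congr rfl fun s _ =>
      Finset.sum_congr rfl fun t _ => ?_
    rw [smul_smul, mul_comm]
    congr 2
    simp [matCoeff]
  rw [e3]
  -- The relation Δᶜᵒᵖ R = RΔ for the element mᵢₛ, with the coproduct of m written out.
  have e4 : ∀ s q, ∑ t, ∑ r, 𝛒 r j (mMat R (𝛒) i t) • (lMat R (𝛒) q r * mMat R (𝛒) t s) =
      ∑ r, ∑ t, 𝛒 q r (mMat R (𝛒) t s) • (mMat R (𝛒) i t * lMat R (𝛒) r j) := by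
    intro s q
    have := (sum_hitR_mul_lMat hR hρ q j (mMat R (𝛒) i s)).symm
    simp only [hitL, hitR, LinearMap.comp_apply, comul_mMat hR hρ, map_sum, sliceL_tmul,
      sliceR_tmul, Finset.mul_sum, Finset.sum_mul, mul_smul_comm, smul_mul_assoc] at this
    rw [Finset.sum_comm]
    exact this
  calc _ = ∑ s, ∑ p, ∑ q, 𝛒 s p (𝒮 (lMat R (𝛒) p q)) •
        ∑ t, ∑ r, 𝛒 r j (mMat R (𝛒) i t) • (lMat R (𝛒) q r * mMat R (𝛒) t s) := by
        simp only [Finset.smul_sum, smul_smul]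
        simp only [mul_comm (𝛒 _ _ (𝒮 _))]
        exact sum_perm _
    _ = ∑ r, ∑ t, (∑ s, ∑ p, ∑ q, 𝛒 s p (𝒮 (lMat R (𝛒) p q)) * 𝛒 q r (mMat R (𝛒) t s)) •
          (mMat R (𝛒) i t * lMat R (𝛒) r j) := by
        simp only [e4, Finset.smul_sum, Finset.sum_smul, smul_smul]
        exact sum_perm' _
    _ = ∑ r, ∑ t, (if t = r then (1 : k) else 0) • (mMat R (𝛒) i t * lMat R (𝛒) r j) := by
        refine Finset.sum_congr rfl fun r _ => Finset.sum_congr rfl fun t _ => ?_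
        congr 1
        have h1 : ∀ s p q, 𝛒 s p (𝒮 (lMat R (𝛒) p q)) * 𝛒 q r (mMat R (𝛒) t s) =
            𝛒 t s (lMat R (𝛒) q r) * 𝛒 s p (𝒮 (lMat R (𝛒) p q)) := by
          intro s p q
          rw [rho_mMat, mul_comm]
        simp only [h1]
        rw [Finset.sum_comm]
        -- Once ρ(m) is rewritten as ρ(l), multiplicativity of ρ collects the scalars into ρ of
        -- l·𝒮(l), which is the antipode axiom for l.
        have h2 : ∀ p, ∑ s, ∑ q, 𝛒 t s (lMat R (𝛒) q r) * 𝛒 s p (𝒮 (lMat R (𝛒) p q)) =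
            𝛒 t p (if p = r then 1 else 0) := by
          intro p
          rw [← sum_lMat_mul_antipode_lMat hR hρ, map_sum, Finset.sum_comm]
          exact Finset.sum_congr rfl fun q _ => (hρ.mul _ _ _ _).symm
        simp only [h2, apply_ite (𝛒 t _), hρ.one, map_zero]
        simp
    _ = zMat R (𝛒) i j := by
        simp [zMat]

end Coordinates

/-! ### Skew derivations of T(V) and the action of H. -/

section DerivationsV

variable {k : Type u} {H : Type u} [Field k] [Ring H] [HopfAlgebra k H] {R : H ⊗[k] H}
  {V : Type u} [AddCommGroup V] [Module k V] [Module H V] [IsScalarTower k H V]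
  {ι : Type} [Fintype ι] [DecidableEq ι] (b : Module.Basis ι k V)

local notation "ε" => Coalgebra.counit (R := k) (A := H)
local notation "𝒮" => HopfAlgebra.antipode k (A := H)
local notation "𝛒" => matCoeff (H := H) b

variable (R) in
/-- The left skew derivation of `T(V)` in the direction of the `i`-th coordinate. -/
def derL (i : ι) : TensorAlgebra k V →ₗ[k] TensorAlgebra k V :=
  leftDer (repV k V) (coactV k R V) (b.coord i)

variable (R) in
/-- The right skew derivation of `T(V)` in the direction of the `i`-th coordinate. -/
def derR (i : ι) : TensorAlgebra k V →ₗ[k] TensorAlgebra k V :=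
  rightDer (repV k V) (coactV k R V) (b.coord i)

variable (H) in
omit [DecidableEq ι] in
theorem tensorAct_V_mul (h : H) (j : ι) (t : TensorAlgebra k V) :
    tensorAct (repV k V) h (TensorAlgebra.ι k (b j) * t) =
      ∑ i, TensorAlgebra.ι k (b i) * tensorAct (repV k V) (hitL (𝛒 i j) h) t :=
  tensorAct_ι_mul_of_matrix _ b _ (repV_basis b) h j t

theorem tensorAct_Vbar_mul (h : H) (i : ι) (t : TensorAlgebra k (Module.Dual k V)) :
    tensorAct (repVbar k V) h (TensorAlgebra.ι k (b.dualBasis i) * t) =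
      ∑ p, TensorAlgebra.ι k (b.dualBasis p) *
        tensorAct (repVbar k V) (hitL (𝛒 i p ∘ₗ 𝒮) h) t :=
  tensorAct_ι_mul_of_matrix _ b.dualBasis (fun p i => 𝛒 i p ∘ₗ 𝒮) (repVbar_basis b) h i t

omit [Fintype ι] [DecidableEq ι] in
theorem derL_one (i : ι) : derL R b i 1 = 0 := leftDer_one _ _

omit [Fintype ι] [DecidableEq ι] in
theorem derR_one (i : ι) : derR R b i 1 = 0 := rightDer_one _ _

omit [DecidableEq ι] in
theorem sum_perm₄ {M : Type*} [AddCommMonoid M] (F : ι → ι → ι → ι → M) :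
    ∑ p, ∑ q, ∑ r, ∑ s, F p q r s = ∑ r, ∑ s, ∑ q, ∑ p, F p q r s := by
  have h1 : ∑ p, ∑ q, ∑ r, ∑ s, F p q r s =
      ∑ x : ι × ι × ι × ι, F x.1 x.2.1 x.2.2.1 x.2.2.2 := by
    simp only [Fintype.sum_prod_type]
  have h2 : ∑ r, ∑ s, ∑ q, ∑ p, F p q r s =
      ∑ x : ι × ι × ι × ι, F x.2.2.2 x.2.2.1 x.1 x.2.1 := by
    simp only [Fintype.sum_prod_type]
  rw [h1, h2]
  exact Fintype.sum_equiv ⟨fun x => (x.2.2.1, x.2.2.2, x.2.1, x.1),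
    fun x => (x.2.2.2, x.2.2.1, x.1, x.2.1), fun _ => rfl, fun _ => rfl⟩ _ _ fun _ => rfl

variable (hR : IsQuasitriangular R)

include hR

theorem derL_mul (i j : ι) (t : TensorAlgebra k V) :
    derL R b i (TensorAlgebra.ι k (b j) * t) = (if i = j then t else 0) +
      ∑ p, ∑ q, 𝛒 p j (mMat R (𝛒) i q) • (TensorAlgebra.ι k (b p) * derL R b q t) := by
  rw [derL, leftDer_basis_mul _ (isCoactMatrix_coactV b hR)]
  congr 1
  · simp [Finsupp.single_apply, eq_comm]
  · refine Finset.sum_congr rfl fun p _ => ?_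
    rw [coord_comp_repV, leftDer_sum, Finset.mul_sum]
    refine Finset.sum_congr rfl fun q _ => ?_
    rw [mul_smul_comm, rho_mMat]
    rfl

theorem derR_mul (i j : ι) (t : TensorAlgebra k V) :
    derR R b i (TensorAlgebra.ι k (b j) * t) = TensorAlgebra.ι k (b j) * derR R b i t +
      tensorAct (repV k V) (lMat R (𝛒) i j) t := by
  rw [derR, rightDer_basis_mul _ (isCoactMatrix_coactV b hR)]
  simp [Finsupp.single_apply]

/-- Evaluate `sum_hitL_mul_mMat` at ρᵣⱼ. This is the identity behind the H-covariance of the twisted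
term in the Leibniz rule for `derL`. -/
theorem sum_rho_mMat_hitL (i j r s : ι) (h : H) :
    ∑ p, ∑ q, 𝛒 r p (mMat R (𝛒) i q) • hitL (𝛒 q s) (hitL (𝛒 p j) h) =
      ∑ t, ∑ p, 𝛒 p j (mMat R (𝛒) t s) • hitL (𝛒 r p) (hitL (𝛒 i t) h) := by
  have hρ := isMatrixRep_matCoeff (H := H) b
  simp only [hitL_hitL, ← hitL_smul, ← hitL_sum]
  congr 1
  refine congrArg _ (LinearMap.ext fun g => ?_)
  have key := congrArg (𝛒 r j) (sum_hitL_mul_mMat hR hρ i s g)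
  simp only [map_sum, hρ.mul] at key
  simp only [LinearMap.sum_apply, LinearMap.smul_apply, smul_eq_mul]
  have e1 : ∀ p q, conv (𝛒 p j) (𝛒 q s) g = 𝛒 p j (hitR (𝛒 q s) g) := fun p q => conv_apply' _ _ _
  have e2 : ∀ t p, conv (𝛒 i t) (𝛒 r p) g = 𝛒 r p (hitL (𝛒 i t) g) := fun _ _ => rfl
  simp only [e1, e2]
  rw [Finset.sum_comm, ← key]
  exact Finset.sum_congr rfl fun t _ => Finset.sum_congr rfl fun p _ => mul_comm _ _

/-- A left derivation removes the first tensor leg, which is acted on by the first leg of Δ(h),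
hence `hitL`. A right derivation removes the last one, hence `hitR` in `derR_tensorAct`. -/
theorem derL_tensorAct (i : ι) (h : H) (t : TensorAlgebra k V) :
    derL R b i (tensorAct (repV k V) h t) =
      ∑ p, tensorAct (repV k V) (hitL (𝛒 i p) h) (derL R b p t) := by
  induction t using tensorAlgebra_induction b generalizing h i with
  | one => simp [tensorAct_one, derL_one]
  | add s t hs ht => simp only [map_add, hs, ht, Finset.sum_add_distrib]
  | smul c t ht => simp only [map_smul, ht, Finset.smul_sum]
  | mul j t ht =>
    rw [tensorAct_V_mul]
    simp only [map_sum, derL_mul b hR, map_add, ht, Finset.sum_add_distrib, map_smul,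
      tensorAct_V_mul]
    congr 1
    · simp [apply_ite]
    · have key := fun r s => congrArg (fun g => TensorAlgebra.ι k (b r) *
        tensorAct (repV k V) g (derL R b s t)) (sum_rho_mMat_hitL b hR i j r s h)
      simp only [map_sum, map_smul, LinearMap.sum_apply, LinearMap.smul_apply, Finset.mul_sum,
        mul_smul_comm] at key
      simp only [Finset.mul_sum, Finset.smul_sum]
      calc _ = ∑ r, ∑ s, ∑ p, ∑ q, 𝛒 r p (mMat R (𝛒) i q) • (TensorAlgebra.ι k (b r) *
            tensorAct (repV k V) (hitL (𝛒 q s) (hitL (𝛒 p j) h)) (derL R b s t)) := by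
            rw [Finset.sum_comm]
            refine Finset.sum_congr rfl fun r _ => ?_
            rw [Finset.sum_comm]
            conv_rhs => rw [Finset.sum_comm]
            rw [Finset.sum_comm]
            refine Finset.sum_congr rfl fun p _ => ?_
            rw [Finset.sum_comm]
        _ = _ := by
            simp only [key]
            exact sum_perm₄ _

theorem derR_tensorAct (i : ι) (h : H) (t : TensorAlgebra k V) :
    derR R b i (tensorAct (repV k V) h t) =
      ∑ p, tensorAct (repV k V) (hitR (𝛒 i p) h) (derR R b p t) := by
  have hρ := isMatrixRep_matCoeff (H := H) b
  induction t using tensorAlgebra_induction b generalizing h i with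
  | one => simp [tensorAct_one, derR_one]
  | add s t hs ht => simp only [map_add, hs, ht, Finset.sum_add_distrib]
  | smul c t ht => simp only [map_smul, ht, Finset.smul_sum]
  | mul j t ht =>
    rw [tensorAct_V_mul]
    simp only [map_sum, derR_mul b hR, map_add, ht, Finset.sum_add_distrib,
      tensorAct_V_mul]
    congr 1
    · simp only [Finset.mul_sum, hitL_hitR]
      rw [Finset.sum_comm]
    · have := sum_hitR_mul_lMat hR hρ i j h
      have := congrArg (fun g => tensorAct (repV k V) g t) this
      simp only [map_sum, map_mul, LinearMap.sum_apply, Module.End.mul_apply] at this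
      exact this.symm

end DerivationsV

/-! ### Skew derivations of T(V̄) and the commutation of T(V̄) with V. -/

section DerivationsVbar

variable {k : Type u} {H : Type u} [Field k] [Ring H] [HopfAlgebra k H] {R : H ⊗[k] H}
  {V : Type u} [AddCommGroup V] [Module k V] [Module H V] [IsScalarTower k H V]
  {ι : Type} [Fintype ι] [DecidableEq ι] (b : Module.Basis ι k V)

local notation "ε" => Coalgebra.counit (R := k) (A := H)
local notation "𝒮" => HopfAlgebra.antipode k (A := H)
local notation "𝛒" => matCoeff (H := H) b

variable (R) in
/-- The left skew derivation of `T(V̄)` in the direction of the `j`-th coordinate. -/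
def derLbar (j : ι) : TensorAlgebra k (Module.Dual k V) →ₗ[k] TensorAlgebra k (Module.Dual k V) :=
  leftDer (repVbar k V) (coactVbar k R V) (Module.Dual.eval k V (b j))

variable (R) in
/-- The right skew derivation of `T(V̄)` in the direction of the `j`-th coordinate. -/
def derRbar (j : ι) : TensorAlgebra k (Module.Dual k V) →ₗ[k] TensorAlgebra k (Module.Dual k V) :=
  rightDer (repVbar k V) (coactVbar k R V) (Module.Dual.eval k V (b j))

omit [Fintype ι] [DecidableEq ι] in
theorem derLbar_one (i : ι) : derLbar R b i 1 = 0 := leftDer_one _ _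

omit [Fintype ι] [DecidableEq ι] in
theorem derRbar_one (i : ι) : derRbar R b i 1 = 0 := rightDer_one _ _

omit [DecidableEq ι] in
theorem sum_perm₅ {M : Type*} [AddCommMonoid M] (F : ι → ι → ι → ι → ι → M) :
    ∑ p, ∑ r, ∑ q, ∑ c, ∑ d, F p r q c d = ∑ q, ∑ c, ∑ d, ∑ p, ∑ r, F p r q c d := by
  have h1 : ∑ p, ∑ r, ∑ q, ∑ c, ∑ d, F p r q c d =
      ∑ x : ι × ι × ι × ι × ι, F x.1 x.2.1 x.2.2.1 x.2.2.2.1 x.2.2.2.2 := by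
    simp only [Fintype.sum_prod_type]
  have h2 : ∑ q, ∑ c, ∑ d, ∑ p, ∑ r, F p r q c d =
      ∑ x : ι × ι × ι × ι × ι, F x.2.2.2.1 x.2.2.2.2 x.1 x.2.1 x.2.2.1 := by
    simp only [Fintype.sum_prod_type]
  rw [h1, h2]
  exact Fintype.sum_equiv ⟨fun x => (x.2.2.1, x.2.2.2.1, x.2.2.2.2, x.1, x.2.1),
    fun x => (x.2.2.2.1, x.2.2.2.2, x.1, x.2.1, x.2.2.1), fun _ => rfl, fun _ => rfl⟩ _ _
    fun _ => rfl

variable (hR : IsQuasitriangular R)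

include hR

theorem derLbar_mul (i j : ι) (t : TensorAlgebra k (Module.Dual k V)) :
    derLbar R b j (TensorAlgebra.ι k (b.dualBasis i) * t) = (if i = j then t else 0) +
      ∑ p, ∑ q, 𝛒 q j (𝒮 (mMat R (𝛒) i p)) •
        (TensorAlgebra.ι k (b.dualBasis p) * derLbar R b q t) := by
  rw [derLbar, leftDer_basis_mul _ (isCoactMatrix_coactVbar b hR)]
  congr 1
  · simp [Finsupp.single_apply, eq_comm]
  · refine Finset.sum_congr rfl fun p _ => ?_
    rw [eval_comp_repVbar, leftDer_sum, Finset.mul_sum]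
    refine Finset.sum_congr rfl fun q _ => ?_
    rw [mul_smul_comm]
    rfl

theorem derRbar_mul (i j : ι) (t : TensorAlgebra k (Module.Dual k V)) :
    derRbar R b j (TensorAlgebra.ι k (b.dualBasis i) * t) =
      TensorAlgebra.ι k (b.dualBasis i) * derRbar R b j t +
      tensorAct (repVbar k V) (mMat R (𝛒) i j) t := by
  rw [derRbar, rightDer_basis_mul _ (isCoactMatrix_coactVbar b hR)]
  simp [Finsupp.single_apply]

theorem tensorAct_nMat_mul (q j i : ι) (t : TensorAlgebra k (Module.Dual k V)) :
    tensorAct (repVbar k V) (nMat R (𝛒) q j) (TensorAlgebra.ι k (b.dualBasis i) * t) =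
      ∑ p, ∑ r, 𝛒 q p (mMat R (𝛒) i r) • (TensorAlgebra.ι k (b.dualBasis r) *
        tensorAct (repVbar k V) (nMat R (𝛒) p j) t) := by
  rw [tensorAct_mul_of_comul_eq _ _ _ _ _ (comul_nMat hR (isMatrixRep_matCoeff b) q j)]
  refine Finset.sum_congr rfl fun p _ => ?_
  rw [tensorAct_ι, repVbar_basis, map_sum, Finset.sum_mul]
  refine Finset.sum_congr rfl fun r _ => ?_
  rw [rho_antipode_nMat hR, map_smul, smul_mul_assoc]

/-- The Leibniz rule for `derLbar` carries coefficients ρ(𝒮(m)), while the action of n on a product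
produces ρ(m). These cancel, so the combination Dⱼ = Σ nₚⱼ·∂ᴸₚ satisfies the simpler rule Dⱼ(yᵢt) =
nᵢⱼ·t + yᵢDⱼ(t). -/
theorem sum_tensorAct_nMat_derLbar (i j : ι) (t : TensorAlgebra k (Module.Dual k V)) :
    ∑ p, tensorAct (repVbar k V) (nMat R (𝛒) p j)
        (derLbar R b p (TensorAlgebra.ι k (b.dualBasis i) * t)) =
      tensorAct (repVbar k V) (nMat R (𝛒) i j) t + TensorAlgebra.ι k (b.dualBasis i) *
        ∑ q, tensorAct (repVbar k V) (nMat R (𝛒) q j) (derLbar R b q t) := by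
  have hρ := isMatrixRep_matCoeff (H := H) b
  simp only [derLbar_mul b hR, map_add, Finset.sum_add_distrib]
  congr 1
  · simp [apply_ite]
  · simp only [map_sum, map_smul, tensorAct_nMat_mul b hR, Finset.smul_sum, smul_smul]
    have key : ∀ q c d, ∑ p, ∑ r, 𝛒 q p (𝒮 (mMat R (𝛒) i r)) * 𝛒 p c (mMat R (𝛒) r d) =
        if i = d then (if q = c then 1 else 0) else 0 := by
      intro q c d
      rw [Finset.sum_comm]
      simp only [← hρ.mul, ← map_sum, sum_antipode_mMat_mul_mMat hR hρ]
      split_ifs <;> simp_all [hρ.one]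
    calc _ = ∑ q, ∑ c, ∑ d, (∑ p, ∑ r, 𝛒 q p (𝒮 (mMat R (𝛒) i r)) * 𝛒 p c (mMat R (𝛒) r d)) •
          (TensorAlgebra.ι k (b.dualBasis d) *
            tensorAct (repVbar k V) (nMat R (𝛒) c j) (derLbar R b q t)) := by
          simp only [Finset.sum_smul]
          exact sum_perm₅ _
      _ = _ := by
          simp only [key, Finset.mul_sum]
          simp

/-- Algebra elements that satisfy the relations of `T(V̄) # H`, together with elements `xⱼ`
that satisfy the cross relations with `T(V̄)`. -/
structure IsCrossRep {E : Type*} [Ring E] [Algebra k E] (R : H ⊗[k] H) (g : H →ₐ[k] E) (x : ι → E)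
    (T : TensorAlgebra k (Module.Dual k V) →ₐ[k] E) : Prop where
  smash : ∀ h t, g h * T t = LinearMap.mul' k E (TensorProduct.map
    (T.toLinearMap ∘ₗ (tensorAct (repVbar k V)).toLinearMap.flip t) g.toLinearMap
      (Coalgebra.comul (R := k) h))
  cross : ∀ i j, T (TensorAlgebra.ι k (b.dualBasis i)) * x j =
    ∑ p, ∑ q, 𝛒 p j (mMat R (𝛒) i q) • (x p * T (TensorAlgebra.ι k (b.dualBasis q))) +
      (if i = j then 1 else 0) - g (zMat R (𝛒) i j)

variable {b} {E : Type*} [Ring E] [Algebra k E] {g : H →ₐ[k] E} {x : ι → E}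
    {T : TensorAlgebra k (Module.Dual k V) →ₐ[k] E}

/-- The first leg of Δ(z) is m·l. Its factor l meets the acting element n and cancels against it,
which leaves the action of m. -/
theorem IsCrossRep.zMat_mul (hE : IsCrossRep b R g x T) (i j : ι)
    (t : TensorAlgebra k (Module.Dual k V)) :
    ∑ p, g (zMat R (𝛒) i p) * T (tensorAct (repVbar k V) (nMat R (𝛒) p j) t) =
      ∑ p, T (tensorAct (repVbar k V) (mMat R (𝛒) i p) t) * g (zMat R (𝛒) p j) := by
  have hρ := isMatrixRep_matCoeff (H := H) b
  simp only [hE.smash, comul_zMat hR hρ, map_sum, TensorProduct.map_tmul, LinearMap.mul'_apply,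
    LinearMap.comp_apply, LinearMap.flip_apply, AlgHom.toLinearMap_apply, map_mul,
    Module.End.mul_apply]
  rw [Finset.sum_comm]
  refine Finset.sum_congr rfl fun a _ => ?_
  rw [Finset.sum_comm]
  have : ∀ q, ∑ p, T (tensorAct (repVbar k V) (mMat R (𝛒) i a) (tensorAct (repVbar k V)
      (lMat R (𝛒) q p) (tensorAct (repVbar k V) (nMat R (𝛒) p j) t))) =
      if q = j then T (tensorAct (repVbar k V) (mMat R (𝛒) i a) t) else 0 := by
    intro q
    simp only [← map_sum, ← Module.End.mul_apply, ← map_mul, ← LinearMap.sum_apply]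
    simp only [← Finset.mul_sum, sum_lMat_mul_nMat hR hρ]
    split_ifs <;> simp
  simp only [← Finset.sum_mul, this]
  simp

/-- Induction on t through the cross relation. The point of the formula is that its right side
involves t only through the action of H and through skew derivations of t, so an ideal stable under
these can be moved past xⱼ. -/
theorem IsCrossRep.mul_x (hE : IsCrossRep b R g x T) (j : ι)
    (t : TensorAlgebra k (Module.Dual k V)) :
    T t * x j = ∑ p, x p * T (tensorAct (repVbar k V) (nMat R (𝛒) p j) t) +
      T (∑ p, tensorAct (repVbar k V) (nMat R (𝛒) p j) (derLbar R b p t)) -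
      ∑ p, T (derRbar R b p t) * g (zMat R (𝛒) p j) := by
  have hρ := isMatrixRep_matCoeff (H := H) b
  induction t using tensorAlgebra_induction b.dualBasis with
  | one =>
    simp [derLbar_one, derRbar_one, tensorAct_one, counit_nMat hR hρ]
  | add s t hs ht =>
    simp only [map_add, add_mul, mul_add, hs, ht, Finset.sum_add_distrib]
    abel
  | smul c t ht =>
    simp only [map_smul, smul_mul_assoc, ht, mul_smul_comm, ← Finset.smul_sum, smul_sub, smul_add]
  | mul i t ht =>
    rw [map_mul, mul_assoc, ht, mul_sub, mul_add, Finset.mul_sum, sum_tensorAct_nMat_derLbar b hR]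
    simp only [derRbar_mul b hR, ← mul_assoc, hE.cross, map_add, add_mul, sub_mul,
      Finset.sum_add_distrib, Finset.sum_sub_distrib, hE.zMat_mul hR]
    have e1 : ∑ p, x p * T (tensorAct (repVbar k V) (nMat R (𝛒) p j)
        (TensorAlgebra.ι k (b.dualBasis i) * t)) =
        ∑ p, (∑ r, ∑ q, 𝛒 r p (mMat R (𝛒) i q) •
          (x r * T (TensorAlgebra.ι k (b.dualBasis q)))) *
            T (tensorAct (repVbar k V) (nMat R (𝛒) p j) t) := by
      simp only [tensorAct_nMat_mul b hR, map_sum, map_smul, map_mul, Finset.mul_sum,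
        Finset.sum_mul, smul_mul_assoc, mul_smul_comm, mul_assoc]
      rw [Finset.sum_comm]
    have e2 : ∑ p, (if i = p then (1 : E) else 0) *
        T (tensorAct (repVbar k V) (nMat R (𝛒) p j) t) =
        T (tensorAct (repVbar k V) (nMat R (𝛒) i j) t) := by simp
    rw [e1, e2]
    simp only [map_mul, mul_assoc, ← Finset.mul_sum]
    abel

end DerivationsVbar

/-! ### The defining ideal of a Nichols algebra -/

section NicholsIdeal

variable {k H W : Type u} [Field k] [Ring H] [HopfAlgebra k H] [AddCommGroup W] [Module k W]
  {ρ : H →ₐ[k] Module.End k W} {δ : W →ₗ[k] H ⊗[k] W}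

local notation "𝐓" => TensorAlgebra k W

open TensorAlgebra (algebraMapInv ιInv)
open Polynomial (X C)

/-- Generators of degree at least two vanish in the trivial square-zero extension of k by W, from
which `ιInv` reads off the degree-one part. -/
theorem IsNicholsIdeal.ιInv_eq {I : TwoSidedIdeal 𝐓} (hI : IsNicholsIdeal ρ δ I) {t : 𝐓}
    (ht : t ∈ I) : ιInv t = 0 := by
  let : Module kᵐᵒᵖ W := Module.compHom _ ((RingHom.id k).fromOpposite mul_comm)
  have : IsCentralScalar k W := ⟨fun r m => rfl⟩
  obtain ⟨X, hX, rfl⟩ := hI.generated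
  have hle : TwoSidedIdeal.span X ≤
      TwoSidedIdeal.ker (TensorAlgebra.toTrivSqZeroExt (R := k) (M := W)) := by
    rw [TwoSidedIdeal.span_le]
    intro x hx
    obtain ⟨n, hn, hxn⟩ := hX x hx
    rw [SetLike.mem_coe, TwoSidedIdeal.mem_ker]
    have h1 := Submodule.mem_map_of_mem
      (f := (TensorAlgebra.toTrivSqZeroExt (R := k) (M := W)).toLinearMap) hxn
    rw [Submodule.map_pow] at h1
    have h2 : (Submodule.map (TensorAlgebra.toTrivSqZeroExt (R := k) (M := W)).toLinearMap
        (LinearMap.range (TensorAlgebra.ι k (M := W)))) ^ 2 = ⊥ := by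
      rw [eq_bot_iff, pow_two, Submodule.mul_le]
      rintro _ ⟨_, ⟨a, rfl⟩, rfl⟩ _ ⟨_, ⟨b, rfl⟩, rfl⟩
      simp
    obtain ⟨m, rfl⟩ := Nat.exists_eq_add_of_le hn
    rw [pow_add, h2, Submodule.bot_mul] at h1
    simpa using h1
  have h := hle ht
  rw [TwoSidedIdeal.mem_ker] at h
  have h' := congrArg (TrivSqZeroExt.sndHom k W) h
  rw [map_zero] at h'
  exact h'

/-- In I ⊗ T + T ⊗ I the first summand is killed because elements of I have no degree-one part, and
the second is sent into I. -/
theorem IsNicholsIdeal.leftDer_mem {I : TwoSidedIdeal 𝐓} (hI : IsNicholsIdeal ρ δ I)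
    (φ : W →ₗ[k] k) {t : 𝐓} (ht : t ∈ I) : leftDer ρ δ φ t ∈ I := by
  have h := hI.comul_mem t ht
  rw [leftDer, LinearMap.comp_apply, LinearMap.comp_apply]
  generalize braidedComul ρ δ t = u at h
  obtain ⟨_, ⟨x, rfl⟩, _, ⟨y, rfl⟩, rfl⟩ := Submodule.mem_sup.1 h
  clear h
  rw [map_add, ← LinearMap.rTensor_comp_apply, map_add]
  have h0 : (φ ∘ₗ ιInv) ∘ₗ (I.asIdeal.restrictScalars k).subtype = 0 := by
    ext s
    have : ιInv (s : 𝐓) = 0 := hI.ιInv_eq s.2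
    simp [this]
  rw [h0, LinearMap.rTensor_zero, LinearMap.zero_apply, map_zero, zero_add]
  induction y using TensorProduct.induction_on with
  | zero => simp [I.zero_mem]
  | tmul a b =>
    simp only [LinearMap.lTensor_tmul, LinearMap.rTensor_tmul, LinearEquiv.coe_coe,
      TensorProduct.lid_tmul, Submodule.subtype_apply]
    exact (I.asIdeal.restrictScalars k).smul_mem _ b.2
  | add a b ha hb =>
    simp only [map_add]
    exact I.add_mem ha hb

theorem IsNicholsIdeal.rightDer_mem {I : TwoSidedIdeal 𝐓} (hI : IsNicholsIdeal ρ δ I)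
    (φ : W →ₗ[k] k) {t : 𝐓} (ht : t ∈ I) : rightDer ρ δ φ t ∈ I := by
  have h := hI.comul_mem t ht
  rw [rightDer, LinearMap.comp_apply, LinearMap.comp_apply]
  generalize braidedComul ρ δ t = u at h
  obtain ⟨_, ⟨x, rfl⟩, _, ⟨y, rfl⟩, rfl⟩ := Submodule.mem_sup.1 h
  clear h
  rw [map_add, ← LinearMap.lTensor_comp_apply, map_add]
  have h0 : (φ ∘ₗ ιInv) ∘ₗ (I.asIdeal.restrictScalars k).subtype = 0 := by
    ext s
    have : ιInv (s : 𝐓) = 0 := hI.ιInv_eq s.2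
    simp [this]
  rw [h0, LinearMap.lTensor_zero, LinearMap.zero_apply, map_zero, add_zero]
  induction x using TensorProduct.induction_on with
  | zero => simp [I.zero_mem]
  | tmul a b =>
    simp only [LinearMap.lTensor_tmul, LinearMap.rTensor_tmul, LinearEquiv.coe_coe,
      TensorProduct.rid_tmul, Submodule.subtype_apply]
    exact (I.asIdeal.restrictScalars k).smul_mem _ a.2
  | add a b ha hb =>
    simp only [map_add]
    exact I.add_mem ha hb

variable (ρ δ)

/-- The elements of the defining ideal are sums of elements of Hopf ideals. -/
theorem mem_span_of_mem_nicholsIdeal {t : 𝐓} (ht : t ∈ nicholsIdeal ρ δ) :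
    t ∈ Submodule.span k {t : 𝐓 | ∃ I, IsNicholsIdeal ρ δ I ∧ t ∈ I} := by
  set P := Submodule.span k {t : 𝐓 | ∃ I, IsNicholsIdeal ρ δ I ∧ t ∈ I} with hP
  have hl : ∀ x y : 𝐓, y ∈ P → x * y ∈ P := by
    intro x y hy
    have : P ≤ P.comap (LinearMap.mulLeft k x) := Submodule.span_le.2 (by
      rintro t ⟨I, hI, ht⟩
      exact Submodule.subset_span ⟨I, hI, I.mul_mem_left _ _ ht⟩)
    exact this hy
  have hr : ∀ x y : 𝐓, x ∈ P → x * y ∈ P := by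
    intro x y hx
    have : P ≤ P.comap (LinearMap.mulRight k y) := Submodule.span_le.2 (by
      rintro t ⟨I, hI, ht⟩
      exact Submodule.subset_span ⟨I, hI, I.mul_mem_right _ _ ht⟩)
    exact this hx
  -- The linear span of all the Hopf ideals is itself a two-sided ideal, so it contains their
  -- supremum.
  let J : TwoSidedIdeal 𝐓 := TwoSidedIdeal.mk' P P.zero_mem (fun h h' => P.add_mem h h')
    (fun h => P.neg_mem h) (fun h => hl _ _ h) (fun h => hr _ _ h)
  have hle : nicholsIdeal ρ δ ≤ J := by
    refine sSup_le fun I hI t ht => ?_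
    rw [TwoSidedIdeal.mem_mk']
    exact Submodule.subset_span ⟨I, hI, ht⟩
  have := hle ht
  rwa [TwoSidedIdeal.mem_mk'] at this

/-- A linear map that preserves every Hopf ideal preserves the defining ideal. -/
theorem map_mem_nicholsIdeal (F : 𝐓 →ₗ[k] 𝐓)
    (hF : ∀ I, IsNicholsIdeal ρ δ I → ∀ t ∈ I, F t ∈ I) {t : 𝐓} (ht : t ∈ nicholsIdeal ρ δ) :
    F t ∈ nicholsIdeal ρ δ := by
  have h := mem_span_of_mem_nicholsIdeal ρ δ ht
  have : Submodule.span k {t : 𝐓 | ∃ I, IsNicholsIdeal ρ δ I ∧ t ∈ I} ≤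
      ((nicholsIdeal ρ δ).asIdeal.restrictScalars k).comap F := Submodule.span_le.2 (by
    rintro t ⟨I, hI, ht⟩
    exact (le_sSup hI : I ≤ nicholsIdeal ρ δ) (hF I hI t ht))
  exact this h

theorem algebraMapInv_nicholsIdeal {t : 𝐓} (ht : t ∈ nicholsIdeal ρ δ) : algebraMapInv t = 0 := by
  have h := mem_span_of_mem_nicholsIdeal ρ δ ht
  have : Submodule.span k {t : 𝐓 | ∃ I, IsNicholsIdeal ρ δ I ∧ t ∈ I} ≤
      LinearMap.ker (algebraMapInv (R := k) (M := W)).toLinearMap := Submodule.span_le.2 (by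
    rintro t ⟨I, hI, ht⟩
    exact hI.counit_eq t ht)
  exact this h

/-- The projection `T(W) → B(W)`. -/
def nicholsMk : 𝐓 →ₐ[k] Nichols ρ δ := (nicholsIdeal ρ δ).ringCon.mkₐ k

theorem nicholsMk_surjective : Function.Surjective (nicholsMk ρ δ) := RingCon.mkₐ_surjective _

theorem nicholsMk_eq_zero {t : 𝐓} : nicholsMk ρ δ t = 0 ↔ t ∈ nicholsIdeal ρ δ := by
  rw [TwoSidedIdeal.mem_iff]
  exact RingCon.eq _

/-- The operator on `B(W)` induced by an operator on `T(W)` that preserves the defining ideal. -/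
def nicholsDescend (F : 𝐓 →ₗ[k] 𝐓) (hF : ∀ t ∈ nicholsIdeal ρ δ, F t ∈ nicholsIdeal ρ δ) :
    Nichols ρ δ →ₗ[k] Nichols ρ δ :=
  (LinearMap.ker (nicholsMk ρ δ).toLinearMap).liftQ ((nicholsMk ρ δ).toLinearMap ∘ₗ F)
    (fun t ht => (nicholsMk_eq_zero ρ δ).2 (hF t ((nicholsMk_eq_zero ρ δ).1 ht))) ∘ₗ
  ((nicholsMk ρ δ).toLinearMap.quotKerEquivOfSurjective
    (nicholsMk_surjective ρ δ)).symm.toLinearMap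

@[simp] theorem nicholsDescend_mk (F : 𝐓 →ₗ[k] 𝐓)
    (hF : ∀ t ∈ nicholsIdeal ρ δ, F t ∈ nicholsIdeal ρ δ) (t : 𝐓) :
    nicholsDescend ρ δ F hF (nicholsMk ρ δ t) = nicholsMk ρ δ (F t) := by
  have : ((nicholsMk ρ δ).toLinearMap.quotKerEquivOfSurjective
      (nicholsMk_surjective ρ δ)).symm (nicholsMk ρ δ t) = Submodule.Quotient.mk t := by
    rw [LinearEquiv.symm_apply_eq]
    rfl
  rw [nicholsDescend, LinearMap.comp_apply, LinearEquiv.coe_coe, this]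
  rfl

/-- The action of `H` on `B(W)`. -/
def nicholsAct : H →ₐ[k] Module.End k (Nichols ρ δ) :=
  AlgHom.ofLinearMap
    { toFun := fun h => nicholsDescend ρ δ (tensorAct ρ h) fun _ ht =>
        map_mem_nicholsIdeal ρ δ _ (fun _ hI t ht => hI.act_mem h t ht) ht
      map_add' := fun g h => LinearMap.ext fun x => by
        obtain ⟨t, rfl⟩ := nicholsMk_surjective ρ δ x
        simp
      map_smul' := fun c h => LinearMap.ext fun x => by
        obtain ⟨t, rfl⟩ := nicholsMk_surjective ρ δ x
        simp }
    (LinearMap.ext fun x => by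
      obtain ⟨t, rfl⟩ := nicholsMk_surjective ρ δ x
      simp)
    (fun g h => LinearMap.ext fun x => by
      obtain ⟨t, rfl⟩ := nicholsMk_surjective ρ δ x
      simp)

@[simp] theorem nicholsAct_mk (h : H) (t : 𝐓) :
    nicholsAct ρ δ h (nicholsMk ρ δ t) = nicholsMk ρ δ (tensorAct ρ h t) :=
  nicholsDescend_mk ρ δ _ (fun _ ht =>
    map_mem_nicholsIdeal ρ δ _ (fun _ hI t ht => hI.act_mem h t ht) ht) t

/-- The algebra map `T(W) → B(W)[X]`, `w ↦ w X`, which records the degree. -/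
def tensorToPoly : 𝐓 →ₐ[k] Polynomial (Nichols ρ δ) :=
  TensorAlgebra.lift k (LinearMap.mulLeft k (X : Polynomial (Nichols ρ δ)) ∘ₗ
    (Polynomial.CAlgHom : Nichols ρ δ →ₐ[k] _).toLinearMap ∘ₗ (nicholsMk ρ δ).toLinearMap ∘ₗ
    TensorAlgebra.ι k)

theorem tensorToPoly_of_mem_pow {n : ℕ} {t : 𝐓} (ht : t ∈ LinearMap.range (TensorAlgebra.ι k) ^ n) :
    tensorToPoly ρ δ t = C (nicholsMk ρ δ t) * X ^ n := by
  induction n generalizing t with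
  | zero =>
    rw [pow_zero] at ht
    obtain ⟨r, rfl⟩ := Submodule.mem_one.1 ht
    rw [AlgHom.commutes, AlgHom.commutes, pow_zero, mul_one]
    rfl
  | succ n ih =>
    rw [pow_succ'] at ht
    induction ht using Submodule.mul_induction_on' with
    | mem_mul_mem m hm s hs =>
      obtain ⟨w, rfl⟩ := hm
      rw [map_mul, map_mul, ih hs, tensorToPoly, TensorAlgebra.lift_ι_apply, pow_succ', map_mul]
      change X * C (nicholsMk ρ δ (TensorAlgebra.ι k w)) * _ = _
      rw [Polynomial.X_mul_C, mul_assoc, mul_assoc, ← mul_assoc X, Polynomial.X_mul_C, mul_assoc]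
    | add x _ y _ hx hy => rw [map_add, hx, hy, map_add, map_add, add_mul]

/-- A homogeneous generator of degree n goes to its class times Xⁿ, and the class is zero. Thus 𝒥(W)
is homogeneous, and the coefficients of the polynomial define the grading of 𝔅(W). -/
theorem tensorToPoly_eq_zero {t : 𝐓} (ht : t ∈ nicholsIdeal ρ δ) : tensorToPoly ρ δ t = 0 := by
  have hle : nicholsIdeal ρ δ ≤ TwoSidedIdeal.ker (tensorToPoly ρ δ) := by
    refine sSup_le fun I hI => ?_
    obtain ⟨S, hS, hIS⟩ := id hI.generated
    rw [hIS, TwoSidedIdeal.span_le]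
    intro x hx
    obtain ⟨n, -, hxn⟩ := hS x hx
    have hxI : x ∈ I := by rw [hIS]; exact TwoSidedIdeal.subset_span hx
    rw [SetLike.mem_coe, TwoSidedIdeal.mem_ker, tensorToPoly_of_mem_pow ρ δ hxn,
      (nicholsMk_eq_zero ρ δ).2 ((le_sSup hI : I ≤ nicholsIdeal ρ δ) hxI), map_zero, zero_mul]
  exact (TwoSidedIdeal.mem_ker _).1 (hle ht)

/-- The projection of `B(W)` to its component of degree `n`. -/
def nicholsProj (n : ℕ) : Nichols ρ δ →ₗ[k] Nichols ρ δ :=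
  (LinearMap.ker (nicholsMk ρ δ).toLinearMap).liftQ
    (((Polynomial.lcoeff (Nichols ρ δ) n).restrictScalars k) ∘ₗ (tensorToPoly ρ δ).toLinearMap)
    (fun t ht => by
      simp [tensorToPoly_eq_zero ρ δ ((nicholsMk_eq_zero ρ δ).1 ht)]) ∘ₗ
  ((nicholsMk ρ δ).toLinearMap.quotKerEquivOfSurjective
    (nicholsMk_surjective ρ δ)).symm.toLinearMap

theorem nicholsProj_mk (n : ℕ) (t : 𝐓) :
    nicholsProj ρ δ n (nicholsMk ρ δ t) = (tensorToPoly ρ δ t).coeff n := by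
  have : ((nicholsMk ρ δ).toLinearMap.quotKerEquivOfSurjective
      (nicholsMk_surjective ρ δ)).symm (nicholsMk ρ δ t) = Submodule.Quotient.mk t := by
    rw [LinearEquiv.symm_apply_eq]
    rfl
  rw [nicholsProj, LinearMap.comp_apply, LinearEquiv.coe_coe, this]
  rfl

theorem nicholsProj_mk_of_mem {n : ℕ} {t : 𝐓} (ht : t ∈ LinearMap.range (TensorAlgebra.ι k) ^ n)
    (m : ℕ) : nicholsProj ρ δ m (nicholsMk ρ δ t) = if m = n then nicholsMk ρ δ t else 0 := by
  rw [nicholsProj_mk, tensorToPoly_of_mem_pow ρ δ ht, Polynomial.coeff_C_mul_X_pow]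

/-- Induction on products of elements of `W` in `T(W)`, with their degree. -/
theorem tensorAlgebra_hom_induction {P : 𝐓 → Prop} (add : ∀ s t, P s → P t → P (s + t))
    (hom : ∀ n, ∀ t ∈ LinearMap.range (TensorAlgebra.ι k (M := W)) ^ n, P t) (t : 𝐓) : P t := by
  have key : t ∈ ⨆ n : ℕ, LinearMap.range (TensorAlgebra.ι k (M := W)) ^ n := by
    induction t using TensorAlgebra.induction with
    | algebraMap r =>
      refine Submodule.mem_iSup_of_mem 0 ?_
      rw [pow_zero]
      exact Submodule.algebraMap_mem r
    | ι x =>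
      refine Submodule.mem_iSup_of_mem 1 ?_
      rw [pow_one]
      exact ⟨x, rfl⟩
    | mul a b ha hb =>
      have h := Submodule.mul_mem_mul ha hb
      rw [Submodule.iSup_mul] at h
      simp only [Submodule.mul_iSup, ← pow_add] at h
      exact (iSup_le fun i => iSup_le fun j => le_iSup (fun n : ℕ =>
        LinearMap.range (TensorAlgebra.ι k (M := W)) ^ n) (i + j)) h
    | add a b ha hb => exact Submodule.add_mem _ ha hb
  induction key using Submodule.iSup_induction' with
  | mem n x hx => exact hom n x hx
  | zero => exact hom 0 0 (Submodule.zero_mem _)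
  | add x y _ _ hx hy => exact add x y hx hy

theorem nichols_hom_induction {P : Nichols ρ δ → Prop} (add : ∀ s t, P s → P t → P (s + t))
    (hom : ∀ n, ∀ t ∈ LinearMap.range (TensorAlgebra.ι k (M := W)) ^ n, P (nicholsMk ρ δ t))
    (x : Nichols ρ δ) : P x := by
  obtain ⟨t, rfl⟩ := nicholsMk_surjective ρ δ x
  induction t using tensorAlgebra_hom_induction with
  | add s t hs ht => rw [map_add]; exact add _ _ hs ht
  | hom n t ht => exact hom n t ht

/-- Each element has finitely many homogeneous components, so the degrees in a finite spanning set
are bounded. -/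
theorem exists_nicholsProj_eq_zero [Module.Finite k (Nichols ρ δ)] :
    ∃ N : ℕ, ∀ n, N ≤ n → nicholsProj ρ δ n = 0 := by
  obtain ⟨s, hs⟩ := (Module.Finite.iff_fg (R := k) (N := (⊤ : Submodule k (Nichols ρ δ)))).1
    inferInstance
  have : ∀ x : Nichols ρ δ, ∃ N : ℕ, ∀ n, N ≤ n → nicholsProj ρ δ n x = 0 := by
    intro x
    obtain ⟨t, rfl⟩ := nicholsMk_surjective ρ δ x
    exact ⟨(tensorToPoly ρ δ t).natDegree + 1, fun n hn => by
      rw [nicholsProj_mk]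
      exact Polynomial.coeff_eq_zero_of_natDegree_lt (by omega)⟩
  choose F hF using this
  refine ⟨s.sup F, fun n hn => LinearMap.ext_on (s := (s : Set _)) hs fun x hx => ?_⟩
  exact hF x n ((Finset.le_sup hx).trans hn)

end NicholsIdeal

/-! ### The antipode and the contractions by matrix coefficients. -/

section AntipodeHit

variable {k H : Type u} [Field k] [Ring H] [HopfAlgebra k H]
  {ι : Type} [Fintype ι] [DecidableEq ι] {ρ : ι → ι → H →ₗ[k] k} (hρ : IsMatrixRep ρ)

local notation "𝒮" => HopfAlgebra.antipode k (A := H)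

include hρ

theorem IsMatrixRep.hitR_mul (i j : ι) (g h : H) :
    hitR (ρ i j) (g * h) = ∑ p, hitR (ρ i p) g * hitR (ρ p j) h := by
  simp only [hitR, LinearMap.comp_apply, Bialgebra.comul_mul, hρ.sliceR_mul]

/-- In substance Δ(𝒮h) = 𝒮h₂ ⊗ 𝒮h₁ with the second leg contracted. It is proved by uniqueness of
inverses for matrices over the convolution algebra of H: the two sides are a left and a right
inverse of the matrix `hitR` of ρ. -/
theorem IsMatrixRep.hitR_antipode (i j : ι) (h : H) :
    hitR (ρ i j) (𝒮 h) = 𝒮 (hitL (ρ i j ∘ₗ 𝒮) h) := by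
  let A : Matrix ι ι (WithConv (H →ₗ[k] H)) := fun i j => WithConv.toConv (hitR (ρ i j) ∘ₗ 𝒮)
  let B : Matrix ι ι (WithConv (H →ₗ[k] H)) := fun i j =>
    WithConv.toConv (𝒮 ∘ₗ hitL (ρ i j ∘ₗ 𝒮))
  let C : Matrix ι ι (WithConv (H →ₗ[k] H)) := fun i j => WithConv.toConv (hitR (ρ i j))
  have happ : ∀ (s : Finset ι) (F : ι → WithConv (H →ₗ[k] H)) (g : H),
      (∑ i ∈ s, F i).ofConv g = ∑ i ∈ s, (F i).ofConv g := by
    intro s F g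
    induction s using Finset.cons_induction with
    | empty => simp
    | cons a s _ ih => simp
  have h1 : A * C = 1 := by
    ext1 i j
    rw [Matrix.mul_apply]
    apply WithConv.ofConv_injective
    ext g
    rw [happ]
    have : ∀ t : H ⊗[k] H, ∑ p, LinearMap.mul' k H (TensorProduct.map (hitR (ρ i p) ∘ₗ 𝒮)
        (hitR (ρ p j)) t) = hitR (ρ i j) (LinearMap.mul' k H (LinearMap.rTensor H 𝒮 t)) := by
      intro t
      induction t using TensorProduct.induction_on with
      | zero => simp
      | tmul a b => simp [hρ.hitR_mul]
      | add a b ha hb => simp only [map_add, Finset.sum_add_distrib, ha, hb]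
    have h2 := this (Coalgebra.comul g)
    rw [mul'_rTensor_antipode_comul, Algebra.algebraMap_eq_smul_one, map_smul] at h2
    simp only [LinearMap.convMul_apply]
    refine h2.trans ?_
    rw [Matrix.one_apply, hitR, LinearMap.comp_apply, Bialgebra.comul_one,
      Algebra.TensorProduct.one_def, sliceR_tmul, hρ.one]
    split_ifs <;> simp [Algebra.algebraMap_eq_smul_one]
  have h2 : C * B = 1 := by
    ext1 i j
    rw [Matrix.mul_apply]
    apply WithConv.ofConv_injective
    ext g
    rw [happ]
    have h3 : ∀ p, LinearMap.mul' k H (TensorProduct.map (hitR (ρ i p)) (𝒮 ∘ₗ hitL (ρ p j ∘ₗ 𝒮))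
        (Coalgebra.comul (R := k) g)) = LinearMap.mul' k H (LinearMap.lTensor H
          (𝒮 ∘ₗ hitL (ρ p j ∘ₗ 𝒮) ∘ₗ hitL (ρ i p)) (Coalgebra.comul (R := k) g)) := by
      intro p
      have := congrArg (fun t => LinearMap.mul' k H (LinearMap.lTensor H
        (𝒮 ∘ₗ hitL (ρ p j ∘ₗ 𝒮)) t)) (lTensor_hitL_comul (ρ i p) g)
      simp only [← LinearMap.lTensor_comp_apply] at this
      rw [LinearMap.comp_assoc] at this
      rw [this, ← LinearMap.lTensor_comp_rTensor]
      rfl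
    have h4 : ∑ p, 𝒮 ∘ₗ hitL (ρ p j ∘ₗ 𝒮) ∘ₗ hitL (ρ i p) = if i = j then 𝒮 else 0 := by
      ext g
      have := congrArg 𝒮 (hρ.sum_hitL_antipode_hitL i j g)
      rw [map_sum] at this
      rw [LinearMap.sum_apply]
      refine this.trans ?_
      split_ifs <;> simp
    simp only [LinearMap.convMul_apply]
    refine (Finset.sum_congr rfl fun p _ => h3 p).trans ?_
    rw [← map_sum, ← LinearMap.sum_apply]
    have h5 : ∑ p, LinearMap.lTensor H (𝒮 ∘ₗ hitL (ρ p j ∘ₗ 𝒮) ∘ₗ hitL (ρ i p)) =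
        LinearMap.lTensor H (∑ p, 𝒮 ∘ₗ hitL (ρ p j ∘ₗ 𝒮) ∘ₗ hitL (ρ i p)) :=
      (map_sum (LinearMap.lTensorHom (R := k) H) _ _).symm
    rw [h5, h4, Matrix.one_apply]
    split_ifs
    · rw [mul'_lTensor_antipode_comul]
      simp [Algebra.algebraMap_eq_smul_one]
    · simp
  have h3 := congrArg (fun M : Matrix ι ι (WithConv (H →ₗ[k] H)) => M i j)
    (left_inv_eq_right_inv h1 h2)
  exact LinearMap.congr_fun (congrArg WithConv.ofConv h3) h

end AntipodeHit

/-! ### The pairing of T(V̄) with T(V). -/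

section Duality

variable {k : Type u} {H : Type u} [Field k] [Ring H] [HopfAlgebra k H] {R : H ⊗[k] H}
  {V : Type u} [AddCommGroup V] [Module k V] [Module H V] [IsScalarTower k H V]
  {ι : Type} [Fintype ι] [DecidableEq ι] (b : Module.Basis ι k V)

local notation "ε" => Coalgebra.counit (R := k) (A := H)
local notation "𝒮" => HopfAlgebra.antipode k (A := H)
local notation "𝛒" => matCoeff (H := H) b
local notation "𝐓" => TensorAlgebra k V
local notation "𝐓'" => TensorAlgebra k (Module.Dual k V)
local notation "ηε" => TensorAlgebra.algebraMapInv (R := k)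

variable (R)

/-- The action of `T(V̄)` on `T(V)` by left skew derivations. -/
def derAct : 𝐓' →ₐ[k] Module.End k 𝐓 :=
  TensorAlgebra.lift k (∑ i, (Module.Dual.eval k V (b i)).smulRight (derL R b i))

theorem derAct_ι (i : ι) : derAct R b (TensorAlgebra.ι k (b.dualBasis i)) = derL R b i := by
  simp [derAct, Finsupp.single_apply]

/-- The pairing `T(V̄) × T(V) → k` by iterated left skew derivations. -/
def dualPair : 𝐓' →ₗ[k] 𝐓 →ₗ[k] k :=
  (derAct R b).toLinearMap.compr₂ (TensorAlgebra.algebraMapInv (R := k) (M := V)).toLinearMap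

omit [DecidableEq ι] in
theorem dualPair_apply (t : 𝐓') (s : 𝐓) : dualPair R b t s = ηε (derAct R b t s) := rfl

omit [DecidableEq ι] in
theorem dualPair_one (s : 𝐓) : dualPair R b 1 s = ηε s := by simp [dualPair_apply]

theorem dualPair_mul_ι (t : 𝐓') (i : ι) (s : 𝐓) :
    dualPair R b (t * TensorAlgebra.ι k (b.dualBasis i)) s = dualPair R b t (derL R b i s) := by
  simp only [dualPair_apply, map_mul, derAct_ι, Module.End.mul_apply]

variable {R} (hR : IsQuasitriangular R)
include hR

/-- They remove tensor legs at opposite ends. In the induction the mixed terms agree because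
contracting the first leg of Δ(l) with ρ produces coefficients ρ(m). -/
theorem derL_derR (i j : ι) (t : 𝐓) :
    derL R b i (derR R b j t) = derR R b j (derL R b i t) := by
  have hρ := isMatrixRep_matCoeff (H := H) b
  induction t using tensorAlgebra_induction b generalizing i with
  | one => simp [derL_one, derR_one]
  | add s t hs ht => simp only [map_add, hs, ht]
  | smul c t ht => simp only [map_smul, ht]
  | mul a t ht =>
    simp only [derR_mul b hR, derL_mul b hR, map_add, map_sum, map_smul, derL_tensorAct b hR, ht,
      smul_add, Finset.sum_add_distrib, apply_ite (derR R b j), map_zero, add_assoc]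
    congr 2
    have : ∀ q, hitL (𝛒 i q) (lMat R (𝛒) j a) =
        ∑ p, 𝛒 p a (mMat R (𝛒) i q) • lMat R (𝛒) j p := by
      intro q
      rw [hitL, LinearMap.comp_apply, comul_lMat hR hρ, map_sum]
      simp only [sliceL_tmul, rho_mMat]
    simp only [this, map_sum, map_smul, LinearMap.sum_apply, LinearMap.smul_apply]
    rw [Finset.sum_comm]

/-- After the counit only the degree-one part of t counts, and on it both derivations are the i-th
coordinate. -/
theorem algebraMapInv_derL (i : ι) (t : 𝐓) : ηε (derL R b i t) = ηε (derR R b i t) := by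
  have hρ := isMatrixRep_matCoeff (H := H) b
  induction t using tensorAlgebra_induction b with
  | one => simp [derL_one, derR_one]
  | add s t hs ht => simp only [map_add, hs, ht]
  | smul c t ht => simp only [map_smul, ht]
  | mul a t ht =>
    simp only [derR_mul b hR, derL_mul b hR, map_add, map_sum, map_smul, algebraMapInv_ι_mul,
      algebraMapInv_tensorAct, counit_lMat hR hρ]
    split_ifs <;> simp

theorem derAct_derR (t : 𝐓') (j : ι) (s : 𝐓) :
    derAct R b t (derR R b j s) = derR R b j (derAct R b t s) := by
  induction t using tensorAlgebra_induction b.dualBasis generalizing s with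
  | one => simp
  | add u t hu ht => simp only [map_add, LinearMap.add_apply, hu, ht]
  | smul c t ht => simp only [map_smul, LinearMap.smul_apply, ht]
  | mul i t ht => simp only [map_mul, derAct_ι, Module.End.mul_apply, ht, derL_derR b hR]

/-- On the left of a word yᵢ acts last. Its ∂ᴸᵢ may be replaced by ∂ᴿᵢ in front of the counit, and
∂ᴿᵢ then commutes past the remaining left derivations. -/
theorem dualPair_ι_mul (t : 𝐓') (i : ι) (s : 𝐓) :
    dualPair R b (TensorAlgebra.ι k (b.dualBasis i) * t) s = dualPair R b t (derR R b i s) := by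
  simp only [dualPair_apply, map_mul, derAct_ι, Module.End.mul_apply, derAct_derR b hR,
    algebraMapInv_derL b hR]

/-- Induction on t: the action on yᵢt contributes ρ ∘ 𝒮, and `IsMatrixRep.hitR_antipode` matches
this with the covariance of ∂ᴿ under 𝒮(h). -/
theorem dualPair_tensorAct (h : H) (t : 𝐓') (s : 𝐓) :
    dualPair R b (tensorAct (repVbar k V) h t) s =
      dualPair R b t (tensorAct (repV k V) (𝒮 h) s) := by
  have hρ := isMatrixRep_matCoeff (H := H) b
  induction t using tensorAlgebra_induction b.dualBasis generalizing h s with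
  | one => simp [tensorAct_one, dualPair_one, algebraMapInv_tensorAct]
  | add u t hu ht => simp only [map_add, LinearMap.add_apply, hu, ht]
  | smul c t ht => simp only [map_smul, LinearMap.smul_apply, ht]
  | mul i t ht =>
    rw [tensorAct_Vbar_mul, dualPair_ι_mul b hR, derR_tensorAct b hR]
    simp only [map_sum, LinearMap.sum_apply, dualPair_ι_mul b hR, ht, hρ.hitR_antipode]

theorem derR_mul_mul (i : ι) (s s' : 𝐓) :
    derR R b i (s * s') = s * derR R b i s' +
      ∑ p, derR R b p s * tensorAct (repV k V) (lMat R (𝛒) i p) s' := by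
  have hρ := isMatrixRep_matCoeff (H := H) b
  induction s using tensorAlgebra_induction b with
  | one => simp [derR_one]
  | add s t hs ht =>
    simp only [map_add, add_mul, hs, ht, Finset.sum_add_distrib]
    abel
  | smul c t ht => simp only [map_smul, smul_mul_assoc, ht, smul_add, Finset.smul_sum]
  | mul a t ht =>
    simp only [mul_assoc, derR_mul b hR, ht, add_mul, Finset.sum_add_distrib, mul_add,
      Finset.mul_sum, add_assoc]
    rw [tensorAct_mul_of_comul_eq _ _ _ _ _ (comul_lMat hR hρ i a)]

variable (H V) in
omit hR in
/-- The action of `H ⊗ H` on `T(V) ⊗ T(V)`. -/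
def tensorAct₂ : H ⊗[k] H →ₐ[k] Module.End k (𝐓 ⊗[k] 𝐓) :=
  (Module.endTensorEndAlgHom (R := k) (S := k) (A := k) (M := 𝐓) (N := 𝐓)).comp
    (Algebra.TensorProduct.map (tensorAct (repV k V)) (tensorAct (repV k V)))

omit hR in
theorem tensorAct₂_tmul (g h : H) (s s' : 𝐓) : tensorAct₂ H V (g ⊗ₜ[k] h) (s ⊗ₜ s') =
    tensorAct (repV k V) g s ⊗ₜ tensorAct (repV k V) h s' := by
  rw [tensorAct₂, AlgHom.comp_apply, Algebra.TensorProduct.map_tmul,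
    Module.endTensorEndAlgHom_apply]
  rfl

variable (R) in
omit hR in
/-- The pairing of `T(V̄) ⊗ T(V̄)` and `T(V) ⊗ T(V)`. -/
def dualPair₂ : 𝐓' ⊗[k] 𝐓' →ₗ[k] 𝐓 ⊗[k] 𝐓 →ₗ[k] k :=
  TensorProduct.dualDistrib k 𝐓 𝐓 ∘ₗ TensorProduct.map (dualPair R b) (dualPair R b)

omit hR [DecidableEq ι] in
theorem dualPair₂_tmul (t t' : 𝐓') (s s' : 𝐓) :
    dualPair₂ R b (t ⊗ₜ t') (s ⊗ₜ s') = dualPair R b t s * dualPair R b t' s' := by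
  simp [dualPair₂]

theorem dualPair₂_rTensor (i : ι) (u : 𝐓' ⊗[k] 𝐓') (z : 𝐓 ⊗[k] 𝐓) :
    dualPair₂ R b (LinearMap.rTensor 𝐓' (LinearMap.mulLeft k (TensorAlgebra.ι k (b.dualBasis i)))
      u) z = dualPair₂ R b u (LinearMap.rTensor 𝐓 (derR R b i) z) := by
  induction u using TensorProduct.induction_on with
  | zero => simp
  | add u u' hu hu' => simp only [map_add, LinearMap.add_apply, hu, hu']
  | tmul t t' =>
    induction z using TensorProduct.induction_on with
    | zero => simp
    | add u u' hu hu' => simp only [map_add, hu, hu']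
    | tmul s s' => simp only [LinearMap.rTensor_tmul, LinearMap.mulLeft_apply, dualPair₂_tmul,
        dualPair_ι_mul b hR]

theorem dualPair₂_map (h : H) (i : ι) (u : 𝐓' ⊗[k] 𝐓') (z : 𝐓 ⊗[k] 𝐓) :
    dualPair₂ R b (TensorProduct.map (tensorAct (repVbar k V) h)
      (LinearMap.mulLeft k (TensorAlgebra.ι k (b.dualBasis i))) u) z =
    dualPair₂ R b u (TensorProduct.map (tensorAct (repV k V) (𝒮 h)) (derR R b i) z) := by
  induction u using TensorProduct.induction_on with
  | zero => simp
  | add u u' hu hu' => simp only [map_add, LinearMap.add_apply, hu, hu']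
  | tmul t t' =>
    induction z using TensorProduct.induction_on with
    | zero => simp
    | add u u' hu hu' => simp only [map_add, hu, hu']
    | tmul s s' => simp only [TensorProduct.map_tmul, LinearMap.mulLeft_apply, dualPair₂_tmul,
        dualPair_ι_mul b hR, dualPair_tensorAct b hR]

theorem rTensor_derR_tensorAct₂ (i : ι) (C : H ⊗[k] H) (s s' : 𝐓) :
    LinearMap.rTensor 𝐓 (derR R b i) (tensorAct₂ H V C (s ⊗ₜ s')) =
      ∑ p, tensorAct₂ H V (LinearMap.rTensor H (hitR (𝛒 i p)) C) (derR R b p s ⊗ₜ s') := by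
  induction C using TensorProduct.induction_on with
  | zero => simp
  | add u u' hu hu' => simp only [map_add, LinearMap.add_apply, hu, hu', Finset.sum_add_distrib]
  | tmul g h => simp only [LinearMap.rTensor_tmul, tensorAct₂_tmul, derR_tensorAct b hR,
      TensorProduct.sum_tmul]

theorem map_derR_tensorAct₂ (h : H) (i : ι) (C : H ⊗[k] H) (s s' : 𝐓) :
    TensorProduct.map (tensorAct (repV k V) h) (derR R b i) (tensorAct₂ H V C (s ⊗ₜ s')) =
      ∑ p, tensorAct₂ H V ((h ⊗ₜ 1) * LinearMap.lTensor H (hitR (𝛒 i p)) C)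
        (s ⊗ₜ derR R b p s') := by
  induction C using TensorProduct.induction_on with
  | zero => simp
  | add u u' hu hu' =>
    simp only [map_add, LinearMap.add_apply, hu, hu', Finset.sum_add_distrib, mul_add]
  | tmul g g' => simp only [LinearMap.lTensor_tmul, tensorAct₂_tmul, derR_tensorAct b hR,
      TensorProduct.tmul_sum, TensorProduct.map_tmul, Algebra.TensorProduct.tmul_mul_tmul, map_mul,
      Module.End.mul_apply, one_mul]

/-- The comultiplication of `T(V̄)` is dual to the product of `T(V)`, up to the action of `R`. -/
theorem dualPair_mul (t : 𝐓') (z : 𝐓 ⊗[k] 𝐓) :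
    dualPair R b t (LinearMap.mul' k 𝐓 z) =
      dualPair₂ R b (braidedComul (repVbar k V) (coactVbar k R V) t) (tensorAct₂ H V R z) := by
  have hρ := isMatrixRep_matCoeff (H := H) b
  induction z using TensorProduct.induction_on with
  | zero => simp
  | add u u' hu hu' => simp only [map_add, hu, hu']
  | tmul s s' =>
    rw [LinearMap.mul'_apply]
    induction t using tensorAlgebra_induction b.dualBasis generalizing s s' with
    | one =>
      rw [braidedComul_one, dualPair_one, map_mul]
      have key : ∀ C : H ⊗[k] H, dualPair₂ R b (1 ⊗ₜ 1) (tensorAct₂ H V C (s ⊗ₜ s')) =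
          ε (TensorProduct.lid k H (LinearMap.rTensor H ε C)) * (ηε s * ηε s') := by
        intro C
        induction C using TensorProduct.induction_on with
        | zero => simp
        | add u u' hu hu' => simp only [map_add, LinearMap.add_apply, hu, hu', add_mul]
        | tmul g h =>
          simp only [tensorAct₂_tmul, dualPair₂_tmul, dualPair_one, algebraMapInv_tensorAct,
            LinearMap.rTensor_tmul, TensorProduct.lid_tmul, map_smul, smul_eq_mul]
          ring
      rw [key, hR.counit_left]
      simp
    | add u t hu ht => simp only [map_add, LinearMap.add_apply, hu, ht]
    | smul c t ht => simp only [map_smul, LinearMap.smul_apply, ht]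
    | mul i t ht =>
      rw [dualPair_ι_mul b hR, derR_mul_mul b hR,
        braidedComul_basis_mul _ (isCoactMatrix_coactVbar b hR)]
      simp only [map_add, map_sum, LinearMap.add_apply, LinearMap.sum_apply, ht,
        dualPair₂_rTensor b hR, dualPair₂_map b hR, rTensor_derR_tensorAct₂ b hR,
        map_derR_tensorAct₂ b hR, rTensor_hitR_R hR, lTensor_hitR_R hR]
      rw [add_comm]
      congr 1
      · refine Finset.sum_congr rfl fun p _ => ?_
        rw [map_mul, Module.End.mul_apply, tensorAct₂_tmul, map_one, Module.End.one_apply]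
      -- The antipode of the m from the coaction of V̄ cancels the m that arises when ∂ᴿ is moved
      -- through R.
      · have h1 : ∀ q, ∑ p, (𝒮 (mMat R (𝛒) i p) ⊗ₜ[k] (1 : H)) *
            ((mMat R (𝛒) p q ⊗ₜ[k] (1 : H)) * R) = if i = q then R else 0 := by
          intro q
          simp only [← mul_assoc, Algebra.TensorProduct.tmul_mul_tmul, one_mul]
          rw [← Finset.sum_mul, ← TensorProduct.sum_tmul, sum_antipode_mMat_mul_mMat hR hρ]
          split_ifs
          · rw [← Algebra.TensorProduct.one_def, one_mul]
          · simp
        rw [Finset.sum_comm]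
        simp only [← map_sum, ← LinearMap.sum_apply, h1]
        rw [Finset.sum_eq_single i]
        · simp
        · intro q _ hq
          simp [Ne.symm hq]
        · simp

end Duality

/-! ### Nondegeneracy of the tensor square of a pairing. -/

section Tensor

variable {k M N : Type*} [Field k] [AddCommGroup M] [Module k M] [AddCommGroup N] [Module k N]

/-- A pairing that is nondegenerate on the left induces a nondegenerate pairing of tensor
squares. -/
theorem eq_zero_of_dualDistrib (f : M →ₗ[k] N →ₗ[k] k) (hf : Function.Injective f)
    (u : M ⊗[k] M) (hu : ∀ s s' : N, TensorProduct.dualDistrib k N N (TensorProduct.map f f u)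
      (s ⊗ₜ s') = 0) : u = 0 := by
  classical
  let e := Module.Basis.ofVectorSpace k M
  -- Injectivity of `f` is used once for each factor: here for the second one, then for the first
  -- one after taking coordinates in the second.
  have h1 : ∀ s, TensorProduct.lid k M (LinearMap.rTensor M (f.flip s) u) = 0 := by
    intro s
    apply hf
    rw [map_zero]
    ext s'
    rw [LinearMap.zero_apply, ← hu s s']
    clear hu
    induction u using TensorProduct.induction_on with
    | zero => simp
    | tmul a b => simp
    | add a b ha hb =>
      simp only [map_add, LinearMap.add_apply, ha, hb] at *
  apply (TensorProduct.equivFinsuppOfBasisRight (M := M) e).injective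
  rw [map_zero]
  ext i
  apply hf
  rw [Finsupp.zero_apply, map_zero]
  ext s
  have h2 := congrArg (e.coord i) (h1 s)
  rw [map_zero] at h2
  rw [LinearMap.zero_apply, ← h2]
  clear h2 h1 hu
  induction u using TensorProduct.induction_on with
  | zero => simp
  | tmul a b =>
    rw [TensorProduct.equivFinsuppOfBasisRight_apply_tmul_apply]
    simp [mul_comm]
  | add a b ha hb => simp only [map_add, LinearMap.add_apply, ha, hb, Finsupp.add_apply]

end Tensor

/-! ### The radical of the pairing, and finiteness of 𝔅(V̄). -/

section Radical

variable {k : Type u} {H : Type u} [Field k] [Ring H] [HopfAlgebra k H] {R : H ⊗[k] H}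
  {V : Type u} [AddCommGroup V] [Module k V] [Module H V] [IsScalarTower k H V]
  {ι : Type} [Fintype ι] [DecidableEq ι] (b : Module.Basis ι k V)

local notation "ε" => Coalgebra.counit (R := k) (A := H)
local notation "𝒮" => HopfAlgebra.antipode k (A := H)
local notation "𝛒" => matCoeff (H := H) b
local notation "𝐓" => TensorAlgebra k V
local notation "𝐓'" => TensorAlgebra k (Module.Dual k V)
local notation "ηε" => TensorAlgebra.algebraMapInv (R := k)
local notation "gr" => LinearMap.range (TensorAlgebra.ι k (M := V))
local notation "gr'" => LinearMap.range (TensorAlgebra.ι k (M := Module.Dual k V))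

variable (hR : IsQuasitriangular R)
include hR

/-- The left radical of the pairing of `T(V̄)` and `T(V)`. -/
def dualRadical : TwoSidedIdeal 𝐓' :=
  TwoSidedIdeal.mk' (LinearMap.ker (dualPair R b)) (Submodule.zero_mem _)
    (fun h h' => Submodule.add_mem _ h h') (fun h => Submodule.neg_mem _ h)
    -- Left multiplication by yᵢ is adjoint to ∂ᴿᵢ and right multiplication to ∂ᴸᵢ, so neither
    -- leaves the radical.
    (fun {x y} h => by
      induction x using tensorAlgebra_induction b.dualBasis with
      | one => simpa using h
      | add s t hs ht => rw [add_mul]; exact Submodule.add_mem _ hs ht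
      | smul c t ht => rw [smul_mul_assoc]; exact Submodule.smul_mem _ c ht
      | mul i t ht =>
        rw [mul_assoc]
        refine LinearMap.mem_ker.2 (LinearMap.ext fun s => ?_)
        rw [dualPair_ι_mul b hR, LinearMap.mem_ker.1 ht]
        rfl)
    (fun {x y} h => by
      have key : ∀ x ∈ LinearMap.ker (dualPair R b), x * y ∈ LinearMap.ker (dualPair R b) := by
        clear h
        induction y using tensorAlgebra_induction b.dualBasis with
        | one => simp
        | add s t hs ht =>
          intro x hx
          rw [mul_add]; exact Submodule.add_mem _ (hs x hx) (ht x hx)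
        | smul c t ht =>
          intro x hx
          rw [mul_smul_comm]; exact Submodule.smul_mem _ c (ht x hx)
        | mul i t ht =>
          intro x hx
          rw [← mul_assoc]
          refine ht _ (LinearMap.mem_ker.2 (LinearMap.ext fun s => ?_))
          rw [dualPair_mul_ι, LinearMap.mem_ker.1 hx]
          rfl
      exact key x h)

theorem mem_dualRadical {t : 𝐓'} : t ∈ dualRadical b hR ↔ dualPair R b t = 0 := by
  rw [dualRadical, TwoSidedIdeal.mem_mk', SetLike.mem_coe, LinearMap.mem_ker]

theorem asIdeal_dualRadical :
    (dualRadical b hR).asIdeal.restrictScalars k = LinearMap.ker (dualPair R b) := by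
  ext t
  exact mem_dualRadical b hR

omit [DecidableEq ι] hR in
include b in
theorem tensorAct_mem_pow (h : H) {n : ℕ} {s : 𝐓} (hs : s ∈ gr ^ n) :
    tensorAct (repV k V) h s ∈ gr ^ n := by
  induction n generalizing h s with
  | zero =>
    rw [pow_zero] at hs ⊢
    obtain ⟨r, rfl⟩ := Submodule.mem_one.1 hs
    rw [Algebra.algebraMap_eq_smul_one, map_smul, tensorAct_one]
    exact Submodule.smul_mem _ _ (Submodule.smul_mem _ _ (Submodule.one_le.1 le_rfl))
  | succ n ih =>
    rw [pow_succ'] at hs ⊢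
    induction hs using Submodule.mul_induction_on' with
    | mem_mul_mem m hm s hs =>
      obtain ⟨w, rfl⟩ := hm
      rw [← b.sum_repr w]
      simp only [map_sum, map_smul, Finset.sum_mul, smul_mul_assoc, tensorAct_V_mul]
      exact Submodule.sum_mem _ fun j _ => Submodule.smul_mem _ _ (Submodule.sum_mem _ fun i _ =>
        Submodule.mul_mem_mul ⟨_, rfl⟩ (ih _ hs))
    | add x _ y _ hx hy => rw [map_add]; exact Submodule.add_mem _ hx hy

theorem derR_mem_pow (i : ι) {n : ℕ} {s : 𝐓} (hs : s ∈ gr ^ (n + 1)) : derR R b i s ∈ gr ^ n := by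
  induction n generalizing s with
  | zero =>
    rw [zero_add, pow_one] at hs
    obtain ⟨w, rfl⟩ := hs
    rw [← b.sum_repr w]
    simp only [map_sum, map_smul]
    refine Submodule.sum_mem _ fun j _ => Submodule.smul_mem _ _ ?_
    rw [← mul_one (TensorAlgebra.ι k (b j)), derR_mul b hR, derR_one, mul_zero, zero_add,
      tensorAct_one, pow_zero]
    exact Submodule.smul_mem _ _ (Submodule.one_le.1 le_rfl)
  | succ n ih =>
    rw [pow_succ'] at hs
    induction hs using Submodule.mul_induction_on' with
    | mem_mul_mem m hm s hs =>
      obtain ⟨w, rfl⟩ := hm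
      rw [← b.sum_repr w]
      simp only [map_sum, map_smul, Finset.sum_mul, smul_mul_assoc, derR_mul b hR]
      refine Submodule.sum_mem _ fun j _ => Submodule.smul_mem _ _ (Submodule.add_mem _ ?_ ?_)
      · rw [pow_succ']
        exact Submodule.mul_mem_mul ⟨_, rfl⟩ (ih hs)
      · exact tensorAct_mem_pow b _ hs
    | add x _ y _ hx hy => rw [map_add]; exact Submodule.add_mem _ hx hy

omit hR [Fintype ι] [DecidableEq ι] in
theorem derR_of_mem_pow_zero (i : ι) {s : 𝐓} (hs : s ∈ gr ^ 0) : derR R b i s = 0 := by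
  rw [pow_zero] at hs
  obtain ⟨r, rfl⟩ := Submodule.mem_one.1 hs
  rw [Algebra.algebraMap_eq_smul_one, map_smul, derR_one, smul_zero]

omit hR [Fintype ι] [DecidableEq ι] [Module H V] [IsScalarTower k H V] in
theorem algebraMapInv_of_mem_pow {n : ℕ} (hn : n ≠ 0) {s : 𝐓} (hs : s ∈ gr ^ n) : ηε s = 0 := by
  obtain ⟨n, rfl⟩ := Nat.exists_eq_succ_of_ne_zero hn
  rw [Nat.succ_eq_add_one, pow_succ'] at hs
  induction hs using Submodule.mul_induction_on' with
  | mem_mul_mem m hm s hs =>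
    obtain ⟨w, rfl⟩ := hm
    rw [algebraMapInv_ι_mul]
  | add x _ y _ hx hy => rw [map_add, hx, hy, add_zero]

/-- Each yᵢ lowers the degree of the partner by one, and the counit sees degree zero only. -/
theorem dualPair_of_ne {m n : ℕ} (hmn : m ≠ n) {t : 𝐓'} (ht : t ∈ gr' ^ m) {s : 𝐓}
    (hs : s ∈ gr ^ n) : dualPair R b t s = 0 := by
  induction m generalizing t n s with
  | zero =>
    rw [pow_zero] at ht
    obtain ⟨r, rfl⟩ := Submodule.mem_one.1 ht
    rw [Algebra.algebraMap_eq_smul_one, map_smul, LinearMap.smul_apply, dualPair_one,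
      algebraMapInv_of_mem_pow (Ne.symm hmn) hs, smul_zero]
  | succ m ih =>
    rw [pow_succ'] at ht
    induction ht using Submodule.mul_induction_on' with
    | mem_mul_mem x hx t ht =>
      obtain ⟨w, rfl⟩ := hx
      rw [← b.dualBasis.sum_repr w]
      simp only [map_sum, map_smul, Finset.sum_mul, smul_mul_assoc, LinearMap.sum_apply,
        LinearMap.smul_apply, dualPair_ι_mul b hR]
      refine Finset.sum_eq_zero fun i _ => ?_
      rcases n with _ | n
      · rw [derR_of_mem_pow_zero b i hs, map_zero, smul_zero]
      · rw [ih (by omega) ht (derR_mem_pow b hR i hs), smul_zero]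
    | add x _ y _ hx hy => rw [map_add, LinearMap.add_apply, hx, hy, add_zero]

theorem decompose_mem_dualRadical {t : 𝐓'} (ht : t ∈ dualRadical b hR) (n : ℕ) :
    ((DirectSum.decompose (fun n : ℕ => gr' ^ n) t n : 𝐓') : 𝐓') ∈ dualRadical b hR := by
  classical
  rw [mem_dualRadical] at ht ⊢
  ext1 s
  rw [LinearMap.zero_apply]
  induction s using tensorAlgebra_hom_induction with
  | add s s' hs hs' => rw [map_add, hs, hs', add_zero]
  | hom m s hs =>
    by_cases hmn : n = m
    · subst hmn
      have h1 := LinearMap.congr_fun ht s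
      rw [← DirectSum.sum_support_decompose (fun n : ℕ => gr' ^ n) t] at h1
      rw [map_sum, LinearMap.sum_apply, LinearMap.zero_apply] at h1
      by_cases hn : n ∈ (DirectSum.decompose (fun n : ℕ => gr' ^ n) t).support
      · rw [Finset.sum_eq_single_of_mem n hn fun i _ hi =>
          dualPair_of_ne b hR hi (SetLike.coe_mem _) hs] at h1
        exact h1
      · rw [DFinsupp.notMem_support_iff.1 hn]
        simp
    · exact dualPair_of_ne b hR hmn (SetLike.coe_mem _) hs

/-- Since different degrees are orthogonal, the radical is homogeneous. It has nothing in degrees 0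
and 1, where the pairing is the product of scalars and the evaluation of V* on V. -/
theorem dualRadical_generated : ∃ X : Set 𝐓', (∀ x ∈ X, ∃ n : ℕ, 2 ≤ n ∧ x ∈ gr' ^ n) ∧
    dualRadical b hR = TwoSidedIdeal.span X := by
  classical
  refine ⟨{x | x ∈ dualRadical b hR ∧ ∃ n : ℕ, 2 ≤ n ∧ x ∈ gr' ^ n}, fun x hx => hx.2,
    le_antisymm (fun t ht => ?_) (TwoSidedIdeal.span_le.2 fun x hx => hx.1)⟩
  rw [← DirectSum.sum_support_decompose (fun n : ℕ => gr' ^ n) t]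
  refine sum_mem fun n _ => ?_
  have h := decompose_mem_dualRadical b hR ht n
  generalize hx : DirectSum.decompose (fun n : ℕ => gr' ^ n) t n = x at h
  clear hx
  obtain ⟨x, hxn⟩ := x
  change x ∈ _ at h
  change x ∈ _
  by_cases hn : 2 ≤ n
  · exact TwoSidedIdeal.subset_span ⟨h, n, hn, hxn⟩
  · rw [mem_dualRadical] at h
    have : x = 0 := by
      obtain rfl | rfl : n = 0 ∨ n = 1 := by omega
      · rw [pow_zero] at hxn
        obtain ⟨r, rfl⟩ := Submodule.mem_one.1 hxn
        have h1 := LinearMap.congr_fun h 1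
        rw [Algebra.algebraMap_eq_smul_one, map_smul, LinearMap.smul_apply, dualPair_one,
          map_one] at h1
        simp only [smul_eq_mul, mul_one, LinearMap.zero_apply] at h1
        rw [h1, map_zero]
      · rw [pow_one] at hxn
        obtain ⟨w, rfl⟩ := hxn
        have h1 : ∀ j, w (b j) = 0 := by
          intro j
          have h1 := LinearMap.congr_fun h (TensorAlgebra.ι k (b j) * 1)
          rw [← b.dualBasis.sum_repr w, LinearMap.zero_apply] at h1
          simp only [map_sum, map_smul, LinearMap.sum_apply, LinearMap.smul_apply] at h1
          have h2 : ∀ i, dualPair R b (TensorAlgebra.ι k (b.dualBasis i))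
              (TensorAlgebra.ι k (b j) * 1) = if i = j then 1 else 0 := by
            intro i
            rw [← mul_one (TensorAlgebra.ι k (b.dualBasis i)), dualPair_ι_mul b hR, dualPair_one,
              derR_mul b hR, derR_one, mul_zero, zero_add, algebraMapInv_tensorAct,
              counit_lMat hR (isMatrixRep_matCoeff b)]
            simp
          simp only [h2] at h1
          simpa using h1
        have h2 : w = 0 := b.ext h1
        rw [h2, map_zero]
    rw [this]
    exact zero_mem _

theorem tensorAct_mem_dualRadical (h : H) {t : 𝐓'} (ht : t ∈ dualRadical b hR) :
    tensorAct (repVbar k V) h t ∈ dualRadical b hR := by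
  rw [mem_dualRadical] at ht ⊢
  ext1 s
  rw [dualPair_tensorAct b hR, ht]
  rfl

/-- Modulo the radical K the pairing is nondegenerate on the left, and hence so is its tensor
square. By `dualPair_mul`, Δ(t) pairs to zero with every R·z, and R·(𝒮 ⊗ 1)R = 1 shows that every s
⊗ s' has this form. So Δ(t) vanishes in T/K ⊗ T/K. -/
theorem braidedComul_mem_dualRadical {t : 𝐓'} (ht : t ∈ dualRadical b hR) :
    braidedComul (repVbar k V) (coactVbar k R V) t ∈
    LinearMap.range (LinearMap.rTensor 𝐓'
      ((dualRadical b hR).asIdeal.restrictScalars k).subtype) ⊔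
    LinearMap.range (LinearMap.lTensor 𝐓'
      ((dualRadical b hR).asIdeal.restrictScalars k).subtype) := by
  rw [mem_dualRadical] at ht
  rw [asIdeal_dualRadical, sup_comm]
  set K := LinearMap.ker (dualPair R b) with hK
  set u := braidedComul (repVbar k V) (coactVbar k R V) t with hu
  rw [← TensorProduct.map_ker (LinearMap.exact_subtype_mkQ K) K.mkQ_surjective
      (LinearMap.exact_subtype_mkQ K) K.mkQ_surjective, LinearMap.mem_ker]
  refine eq_zero_of_dualDistrib (K.liftQ (dualPair R b) le_rfl)
    (LinearMap.ker_eq_bot.1 (Submodule.ker_liftQ_eq_bot _ _ _ le_rfl)) _ fun s s' => ?_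
  have h1 : TensorProduct.map (K.liftQ (dualPair R b) le_rfl) (K.liftQ (dualPair R b) le_rfl)
      (TensorProduct.map K.mkQ K.mkQ u) = TensorProduct.map (dualPair R b) (dualPair R b) u := by
    rw [← LinearMap.comp_apply, ← TensorProduct.map_comp, Submodule.liftQ_mkQ]
  rw [h1]
  have h2 := dualPair_mul b hR t (tensorAct₂ H V (LinearMap.rTensor H 𝒮 R) (s ⊗ₜ s'))
  rw [← Module.End.mul_apply, ← map_mul, hR.mul_inv, map_one, Module.End.one_apply, ht] at h2
  exact h2.symm

include b in
-- The hexagon axiom extends the formula 𝒮(R¹) ⊗ R²t for the coaction from V̄ to all of T(V̄).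
-- Subspaces stable under H are therefore subcomodules.
theorem tensorCoact_Vbar (t : 𝐓') : tensorCoact (coactVbar k R V) t =
    LinearMap.lTensor H ((tensorAct (repVbar k V)).toLinearMap.flip t)
      (LinearMap.rTensor H 𝒮 R) := by
  have hρ := isMatrixRep_matCoeff (H := H) b
  induction t using tensorAlgebra_induction b.dualBasis with
  | one =>
    rw [map_one]
    have h1 : (tensorAct (repVbar (H := H) k V)).toLinearMap.flip 1 =
        LinearMap.toSpanSingleton k 𝐓' 1 ∘ₗ ε := by
      ext h
      simp [tensorAct_one]
    have h2 : ∀ C : H ⊗[k] H, LinearMap.lTensor H (LinearMap.toSpanSingleton k 𝐓' 1 ∘ₗ ε)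
        (LinearMap.rTensor H 𝒮 C) =
        𝒮 (TensorProduct.rid k H (LinearMap.lTensor H ε C)) ⊗ₜ 1 := by
      intro C
      induction C using TensorProduct.induction_on with
      | zero => simp
      | tmul g h => simp [TensorProduct.smul_tmul']
      | add a b ha hb => simp only [map_add, TensorProduct.add_tmul, ha, hb]
    rw [h1, h2, hR.counit_right, HopfAlgebra.antipode_one]
    rfl
  | add s t hs ht => simp only [map_add, hs, ht, LinearMap.lTensor_add, LinearMap.add_apply]
  | smul c t ht => simp only [map_smul, ht, LinearMap.lTensor_smul, LinearMap.smul_apply]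
  | mul i t ht =>
    have h1 : ∀ C : H ⊗[k] H, LinearMap.lTensor H ((tensorAct (repVbar k V)).toLinearMap.flip
        (TensorAlgebra.ι k (b.dualBasis i) * t)) C = ∑ p, ((1 : H) ⊗ₜ[k]
        TensorAlgebra.ι k (b.dualBasis p)) * LinearMap.lTensor H
        ((tensorAct (repVbar k V)).toLinearMap.flip t)
          (LinearMap.lTensor H (hitL (𝛒 i p ∘ₗ 𝒮)) C) := by
      intro C
      induction C using TensorProduct.induction_on with
      | zero => simp
      | tmul g h =>
        simp only [LinearMap.lTensor_tmul, LinearMap.flip_apply, AlgHom.toLinearMap_apply,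
          tensorAct_Vbar_mul, TensorProduct.tmul_sum, Algebra.TensorProduct.tmul_mul_tmul,
          one_mul]
      | add a b ha hb => simp only [map_add, mul_add, Finset.sum_add_distrib, ha, hb]
    have h2 : ∀ φ : H →ₗ[k] k, LinearMap.lTensor H (hitL φ) (LinearMap.rTensor H 𝒮 R) =
        (𝒮 (sliceR φ R) ⊗ₜ 1) * LinearMap.rTensor H 𝒮 R := by
      intro φ
      have key := congrArg (TensorProduct.map 𝒮 (sliceL φ)) hR.comul_right
      have h3 := bilin_ext
        (F := ((LinearMap.mul k (H ⊗[k] (H ⊗[k] H))).compl₁₂ leg13.toLinearMap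
          leg12.toLinearMap).compr₂ (TensorProduct.map 𝒮 (sliceL φ)))
        (G := (LinearMap.mul k (H ⊗[k] H)).flip.compl₁₂ (LinearMap.rTensor H 𝒮)
          ((TensorProduct.mk k H H).flip 1 ∘ₗ 𝒮 ∘ₗ sliceR φ))
        (fun a b c d => by
          simp [leg13, leg12, TensorProduct.smul_tmul',
            HopfAlgebra.antipode_mul_antidistrib]) R R
      simp only [LinearMap.compr₂_apply, LinearMap.compl₁₂_apply, LinearMap.comp_apply,
        LinearMap.mul_apply', AlgHom.toLinearMap_apply, TensorProduct.mk_apply,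
        LinearMap.flip_apply] at h3
      rw [h3] at key
      rw [← key]
      generalize R = C
      induction C using TensorProduct.induction_on with
      | zero => simp
      | tmul g h => simp [hitL]
      | add a b ha hb => simp only [map_add, ha, hb]
    have h3 : ∀ p, 𝒮 (sliceR (𝛒 i p ∘ₗ 𝒮) R) = mMat R (𝛒) i p := by
      intro p
      rw [mMat]
      conv_rhs => rw [← hR.map_antipode]
      generalize R = C
      induction C using TensorProduct.induction_on with
      | zero => simp
      | tmul g h => simp
      | add a b ha hb => simp only [map_add, ha, hb]
    rw [h1, map_mul, ht]
    have h4 : tensorCoact (coactVbar k R V) (TensorAlgebra.ι k (b.dualBasis i)) =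
        ∑ p, mMat R (𝛒) i p ⊗ₜ TensorAlgebra.ι k (b.dualBasis p) := by
      rw [tensorCoact, TensorAlgebra.lift_ι_apply, LinearMap.comp_apply,
        (isCoactMatrix_coactVbar b hR).coact]
      simp only [map_sum, LinearMap.lTensor_tmul]
    rw [h4, Finset.sum_mul]
    refine Finset.sum_congr rfl fun p _ => ?_
    rw [h2, h3]
    generalize LinearMap.rTensor H 𝒮 R = C
    induction C using TensorProduct.induction_on with
    | zero => simp
    | tmul g h => simp
    | add a b ha hb => simp only [map_add, mul_add, ha, hb]

theorem tensorCoact_mem_dualRadical {t : 𝐓'} (ht : t ∈ dualRadical b hR) :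
    tensorCoact (coactVbar k R V) t ∈ LinearMap.range (LinearMap.lTensor H
      ((dualRadical b hR).asIdeal.restrictScalars k).subtype) := by
  rw [tensorCoact_Vbar b hR]
  generalize LinearMap.rTensor H 𝒮 R = C
  induction C using TensorProduct.induction_on with
  | zero => simp
  | tmul g h =>
    exact ⟨g ⊗ₜ ⟨tensorAct (repVbar k V) h t, tensorAct_mem_dualRadical b hR h ht⟩, rfl⟩
  | add a b ha hb => rw [map_add]; exact Submodule.add_mem _ ha hb

local notation "𝒮ₜ" => braidedAntipode (repVbar k V) (coactVbar k R V)

theorem braidedAntipode_mul (i : ι) (t : 𝐓') : 𝒮ₜ (TensorAlgebra.ι k (b.dualBasis i) * t) =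
    -∑ p, tensorAct (repVbar k V) (mMat R (𝛒) i p) (𝒮ₜ t) *
      TensorAlgebra.ι k (b.dualBasis p) := by
  have : 𝒮ₜ (TensorAlgebra.ι k (b.dualBasis i) * t) =
      mulAntipode (repVbar k V) (coactVbar k R V) (b.dualBasis i) (𝒮ₜ t) := by
    simp [braidedAntipode]
  rw [this, mulAntipode]
  simp only [LinearMap.neg_apply, LinearMap.comp_apply, (isCoactMatrix_coactVbar b hR).coact,
    map_sum, LinearEquiv.coe_coe, TensorProduct.comm_tmul, TensorProduct.map_tmul,
    LinearMap.mul'_apply, LinearMap.sum_apply]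
  rfl

include b in
theorem mul_braidedAntipode (t : 𝐓') : LinearMap.mul' k 𝐓' (LinearMap.lTensor 𝐓' (𝒮ₜ)
    (braidedComul (repVbar k V) (coactVbar k R V) t)) = algebraMap k 𝐓' (ηε t) := by
  have hρ := isMatrixRep_matCoeff (H := H) b
  induction t using tensorAlgebra_induction b.dualBasis with
  | one => simp [braidedComul_one, braidedAntipode]
  | add s t hs ht => simp only [map_add, hs, ht]
  | smul c t ht => simp only [map_smul, ht, Algebra.algebraMap_eq_smul_one, smul_eq_mul, mul_smul]
  | mul i t ht =>
    rw [braidedComul_basis_mul _ (isCoactMatrix_coactVbar b hR), algebraMapInv_ι_mul, map_zero]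
    have h1 : ∀ u : 𝐓' ⊗[k] 𝐓', LinearMap.mul' k 𝐓' (LinearMap.lTensor 𝐓' (𝒮ₜ)
        (LinearMap.rTensor 𝐓' (LinearMap.mulLeft k (TensorAlgebra.ι k (b.dualBasis i))) u)) =
        TensorAlgebra.ι k (b.dualBasis i) *
          LinearMap.mul' k 𝐓' (LinearMap.lTensor 𝐓' (𝒮ₜ) u) := by
      intro u
      induction u using TensorProduct.induction_on with
      | zero => simp
      | tmul g h => simp [mul_assoc]
      | add a b ha hb => simp only [map_add, mul_add, ha, hb]
    have h2 : ∀ u : 𝐓' ⊗[k] 𝐓', ∑ p, LinearMap.mul' k 𝐓' (LinearMap.lTensor 𝐓' (𝒮ₜ)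
        (TensorProduct.map (tensorAct (repVbar k V) (mMat R (𝛒) i p))
          (LinearMap.mulLeft k (TensorAlgebra.ι k (b.dualBasis p))) u)) =
        -∑ p, tensorAct (repVbar k V) (mMat R (𝛒) i p)
          (LinearMap.mul' k 𝐓' (LinearMap.lTensor 𝐓' (𝒮ₜ) u)) *
            TensorAlgebra.ι k (b.dualBasis p) := by
      intro u
      induction u using TensorProduct.induction_on with
      | zero => simp
      | tmul g h =>
        simp only [TensorProduct.map_tmul, LinearMap.lTensor_tmul, LinearMap.mulLeft_apply,
          LinearMap.mul'_apply, braidedAntipode_mul b hR,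
          tensorAct_mul_of_comul_eq _ _ _ _ _ (comul_mMat hR hρ i _), mul_neg, Finset.mul_sum,
          Finset.sum_neg_distrib, Finset.sum_mul, mul_assoc]
        rw [Finset.sum_comm]
      | add a b ha hb =>
        simp only [map_add, Finset.sum_add_distrib, add_mul, ha, hb, neg_add]
    rw [map_add, map_add, map_sum, map_sum, h1, h2, ht]
    simp [Algebra.algebraMap_eq_smul_one, tensorAct_one, counit_mMat hR hρ]

theorem dualPair_apply_one (t : 𝐓') : dualPair R b t 1 = ηε t := by
  induction t using tensorAlgebra_induction b.dualBasis with
  | one => simp [dualPair_one]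
  | add s t hs ht => simp only [map_add, LinearMap.add_apply, hs, ht]
  | smul c t ht => simp only [map_smul, LinearMap.smul_apply, ht]
  | mul i t ht => rw [dualPair_ι_mul b hR, derR_one, map_zero, algebraMapInv_ι_mul]

/-- Write K for the radical and use Σ t₁𝒮(t₂) = ε(t) = 0 with Δ(t) in K ⊗ T + T ⊗ K. The first part
pairs to zero since K is an ideal. In the second part a left factor may be replaced by its counit: a
factor yᵢ would lower the degree of s, where induction applies. What is left is 𝒮 of (ε ⊗ 1)Δ(t) =
t. The factor a is included in the claim for the sake of this induction. -/
theorem dualPair_mul_braidedAntipode {n : ℕ} {s : 𝐓} (hs : s ∈ gr ^ n) (a : 𝐓') {t : 𝐓'}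
    (ht : t ∈ dualRadical b hR) : dualPair R b (a * 𝒮ₜ t) s = 0 := by
  induction n using Nat.strong_induction_on generalizing a t s with
  | _ n ih =>
    have h1 : ∀ (t : 𝐓'), t ∈ dualRadical b hR → ∀ a : 𝐓',
        dualPair R b (a * 𝒮ₜ t) s = ηε a * dualPair R b (𝒮ₜ t) s := by
      intro t ht a
      induction a using tensorAlgebra_induction b.dualBasis with
      | one => simp
      | add s t hs ht => simp only [map_add, add_mul, LinearMap.add_apply, hs, ht]
      | smul c t ht => simp only [map_smul, smul_mul_assoc, LinearMap.smul_apply, ht, smul_eq_mul,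
          mul_assoc]
      | mul i a _ =>
        rw [algebraMapInv_ι_mul, zero_mul, mul_assoc, dualPair_ι_mul b hR]
        rcases n with _ | n
        · rw [derR_of_mem_pow_zero b i hs, map_zero]
        · exact ih n (Nat.lt_succ_self n) (derR_mem_pow b hR i hs) a ht
    rw [h1 t ht]
    have h2 := congrArg (fun x => dualPair R b x s) (mul_braidedAntipode b hR t)
    have hε : ∀ x ∈ dualRadical b hR, ηε x = 0 := by
      intro x hx
      rw [← dualPair_apply_one b hR, (mem_dualRadical b hR).1 hx, LinearMap.zero_apply]
    have h3 := lid_rTensor_braidedComul (repVbar k V) (isCoactMatrix_coactVbar b hR) t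
    have h4 := braidedComul_mem_dualRadical b hR ht
    generalize braidedComul (repVbar k V) (coactVbar k R V) t = u at h2 h3 h4
    rw [hε t ht, map_zero, map_zero, LinearMap.zero_apply] at h2
    obtain ⟨_, ⟨x, rfl⟩, _, ⟨y, rfl⟩, rfl⟩ := Submodule.mem_sup.1 h4
    have h5 : TensorProduct.lid k 𝐓' (LinearMap.rTensor 𝐓' (TensorAlgebra.algebraMapInv (R := k) (M := Module.Dual k V)).toLinearMap
        (LinearMap.rTensor 𝐓' ((dualRadical b hR).asIdeal.restrictScalars k).subtype x)) = 0 := by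
      clear h2 h3 h4
      induction x using TensorProduct.induction_on with
      | zero => simp
      | tmul c d => simp [hε c c.2]
      | add c d hc hd => simp only [map_add, hc, hd, add_zero]
    have h6 : dualPair R b (LinearMap.mul' k 𝐓' (LinearMap.lTensor 𝐓' (𝒮ₜ)
        (LinearMap.rTensor 𝐓' ((dualRadical b hR).asIdeal.restrictScalars k).subtype x))) s =
        0 := by
      clear h2 h3 h4 h5
      induction x using TensorProduct.induction_on with
      | zero => simp
      | tmul c d =>
        simp only [LinearMap.rTensor_tmul, LinearMap.lTensor_tmul, LinearMap.mul'_apply]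
        exact LinearMap.congr_fun
          ((mem_dualRadical b hR).1 ((dualRadical b hR).mul_mem_right _ _ c.2)) s
      | add c d hc hd => simp only [map_add, LinearMap.add_apply, hc, hd, add_zero]
    have h7 : dualPair R b (LinearMap.mul' k 𝐓' (LinearMap.lTensor 𝐓' (𝒮ₜ)
        (LinearMap.lTensor 𝐓' ((dualRadical b hR).asIdeal.restrictScalars k).subtype y))) s =
        dualPair R b (𝒮ₜ (TensorProduct.lid k 𝐓' (LinearMap.rTensor 𝐓' (TensorAlgebra.algebraMapInv (R := k) (M := Module.Dual k V)).toLinearMap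
        (LinearMap.lTensor 𝐓' ((dualRadical b hR).asIdeal.restrictScalars k).subtype y)))) s := by
      clear h2 h3 h4 h5 h6
      induction y using TensorProduct.induction_on with
      | zero => simp
      | tmul c d =>
        simp only [LinearMap.rTensor_tmul, LinearMap.lTensor_tmul, LinearMap.mul'_apply,
          TensorProduct.lid_tmul, map_smul, LinearMap.smul_apply]
        exact h1 _ d.2 c
      | add c d hc hd => simp only [map_add, LinearMap.add_apply, hc, hd]
    rw [map_add, map_add, map_add, LinearMap.add_apply, h6, zero_add, h7] at h2
    rw [map_add, map_add, h5, zero_add] at h3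
    rw [← h3, h2, mul_zero]

/-- Its use is the inclusion of the radical in 𝒥(V̄), which bounds 𝔅(V̄) from above. -/
theorem isNicholsIdeal_dualRadical :
    IsNicholsIdeal (repVbar k V) (coactVbar k R V) (dualRadical b hR) where
  generated := dualRadical_generated b hR
  act_mem h _ ht := tensorAct_mem_dualRadical b hR h ht
  coact_mem _ ht := tensorCoact_mem_dualRadical b hR ht
  comul_mem _ ht := braidedComul_mem_dualRadical b hR ht
  counit_eq t ht := by
    rw [← dualPair_apply_one b hR, (mem_dualRadical b hR).1 ht, LinearMap.zero_apply]
  antipode_mem t ht := by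
    rw [mem_dualRadical]
    ext1 s
    rw [LinearMap.zero_apply]
    induction s using tensorAlgebra_hom_induction with
    | add s s' hs hs' => rw [map_add, hs, hs', add_zero]
    | hom n s hs =>
      rw [← one_mul (𝒮ₜ t)]
      exact dualPair_mul_braidedAntipode b hR hs 1 ht

omit hR [Fintype ι] [DecidableEq ι] in
theorem derL_mem_nicholsIdeal (i : ι) {s : 𝐓}
    (hs : s ∈ nicholsIdeal (repV k V) (coactV k R V)) :
    derL R b i s ∈ nicholsIdeal (repV k V) (coactV k R V) :=
  map_mem_nicholsIdeal _ _ _ (fun _ hI _ ht => hI.leftDer_mem _ ht) hs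

omit hR in
theorem derAct_mem_nicholsIdeal (t : 𝐓') {s : 𝐓}
    (hs : s ∈ nicholsIdeal (repV k V) (coactV k R V)) :
    derAct R b t s ∈ nicholsIdeal (repV k V) (coactV k R V) := by
  induction t using tensorAlgebra_induction b.dualBasis with
  | one => simpa using hs
  | add x y hx hy => rw [map_add, LinearMap.add_apply]; exact add_mem hx hy
  | smul c x hx =>
    rw [map_smul, LinearMap.smul_apply]
    exact ((nicholsIdeal (repV k V) (coactV k R V)).asIdeal.restrictScalars k).smul_mem c hx
  | mul i t ht =>
    rw [map_mul, derAct_ι, Module.End.mul_apply]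
    exact derL_mem_nicholsIdeal b i ht

include b in
/-- If the Nichols algebra of `V` is finite-dimensional, so is that of `V̄`. -/
theorem finite_nichols_Vbar [Module.Finite k (NicholsV k R V)] :
    Module.Finite k (Nichols (repVbar k V) (coactVbar k R V)) := by
  obtain ⟨N, hN⟩ := exists_nicholsProj_eq_zero (repV k V) (coactV k R V)
  -- 𝔅(V) has no component of degree N.
  have h1 : ∀ s ∈ gr ^ N, s ∈ nicholsIdeal (repV k V) (coactV k R V) := by
    intro s hs
    have h := nicholsProj_mk_of_mem (repV k V) (coactV k R V) hs N
    rw [hN N le_rfl, if_pos rfl] at h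
    exact (nicholsMk_eq_zero _ _).1 h.symm
  -- In degree N the partner lies in 𝒥(V), which the derivations preserve and the counit kills; all
  -- other degrees are orthogonal to t.
  have h2 : ∀ t ∈ gr' ^ N, t ∈ nicholsIdeal (repVbar k V) (coactVbar k R V) := by
    intro t ht
    refine (le_sSup (isNicholsIdeal_dualRadical b hR) :
      dualRadical b hR ≤ nicholsIdeal (repVbar k V) (coactVbar k R V)) ?_
    rw [mem_dualRadical]
    ext1 s
    rw [LinearMap.zero_apply]
    induction s using tensorAlgebra_hom_induction with
    | add s s' hs hs' => rw [map_add, hs, hs', add_zero]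
    | hom n s hs =>
      by_cases hn : N = n
      · subst hn
        exact algebraMapInv_nicholsIdeal _ _ (derAct_mem_nicholsIdeal b t (h1 s hs))
      · exact dualPair_of_ne b hR hn ht hs
  set π := nicholsMk (repVbar k V) (coactVbar k R V) with hπ
  have h3 : ∀ n, N ≤ n → ∀ t ∈ gr' ^ n, π t = 0 := by
    intro n hn t ht
    obtain ⟨m, rfl⟩ := Nat.exists_eq_add_of_le hn
    rw [pow_add] at ht
    induction ht using Submodule.mul_induction_on' with
    | mem_mul_mem x hx y hy => rw [map_mul, (nicholsMk_eq_zero _ _).2 (h2 x hx), zero_mul]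
    | add x _ y _ hx hy => rw [map_add, hx, hy, add_zero]
  have hfin : Module.Finite k V := Module.Finite.of_basis b
  have hfg : (gr').FG := by
    rw [LinearMap.range_eq_map]
    exact Submodule.FG.map _ Module.Finite.fg_top
  have h4 : (⊤ : Submodule k (Nichols (repVbar k V) (coactVbar k R V))) ≤
      ⨆ n ∈ Finset.range N, (gr' ^ n).map π.toLinearMap := by
    intro x _
    induction x using nichols_hom_induction with
    | add s t hs ht => exact Submodule.add_mem _ (hs trivial) (ht trivial)
    | hom n t ht =>
      by_cases hn : n < N
      · exact Submodule.mem_iSup_of_mem n (Submodule.mem_iSup_of_mem (Finset.mem_range.2 hn)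
          ⟨t, ht, rfl⟩)
      · rw [← hπ, h3 n (by omega) t ht]
        exact Submodule.zero_mem _
  refine ⟨?_⟩
  rw [← top_le_iff.1 h4]
  exact Submodule.fg_biSup _ _ fun n _ => (hfg.pow n).map _

end Radical

/-! ### Presentation of `u_(H,R)(V)` -/

section SmashPair

variable {k H A E : Type u} [Field k] [Ring H] [HopfAlgebra k H] [Ring A] [Algebra k A]
  [Ring E] [Algebra k E]

/-- The images of `h` and `t` in the algebra `E` satisfy the relations of a smash product. -/
def IsSmashPair (act : H →ₐ[k] Module.End k A) (g : H →ₐ[k] E) (a : A →ₐ[k] E) : Prop :=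
  ∀ h t, g h * a t = LinearMap.mul' k E (TensorProduct.map
    (a.toLinearMap ∘ₗ act.toLinearMap.flip t) g.toLinearMap (Coalgebra.comul (R := k) h))

/-- By multiplicativity it suffices to know how H passes the generators; the induction on t uses
coassociativity in the form `comul_hitL`. -/
theorem isSmashPair_of_matrix {W : Type u} [AddCommGroup W] [Module k W]
    {κ : Type} [Fintype κ] (ρ : H →ₐ[k] Module.End k W) (w : Module.Basis κ k W)
    (τ : κ → κ → H →ₗ[k] k) (hτ : ∀ h j, ρ h (w j) = ∑ i, τ i j h • w i)
    (g : H →ₐ[k] E) (a : TensorAlgebra k W →ₐ[k] E)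
    (hga : ∀ h j, g h * a (TensorAlgebra.ι k (w j)) =
      ∑ i, a (TensorAlgebra.ι k (w i)) * g (hitL (τ i j) h)) :
    IsSmashPair (tensorAct ρ) g a := by
  intro h t
  induction t using tensorAlgebra_induction w generalizing h with
  | one =>
    rw [map_one, mul_one]
    conv_lhs => rw [← hitL_counit (k := k) h, hitL, LinearMap.comp_apply]
    induction Coalgebra.comul (R := k) h using TensorProduct.induction_on with
    | zero => simp
    | tmul c d => simp [tensorAct_one]
    | add c d hc hd => simp only [map_add, hc, hd]
  | add s t hs ht =>
    simp only [map_add, mul_add, hs, ht, LinearMap.comp_add, TensorProduct.map_add_left,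
      LinearMap.add_apply]
  | smul c t ht =>
    simp only [map_smul, mul_smul_comm, ht, LinearMap.comp_smul, TensorProduct.map_smul_left,
      LinearMap.smul_apply]
  | mul j t ht =>
    rw [map_mul, ← mul_assoc, hga, Finset.sum_mul]
    simp only [mul_assoc, ht, comul_hitL]
    induction Coalgebra.comul (R := k) h using TensorProduct.induction_on with
    | zero => simp
    | tmul c d =>
      simp [tensorAct_ι_mul_of_matrix ρ w τ hτ, Finset.sum_mul, mul_assoc]
    | add c d hc hd => simp only [map_add, mul_add, Finset.sum_add_distrib, hc, hd]

theorem IsSmashPair.mul_ι {W : Type u} [AddCommGroup W] [Module k W]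
    {κ : Type} [Fintype κ] {ρ : H →ₐ[k] Module.End k W} {w₀ : W} {w : κ → W}
    {τ : κ → H →ₗ[k] k} (hτ : ∀ h, ρ h w₀ = ∑ i, τ i h • w i)
    {g : H →ₐ[k] E} {a : TensorAlgebra k W →ₐ[k] E} (hga : IsSmashPair (tensorAct ρ) g a) (h : H) :
    g h * a (TensorAlgebra.ι k w₀) = ∑ i, a (TensorAlgebra.ι k (w i)) * g (hitL (τ i) h) := by
  rw [hga]
  simp only [hitL, LinearMap.comp_apply]
  induction Coalgebra.comul (R := k) h using TensorProduct.induction_on with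
  | zero => simp
  | tmul c d => simp [tensorAct_ι, hτ, Finset.sum_mul]
  | add c d hc hd => simp only [map_add, mul_add, Finset.sum_add_distrib, hc, hd]

variable (α : ModuleAlgebra k H A)

theorem Smash.inA_mul_inH (x : A) (h : H) :
    Smash.inA α x * Smash.inH α h = (x ⊗ₜ[k] h : A ⊗[k] H) := by
  change Smash.mulMap α (x ⊗ₜ 1) (1 ⊗ₜ h) = _
  rw [Smash.mulMap_tmul, map_one, mul_one, Smash.aAct_tmul, mul_one]

theorem Smash.isSmashPair : IsSmashPair α.act (Smash.inH α) (Smash.inA α) := by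
  intro h t
  change Smash.mulMap α (1 ⊗ₜ h) (t ⊗ₜ 1) = _
  rw [Smash.mulMap_tmul, map_one, one_mul, Smash.hAct_tmul]
  induction Coalgebra.comul (R := k) h using TensorProduct.induction_on with
  | zero => simp; rfl
  | tmul c d =>
    simp only [TensorProduct.map_tmul, LinearMap.mul'_apply, LinearMap.comp_apply,
      AlgHom.toLinearMap_apply, Smash.inA_mul_inH]
    simp
  | add c d hc hd => simp only [map_add, ← hc, ← hd]; rfl

variable {α} {g : H →ₐ[k] E} {a : A →ₐ[k] E}

/-- The universal property of the smash product. -/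
def Smash.lift (hga : IsSmashPair α.act g a) : Smash α →ₐ[k] E :=
  AlgHom.ofLinearMap
    ((LinearMap.mul' k E ∘ₗ TensorProduct.map a.toLinearMap g.toLinearMap : A ⊗[k] H →ₗ[k] E) :
      Smash α →ₗ[k] E)
    (by
      change LinearMap.mul' k E (TensorProduct.map a.toLinearMap g.toLinearMap (1 ⊗ₜ 1)) = 1
      simp)
    (by
      intro s t
      change LinearMap.mul' k E (TensorProduct.map a.toLinearMap g.toLinearMap
        (Smash.mulMap α s t)) = LinearMap.mul' k E (TensorProduct.map a.toLinearMap g.toLinearMap s)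
          * LinearMap.mul' k E (TensorProduct.map a.toLinearMap g.toLinearMap t)
      change A ⊗[k] H at s t
      induction s using TensorProduct.induction_on with
      | zero => simp
      | add c d hc hd => simp only [map_add, LinearMap.add_apply, add_mul, hc, hd]
      | tmul x h =>
        induction t using TensorProduct.induction_on with
        | zero => simp
        | add c d hc hd => simp only [map_add, mul_add, hc, hd]
        | tmul y l =>
          rw [Smash.mulMap_tmul, Module.End.mul_apply, Smash.hAct_tmul]
          simp only [TensorProduct.map_tmul, LinearMap.mul'_apply, AlgHom.toLinearMap_apply]
          rw [mul_assoc, ← mul_assoc (g h), hga]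
          induction Coalgebra.comul (R := k) h using TensorProduct.induction_on with
          | zero => simp
          | tmul c d => simp [Smash.aAct_tmul, mul_assoc]
          | add c d hc hd => simp only [map_add, mul_add, add_mul, hc, hd])

theorem Smash.lift_inA (hga : IsSmashPair α.act g a) (x : A) :
    Smash.lift hga (Smash.inA α x) = a x := by
  change LinearMap.mul' k E (TensorProduct.map a.toLinearMap g.toLinearMap (x ⊗ₜ 1)) = _
  simp

theorem Smash.lift_inH (hga : IsSmashPair α.act g a) (h : H) :
    Smash.lift hga (Smash.inH α h) = g h := by
  change LinearMap.mul' k E (TensorProduct.map a.toLinearMap g.toLinearMap (1 ⊗ₜ h)) = _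
  simp

end SmashPair

/-! ### The universal property of 𝔲 in coordinates. -/

section Presentation

variable {k : Type u} {H : Type u} [Field k] [Ring H] [HopfAlgebra k H] {R : H ⊗[k] H}
  {V : Type u} [AddCommGroup V] [Module k V] [Module H V] [IsScalarTower k H V]
  {ι : Type} [Fintype ι] [DecidableEq ι] (b : Module.Basis ι k V)

local notation "ε" => Coalgebra.counit (R := k) (A := H)
local notation "𝒮" => HopfAlgebra.antipode k (A := H)
local notation "𝛒" => matCoeff (H := H) b
local notation "𝐓" => TensorAlgebra k V
local notation "𝐓'" => TensorAlgebra k (Module.Dual k V)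

/-- `⟦y, x⟧` as a bilinear map. -/
def bracketHom : Module.Dual k V →ₗ[k] V →ₗ[k] BigSmash k H V :=
  LinearMap.mk₂ k (bracket k R V)
    (fun y y' x => by
      simp only [bracket, crossTerm, pairTerm, iterVbar, map_add, add_mul, TensorProduct.add_tmul,
        LinearMap.add_apply]
      abel)
    (fun c y x => by
      simp only [bracket, crossTerm, pairTerm, iterVbar, map_smul, smul_mul_assoc,
        ← TensorProduct.smul_tmul', LinearMap.smul_apply, smul_eq_mul, smul_add, smul_sub,
        Algebra.algebraMap_eq_smul_one, mul_smul])
    (fun y x x' => by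
      simp only [bracket, crossTerm, pairTerm, iterVact, iterV, map_add, mul_add,
        TensorProduct.tmul_add, LinearMap.comp_add, TensorProduct.map_add_left,
        LinearMap.add_apply]
      abel)
    (fun c y x => by
      simp only [bracket, crossTerm, pairTerm, iterVact, iterV, map_smul, mul_smul_comm,
        TensorProduct.tmul_smul, LinearMap.comp_smul, TensorProduct.map_smul_left,
        LinearMap.smul_apply, smul_eq_mul, smul_add, smul_sub,
        Algebra.algebraMap_eq_smul_one, mul_smul])

variable (R) in
/-- Operators that satisfy the relations of `u_(H,R)(V)` in coordinates. -/
structure IsURep {E : Type*} [Ring E] [Algebra k E] (g : H →ₐ[k] E) (x y : ι → E) : Prop where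
  mul_x : ∀ h j, g h * x j = ∑ i, x i * g (hitL (𝛒 i j) h)
  mul_y : ∀ h i, g h * y i = ∑ p, y p * g (hitL (𝛒 i p ∘ₗ 𝒮) h)
  cross : ∀ i j, y i * x j = ∑ p, ∑ q, 𝛒 p j (mMat R (𝛒) i q) • (x p * y q) +
    (if i = j then 1 else 0) - g (zMat R (𝛒) i j)
  left : ∀ t ∈ nicholsIdeal (repV k V) (coactV k R V),
    TensorAlgebra.lift k (b.constr k x) t = 0
  right : ∀ t ∈ nicholsIdeal (repVbar k V) (coactVbar k R V),
    TensorAlgebra.lift k (b.dualBasis.constr k y) t = 0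

theorem crossTerm_basis (hR : IsQuasitriangular R) (i j : ι) :
    crossTerm k R V (b.dualBasis i) (b j) = ∑ p, ∑ q, 𝛒 p j (mMat R (𝛒) i q) •
      (eV k V (b p) * eVbar k V (b.dualBasis q)) := by
  rw [crossTerm, (isCoactMatrix_coactVbar b hR).coact, Finset.sum_comm]
  simp only [map_sum, TensorProduct.map_tmul, LinearMap.mul'_apply, LinearMap.comp_apply,
    LinearMap.flip_apply, AlgHom.toLinearMap_apply, repV_basis b, map_smul, Finset.sum_mul,
    smul_mul_assoc]

variable {E : Type u} [Ring E] [Algebra k E] {g : H →ₐ[k] E} {x y : ι → E}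

theorem IsURep.isSmashPair (hE : IsURep R b g x y) :
    IsSmashPair (tensorAct (repSum k V)) g
      (TensorAlgebra.lift k ((b.constr k x).coprod (b.dualBasis.constr k y))) := by
  -- The matrix of coefficients of V ⊕ V̄ is block diagonal, with blocks ρ and the transpose of ρ ∘
  -- 𝒮.
  refine isSmashPair_of_matrix (repSum k V) (b.prod b.dualBasis)
    (Sum.elim (fun i => Sum.elim (fun j => 𝛒 i j) (fun _ => 0))
      (fun p => Sum.elim (fun _ => 0) (fun i => 𝛒 i p ∘ₗ 𝒮))) ?_ g _ ?_
  · rintro h (j | j)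
    · simp only [Fintype.sum_sum_type, Sum.elim_inl, Sum.elim_inr, LinearMap.zero_apply, zero_smul,
        Finset.sum_const_zero, add_zero]
      apply Prod.ext
      · simp [repSum, repV_basis b, Prod.fst_sum]
      · simp [repSum, Prod.snd_sum]
    · simp only [Fintype.sum_sum_type, Sum.elim_inl, Sum.elim_inr, LinearMap.zero_apply, zero_smul,
        Finset.sum_const_zero, zero_add]
      apply Prod.ext
      · simp [repSum, Prod.fst_sum]
      · have := repVbar_basis b h j
        simp only [Module.Basis.coe_dualBasis] at this
        simp [repSum, Prod.snd_sum, this]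
  · have h0 : ∀ h : H, hitL (0 : H →ₗ[k] k) h = 0 := fun h => by simp [hitL, sliceL]
    rintro h (j | j)
    · simp only [Fintype.sum_sum_type, Sum.elim_inl, Sum.elim_inr, h0, map_zero, mul_zero,
        Finset.sum_const_zero, add_zero, TensorAlgebra.lift_ι_apply]
      simpa using hE.mul_x h j
    · simp only [Fintype.sum_sum_type, Sum.elim_inl, Sum.elim_inr, h0, map_zero, mul_zero,
        Finset.sum_const_zero, zero_add, TensorAlgebra.lift_ι_apply]
      have := hE.mul_y h j
      simpa [← Module.Basis.coe_dualBasis, Module.Basis.constr_basis] using this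

/-- The map of `T(V ⊕ V̄) # H` given by operators that satisfy the relations of
`u_(H,R)(V)`. -/
def IsURep.liftSmash (hE : IsURep R b g x y) : BigSmash k H V →ₐ[k] E :=
  Smash.lift (hE.isSmashPair b)

variable {b}

theorem IsURep.liftSmash_eH (hE : IsURep R b g x y) (h : H) : hE.liftSmash b (eH k V h) = g h :=
  Smash.lift_inH _ h

theorem IsURep.liftSmash_tV (hE : IsURep R b g x y) (t : 𝐓) :
    hE.liftSmash b (tV k V t) = TensorAlgebra.lift k (b.constr k x) t := by
  have : (hE.liftSmash b).comp (tV k V) = TensorAlgebra.lift k (b.constr k x) := by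
    apply TensorAlgebra.hom_ext
    ext v
    exact (Smash.lift_inA (hE.isSmashPair b) _).trans (by simp)
  exact DFunLike.congr_fun this t

theorem IsURep.liftSmash_tVbar (hE : IsURep R b g x y) (t : 𝐓') :
    hE.liftSmash b (tVbar k V t) = TensorAlgebra.lift k (b.dualBasis.constr k y) t := by
  have : (hE.liftSmash b).comp (tVbar k V) = TensorAlgebra.lift k (b.dualBasis.constr k y) := by
    apply TensorAlgebra.hom_ext
    ext v
    exact (Smash.lift_inA (hE.isSmashPair b) _).trans (by simp)
  exact DFunLike.congr_fun this t

theorem IsURep.liftSmash_eV (hE : IsURep R b g x y) (j : ι) :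
    hE.liftSmash b (eV k V (b j)) = x j := by
  refine (hE.liftSmash_tV _).trans ?_
  rw [TensorAlgebra.lift_ι_apply, Module.Basis.constr_basis]

theorem IsURep.liftSmash_eVbar (hE : IsURep R b g x y) (i : ι) :
    hE.liftSmash b (eVbar k V (b.dualBasis i)) = y i := by
  refine (hE.liftSmash_tVbar _).trans ?_
  rw [TensorAlgebra.lift_ι_apply, Module.Basis.constr_basis]

variable (hR : IsQuasitriangular R)

include hR in
theorem IsURep.liftSmash_bracket (hE : IsURep R b g x y) (η : Module.Dual k V) (v : V) :
    hE.liftSmash b (bracket k R V η v) = 0 := by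
  have : (bracketHom (H := H) (R := R) (V := V)).compr₂ (hE.liftSmash b).toLinearMap = 0 := by
    refine LinearMap.ext_basis b.dualBasis b fun i j => ?_
    change hE.liftSmash b (bracket k R V (b.dualBasis i) (b j)) = 0
    rw [bracket, crossTerm_basis b hR, pairTerm_basis b hR]
    simp only [map_add, map_sub, map_mul, map_sum, map_smul, hE.liftSmash_eV, hE.liftSmash_eVbar,
      hE.liftSmash_eH, hE.cross, AlgHom.commutes]
    have : algebraMap k E ((b.dualBasis i) (b j)) = if i = j then 1 else 0 := by
      rw [Module.Basis.coe_dualBasis, Module.Basis.coord_apply, Module.Basis.repr_self,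
        Finsupp.single_apply]
      split_ifs with h1 h2 h2
      · simp
      · exact absurd h1.symm h2
      · exact absurd h2.symm h1
      · simp
    rw [this]
    abel
  exact LinearMap.congr_fun (LinearMap.congr_fun this η) v

/-- The map of `U_(H,R)(V)` given by operators that satisfy the relations of
`u_(H,R)(V)`. -/
def IsURep.liftBig (hE : IsURep R b g x y) : BigU k R V →ₐ[k] E :=
  RingQuot.liftAlgHom k ⟨hE.liftSmash b, by
    rintro _ _ ⟨η, v⟩
    rw [hE.liftSmash_bracket hR, map_zero]⟩

theorem IsURep.liftBig_projBig (hE : IsURep R b g x y) (a : BigSmash k H V) :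
    hE.liftBig hR (projBig k R V a) = hE.liftSmash b a :=
  RingQuot.liftAlgHom_mkAlgHom_apply _ _ _ a

/-- The universal property of `u_(H,R)(V)`. -/
def IsURep.lift (hE : IsURep R b g x y) : SmallU k R V →ₐ[k] E :=
  RingQuot.liftAlgHom k ⟨hE.liftBig hR, by
    rintro _ _ (⟨t, ht⟩ | ⟨t, ht⟩)
    · rw [hE.liftBig_projBig, hE.liftSmash_tV, hE.left t ht, map_zero]
    · rw [hE.liftBig_projBig, hE.liftSmash_tVbar, hE.right t ht, map_zero]⟩

theorem IsURep.lift_proj (hE : IsURep R b g x y) (a : BigSmash k H V) :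
    hE.lift hR (proj k R V a) = hE.liftSmash b a :=
  (RingQuot.liftAlgHom_mkAlgHom_apply _ _ _ _).trans (hE.liftBig_projBig hR a)

theorem IsURep.lift_ofH (hE : IsURep R b g x y) (h : H) : hE.lift hR (ofH k R V h) = g h :=
  (hE.lift_proj hR _).trans (hE.liftSmash_eH h)

theorem IsURep.lift_ofV (hE : IsURep R b g x y) (j : ι) : hE.lift hR (ofV k R V (b j)) = x j :=
  (hE.lift_proj hR _).trans (hE.liftSmash_eV j)

theorem IsURep.lift_ofVbar (hE : IsURep R b g x y) (i : ι) :
    hE.lift hR (ofVbar k R V (b.dualBasis i)) = y i :=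
  (hE.lift_proj hR _).trans (hE.liftSmash_eVbar i)

variable (k R V) in
/-- `T(V) → u_(H,R)(V)` -/
def uV : 𝐓 →ₐ[k] SmallU k R V := (proj k R V).comp (tV k V)

variable (k R V) in
/-- `T(V̄) → u_(H,R)(V)` -/
def uVbar : 𝐓' →ₐ[k] SmallU k R V := (proj k R V).comp (tVbar k V)

theorem uV_eq_lift : uV k R V = TensorAlgebra.lift k (b.constr k fun j => ofV k R V (b j)) := by
  apply TensorAlgebra.hom_ext
  apply b.ext
  intro j
  simp [uV, ofV, eV]

theorem uVbar_eq_lift : uVbar k R V =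
    TensorAlgebra.lift k (b.dualBasis.constr k fun j => ofVbar k R V (b.dualBasis j)) := by
  apply TensorAlgebra.hom_ext
  apply b.dualBasis.ext
  intro j
  simp only [LinearMap.comp_apply, AlgHom.toLinearMap_apply, TensorAlgebra.lift_ι_apply,
    Module.Basis.constr_basis]
  rfl

theorem uV_eq_zero {t : 𝐓} (ht : t ∈ nicholsIdeal (repV k V) (coactV k R V)) :
    uV k R V t = 0 := by
  have := RingQuot.mkAlgHom_rel k (SmallRel.left (R := R) t ht)
  rw [map_zero] at this
  exact this

theorem uVbar_eq_zero {t : 𝐓'} (ht : t ∈ nicholsIdeal (repVbar k V) (coactVbar k R V)) :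
    uVbar k R V t = 0 := by
  have := RingQuot.mkAlgHom_rel k (SmallRel.right (R := R) t ht)
  rw [map_zero] at this
  exact this

theorem proj_isSmashPair : IsSmashPair (tensorAct (repSum k V)) (ofH k R V)
    ((proj k R V).comp (Smash.inA _)) := by
  intro h t
  change proj k R V (Smash.inH _ h) * proj k R V (Smash.inA _ t) = _
  rw [← map_mul, Smash.isSmashPair]
  induction Coalgebra.comul (R := k) h using TensorProduct.induction_on with
  | zero => simp
  | tmul c d => simp; rfl
  | add c d hc hd => simp only [map_add, hc, hd]

include hR in
variable (b) in
/-- The generators of `u_(H,R)(V)` satisfy the relations of `u_(H,R)(V)`. -/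
theorem isURep_ofH : IsURep R b (ofH k R V) (fun j => ofV k R V (b j))
    (fun i => ofVbar k R V (b.dualBasis i)) where
  mul_x h j := by
    have := (proj_isSmashPair (k := k) (R := R) (V := V)).mul_ι (w₀ := (b j, 0))
      (w := fun i => (b i, 0)) (τ := fun i => 𝛒 i j) (fun h => by
        apply Prod.ext
        · simp [repSum, repV_basis b, Prod.fst_sum]
        · simp [repSum, Prod.snd_sum]) h
    have e : ∀ v, ((proj k R V).comp (Smash.inA _)) (TensorAlgebra.ι k ((v, 0) :
        V × Module.Dual k V)) = ofV k R V v := by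
      intro v
      simp [ofV, eV, tV]
    simpa only [e] using this
  mul_y h i := by
    have := (proj_isSmashPair (k := k) (R := R) (V := V)).mul_ι (w₀ := (0, b.dualBasis i))
      (w := fun p => (0, b.dualBasis p)) (τ := fun p => 𝛒 i p ∘ₗ 𝒮) (fun h => by
        apply Prod.ext
        · simp [repSum, Prod.fst_sum]
        · have := repVbar_basis b h i
          simp only [Module.Basis.coe_dualBasis] at this
          simp [repSum, Prod.snd_sum, this]) h
    have e : ∀ v, ((proj k R V).comp (Smash.inA _)) (TensorAlgebra.ι k ((0, v) :
        V × Module.Dual k V)) = ofVbar k R V v := by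
      intro v
      simp [ofVbar, eVbar, tVbar]
    simpa only [e] using this
  cross i j := by
    have h0 : projBig k R V (bracket k R V (b.dualBasis i) (b j)) = 0 :=
      (RingQuot.mkAlgHom_rel k (BigRel.bracket (R := R) (b.dualBasis i) (b j))).trans
        (map_zero _)
    have h : proj k R V (bracket k R V (b.dualBasis i) (b j)) = 0 :=
      (congrArg (projSmall k R V) h0).trans (map_zero _)
    rw [bracket, crossTerm_basis b hR, pairTerm_basis b hR] at h
    simp only [map_add, map_sub, map_mul, map_sum, map_smul, AlgHom.commutes] at h
    have e : algebraMap k (SmallU k R V) ((b.dualBasis i) (b j)) = if i = j then 1 else 0 := by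
      rw [Module.Basis.coe_dualBasis, Module.Basis.coord_apply, Module.Basis.repr_self,
        Finsupp.single_apply]
      split_ifs with h1 h2 h2
      · simp
      · exact absurd h1.symm h2
      · exact absurd h2.symm h1
      · simp
    rw [e] at h
    rw [← sub_eq_zero]
    refine Eq.trans ?_ h
    simp only [ofV, ofVbar, ofH, LinearMap.comp_apply, AlgHom.toLinearMap_apply,
      AlgHom.comp_apply]
    abel
  left t ht := by rw [← uV_eq_lift, uV_eq_zero ht]
  right t ht := by rw [← uVbar_eq_lift, uVbar_eq_zero ht]

/-- T(V ⊕ V̄) # H is spanned by products of a tensor and an element of H, and it maps onto 𝔲. -/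
theorem smallU_induction {S : Subalgebra k (SmallU k R V)} (hH : ∀ h, ofH k R V h ∈ S)
    (hV : ∀ v, ofV k R V v ∈ S) (hVbar : ∀ v, ofVbar k R V v ∈ S) (a : SmallU k R V) : a ∈ S := by
  have hT : ∀ t : TensorAlgebra k (V × Module.Dual k V),
      proj k R V (Smash.inA (tensorModuleAlgebra (repSum k V)) t) ∈ S := by
    intro t
    induction t using TensorAlgebra.induction with
    | algebraMap r => rw [AlgHom.commutes, AlgHom.commutes]; exact S.algebraMap_mem r
    | ι w =>
      have e1 : proj k R V (Smash.inA (tensorModuleAlgebra (repSum (H := H) k V))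
          (TensorAlgebra.ι k w)) = ofV k R V w.1 + ofVbar k R V w.2 := by
        have : w = (w.1, 0) + (0, w.2) := by simp
        conv_lhs => rw [this, map_add, map_add, map_add]
        simp [ofV, ofVbar, eV, eVbar, tV, tVbar]
      rw [e1]
      exact S.add_mem (hV _) (hVbar _)
    | mul a b ha hb => rw [map_mul, map_mul]; exact S.mul_mem ha hb
    | add a b ha hb => rw [map_add, map_add]; exact S.add_mem ha hb
  obtain ⟨a, rfl⟩ := RingQuot.mkAlgHom_surjective k (SmallRel k R V) a
  obtain ⟨a, rfl⟩ := RingQuot.mkAlgHom_surjective k (BigRel k R V) a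
  change proj k R V a ∈ S
  change TensorAlgebra k (V × Module.Dual k V) ⊗[k] H at a
  induction a using TensorProduct.induction_on with
  | zero => exact (congrArg (· ∈ S) (map_zero (proj k R V))).mpr S.zero_mem
  | tmul x h =>
    rw [← Smash.inA_mul_inH (tensorModuleAlgebra (repSum k V)), map_mul]
    exact S.mul_mem (hT x) (hH h)
  | add a b ha hb =>
    exact (congrArg (· ∈ S) (map_add (proj k R V) a b)).mpr (S.add_mem ha hb)

end Presentation

/-! ### Induced modules -/

section NicholsOperators

variable {k : Type u} {H : Type u} [Field k] [Ring H] [HopfAlgebra k H] {R : H ⊗[k] H}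
  {V : Type u} [AddCommGroup V] [Module k V] [Module H V] [IsScalarTower k H V]
  {ι : Type} [Fintype ι] [DecidableEq ι] (b : Module.Basis ι k V)

local notation "ε" => Coalgebra.counit (R := k) (A := H)
local notation "𝒮" => HopfAlgebra.antipode k (A := H)
local notation "𝛒" => matCoeff (H := H) b
local notation "𝐓" => TensorAlgebra k V
local notation "𝐓'" => TensorAlgebra k (Module.Dual k V)
local notation "𝐁" => NicholsV k R V
local notation "πB" => nicholsMk (repV k V) (coactV k R V)
local notation "aB" => nicholsAct (repV k V) (coactV k R V)

variable (R) in
/-- Left multiplication by a basis vector of `V` on `B(V)`. -/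
def nicholsX (j : ι) : Module.End k 𝐁 := LinearMap.mulLeft k (πB (TensorAlgebra.ι k (b j)))

variable (R) in
/-- The left skew derivations of `B(V)`. -/
def nicholsDerL (i : ι) : Module.End k 𝐁 :=
  nicholsDescend _ _ (derL R b i) fun _ ht =>
    map_mem_nicholsIdeal _ _ _ (fun _ hI _ ht => hI.leftDer_mem _ ht) ht

variable (R) in
/-- The right skew derivations of `B(V)`. -/
def nicholsDerR (i : ι) : Module.End k 𝐁 :=
  nicholsDescend _ _ (derR R b i) fun _ ht =>
    map_mem_nicholsIdeal _ _ _ (fun _ hI _ ht => hI.rightDer_mem _ ht) ht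

omit [Fintype ι] [DecidableEq ι] in
theorem nicholsX_mk (j : ι) (t : 𝐓) :
    nicholsX R b j (πB t) = πB (TensorAlgebra.ι k (b j) * t) := by
  simp [nicholsX]

omit [Fintype ι] [DecidableEq ι] in
theorem nicholsDerL_mk (i : ι) (t : 𝐓) : nicholsDerL R b i (πB t) = πB (derL R b i t) :=
  nicholsDescend_mk _ _ _ _ _

omit [Fintype ι] [DecidableEq ι] in
theorem nicholsDerR_mk (i : ι) (t : 𝐓) : nicholsDerR R b i (πB t) = πB (derR R b i t) :=
  nicholsDescend_mk _ _ _ _ _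

theorem end_nichols_ext {F G : Module.End k 𝐁} (h : ∀ t, F (πB t) = G (πB t)) : F = G := by
  ext x
  obtain ⟨t, rfl⟩ := nicholsMk_surjective _ _ x
  exact h t

omit [DecidableEq ι] in
theorem nicholsAct_mul_nicholsX (h : H) (j : ι) :
    aB h * nicholsX R b j = ∑ i, nicholsX R b i * aB (hitL (𝛒 i j) h) := by
  refine end_nichols_ext fun t => ?_
  simp only [Module.End.mul_apply, LinearMap.sum_apply, nicholsX_mk, nicholsAct_mk,
    tensorAct_V_mul H b, map_sum]

variable (hR : IsQuasitriangular R)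
include hR

theorem nicholsDerL_mul_nicholsX (i j : ι) : nicholsDerL R b i * nicholsX R b j =
    (if i = j then 1 else 0) +
      ∑ p, ∑ q, 𝛒 p j (mMat R (𝛒) i q) • (nicholsX R b p * nicholsDerL R b q) := by
  refine end_nichols_ext fun t => ?_
  simp only [Module.End.mul_apply, LinearMap.sum_apply, LinearMap.add_apply, LinearMap.smul_apply,
    nicholsX_mk, nicholsDerL_mk, derL_mul b hR, map_add, map_sum, map_smul]
  congr 1
  split_ifs <;> simp

theorem nicholsDerR_mul_nicholsX (i j : ι) : nicholsDerR R b i * nicholsX R b j =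
    nicholsX R b j * nicholsDerR R b i + aB (lMat R (𝛒) i j) := by
  refine end_nichols_ext fun t => ?_
  simp only [Module.End.mul_apply, LinearMap.add_apply, nicholsX_mk, nicholsDerR_mk,
    derR_mul b hR, map_add, nicholsAct_mk]

theorem nicholsDerL_mul_nicholsAct (i : ι) (h : H) : nicholsDerL R b i * aB h =
    ∑ p, aB (hitL (𝛒 i p) h) * nicholsDerL R b p := by
  refine end_nichols_ext fun t => ?_
  simp only [Module.End.mul_apply, LinearMap.sum_apply, nicholsDerL_mk, nicholsAct_mk,
    derL_tensorAct b hR, map_sum]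

theorem nicholsDerR_mul_nicholsAct (i : ι) (h : H) : nicholsDerR R b i * aB h =
    ∑ p, aB (hitR (𝛒 i p) h) * nicholsDerR R b p := by
  refine end_nichols_ext fun t => ?_
  simp only [Module.End.mul_apply, LinearMap.sum_apply, nicholsDerR_mk, nicholsAct_mk,
    derR_tensorAct b hR, map_sum]

theorem nicholsAct_mMat_mul_nicholsX (i l j : ι) : aB (mMat R (𝛒) i l) * nicholsX R b j =
    ∑ p, ∑ q, 𝛒 p j (mMat R (𝛒) i q) • (nicholsX R b p * aB (mMat R (𝛒) q l)) := by
  rw [nicholsAct_mul_nicholsX]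
  refine Finset.sum_congr rfl fun p _ => ?_
  rw [hitL, LinearMap.comp_apply, comul_mMat hR (isMatrixRep_matCoeff b)]
  simp [Finset.mul_sum]

end NicholsOperators

/-! ### The action of V̄ on an induced module. -/

section Induced

variable {k : Type u} {H : Type u} [Field k] [Ring H] [HopfAlgebra k H] {R : H ⊗[k] H}
  {V : Type u} [AddCommGroup V] [Module k V] [Module H V] [IsScalarTower k H V]
  {ι : Type} [Fintype ι] [DecidableEq ι] {b : Module.Basis ι k V}

local notation "ε" => Coalgebra.counit (R := k) (A := H)
local notation "𝒮" => HopfAlgebra.antipode k (A := H)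
local notation "𝛒" => matCoeff (H := H) b
local notation "𝐓" => TensorAlgebra k V
local notation "𝐓'" => TensorAlgebra k (Module.Dual k V)
local notation "𝐁" => NicholsV k R V
local notation "πB" => nicholsMk (repV k V) (coactV k R V)
local notation "aB" => nicholsAct (repV k V) (coactV k R V)

/-- The two ways of ordering H and V̄ carry the same information because ρ ∘ 𝒮 is the convolution
inverse of ρ. The antipode-free form is the one that is checked on induced modules. -/
theorem mul_y_iff {E : Type*} [Ring E] [Algebra k E] (g : H →ₐ[k] E) (y : ι → E) :
    (∀ h i, g h * y i = ∑ p, y p * g (hitL (𝛒 i p ∘ₗ 𝒮) h)) ↔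
      ∀ h i, y i * g h = ∑ p, g (hitL (𝛒 i p) h) * y p := by
  have hρ := isMatrixRep_matCoeff (H := H) b
  constructor
  · intro H1 h i
    simp only [H1]
    rw [Finset.sum_comm]
    simp only [← Finset.mul_sum, ← map_sum, hρ.sum_hitL_antipode_hitL]
    simp [apply_ite g, mul_ite]
  · intro H1 h i
    simp only [H1]
    rw [Finset.sum_comm]
    simp only [← Finset.sum_mul, ← map_sum, hρ.sum_hitL_hitL_antipode]
    simp [apply_ite g, ite_mul]

variable {A E : Type u} [Ring A] [Algebra k A] [Ring E] [Algebra k E]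
  (l : Module.End k (NicholsV k R V) →ₐ[k] E) (r : A →ₐ[k] E)
  (hc : ∀ (X : Module.End k (NicholsV k R V)) (a : A), Commute (l X) (r a))
  (g : H →ₐ[k] A) (y : ι → A)

/-- The diagonal action of `H ⊗ H`. -/
def indMap : H ⊗[k] H →ₐ[k] E :=
  Algebra.TensorProduct.lift (l.comp aB) (r.comp g) fun c d => hc (aB c) (g d)

variable (b) in
/-- The action of `V̄` on an induced module. -/
def indY (i : ι) : E :=
  -- The three summands answer the three terms of the cross relation: yᵢ passes 𝔅(V) by the braiding
  -- m and acts on N, ∂ᴸᵢ accounts for δᵢⱼ, and the terms with ∂ᴿ account for −zᵢⱼ.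
  ∑ p, l (aB (mMat R (𝛒) i p)) * r (y p) + l (nicholsDerL R b i) -
    ∑ p, l (aB (mMat R (𝛒) i p)) * ∑ q, l (nicholsDerR R b q) * r (g (zMat R (𝛒) p q))

local notation "Φ" => indMap l r hc g

theorem indMap_tmul (c d : H) : Φ (c ⊗ₜ d) = l (aB c) * r (g d) :=
  Algebra.TensorProduct.lift_tmul _ _ _ _ _

omit [DecidableEq ι] in
theorem indMap_mul_nicholsX (t : H ⊗[k] H) (j : ι) : Φ t * l (nicholsX R b j) =
    ∑ i, l (nicholsX R b i) * Φ (LinearMap.rTensor H (hitL (𝛒 i j)) t) := by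
  induction t using TensorProduct.induction_on with
  | zero => simp
  | tmul c d =>
    simp only [indMap_tmul, LinearMap.rTensor_tmul]
    rw [mul_assoc, ← (hc _ _).eq, ← mul_assoc, ← map_mul, nicholsAct_mul_nicholsX, map_sum,
      Finset.sum_mul]
    simp only [map_mul, mul_assoc]
  | add c d hc hd => simp only [map_add, add_mul, mul_add, Finset.sum_add_distrib, hc, hd]

variable (hR : IsQuasitriangular R)
include hR

/-- `hitL` on the second leg of Δ(h) is `hitR` on the first leg, and m turns that into `hitL` on the
first leg, which is the coproduct of `hitL` of h. -/
theorem mMat_mul_indMap (i j : ι) (h : H) :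
    ∑ p, l (aB (mMat R (𝛒) i p)) *
      Φ (LinearMap.lTensor H (hitL (𝛒 p j)) (Coalgebra.comul h)) =
    ∑ p, Φ (Coalgebra.comul (hitL (𝛒 i p) h)) * l (aB (mMat R (𝛒) p j)) := by
  simp only [lTensor_hitL_comul, comul_hitL]
  induction Coalgebra.comul (R := k) h using TensorProduct.induction_on with
  | zero => simp
  | tmul c d =>
    simp only [LinearMap.rTensor_tmul, indMap_tmul, ← mul_assoc, ← map_mul]
    rw [← Finset.sum_mul, ← map_sum, ← map_sum,
      ← sum_hitL_mul_mMat hR (isMatrixRep_matCoeff b), map_sum, map_sum, Finset.sum_mul]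
    refine Finset.sum_congr rfl fun p _ => ?_
    rw [map_mul, map_mul, mul_assoc, mul_assoc, (hc _ _).eq]
  | add c d hc hd => simp only [map_add, mul_add, add_mul, Finset.sum_add_distrib, hc, hd]

theorem derL_mul_indMap (i : ι) (h : H) :
    l (nicholsDerL R b i) * Φ (Coalgebra.comul h) =
    ∑ p, Φ (Coalgebra.comul (hitL (𝛒 i p) h)) * l (nicholsDerL R b p) := by
  simp only [comul_hitL]
  induction Coalgebra.comul (R := k) h using TensorProduct.induction_on with
  | zero => simp
  | tmul c d =>
    simp only [LinearMap.rTensor_tmul, indMap_tmul]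
    rw [← mul_assoc, ← map_mul, nicholsDerL_mul_nicholsAct b hR, map_sum, Finset.sum_mul]
    refine Finset.sum_congr rfl fun p _ => ?_
    rw [map_mul, mul_assoc, mul_assoc, (hc _ _).eq]
  | add c d hc hd => simp only [map_add, mul_add, add_mul, Finset.sum_add_distrib, hc, hd]

/-- ∂ᴿ produces `hitR` on the first leg of Δ(h). This equals `hitL` on the second leg, which the
matrix z lets pass. -/
theorem derR_mul_indMap (i : ι) (h : H) :
    (∑ q, l (nicholsDerR R b q) * r (g (zMat R (𝛒) i q))) * Φ (Coalgebra.comul h) =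
    ∑ p, Φ (LinearMap.lTensor H (hitL (𝛒 i p)) (Coalgebra.comul h)) *
      ∑ q, l (nicholsDerR R b q) * r (g (zMat R (𝛒) p q)) := by
  have h1 : ∀ t : H ⊗[k] H, (∑ q, l (nicholsDerR R b q) * r (g (zMat R (𝛒) i q))) * Φ t =
      ∑ q, ∑ p, r (g (zMat R (𝛒) i q)) * Φ (LinearMap.rTensor H (hitR (𝛒 q p)) t) *
        l (nicholsDerR R b p) := by
    intro t
    induction t using TensorProduct.induction_on with
    | zero => simp
    | tmul c d =>
      rw [Finset.sum_mul]
      refine Finset.sum_congr rfl fun q _ => ?_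
      simp only [LinearMap.rTensor_tmul, indMap_tmul]
      rw [(hc _ _).eq, mul_assoc, ← mul_assoc (l _), ← map_mul, nicholsDerR_mul_nicholsAct b hR,
        map_sum, Finset.sum_mul, Finset.mul_sum]
      refine Finset.sum_congr rfl fun p _ => ?_
      rw [map_mul, mul_assoc, mul_assoc, mul_assoc, (hc _ _).eq]
    | add c d hc hd => simp only [map_add, mul_add, add_mul, Finset.sum_add_distrib, hc, hd]
  have h2 : ∀ t : H ⊗[k] H, ∀ p,
      ∑ q, r (g (zMat R (𝛒) i q)) * Φ (LinearMap.lTensor H (hitL (𝛒 q p)) t) =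
      ∑ q, Φ (LinearMap.lTensor H (hitL (𝛒 i q)) t) * r (g (zMat R (𝛒) q p)) := by
    intro t p
    induction t using TensorProduct.induction_on with
    | zero => simp
    | tmul c d =>
      simp only [LinearMap.lTensor_tmul, indMap_tmul, ← mul_assoc, ← (hc _ _).eq]
      simp only [mul_assoc, ← map_mul]
      rw [← Finset.mul_sum, ← Finset.mul_sum, ← map_sum, ← map_sum, ← map_sum, ← map_sum,
        sum_hitL_mul_zMat hR (isMatrixRep_matCoeff b)]
    | add c d hc hd => simp only [map_add, mul_add, add_mul, Finset.sum_add_distrib, hc, hd]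
  rw [h1, Finset.sum_comm]
  simp only [← lTensor_hitL_comul, ← Finset.sum_mul, h2]
  simp only [Finset.mul_sum, Finset.sum_mul]
  rw [Finset.sum_comm]
  simp only [mul_assoc, (hc _ _).eq]

/-- Each of the three summands of `indY` satisfies the relation by itself; h2 deals with the factor
m common to the first and the third. -/
theorem indY_mul_indMap (hy : ∀ h i, g h * y i = ∑ p, y p * g (hitL (𝛒 i p ∘ₗ 𝒮) h))
    (i : ι) (h : H) : indY (R := R) b l r g y i * Φ (Coalgebra.comul h) =
      ∑ p, Φ (Coalgebra.comul (hitL (𝛒 i p) h)) * indY b l r g y p := by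
  rw [mul_y_iff] at hy
  have h1 : ∀ (t : H ⊗[k] H) (p : ι), r (y p) * Φ t =
      ∑ q, Φ (LinearMap.lTensor H (hitL (𝛒 p q)) t) * r (y q) := by
    intro t p
    induction t using TensorProduct.induction_on with
    | zero => simp
    | tmul c d =>
      simp only [LinearMap.lTensor_tmul, indMap_tmul]
      rw [(hc _ _).eq, ← mul_assoc, ← map_mul, hy, map_sum, Finset.sum_mul]
      simp only [map_mul, mul_assoc, (hc _ _).eq]
    | add c d hc hd => simp only [map_add, mul_add, add_mul, Finset.sum_add_distrib, hc, hd]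
  have h2 : ∀ F : ι → E, ∑ p, l (aB (mMat R (𝛒) i p)) *
      ∑ q, Φ (LinearMap.lTensor H (hitL (𝛒 p q)) (Coalgebra.comul h)) * F q =
      ∑ q, Φ (Coalgebra.comul (hitL (𝛒 i q) h)) * ∑ p, l (aB (mMat R (𝛒) q p)) * F p := by
    intro F
    simp only [Finset.mul_sum, ← mul_assoc]
    rw [Finset.sum_comm]
    simp only [← Finset.sum_mul, mMat_mul_indMap l r hc g hR]
    simp only [Finset.sum_mul]
    rw [Finset.sum_comm]
  simp only [indY, sub_mul, add_mul, Finset.sum_mul _ _ (Φ _), mul_assoc (l _) _ (Φ _), h1,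
    mul_sub, mul_add, Finset.sum_add_distrib, Finset.sum_sub_distrib,
    derL_mul_indMap l r hc g hR, h2]
  have h3 := fun p => derR_mul_indMap (b := b) l r hc g hR p h
  simp only [Finset.sum_mul, mul_assoc] at h3
  simp only [h3, h2]

/-- Moving m past xⱼ gives the braided terms Σ ρₚⱼ(mᵢ_q) xₚ for the summands that contain m. The
Leibniz rule for ∂ᴸ gives the same together with δᵢⱼ. The rule for ∂ᴿ leaves the extra terms mᵢₚl_qⱼ
⊗ zₚ_q, whose sum is Δ(zᵢⱼ) by `comul_zMat`, that is, the diagonal action of zᵢⱼ. -/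
theorem indY_mul_nicholsX (i j : ι) :
    indY (R := R) b l r g y i * l (nicholsX R b j) = ∑ p, ∑ q, 𝛒 p j (mMat R (𝛒) i q) •
      (l (nicholsX R b p) * indY b l r g y q) + (if i = j then 1 else 0) -
      Φ (Coalgebra.comul (zMat R (𝛒) i j)) := by
  have h1 : ∀ (F : ι → E), ∑ s, l (aB (mMat R (𝛒) i s)) * (l (nicholsX R b j) * F s) =
      ∑ p, ∑ q, 𝛒 p j (mMat R (𝛒) i q) •
        (l (nicholsX R b p) * ∑ s, l (aB (mMat R (𝛒) q s)) * F s) := by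
    intro F
    simp only [← mul_assoc, ← map_mul, nicholsAct_mMat_mul_nicholsX b hR, map_sum, map_smul,
      Finset.sum_mul, Finset.mul_sum, Finset.smul_sum, smul_mul_assoc]
    rw [Finset.sum_comm]
    refine Finset.sum_congr rfl fun p _ => ?_
    rw [Finset.sum_comm]
  have e1 : (∑ p, l (aB (mMat R (𝛒) i p)) * r (y p)) * l (nicholsX R b j) =
      ∑ p, ∑ q, 𝛒 p j (mMat R (𝛒) i q) •
      (l (nicholsX R b p) * ∑ s, l (aB (mMat R (𝛒) q s)) * r (y s)) := by
    rw [← h1, Finset.sum_mul]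
    refine Finset.sum_congr rfl fun p _ => ?_
    rw [mul_assoc, ← (hc _ _).eq]
  have e2 : l (nicholsDerL R b i) * l (nicholsX R b j) = ∑ p, ∑ q, 𝛒 p j (mMat R (𝛒) i q) •
      (l (nicholsX R b p) * l (nicholsDerL R b q)) + (if i = j then 1 else 0) := by
    rw [← map_mul, nicholsDerL_mul_nicholsX b hR, map_add, add_comm]
    congr 1
    · simp only [map_sum, map_smul, map_mul]
    · split_ifs <;> simp
  have e4 : ∀ p, (∑ q, l (nicholsDerR R b q) * r (g (zMat R (𝛒) p q))) * l (nicholsX R b j) =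
      l (nicholsX R b j) * ∑ q, l (nicholsDerR R b q) * r (g (zMat R (𝛒) p q)) +
      ∑ q, l (aB (lMat R (𝛒) q j)) * r (g (zMat R (𝛒) p q)) := by
    intro p
    rw [Finset.sum_mul, Finset.mul_sum, ← Finset.sum_add_distrib]
    refine Finset.sum_congr rfl fun q _ => ?_
    rw [mul_assoc, ← (hc _ _).eq, ← mul_assoc, ← map_mul, nicholsDerR_mul_nicholsX b hR, map_add,
      add_mul, map_mul, mul_assoc]
  have e3 : (∑ p, l (aB (mMat R (𝛒) i p)) *
      ∑ q, l (nicholsDerR R b q) * r (g (zMat R (𝛒) p q))) * l (nicholsX R b j) =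
      ∑ p, ∑ q, 𝛒 p j (mMat R (𝛒) i q) • (l (nicholsX R b p) * ∑ s, l (aB (mMat R (𝛒) q s)) *
        ∑ q, l (nicholsDerR R b q) * r (g (zMat R (𝛒) s q))) +
      Φ (Coalgebra.comul (zMat R (𝛒) i j)) := by
    rw [← h1, Finset.sum_mul]
    simp only [mul_assoc (l (aB _)), e4, mul_add, Finset.sum_add_distrib]
    congr 1
    rw [comul_zMat hR (isMatrixRep_matCoeff b)]
    simp only [map_sum, indMap_tmul, map_mul, Finset.mul_sum, mul_assoc]
  rw [indY, sub_mul, add_mul, e1, e2, e3]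
  simp only [indY, mul_sub, mul_add, smul_sub, smul_add, Finset.sum_sub_distrib,
    Finset.sum_add_distrib]
  abel

end Induced

/-! ### Graded vector spaces -/

section GradedSpaces

variable {k X : Type*} [Field k] [AddCommGroup X] [Module k X] {D : ℤ → Submodule k X}

theorem isInternal_of_proj (p : ℤ → X →ₗ[k] X) (h1 : ∀ n, ∀ x ∈ D n, p n x = x)
    (h2 : ∀ n m, m ≠ n → ∀ x ∈ D m, p n x = 0) (h3 : ⨆ n, D n = ⊤) : DirectSum.IsInternal D := by
  refine (DirectSum.isInternal_submodule_iff_iSupIndep_and_iSup_eq_top _).2 ⟨fun n => ?_, h3⟩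
  rw [Submodule.disjoint_def]
  intro x hx hx'
  have : ⨆ j, ⨆ (_ : j ≠ n), D j ≤ LinearMap.ker (p n) :=
    iSup₂_le fun m hm x hx => h2 n m hm x hx
  rw [← h1 n x hx]
  exact this hx'

variable (k X) in
theorem isInternal_single (d : ℤ) :
    DirectSum.IsInternal fun n => if n = d then (⊤ : Submodule k X) else ⊥ :=
  isInternal_of_proj (fun n => if n = d then LinearMap.id else 0)
    (fun n x hx => by
      split_ifs with h
      · rfl
      · rw [if_neg h] at hx; simpa using hx.symm)
    (fun n m hmn x hx => by
      split_ifs with h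
      · rw [if_neg (h ▸ hmn)] at hx; simpa using hx
      · rfl)
    (eq_top_iff.2 (le_trans (by simp) (le_iSup _ d)))

/-- The projection to the component of degree `n` of a graded space. -/
def gradedProj (hD : DirectSum.IsInternal D) (n : ℤ) : X →ₗ[k] X :=
  (D n).subtype ∘ₗ DirectSum.component k ℤ (fun i => D i) n ∘ₗ
    (LinearEquiv.ofBijective (DirectSum.coeLinearMap D) hD).symm.toLinearMap

variable (hD : DirectSum.IsInternal D)

theorem gradedProj_mem (n : ℤ) (x : X) : gradedProj hD n x ∈ D n := Subtype.mem _

theorem gradedProj_of_mem {m : ℤ} {x : X} (hx : x ∈ D m) (n : ℤ) :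
    gradedProj hD n x = if m = n then x else 0 := by
  have : (LinearEquiv.ofBijective (DirectSum.coeLinearMap D) hD).symm x =
      DirectSum.lof k ℤ (fun i => D i) m ⟨x, hx⟩ := by
    rw [LinearEquiv.symm_apply_eq]
    exact (DirectSum.coeLinearMap_lof D m ⟨x, hx⟩).symm
  simp only [gradedProj, LinearMap.comp_apply, LinearEquiv.coe_coe, this]
  rw [DirectSum.component.of]
  split_ifs with h
  · subst h; rfl
  · rfl

theorem gradedProj_gradedProj (m n : ℤ) (x : X) :
    gradedProj hD n (gradedProj hD m x) = if m = n then gradedProj hD m x else 0 :=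
  gradedProj_of_mem hD (gradedProj_mem hD m x) n

theorem exists_sum_gradedProj [Module.Finite k X] :
    ∃ s : Finset ℤ, (∀ n ∉ s, D n = ⊥) ∧ ∀ x, ∑ n ∈ s, gradedProj hD n x = x := by
  have hfin : {n | D n ≠ ⊥}.Finite := WellFoundedGT.finite_ne_bot_of_iSupIndep
    ((DirectSum.isInternal_submodule_iff_iSupIndep_and_iSup_eq_top _).1 hD).1
  have hs : ∀ n ∉ hfin.toFinset, D n = ⊥ := fun n hn => by simpa using hn
  refine ⟨hfin.toFinset, hs, fun x => ?_⟩
  have hx : x ∈ ⨆ n, D n := by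
    rw [((DirectSum.isInternal_submodule_iff_iSupIndep_and_iSup_eq_top _).1 hD).2]
    trivial
  induction hx using Submodule.iSup_induction' with
  | zero => simp
  | add x y _ _ hx hy => rw [← hx, ← hy]; simp only [map_add, Finset.sum_add_distrib, hx, hy]
  | mem n x hx =>
    simp only [gradedProj_of_mem hD hx]
    rw [Finset.sum_ite_eq]
    split_ifs with h
    · rfl
    · rw [hs n h] at hx
      exact ((Submodule.mem_bot k).1 hx).symm

theorem graded_induction [Module.Finite k X] (hD : DirectSum.IsInternal D) {P : X → Prop}
    (add : ∀ x y, P x → P y → P (x + y)) (hom : ∀ n, ∀ x ∈ D n, P x) (x : X) : P x := by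
  obtain ⟨s, -, hs⟩ := exists_sum_gradedProj hD
  rw [← hs x]
  exact Finset.sum_induction _ P add (hom 0 0 (Submodule.zero_mem _)) fun n _ =>
    hom n _ (gradedProj_mem hD n x)

variable {Y : Type*} [AddCommGroup Y] [Module k Y] {D' : ℤ → Submodule k Y}
  (hD' : DirectSum.IsInternal D')

theorem map_gradedProj [Module.Finite k X] (f : X →ₗ[k] Y) (d : ℤ)
    (hf : ∀ n, ∀ x ∈ D n, f x ∈ D' (d + n)) (n : ℤ) (x : X) :
    f (gradedProj hD n x) = gradedProj hD' (d + n) (f x) := by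
  induction x using graded_induction hD with
  | add x y hx hy => simp only [map_add, hx, hy]
  | hom m x hx =>
    rw [gradedProj_of_mem hD hx, gradedProj_of_mem hD' (hf m x hx)]
    simp only [add_right_inj]
    split_ifs <;> simp

end GradedSpaces

/-! ### The category of graded modules -/

namespace GrMod

variable {k : Type u} [Field k] {A : Type u} [Ring A] [Algebra k A] {𝒜 : ℤ → Submodule k A}
  {M N L : GrMod k 𝒜}

/-- The projection to the component of degree `n`. -/
abbrev gproj (M : GrMod k 𝒜) (n : ℤ) : M →ₗ[k] M := gradedProj M.internal n

@[ext] theorem hom_ext {f g : M ⟶ N} (h : ∀ x, Hom.lin f x = Hom.lin g x) : f = g :=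
  Subtype.ext (LinearMap.ext h)

/-- The morphism given by a linear map of degree zero. -/
def homMk (f : M →ₗ[A] N) (hf : ∀ n, ∀ m ∈ M.deg n, f m ∈ N.deg n) : M ⟶ N := ⟨f, hf⟩

@[simp] theorem lin_comp (f : M ⟶ N) (g : N ⟶ L) (x : M) :
    Hom.lin (f ≫ g) x = Hom.lin g (Hom.lin f x) := rfl
@[simp] theorem lin_zero (x : M) : Hom.lin (0 : M ⟶ N) x = 0 := rfl
theorem lin_mem (f : M ⟶ N) {n : ℤ} {x : M} (hx : x ∈ M.deg n) : Hom.lin f x ∈ N.deg n :=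
  f.2 n x hx

theorem lin_gproj (f : M ⟶ N) (n : ℤ) (x : M) :
    Hom.lin f (M.gproj n x) = N.gproj n (Hom.lin f x) := by
  simpa using map_gradedProj M.internal N.internal ((Hom.lin f).restrictScalars k) 0
    (fun n x hx => by simpa using lin_mem f hx) n x

theorem smul_gproj {i : ℤ} {a : A} (ha : a ∈ 𝒜 i) (n : ℤ) (x : M) :
    a • M.gproj n x = M.gproj (i + n) (a • x) :=
  map_gradedProj M.internal M.internal (Algebra.lsmul k k M.carrier a) i
    (fun n x hx => M.smul_mem i n a x ha hx) n x

/-- A graded submodule. -/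
def sub (M : GrMod k 𝒜) (N : Submodule A M) (hN : ∀ x ∈ N, ∀ n, M.gproj n x ∈ N) :
    GrMod k 𝒜 where
  carrier := N
  finite := inferInstanceAs (Module.Finite k (N.restrictScalars k))
  deg n := (M.deg n).comap (N.subtype.restrictScalars k)
  internal := by
    obtain ⟨s, -, hs⟩ := exists_sum_gradedProj M.internal
    refine isInternal_of_proj (fun n => (M.gproj n).restrict
      (p := N.restrictScalars k) (q := N.restrictScalars k) fun x hx => hN x hx n) ?_ ?_ ?_
    · intro n x hx
      exact Subtype.ext ((gradedProj_of_mem M.internal hx n).trans (if_pos rfl))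
    · intro n m hmn x hx
      exact Subtype.ext ((gradedProj_of_mem M.internal hx n).trans (if_neg hmn))
    · refine eq_top_iff.2 fun x _ => ?_
      have : x = ∑ n ∈ s, (⟨M.gproj n x, hN x x.2 n⟩ : N) :=
        Subtype.ext ((hs x).symm.trans (by simp))
      rw [this]
      exact Submodule.sum_mem _ fun n _ => Submodule.mem_iSup_of_mem n
        (gradedProj_mem M.internal n x.1)
  smul_mem i j a m ha hm := M.smul_mem i j a m ha hm

/-- The inclusion of a graded submodule. -/
def subι (M : GrMod k 𝒜) (N : Submodule A M) (hN : ∀ x ∈ N, ∀ n, M.gproj n x ∈ N) :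
    M.sub N hN ⟶ M := homMk N.subtype fun _ _ hm => hm

/-- The quotient by a graded submodule. -/
def quot (M : GrMod k 𝒜) (N : Submodule A M) (hN : ∀ x ∈ N, ∀ n, M.gproj n x ∈ N) :
    GrMod k 𝒜 where
  carrier := M ⧸ N
  finite := Module.Finite.of_surjective (N.mkQ.restrictScalars k) N.mkQ_surjective
  deg n := (M.deg n).map (N.mkQ.restrictScalars k)
  internal := by
    obtain ⟨s, -, hs⟩ := exists_sum_gradedProj M.internal
    refine isInternal_of_proj (fun n => (N.restrictScalars k).mapQ (N.restrictScalars k)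
      (M.gproj n) fun x hx => hN x hx n) ?_ ?_ ?_
    · rintro n _ ⟨x, hx, rfl⟩
      exact congrArg N.mkQ ((gradedProj_of_mem M.internal hx n).trans (if_pos rfl))
    · rintro n m hmn _ ⟨x, hx, rfl⟩
      exact congrArg N.mkQ ((gradedProj_of_mem M.internal hx n).trans (if_neg hmn))
    · refine eq_top_iff.2 fun x _ => ?_
      obtain ⟨x, rfl⟩ := N.mkQ_surjective x
      rw [← hs x, map_sum]
      exact Submodule.sum_mem _ fun n _ => Submodule.mem_iSup_of_mem n
        ⟨_, gradedProj_mem M.internal n x, rfl⟩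
  smul_mem i j a m ha hm := by
    obtain ⟨x, hx, rfl⟩ := hm
    exact ⟨a • x, M.smul_mem i j a x ha hx, rfl⟩

/-- The projection to the quotient by a graded submodule. -/
def quotπ (M : GrMod k 𝒜) (N : Submodule A M) (hN : ∀ x ∈ N, ∀ n, M.gproj n x ∈ N) :
    M ⟶ M.quot N hN := homMk N.mkQ fun _ m hm => ⟨m, hm, rfl⟩

theorem gproj_mem_ker (f : M ⟶ N) : ∀ x ∈ LinearMap.ker (Hom.lin f), ∀ n,
    M.gproj n x ∈ LinearMap.ker (Hom.lin f) := by
  intro x hx n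
  rw [LinearMap.mem_ker, lin_gproj, LinearMap.mem_ker.1 hx, map_zero]

theorem gproj_mem_range (f : M ⟶ N) : ∀ x ∈ LinearMap.range (Hom.lin f), ∀ n,
    N.gproj n x ∈ LinearMap.range (Hom.lin f) := by
  rintro _ ⟨x, rfl⟩ n
  exact ⟨M.gproj n x, lin_gproj f n x⟩

theorem mem_deg_of_lin_mem {f : M ⟶ N} (hf : Function.Injective (Hom.lin f)) {n : ℤ} {x : M}
    (hx : Hom.lin f x ∈ N.deg n) : x ∈ M.deg n := by
  have : M.gproj n x = x := hf (by rw [lin_gproj, gradedProj_of_mem N.internal hx, if_pos rfl])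
  rw [← this]
  exact gradedProj_mem M.internal n x

theorem exists_mem_deg_of_surjective {f : M ⟶ N} (hf : Function.Surjective (Hom.lin f)) {n : ℤ}
    {y : N} (hy : y ∈ N.deg n) : ∃ x ∈ M.deg n, Hom.lin f x = y := by
  obtain ⟨x, rfl⟩ := hf y
  refine ⟨M.gproj n x, gradedProj_mem M.internal n x, ?_⟩
  rw [lin_gproj, gradedProj_of_mem N.internal hy, if_pos rfl]

theorem exists_lift {f : M ⟶ N} (hf : Function.Injective (Hom.lin f)) (g : L ⟶ N)
    (h : ∀ x, Hom.lin g x ∈ LinearMap.range (Hom.lin f)) : ∃ l : L ⟶ M, l ≫ f = g := by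
  let e := LinearEquiv.ofInjective (Hom.lin f) hf
  have he : ∀ x, Hom.lin f (e.symm ⟨Hom.lin g x, h x⟩) = Hom.lin g x := fun x =>
    congrArg Subtype.val (e.apply_symm_apply ⟨Hom.lin g x, h x⟩)
  refine ⟨homMk (e.symm.toLinearMap ∘ₗ (Hom.lin g).codRestrict _ h) fun n m hm => ?_,
    hom_ext fun x => he x⟩
  refine mem_deg_of_lin_mem hf ?_
  have := he m
  exact this.symm ▸ lin_mem g hm

theorem exists_desc {f : M ⟶ N} (hf : Function.Surjective (Hom.lin f)) (g : M ⟶ L)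
    (h : LinearMap.ker (Hom.lin f) ≤ LinearMap.ker (Hom.lin g)) : ∃ l : N ⟶ L, f ≫ l = g := by
  let e := (Hom.lin f).quotKerEquivOfSurjective hf
  have he : ∀ x, (LinearMap.ker (Hom.lin f)).liftQ (Hom.lin g) h (e.symm (Hom.lin f x)) =
      Hom.lin g x := by
    intro x
    have : e.symm (Hom.lin f x) = (LinearMap.ker (Hom.lin f)).mkQ x := by
      rw [LinearEquiv.symm_apply_eq]; rfl
    rw [this]; simp
  refine ⟨homMk ((LinearMap.ker (Hom.lin f)).liftQ (Hom.lin g) h ∘ₗ e.symm.toLinearMap)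
    fun n m hm => ?_, hom_ext fun x => he x⟩
  obtain ⟨x, hx, rfl⟩ := exists_mem_deg_of_surjective hf hm
  have := he x
  exact this.symm ▸ lin_mem g hx

/-- The kernel of a graded map is a graded submodule, so its inclusion is a morphism against which
the map can be tested. -/
theorem mono_iff_injective (f : M ⟶ N) : Mono f ↔ Function.Injective (Hom.lin f) := by
  constructor
  · intro hf
    have : M.subι _ (gproj_mem_ker f) ≫ f = 0 ≫ f := hom_ext fun x => by
      rw [lin_comp, lin_comp, lin_zero, map_zero]
      exact x.2
    rw [cancel_mono] at this
    rw [← LinearMap.ker_eq_bot, eq_bot_iff]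
    intro x hx
    have hx' := congrArg (fun g => Hom.lin g (⟨x, hx⟩ : LinearMap.ker (Hom.lin f))) this
    exact hx'
  · exact fun hf => ⟨fun g h e => hom_ext fun x => hf (congrArg (fun g => Hom.lin g x) e)⟩

theorem epi_iff_surjective (f : M ⟶ N) : Epi f ↔ Function.Surjective (Hom.lin f) := by
  constructor
  · intro hf
    have : f ≫ N.quotπ _ (gproj_mem_range f) = f ≫ 0 :=
      hom_ext fun x => (Submodule.Quotient.mk_eq_zero _).2 ⟨x, rfl⟩
    rw [cancel_epi] at this
    intro y
    exact (Submodule.Quotient.mk_eq_zero _).1 (congrArg (fun g => Hom.lin g y) this)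
  · refine fun hf => ⟨fun g h e => hom_ext fun x => ?_⟩
    obtain ⟨y, rfl⟩ := hf x
    exact congrArg (fun g => Hom.lin g y) e

/-- The isomorphism given by a bijective morphism. -/
def isoOfBijective (f : M ⟶ N) (hf : Function.Bijective (Hom.lin f)) : M ≅ N where
  hom := f
  inv := homMk (LinearEquiv.ofBijective (Hom.lin f) hf).symm.toLinearMap fun n m hm =>
    mem_deg_of_lin_mem (f := f) hf.1 (by
      have := (LinearEquiv.ofBijective (Hom.lin f) hf).apply_symm_apply m
      exact this.symm ▸ hm)
  hom_inv_id := hom_ext fun x => (LinearEquiv.ofBijective (Hom.lin f) hf).symm_apply_apply x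
  inv_hom_id := hom_ext fun x => (LinearEquiv.ofBijective (Hom.lin f) hf).apply_symm_apply x

theorem comp_eq_zero_iff (f : M ⟶ N) (g : N ⟶ L) :
    f ≫ g = 0 ↔ LinearMap.range (Hom.lin f) ≤ LinearMap.ker (Hom.lin g) := by
  constructor
  · rintro h _ ⟨x, rfl⟩
    exact congrArg (fun g => Hom.lin g x) h
  · exact fun h => hom_ext fun x => h ⟨x, rfl⟩

/-- An injective morphism onto the kernel of a morphism is a kernel. -/
def isKernel (f : M ⟶ N) (g : N ⟶ L) (w : f ≫ g = 0) (hf : Function.Injective (Hom.lin f))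
    (h : LinearMap.ker (Hom.lin g) ≤ LinearMap.range (Hom.lin f)) :
    Limits.IsLimit (Limits.KernelFork.ofι f w) :=
  have hg {W : GrMod k 𝒜} (g' : W ⟶ N) (eq : g' ≫ g = 0) : ∃ l : W ⟶ M, l ≫ f = g' :=
    exists_lift hf g' fun x => h ((comp_eq_zero_iff g' g).1 eq ⟨x, rfl⟩)
  Limits.KernelFork.IsLimit.ofι f w (fun g' eq => (hg g' eq).choose)
    (fun g' eq => (hg g' eq).choose_spec) (fun g' eq m hm => by
      have := (mono_iff_injective f).2 hf
      rw [← cancel_mono f, hm, (hg g' eq).choose_spec])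

/-- A surjective morphism that kills exactly the image of a morphism is a cokernel. -/
def isCokernel (f : M ⟶ N) (g : N ⟶ L) (w : f ≫ g = 0) (hg : Function.Surjective (Hom.lin g))
    (h : LinearMap.ker (Hom.lin g) ≤ LinearMap.range (Hom.lin f)) :
    Limits.IsColimit (Limits.CokernelCofork.ofπ g w) :=
  have hf {W : GrMod k 𝒜} (g' : N ⟶ W) (eq : f ≫ g' = 0) : ∃ l : L ⟶ W, g ≫ l = g' :=
    exists_desc hg g' (h.trans ((comp_eq_zero_iff f g').1 eq))
  Limits.CokernelCofork.IsColimit.ofπ g w (fun g' eq => (hf g' eq).choose)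
    (fun g' eq => (hf g' eq).choose_spec) (fun g' eq m hm => by
      have := (epi_iff_surjective g).2 hg
      rw [← cancel_epi g, hm, (hf g' eq).choose_spec])

instance : Limits.HasKernels (GrMod k 𝒜) where
  has_limit {M N} f := ⟨⟨⟨_, isKernel (M.subι _ (gproj_mem_ker f)) f (hom_ext fun x => x.2)
    (Subtype.val_injective) fun x hx => ⟨⟨x, hx⟩, rfl⟩⟩⟩⟩

instance : Limits.HasCokernels (GrMod k 𝒜) where
  has_colimit {M N} f := ⟨⟨⟨_, isCokernel f (N.quotπ _ (gproj_mem_range f))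
    (hom_ext fun x => (Submodule.Quotient.mk_eq_zero _).2 ⟨x, rfl⟩) (Submodule.mkQ_surjective _)
    fun x hx => (Submodule.Quotient.mk_eq_zero _).1 hx⟩⟩⟩

instance : IsNormalMonoCategory (GrMod k 𝒜) where
  normalMonoOfMono {M N} f hf := ⟨{
    Z := _
    g := N.quotπ _ (gproj_mem_range f)
    w := hom_ext fun x => (Submodule.Quotient.mk_eq_zero _).2 ⟨x, rfl⟩
    isLimit := isKernel f _ _ ((mono_iff_injective f).1 hf) fun _ hx =>
      (Submodule.Quotient.mk_eq_zero _).1 hx }⟩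

instance : IsNormalEpiCategory (GrMod k 𝒜) where
  normalEpiOfEpi {M N} f hf := ⟨{
    W := _
    g := M.subι _ (gproj_mem_ker f)
    w := hom_ext fun x => x.2
    isColimit := isCokernel _ f _ ((epi_iff_surjective f).1 hf) fun x hx => ⟨⟨x, hx⟩, rfl⟩ }⟩

variable (k 𝒜) in
/-- The zero module. -/
def zeroObj : GrMod k 𝒜 where
  carrier := PUnit
  deg _ := ⊥
  internal := isInternal_of_proj (fun _ => 0) (fun _ _ _ => rfl) (fun _ _ _ _ _ => rfl)
    (Subsingleton.elim _ _)
  smul_mem _ _ _ _ _ _ := rfl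

/-- The direct sum. -/
def prod (M N : GrMod k 𝒜) : GrMod k 𝒜 where
  carrier := M × N
  deg n := (M.deg n).prod (N.deg n)
  internal := by
    obtain ⟨s, -, hs⟩ := exists_sum_gradedProj M.internal
    obtain ⟨t, -, ht⟩ := exists_sum_gradedProj N.internal
    refine isInternal_of_proj (fun n => (M.gproj n).prodMap (N.gproj n)) ?_ ?_ ?_
    · intro n x hx
      exact Prod.ext ((gradedProj_of_mem M.internal hx.1 n).trans (if_pos rfl))
        ((gradedProj_of_mem N.internal hx.2 n).trans (if_pos rfl))
    · intro n m hmn x hx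
      exact Prod.ext ((gradedProj_of_mem M.internal hx.1 n).trans (if_neg hmn))
        ((gradedProj_of_mem N.internal hx.2 n).trans (if_neg hmn))
    · refine eq_top_iff.2 fun x _ => ?_
      have : x = ∑ n ∈ s, (M.gproj n x.1, 0) + ∑ n ∈ t, (0, N.gproj n x.2) := by
        refine Prod.ext ?_ ?_ <;> simp [Prod.fst_sum, Prod.snd_sum, hs, ht]
      rw [this]
      refine Submodule.add_mem _ (Submodule.sum_mem _ fun n _ => Submodule.mem_iSup_of_mem n
        ⟨gradedProj_mem M.internal n x.1, Submodule.zero_mem _⟩)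
        (Submodule.sum_mem _ fun n _ => Submodule.mem_iSup_of_mem n
        ⟨Submodule.zero_mem _, gradedProj_mem N.internal n x.2⟩)
  smul_mem i j a m ha hm := ⟨M.smul_mem i j a m.1 ha hm.1, N.smul_mem i j a m.2 ha hm.2⟩

theorem isZero_of_subsingleton (M : GrMod k 𝒜) [Subsingleton M] : Limits.IsZero M where
  unique_to N := ⟨⟨⟨0⟩, fun f => hom_ext fun x => by
    rw [Subsingleton.elim x 0, map_zero, map_zero]⟩⟩
  unique_from N := ⟨⟨⟨0⟩, fun f => hom_ext fun x => Subsingleton.elim _ _⟩⟩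

instance : Limits.HasFiniteProducts (GrMod k 𝒜) := by
  have : Limits.HasTerminal (GrMod k 𝒜) :=
    have : Subsingleton (zeroObj k 𝒜) := inferInstanceAs (Subsingleton PUnit)
    (isZero_of_subsingleton (zeroObj k 𝒜)).isTerminal.hasTerminal
  have (M N : GrMod k 𝒜) : Limits.HasLimit (Limits.pair M N) :=
    ⟨⟨⟨Limits.BinaryFan.mk
      (homMk (N := M) (M := M.prod N) (LinearMap.fst A M N) fun n m hm => hm.1)
      (homMk (N := N) (M := M.prod N) (LinearMap.snd A M N) fun n m hm => hm.2),
      Limits.BinaryFan.IsLimit.mk _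
        (fun f g => homMk (N := M.prod N) ((Hom.lin f).prod (Hom.lin g)) fun n m hm =>
          ⟨lin_mem f hm, lin_mem g hm⟩)
        (fun f g => rfl) (fun f g => rfl) (fun f g m hf hg => hom_ext fun x => Prod.ext
          (congrArg (fun g => Hom.lin g x) hf) (congrArg (fun g => Hom.lin g x) hg))⟩⟩⟩
  have := Limits.hasBinaryProducts_of_hasLimit_pair (GrMod k 𝒜)
  exact hasFiniteProducts_of_has_binary_and_terminal

instance : Abelian (GrMod k 𝒜) where

theorem shortExact_mk (f : M ⟶ N) (g : N ⟶ L) (w : f ≫ g = 0)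
    (hf : Function.Injective (Hom.lin f)) (hg : Function.Surjective (Hom.lin g))
    (h : LinearMap.ker (Hom.lin g) ≤ LinearMap.range (Hom.lin f)) :
    (ShortComplex.mk f g w).ShortExact where
  exact := ShortComplex.exact_of_f_is_kernel _ (isKernel f g w hf h)
  mono_f := (mono_iff_injective f).2 hf
  epi_g := (epi_iff_surjective g).2 hg

/-- Subobjects embed into the lattice of submodules, so the chain conditions follow from finite
dimension over k. -/
theorem strictMono_range_arrow (M : GrMod k 𝒜) :
    StrictMono fun Y : Subobject M => LinearMap.range (Hom.lin Y.arrow) := by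
  refine Monotone.strictMono_of_injective ?_ ?_
  · rintro Y Z h _ ⟨x, rfl⟩
    refine ⟨Hom.lin (Y.ofLE Z h) x, ?_⟩
    rw [← lin_comp, Subobject.ofLE_arrow]
  · have key : ∀ Y Z : Subobject M, LinearMap.range (Hom.lin Y.arrow) =
        LinearMap.range (Hom.lin Z.arrow) → Y ≤ Z := by
      intro Y Z h
      obtain ⟨l, hl⟩ := exists_lift ((mono_iff_injective _).1 inferInstance) Y.arrow
        (f := Z.arrow) fun x => h ▸ ⟨x, rfl⟩
      exact Subobject.le_of_comm l hl
    exact fun Y Z h => le_antisymm (key Y Z h) (key Z Y h.symm)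

theorem isArtinianObject (M : GrMod k 𝒜) : IsArtinianObject M where
  prop := by
    have : IsArtinian A M := isArtinian_of_tower k inferInstance
    exact M.strictMono_range_arrow.wellFoundedLT

theorem isNoetherianObject (M : GrMod k 𝒜) : IsNoetherianObject M where
  prop := by
    have : IsNoetherian A M := isNoetherian_of_tower k inferInstance
    exact M.strictMono_range_arrow.wellFoundedGT

theorem finite_hom (M N : GrMod k 𝒜) : Module.Finite k (M ⟶ N) :=
  Module.Finite.of_injective
    ({ toFun := fun f => (Hom.lin f).restrictScalars k
       map_add' := fun _ _ => rfl
       map_smul' := fun _ _ => rfl } : (M ⟶ N) →ₗ[k] (M →ₗ[k] N))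
    fun _ _ h => hom_ext fun x => LinearMap.congr_fun h x

end GrMod

/-! ### The 𝔲-module structure on 𝔅(V) ⊗ N. -/

section InducedModule

variable {k : Type u} {H : Type u} [Field k] [Ring H] [HopfAlgebra k H] {R : H ⊗[k] H}
  {V : Type u} [AddCommGroup V] [Module k V] [Module H V] [IsScalarTower k H V]
  {ι : Type} [Fintype ι] [DecidableEq ι] {b : Module.Basis ι k V}

local notation "ε" => Coalgebra.counit (R := k) (A := H)
local notation "𝒮" => HopfAlgebra.antipode k (A := H)
local notation "𝛒" => matCoeff (H := H) b
local notation "𝐓" => TensorAlgebra k V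
local notation "𝐓'" => TensorAlgebra k (Module.Dual k V)
local notation "𝐁" => NicholsV k R V
local notation "πB" => nicholsMk (repV k V) (coactV k R V)
local notation "aB" => nicholsAct (repV k V) (coactV k R V)

variable {N : Type u} [AddCommGroup N] [Module k N]

variable (R b) in
/-- Operators that satisfy the relations of the subalgebra of `u_(H,R)(V)` generated by `H`
and `V̄`. -/
structure IsPosRep {E : Type*} [Ring E] [Algebra k E] (g : H →ₐ[k] E) (y : ι → E) : Prop where
  mul_y : ∀ h i, g h * y i = ∑ p, y p * g (hitL (𝛒 i p ∘ₗ 𝒮) h)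
  right : ∀ t ∈ nicholsIdeal (repVbar k V) (coactVbar k R V),
    TensorAlgebra.lift k (b.dualBasis.constr k y) t = 0

theorem IsPosRep.isSmashPair {E : Type u} [Ring E] [Algebra k E] {g : H →ₐ[k] E} {y : ι → E}
    (hy : ∀ h i, g h * y i = ∑ p, y p * g (hitL (𝛒 i p ∘ₗ 𝒮) h)) :
    IsSmashPair (tensorAct (repVbar k V)) g
      (TensorAlgebra.lift k (b.dualBasis.constr k y)) := by
  refine isSmashPair_of_matrix (repVbar k V) b.dualBasis (fun p i => 𝛒 i p ∘ₗ 𝒮)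
    (fun h j => repVbar_basis b h j) g _ fun h i => ?_
  simpa only [TensorAlgebra.lift_ι_apply, Module.Basis.constr_basis] using hy h i

variable (g : H →ₐ[k] Module.End k N) (y : ι → Module.End k N)

variable (R V N) in
/-- The space `B(V) ⊗ N`. -/
def IndSpace : Type u := NicholsV k R V ⊗[k] N

instance : AddCommGroup (IndSpace R V N) := inferInstanceAs (AddCommGroup (NicholsV k R V ⊗[k] N))
instance : Module k (IndSpace R V N) := inferInstanceAs (Module k (NicholsV k R V ⊗[k] N))
instance [Module.Finite k (NicholsV k R V)] [Module.Finite k N] :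
    Module.Finite k (IndSpace R V N) := inferInstanceAs (Module.Finite k (NicholsV k R V ⊗[k] N))

variable (R V N) in
/-- The pure tensors in `B(V) ⊗ N`. -/
def tm : NicholsV k R V →ₗ[k] N →ₗ[k] IndSpace R V N := TensorProduct.mk k (NicholsV k R V) N

theorem indSpace_hom_ext {Y : Type*} [AddCommGroup Y] [Module k Y] {F G : IndSpace R V N →ₗ[k] Y}
    (h : ∀ x n, F (tm R V N x n) = G (tm R V N x n)) : F = G :=
  TensorProduct.ext' h

variable (R V N) in
/-- Operators on `B(V)` act on `B(V) ⊗ N`. -/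
def opB : Module.End k (NicholsV k R V) →ₐ[k] Module.End k (IndSpace R V N) :=
  AlgHom.ofLinearMap
    { toFun := fun F => (LinearMap.rTensor N F : NicholsV k R V ⊗[k] N →ₗ[k] NicholsV k R V ⊗[k] N)
      map_add' := fun F G => LinearMap.rTensor_add N F G
      map_smul' := fun c F => LinearMap.rTensor_smul N c F }
    (LinearMap.rTensor_id N _) (fun F G => LinearMap.rTensor_comp N F G)

variable (R V N) in
/-- Operators on `N` act on `B(V) ⊗ N`. -/
def opN : Module.End k N →ₐ[k] Module.End k (IndSpace R V N) :=
  AlgHom.ofLinearMap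
    { toFun := fun F => (LinearMap.lTensor (NicholsV k R V) F :
        NicholsV k R V ⊗[k] N →ₗ[k] NicholsV k R V ⊗[k] N)
      map_add' := fun F G => LinearMap.lTensor_add _ F G
      map_smul' := fun c F => LinearMap.lTensor_smul _ c F }
    (LinearMap.lTensor_id _ N) (fun F G => LinearMap.lTensor_comp _ F G)

@[simp] theorem opB_tm (F : Module.End k 𝐁) (x : 𝐁) (n : N) :
    opB R V N F (tm R V N x n) = tm R V N (F x) n := rfl

@[simp] theorem opN_tm (F : Module.End k N) (x : 𝐁) (n : N) :
    opN R V N F (tm R V N x n) = tm R V N x (F n) := rfl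

theorem opB_comm (F : Module.End k 𝐁) (G : Module.End k N) :
    Commute (opB R V N F) (opN R V N G) :=
  indSpace_hom_ext fun _ _ => rfl

variable (R V) in
/-- The action of `H` on `B(V) ⊗ N`. -/
def indG : H →ₐ[k] Module.End k (IndSpace R V N) :=
  (indMap (opB R V N) (opN R V N) opB_comm g).comp (Bialgebra.comulAlgHom k H)

variable (b N) in
/-- The action of `V` on `B(V) ⊗ N`. -/
def indX (j : ι) : Module.End k (IndSpace R V N) := opB R V N (nicholsX R b j)

variable (R b) in
/-- The action of `V̄` on `B(V) ⊗ N`. -/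
def indV (i : ι) : Module.End k (IndSpace R V N) :=
  indY b (opB R V N) (opN R V N) g y i

omit [DecidableEq ι] in
-- 𝔅(V) ⊗ N is generated by 1 ⊗ N under V.
theorem ind_induction {P : IndSpace R V N → Prop} (b : Module.Basis ι k V)
    (add : ∀ x z, P x → P z → P (x + z)) (smul : ∀ (c : k) x, P x → P (c • x))
    (one : ∀ n : N, P (tm R V N 1 n)) (mul : ∀ j x, P x → P (indX b N j x))
    (x : IndSpace R V N) : P x := by
  have h1 : ∀ x n, P (tm R V N x n) := by
    intro x n
    obtain ⟨t, rfl⟩ := nicholsMk_surjective _ _ x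
    induction t using tensorAlgebra_induction b with
    | one => rw [map_one]; exact one n
    | add s t hs ht => rw [map_add, map_add]; exact add _ _ hs ht
    | smul c t ht => rw [map_smul, map_smul]; exact smul _ _ ht
    | mul i t ht =>
      have := mul i _ ht
      rwa [indX, opB_tm, nicholsX_mk] at this
  change NicholsV k R V ⊗[k] N at x
  induction x using TensorProduct.induction_on with
  | zero =>
    have h0 := one 0
    rw [map_zero] at h0
    exact h0
  | add x z hx hz => exact add x z hx hz
  | tmul x n => exact h1 x n

variable (hR : IsQuasitriangular R)

theorem indG_one_tmul (h : H) (n : N) : indG R V g h (tm R V N 1 n) = tm R V N 1 (g h n) := by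
  rw [indG, AlgHom.comp_apply, Bialgebra.comulAlgHom_apply]
  conv_rhs => rw [← hitL_counit (k := k) h, hitL, LinearMap.comp_apply]
  induction Coalgebra.comul (R := k) h using TensorProduct.induction_on with
  | zero => simp
  | tmul c d =>
    have : aB c (1 : 𝐁) = algebraMap k _ (ε c) := by
      rw [← map_one πB, nicholsAct_mk, tensorAct_one, map_smul, map_one,
        Algebra.algebraMap_eq_smul_one]
    rw [indMap_tmul, Module.End.mul_apply, opN_tm, opB_tm, this, Algebra.algebraMap_eq_smul_one]
    simp [sliceL]
  | add c d hc hd => simp only [map_add, LinearMap.add_apply, hc, hd]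

include hR

/-- On 1 ⊗ N the derivations vanish and m acts through the counit as the identity matrix, so the
action of V̄ on N is recovered. -/
theorem indV_one_tmul (i : ι) (n : N) : indV R b g y i (tm R V N 1 n) = tm R V N 1 (y i n) := by
  have h1 : ∀ c, aB c (1 : 𝐁) = algebraMap k _ (ε c) := by
    intro c
    rw [← map_one πB, nicholsAct_mk, tensorAct_one, map_smul, map_one,
      Algebra.algebraMap_eq_smul_one]
  have h2 : ∀ i, nicholsDerL R b i (1 : 𝐁) = 0 := by
    intro i
    rw [← map_one πB, nicholsDerL_mk, derL_one, map_zero]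
  have h3 : ∀ i, nicholsDerR R b i (1 : 𝐁) = 0 := by
    intro i
    rw [← map_one πB, nicholsDerR_mk, derR_one, map_zero]
  simp only [indV, indY, LinearMap.sub_apply, LinearMap.add_apply, LinearMap.sum_apply,
    Module.End.mul_apply, opN_tm, opB_tm, h1, h2, h3, LinearMap.zero_apply,
    counit_mMat hR (isMatrixRep_matCoeff b), map_zero, Finset.sum_const_zero, add_zero, sub_zero]
  have h4 : ∀ p, tm R V N (algebraMap k 𝐁 (if i = p then 1 else 0)) (y p n) =
      if i = p then tm R V N 1 (y p n) else 0 := by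
    intro p
    split_ifs <;> simp
  simp only [h4, Finset.sum_ite_eq, Finset.mem_univ, if_true]

omit hR [DecidableEq ι] in
theorem indG_mul_indX (h : H) (j : ι) : indG R V g h * indX b N j =
    ∑ i, indX b N i * indG R V g (hitL (𝛒 i j) h) := by
  simp only [indG, AlgHom.comp_apply, Bialgebra.comulAlgHom_apply, indX, comul_hitL]
  exact indMap_mul_nicholsX _ _ _ _ _ _

theorem indV_mul_indX (i j : ι) : indV R b g y i * indX b N j =
    ∑ p, ∑ q, 𝛒 p j (mMat R (𝛒) i q) • (indX b N p * indV R b g y q) +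
      (if i = j then 1 else 0) - indG R V g (zMat R (𝛒) i j) :=
  indY_mul_nicholsX _ _ opB_comm _ _ hR i j

variable {g y}

theorem IsPosRep.indG_mul_indV (hN : IsPosRep R b g y) (h : H) (i : ι) :
    indG R V g h * indV R b g y i =
      ∑ p, indV R b g y p * indG R V g (hitL (𝛒 i p ∘ₗ 𝒮) h) := by
  revert h i
  rw [mul_y_iff]
  exact fun h i => indY_mul_indMap _ _ opB_comm _ _ hR hN.mul_y i h

theorem IsPosRep.isCrossRep (hN : IsPosRep R b g y) : IsCrossRep b R (indG R V g) (indX b N)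
    (TensorAlgebra.lift k (b.dualBasis.constr k (indV R b g y))) where
  smash := IsPosRep.isSmashPair (hN.indG_mul_indV hR)
  cross i j := by
    simp only [TensorAlgebra.lift_ι_apply, Module.Basis.constr_basis]
    exact indV_mul_indX g y hR i j

/-- On 1 ⊗ N this is the hypothesis on N. By `IsCrossRep.mul_x`, moving T(t) past xⱼ leads only to
images of elements of 𝒥(V̄), since this ideal is stable under H and under both kinds of skew
derivations; so the vanishing spreads along `ind_induction`. -/
theorem IsPosRep.right_ind (hN : IsPosRep R b g y) {t : 𝐓'}
    (ht : t ∈ nicholsIdeal (repVbar k V) (coactVbar k R V)) :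
    TensorAlgebra.lift k (b.dualBasis.constr k (indV R b g y)) t = 0 := by
  set T := TensorAlgebra.lift k (b.dualBasis.constr k (indV R b g y)) with hT
  have hι : ∀ i, T (TensorAlgebra.ι k (b.dualBasis i)) = indV R b g y i := fun i => by
    rw [hT, TensorAlgebra.lift_ι_apply, Module.Basis.constr_basis]
  have h1 : ∀ (t : 𝐓') (n : N), T t (tm R V N 1 n) =
      tm R V N 1 (TensorAlgebra.lift k (b.dualBasis.constr k y) t n) := by
    intro t
    induction t using tensorAlgebra_induction b.dualBasis with
    | one => simp
    | add s t hs ht => intro n; simp only [map_add, LinearMap.add_apply, hs, ht]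
    | smul c t ht => intro n; simp only [map_smul, LinearMap.smul_apply, ht]
    | mul i t ht =>
      intro n
      rw [map_mul, Module.End.mul_apply, ht, hι, indV_one_tmul g y hR, map_mul,
        Module.End.mul_apply, TensorAlgebra.lift_ι_apply, Module.Basis.constr_basis]
  -- An arbitrary h is inserted because moving past xⱼ leaves an entry of z in front of the
  -- remaining vector.
  have h2 : ∀ (x : IndSpace R V N) (t : 𝐓'), t ∈ nicholsIdeal (repVbar k V) (coactVbar k R V) →
      ∀ h, T t (indG R V g h x) = 0 := by
    intro x
    induction x using ind_induction b with
    | add x z hx hz => intro t ht h; rw [map_add, map_add, hx t ht, hz t ht, add_zero]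
    | smul c x hx => intro t ht h; rw [map_smul, map_smul, hx t ht, smul_zero]
    | one n => intro t ht h; rw [indG_one_tmul, h1, hN.right t ht, LinearMap.zero_apply,
        map_zero]
    | mul j x hx =>
      intro t ht h
      have hact : ∀ h, tensorAct (repVbar k V) h t ∈ nicholsIdeal (repVbar k V) (coactVbar k R V) :=
        fun h => map_mem_nicholsIdeal _ _ _ (fun I hI t ht => hI.act_mem h t ht) ht
      have hR' : ∀ p, derRbar R b p t ∈ nicholsIdeal (repVbar k V) (coactVbar k R V) :=
        fun p => map_mem_nicholsIdeal _ _ _ (fun I hI t ht => hI.rightDer_mem _ ht) ht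
      have hL : ∀ p, derLbar R b p t ∈ nicholsIdeal (repVbar k V) (coactVbar k R V) :=
        fun p => map_mem_nicholsIdeal _ _ _ (fun I hI t ht => hI.leftDer_mem _ ht) ht
      have hL' : ∀ j, ∑ p, tensorAct (repVbar k V) (nMat R (𝛒) p j) (derLbar R b p t) ∈
          nicholsIdeal (repVbar k V) (coactVbar k R V) := fun j =>
        sum_mem fun p _ => map_mem_nicholsIdeal _ _ _ (fun I hI t ht => hI.act_mem _ t ht) (hL p)
      have key : ∀ i h, T t (indX b N i (indG R V g h x)) = 0 := by
        intro i h
        rw [← Module.End.mul_apply, (hN.isCrossRep hR).mul_x hR]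
        simp only [LinearMap.sub_apply, LinearMap.add_apply, LinearMap.sum_apply,
          Module.End.mul_apply]
        have e1 : ∀ p, T (derRbar R b p t) (indG R V g (zMat R (𝛒) p i) (indG R V g h x)) = 0 := by
          intro p
          rw [← Module.End.mul_apply (indG R V g _), ← map_mul, hx _ (hR' p)]
        simp only [← hT, e1, hx _ (hL' i), hx _ (hact _), map_zero, Finset.sum_const_zero, add_zero,
          sub_zero]
      rw [← Module.End.mul_apply (indG R V g h), indG_mul_indX, LinearMap.sum_apply, map_sum]
      exact Finset.sum_eq_zero fun i _ => key i _
  ext x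
  simpa using h2 x t ht 1

theorem IsPosRep.isURep (hN : IsPosRep R b g y) :
    IsURep R b (indG R V g) (indX b N) (indV R b g y) where
  mul_x := indG_mul_indX g
  mul_y := hN.indG_mul_indV hR
  cross := indV_mul_indX g y hR
  left t ht := by
    have : ∀ t : 𝐓, TensorAlgebra.lift k (b.constr k (indX b N)) t =
        opB R V N (LinearMap.mulLeft k (πB t)) := by
      intro t
      induction t using tensorAlgebra_induction b with
      | one => exact indSpace_hom_ext fun x n => by simp
      | add s t hs ht => exact indSpace_hom_ext fun x n => by simp [hs, ht, add_mul]
      | smul c t ht => exact indSpace_hom_ext fun x n => by simp [ht]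
      | mul i t ht =>
        exact indSpace_hom_ext fun x n => by simp [ht, indX, nicholsX]
    rw [this, (nicholsMk_eq_zero _ _).2 ht]
    exact indSpace_hom_ext fun x n => by simp
  right t ht := hN.right_ind hR ht

end InducedModule

/-! ### The grading of induced modules. -/

section GradedInduced

variable {k : Type u} {H : Type u} [Field k] [Ring H] [HopfAlgebra k H] {R : H ⊗[k] H}
  {V : Type u} [AddCommGroup V] [Module k V] [Module H V] [IsScalarTower k H V]
  {ι : Type} [Fintype ι] [DecidableEq ι] {b : Module.Basis ι k V}

local notation "ε" => Coalgebra.counit (R := k) (A := H)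
local notation "𝒮" => HopfAlgebra.antipode k (A := H)
local notation "𝛒" => matCoeff (H := H) b
local notation "𝐓" => TensorAlgebra k V
local notation "𝐓'" => TensorAlgebra k (Module.Dual k V)
local notation "𝐁" => NicholsV k R V
local notation "πB" => nicholsMk (repV k V) (coactV k R V)
local notation "aB" => nicholsAct (repV k V) (coactV k R V)
local notation "gr" => LinearMap.range (TensorAlgebra.ι k (M := V))

omit [Fintype ι] [DecidableEq ι] in
theorem derL_of_mem_pow_zero (i : ι) {s : 𝐓} (hs : s ∈ gr ^ 0) : derL R b i s = 0 := by
  rw [pow_zero] at hs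
  obtain ⟨r, rfl⟩ := Submodule.mem_one.1 hs
  rw [Algebra.algebraMap_eq_smul_one, map_smul, derL_one, smul_zero]

theorem derL_mem_pow (hR : IsQuasitriangular R) (i : ι) {n : ℕ} {s : 𝐓} (hs : s ∈ gr ^ (n + 1)) :
    derL R b i s ∈ gr ^ n := by
  induction n generalizing s i with
  | zero =>
    rw [zero_add, pow_one] at hs
    obtain ⟨w, rfl⟩ := hs
    rw [← b.sum_repr w]
    simp only [map_sum, map_smul]
    refine Submodule.sum_mem _ fun j _ => Submodule.smul_mem _ _ ?_
    rw [← mul_one (TensorAlgebra.ι k (b j)), derL_mul b hR]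
    simp only [derL_one, mul_zero, smul_zero, Finset.sum_const_zero, add_zero]
    split_ifs
    · exact Submodule.one_le.1 (pow_zero (gr)).ge
    · exact Submodule.zero_mem _
  | succ n ih =>
    rw [pow_succ'] at hs
    induction hs using Submodule.mul_induction_on' with
    | mem_mul_mem m hm s hs =>
      obtain ⟨w, rfl⟩ := hm
      rw [← b.sum_repr w]
      simp only [map_sum, map_smul, Finset.sum_mul, smul_mul_assoc, derL_mul b hR]
      refine Submodule.sum_mem _ fun j _ => Submodule.smul_mem _ _ (Submodule.add_mem _ ?_ ?_)
      · split_ifs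
        exacts [hs, Submodule.zero_mem _]
      · refine Submodule.sum_mem _ fun p _ => Submodule.sum_mem _ fun q _ =>
          Submodule.smul_mem _ _ ?_
        rw [pow_succ']
        exact Submodule.mul_mem_mul ⟨_, rfl⟩ (ih q hs)
    | add x _ y _ hx hy => rw [map_add]; exact Submodule.add_mem _ hx hy

variable (k R V) in
/-- The component of degree `n` of `B(V)`. -/
def nicholsDeg (n : ℕ) : Submodule k (NicholsV k R V) :=
  (LinearMap.range (TensorAlgebra.ι k (M := V)) ^ n).map (πB).toLinearMap

theorem one_mem_nicholsDeg : (1 : 𝐁) ∈ nicholsDeg k R V 0 :=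
  ⟨1, Submodule.one_le.1 (pow_zero (gr)).ge, map_one πB⟩

theorem nicholsX_mem (j : ι) {n : ℕ} {x : 𝐁} (hx : x ∈ nicholsDeg k R V n) :
    nicholsX R b j x ∈ nicholsDeg k R V (n + 1) := by
  obtain ⟨t, ht, rfl⟩ := hx
  exact ⟨_, by rw [pow_succ']; exact Submodule.mul_mem_mul ⟨b j, rfl⟩ ht, (nicholsX_mk b j t).symm⟩

theorem nicholsAct_mem (b : Module.Basis ι k V) (h : H) {n : ℕ} {x : 𝐁}
    (hx : x ∈ nicholsDeg k R V n) : aB h x ∈ nicholsDeg k R V n := by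
  obtain ⟨t, ht, rfl⟩ := hx
  exact ⟨_, tensorAct_mem_pow b h ht, (nicholsAct_mk _ _ h t).symm⟩

theorem nicholsDerL_mem (hR : IsQuasitriangular R) (i : ι) {n : ℕ} {x : 𝐁}
    (hx : x ∈ nicholsDeg k R V (n + 1)) : nicholsDerL R b i x ∈ nicholsDeg k R V n := by
  obtain ⟨t, ht, rfl⟩ := hx
  exact ⟨_, derL_mem_pow hR i ht, (nicholsDerL_mk b i t).symm⟩

theorem nicholsDerR_mem (hR : IsQuasitriangular R) (i : ι) {n : ℕ} {x : 𝐁}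
    (hx : x ∈ nicholsDeg k R V (n + 1)) : nicholsDerR R b i x ∈ nicholsDeg k R V n := by
  obtain ⟨t, ht, rfl⟩ := hx
  exact ⟨_, derR_mem_pow b hR i ht, (nicholsDerR_mk b i t).symm⟩

theorem nicholsDerL_of_mem_zero (i : ι) {x : 𝐁} (hx : x ∈ nicholsDeg k R V 0) :
    nicholsDerL R b i x = 0 := by
  obtain ⟨t, ht, rfl⟩ := hx
  exact (nicholsDerL_mk b i t).trans (by rw [derL_of_mem_pow_zero i ht, map_zero])

theorem nicholsDerR_of_mem_zero (i : ι) {x : 𝐁} (hx : x ∈ nicholsDeg k R V 0) :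
    nicholsDerR R b i x = 0 := by
  obtain ⟨t, ht, rfl⟩ := hx
  exact (nicholsDerR_mk b i t).trans (by rw [derR_of_mem_pow_zero b i ht, map_zero])

variable (R b) in
/-- A finite-dimensional graded module over the subalgebra of `u_(H,R)(V)` generated by `H`
and `V̄`. -/
structure PosMod where
  /-- the underlying space -/
  carrier : Type u
  [addCommGroup : AddCommGroup carrier]
  [module : Module k carrier]
  [finite : Module.Finite k carrier]
  /-- the action of `H` -/
  g : H →ₐ[k] Module.End k carrier
  /-- the action of `V̄` -/
  y : ι → Module.End k carrier
  isPosRep : IsPosRep R b g y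
  /-- the component of degree `n` -/
  deg : ℤ → Submodule k carrier
  internal : DirectSum.IsInternal deg
  g_mem : ∀ h n, ∀ x ∈ deg n, g h x ∈ deg n
  y_mem : ∀ i n, ∀ x ∈ deg n, y i x ∈ deg (1 + n)

attribute [instance] PosMod.addCommGroup PosMod.module PosMod.finite

variable (N : PosMod R b)

/-- The component of degree `n` of `B(V) ⊗ N`. -/
def indDeg (n : ℤ) : Submodule k (IndSpace R V N.carrier) :=
  Submodule.span k {z | ∃ (j : ℕ) (i : ℤ) (x : NicholsV k R V) (m : N.carrier),
    x ∈ nicholsDeg k R V j ∧ m ∈ N.deg i ∧ i - j = n ∧ tm R V N.carrier x m = z}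

variable {N} in
theorem tm_mem_indDeg {j : ℕ} {i n : ℤ} {x : 𝐁} {m : N.carrier} (hx : x ∈ nicholsDeg k R V j)
    (hm : m ∈ N.deg i) (hn : i - j = n) : tm R V N.carrier x m ∈ indDeg N n :=
  Submodule.subset_span ⟨j, i, x, m, hx, hm, hn, rfl⟩

variable {N} in
theorem map_mem_indDeg {F : Module.End k (IndSpace R V N.carrier)} {d : ℤ}
    (hF : ∀ (j : ℕ) (i : ℤ) (x : 𝐁) (m : N.carrier), x ∈ nicholsDeg k R V j → m ∈ N.deg i →
      F (tm R V N.carrier x m) ∈ indDeg N (d + (i - j))) (n : ℤ) :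
    ∀ z ∈ indDeg N n, F z ∈ indDeg N (d + n) := by
  intro z hz
  have : indDeg N n ≤ (indDeg N (d + n)).comap F := by
    refine Submodule.span_le.2 ?_
    rintro _ ⟨j, i, x, m, hx, hm, rfl, rfl⟩
    exact hF j i x m hx hm
  exact this hz

theorem indX_mem (j : ι) (n : ℤ) :
    ∀ z ∈ indDeg N n, indX b N.carrier j z ∈ indDeg N (-1 + n) :=
  map_mem_indDeg (fun _ _ _ _ hx hm => tm_mem_indDeg (nicholsX_mem j hx) hm (by push_cast; ring)) n

theorem indG_mem (h : H) (n : ℤ) :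
    ∀ z ∈ indDeg N n, indG R V N.g h z ∈ indDeg N (0 + n) := by
  refine map_mem_indDeg (fun j i x m hx hm => ?_) n
  rw [indG, AlgHom.comp_apply, Bialgebra.comulAlgHom_apply]
  induction Coalgebra.comul (R := k) h using TensorProduct.induction_on with
  | zero => simp
  | tmul c d =>
    exact tm_mem_indDeg (nicholsAct_mem b c hx) (N.g_mem d i m hm) (by ring)
  | add c d hc hd => rw [map_add]; exact Submodule.add_mem _ hc hd

theorem indV_mem (hR : IsQuasitriangular R) (i : ι) (n : ℤ) :
    ∀ z ∈ indDeg N n, indV R b N.g N.y i z ∈ indDeg N (1 + n) := by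
  refine map_mem_indDeg (fun j l x m hx hm => ?_) n
  simp only [indV, indY, LinearMap.sub_apply, LinearMap.add_apply, LinearMap.sum_apply,
    Module.End.mul_apply, opN_tm, opB_tm, map_sum]
  refine Submodule.sub_mem _ (Submodule.add_mem _ (Submodule.sum_mem _ fun p _ =>
    tm_mem_indDeg (nicholsAct_mem b _ hx) (N.y_mem p l m hm) (by ring)) ?_)
    (Submodule.sum_mem _ fun p _ => Submodule.sum_mem _ fun q _ => ?_)
  · cases j with
    | zero => rw [nicholsDerL_of_mem_zero i hx, map_zero]; exact Submodule.zero_mem _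
    | succ j => exact tm_mem_indDeg (nicholsDerL_mem hR i hx) hm (by push_cast; ring)
  · cases j with
    | zero =>
      rw [nicholsDerR_of_mem_zero q hx, map_zero, map_zero]; exact Submodule.zero_mem _
    | succ j =>
      exact tm_mem_indDeg (nicholsAct_mem b _ (nicholsDerR_mem hR q hx)) (N.g_mem _ l m hm)
        (by push_cast; ring)

theorem isInternal_indDeg [Module.Finite k (NicholsV k R V)] :
    DirectSum.IsInternal (indDeg N) := by
  obtain ⟨B, hB⟩ := exists_nicholsProj_eq_zero (repV k V) (coactV k R V)
  -- V has degree −1, so the projection to degree n combines degree l of 𝔅(V) with degree n + l of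
  -- N. The sum over l is finite since 𝔅(V) vanishes from degree `B` on.
  have key : ∀ (n : ℤ) (j : ℕ) (i : ℤ) (x : 𝐁) (m : N.carrier), x ∈ nicholsDeg k R V j →
      m ∈ N.deg i → (∑ l ∈ Finset.range B, opB R V N.carrier (nicholsProj _ _ l) *
        opN R V N.carrier (gradedProj N.internal (n + l))) (tm R V N.carrier x m) =
        if i - j = n then tm R V N.carrier x m else 0 := by
    rintro n j i _ m ⟨t, ht, rfl⟩ hm
    simp only [LinearMap.sum_apply, Module.End.mul_apply, opN_tm, opB_tm, AlgHom.toLinearMap_apply,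
      gradedProj_of_mem N.internal hm, nicholsProj_mk_of_mem _ _ ht]
    by_cases hj : j < B
    · rw [Finset.sum_eq_single_of_mem j (Finset.mem_range.2 hj)]
      · have : i = n + j ↔ i - j = n := by omega
        simp only [this, if_true]
        split_ifs <;> simp
      · intro l _ hl
        rw [if_neg hl, map_zero, LinearMap.zero_apply]
    · have h0 : πB t = 0 := by
        have h1 := nicholsProj_mk_of_mem (repV k V) (coactV k R V) ht j
        rwa [if_pos rfl, hB j (not_lt.1 hj), LinearMap.zero_apply, eq_comm] at h1
      simp [h0]
  have key' : ∀ n m : ℤ, ∀ z ∈ indDeg N m, (∑ l ∈ Finset.range B,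
      opB R V N.carrier (nicholsProj _ _ l) *
        opN R V N.carrier (gradedProj N.internal (n + l))) z = if m = n then z else 0 := by
    intro n m z hz
    induction hz using Submodule.span_induction with
    | zero => simp
    | add x y _ _ hx hy => rw [map_add, hx, hy]; split_ifs <;> simp
    | smul c x _ hx => rw [map_smul, hx]; split_ifs <;> simp
    | mem z hz =>
      obtain ⟨j, i, x, w, hx, hw, rfl, rfl⟩ := hz
      exact key n j i x w hx hw
  refine isInternal_of_proj (fun n => ∑ l ∈ Finset.range B, opB R V N.carrier (nicholsProj _ _ l) *
    opN R V N.carrier (gradedProj N.internal (n + l)))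
    (fun n z hz => (key' n n z hz).trans (if_pos rfl))
    (fun n m hmn z hz => (key' n m z hz).trans (if_neg hmn)) ?_
  refine eq_top_iff.2 fun z _ => ?_
  have h1 : ∀ m : N.carrier, tm R V N.carrier 1 m ∈ ⨆ n, indDeg N n := by
    intro m
    induction m using graded_induction N.internal with
    | add x y hx hy => rw [map_add]; exact Submodule.add_mem _ hx hy
    | hom n x hx =>
      exact Submodule.mem_iSup_of_mem n (tm_mem_indDeg one_mem_nicholsDeg hx (by simp))
  induction z using ind_induction b with
  | add x z hx hz => exact Submodule.add_mem _ (hx trivial) (hz trivial)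
  | smul c x hx => exact Submodule.smul_mem _ c (hx trivial)
  | one m => exact h1 m
  | mul j x hx =>
    have : ⨆ n, indDeg N n ≤ (⨆ n, indDeg N n).comap (indX b N.carrier j) :=
      iSup_le fun n z hz => Submodule.mem_iSup_of_mem (-1 + n) (indX_mem N j n z hz)
    exact this (hx trivial)

theorem smallU_smul_mem {X : Type*} [AddCommGroup X] [Module k X] [Module (SmallU k R V) X]
    [IsScalarTower k (SmallU k R V) X] (b : Module.Basis ι k V) (P : Submodule k X)
    (hH : ∀ h, ∀ x ∈ P, ofH k R V h • x ∈ P) (hV : ∀ j, ∀ x ∈ P, ofV k R V (b j) • x ∈ P)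
    (hVbar : ∀ i, ∀ x ∈ P, ofVbar k R V (b.dualBasis i) • x ∈ P) (a : SmallU k R V) :
    ∀ x ∈ P, a • x ∈ P := by
  let S : Subalgebra k (SmallU k R V) :=
    { carrier := {a | ∀ x ∈ P, a • x ∈ P}
      mul_mem' := fun {a c} ha hc x hx => by rw [mul_smul]; exact ha _ (hc x hx)
      add_mem' := fun {a c} ha hc x hx => by rw [add_smul]; exact P.add_mem (ha x hx) (hc x hx)
      algebraMap_mem' := fun c x hx => by rw [algebraMap_smul]; exact P.smul_mem c hx }
  refine smallU_induction (S := S) hH (fun v x hx => ?_) (fun v x hx => ?_) a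
  · rw [← b.sum_repr v, map_sum, Finset.sum_smul]
    refine P.sum_mem fun j _ => ?_
    rw [map_smul, smul_assoc]
    exact P.smul_mem _ (hV j x hx)
  · rw [← b.dualBasis.sum_repr v, map_sum, Finset.sum_smul]
    refine P.sum_mem fun j _ => ?_
    rw [map_smul, smul_assoc]
    exact P.smul_mem _ (hVbar j x hx)

theorem smallU_map_smul {X Y : Type*} [AddCommGroup X] [Module k X] [Module (SmallU k R V) X]
    [IsScalarTower k (SmallU k R V) X] [AddCommGroup Y] [Module k Y] [Module (SmallU k R V) Y]
    [IsScalarTower k (SmallU k R V) Y] (b : Module.Basis ι k V) (F : X →ₗ[k] Y)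
    (hH : ∀ h x, F (ofH k R V h • x) = ofH k R V h • F x)
    (hV : ∀ j x, F (ofV k R V (b j) • x) = ofV k R V (b j) • F x)
    (hVbar : ∀ i x, F (ofVbar k R V (b.dualBasis i) • x) = ofVbar k R V (b.dualBasis i) • F x)
    (a : SmallU k R V) (x : X) : F (a • x) = a • F x := by
  -- A linear map commutes with the action exactly if its graph is stable, so stability under the
  -- generators is enough.
  have := smallU_smul_mem (X := X × Y) b (LinearMap.graph F)
    (fun h x hx => by simp_all [LinearMap.mem_graph_iff])
    (fun h x hx => by simp_all [LinearMap.mem_graph_iff])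
    (fun h x hx => by simp_all [LinearMap.mem_graph_iff]) a (x, F x)
    rfl
  exact Eq.symm this

theorem smallGrading_smul_mem {X : Type*} [AddCommGroup X] [Module k X] [Module (SmallU k R V) X]
    [IsScalarTower k (SmallU k R V) X] (b : Module.Basis ι k V) (D : ℤ → Submodule k X)
    (hH : ∀ h n, ∀ x ∈ D n, ofH k R V h • x ∈ D (0 + n))
    (hV : ∀ j n, ∀ x ∈ D n, ofV k R V (b j) • x ∈ D (-1 + n))
    (hVbar : ∀ i n, ∀ x ∈ D n, ofVbar k R V (b.dualBasis i) • x ∈ D (1 + n)) (i j : ℤ)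
    (a : SmallU k R V) (x : X) (ha : a ∈ smallGrading k R V i) (hx : x ∈ D j) :
    a • x ∈ D (i + j) := by
  have hgen : ∀ (c : Gen k V H) n, ∀ x ∈ D n, Gen.val k R V c • x ∈ D (Gen.deg k V c + n) := by
    rintro (v | h | v) n x hx
    · change ofV k R V v • x ∈ D (-1 + n)
      rw [← b.sum_repr v, map_sum, Finset.sum_smul]
      refine Submodule.sum_mem _ fun j _ => ?_
      rw [map_smul, smul_assoc]
      exact Submodule.smul_mem _ _ (hV j n x hx)
    · exact hH h n x hx
    · change ofVbar k R V v • x ∈ D (1 + n)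
      rw [← b.dualBasis.sum_repr v, map_sum, Finset.sum_smul]
      refine Submodule.sum_mem _ fun j _ => ?_
      rw [map_smul, smul_assoc]
      exact Submodule.smul_mem _ _ (hVbar j n x hx)
  induction ha using Submodule.span_induction with
  | zero => rw [zero_smul]; exact Submodule.zero_mem _
  | add a c _ _ ha hc => rw [add_smul]; exact Submodule.add_mem _ ha hc
  | smul c a _ ha => rw [smul_assoc]; exact Submodule.smul_mem _ _ ha
  | mem a ha =>
    obtain ⟨l, rfl, rfl⟩ := ha
    induction l with
    | nil => simpa using hx
    | cons c l ih =>
      rw [List.map_cons, List.map_cons, List.prod_cons, List.sum_cons, mul_smul, add_assoc]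
      exact hgen c _ _ ih

/-- The graded module induced by a graded module over the subalgebra generated by `H` and `V̄`. -/
def PosMod.ind (hR : IsQuasitriangular R) [Module.Finite k (NicholsV k R V)] (N : PosMod R b) :
    SmallGrMod k R V :=
  letI : Module (SmallU k R V) (IndSpace R V N.carrier) :=
    Module.compHom _ ((N.isPosRep.isURep hR).lift hR).toRingHom
  { carrier := IndSpace R V N.carrier
    tower := ⟨fun c a x => LinearMap.congr_fun
      (map_smul ((N.isPosRep.isURep hR).lift hR) c a) x⟩
    deg := indDeg N
    internal := isInternal_indDeg N
    smul_mem := by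
      have : IsScalarTower k (SmallU k R V) (IndSpace R V N.carrier) :=
        ⟨fun c a x => LinearMap.congr_fun (map_smul ((N.isPosRep.isURep hR).lift hR) c a) x⟩
      refine smallGrading_smul_mem b (indDeg N) (fun h n x hx => ?_) (fun j n x hx => ?_)
        (fun i n x hx => ?_)
      · change (N.isPosRep.isURep hR).lift hR (ofH k R V h) x ∈ _
        rw [IsURep.lift_ofH]
        exact indG_mem N h n x hx
      · change (N.isPosRep.isURep hR).lift hR (ofV k R V (b j)) x ∈ _
        rw [IsURep.lift_ofV]
        exact indX_mem N j n x hx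
      · change (N.isPosRep.isURep hR).lift hR (ofVbar k R V (b.dualBasis i)) x ∈ _
        rw [IsURep.lift_ofVbar]
        exact indV_mem N hR i n x hx }

end GradedInduced

/-! ### The universal property of induced modules. -/

section InducedUniversal

variable {k : Type u} {H : Type u} [Field k] [Ring H] [HopfAlgebra k H] {R : H ⊗[k] H}
  {V : Type u} [AddCommGroup V] [Module k V] [Module H V] [IsScalarTower k H V]
  {ι : Type} [Fintype ι] [DecidableEq ι] {b : Module.Basis ι k V}

local notation "ε" => Coalgebra.counit (R := k) (A := H)
local notation "𝒮" => HopfAlgebra.antipode k (A := H)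
local notation "𝛒" => matCoeff (H := H) b
local notation "𝐓" => TensorAlgebra k V
local notation "𝐓'" => TensorAlgebra k (Module.Dual k V)
local notation "𝐁" => NicholsV k R V
local notation "πB" => nicholsMk (repV k V) (coactV k R V)
local notation "aB" => nicholsAct (repV k V) (coactV k R V)
local notation "gr" => LinearMap.range (TensorAlgebra.ι k (M := V))

theorem mul_mem_smallGrading {i j : ℤ} {a c : SmallU k R V} (ha : a ∈ smallGrading k R V i)
    (hc : c ∈ smallGrading k R V j) : a * c ∈ smallGrading k R V (i + j) := by
  have h : smallGrading k R V i * smallGrading k R V j ≤ smallGrading k R V (i + j) := by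
    rw [smallGrading, smallGrading, Submodule.span_mul_span]
    refine Submodule.span_mono ?_
    rintro _ ⟨_, ⟨l, rfl, rfl⟩, _, ⟨l', rfl, rfl⟩, rfl⟩
    exact ⟨l ++ l', by simp, by simp⟩
  exact h (Submodule.mul_mem_mul ha hc)

theorem ofV_mem_smallGrading (v : V) : ofV k R V v ∈ smallGrading k R V (-1) :=
  Submodule.subset_span ⟨[Gen.v v], by simp [Gen.deg], by simp [Gen.val]⟩

theorem ofH_mem_smallGrading (h : H) : ofH k R V h ∈ smallGrading k R V 0 :=
  Submodule.subset_span ⟨[Gen.h h], by simp [Gen.deg], by simp [Gen.val]⟩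

theorem ofVbar_mem_smallGrading (v : Module.Dual k V) : ofVbar k R V v ∈ smallGrading k R V 1 :=
  Submodule.subset_span ⟨[Gen.vbar v], by simp [Gen.deg], by simp [Gen.val]⟩

theorem smallU_hom_induction {P : SmallU k R V → Prop} (add : ∀ a c, P a → P c → P (a + c))
    (hom : ∀ n, ∀ a ∈ smallGrading k R V n, P a) (a : SmallU k R V) : P a := by
  have h1 : a ∈ Algebra.adjoin k (Set.range (Gen.val (H := H) k R V)) :=
    smallU_induction (S := Algebra.adjoin k (Set.range (Gen.val (H := H) k R V)))
      (fun h => Algebra.subset_adjoin ⟨Gen.h h, rfl⟩)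
      (fun h => Algebra.subset_adjoin ⟨Gen.v h, rfl⟩)
      (fun h => Algebra.subset_adjoin ⟨Gen.vbar h, rfl⟩) a
  rw [← Subalgebra.mem_toSubmodule, Algebra.adjoin_eq_span] at h1
  have h2 : a ∈ ⨆ n, smallGrading k R V n := by
    refine Submodule.span_le.2 ?_ h1
    intro c hc
    obtain ⟨l, hl, rfl⟩ := Submonoid.exists_list_of_mem_closure hc
    obtain ⟨l', rfl⟩ := (Set.range_list_map (Gen.val (H := H) k R V)).ge hl
    exact Submodule.mem_iSup_of_mem _ (Submodule.subset_span ⟨l', rfl, rfl⟩)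
  clear h1
  induction h2 using Submodule.iSup_induction' with
  | zero => exact hom 0 0 (Submodule.zero_mem _)
  | add a c _ _ ha hc => exact add a c ha hc
  | mem n a ha => exact hom n a ha

theorem uV_ι (v : V) : uV k R V (TensorAlgebra.ι k v) = ofV k R V v := rfl

theorem uV_mem_smallGrading {n : ℕ} {t : 𝐓} (ht : t ∈ gr ^ n) :
    uV k R V t ∈ smallGrading k R V (-n) := by
  induction n generalizing t with
  | zero =>
    rw [pow_zero] at ht
    obtain ⟨r, rfl⟩ := Submodule.mem_one.1 ht
    rw [AlgHom.commutes, Algebra.algebraMap_eq_smul_one]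
    exact Submodule.smul_mem _ _ (Submodule.subset_span ⟨[], by simp, by simp⟩)
  | succ n ih =>
    rw [pow_succ'] at ht
    induction ht using Submodule.mul_induction_on' with
    | mem_mul_mem m hm s hs =>
      obtain ⟨w, rfl⟩ := hm
      rw [map_mul, show -((n + 1 : ℕ) : ℤ) = -1 + -n by push_cast; ring]
      exact mul_mem_smallGrading (ofV_mem_smallGrading w) (ih hs)
    | add x _ y _ hx hy => rw [map_add]; exact Submodule.add_mem _ hx hy

variable (k R V) in
/-- The map `B(V) → u_(H,R)(V)`. -/
def uB : NicholsV k R V →ₗ[k] SmallU k R V :=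
  (LinearMap.ker (πB).toLinearMap).liftQ (uV k R V).toLinearMap
    (fun _ ht => uV_eq_zero ((nicholsMk_eq_zero _ _).1 ht)) ∘ₗ
  ((πB).toLinearMap.quotKerEquivOfSurjective (nicholsMk_surjective _ _)).symm.toLinearMap

theorem uB_mk (t : 𝐓) : uB k R V (πB t) = uV k R V t := by
  have : ((πB).toLinearMap.quotKerEquivOfSurjective
      (nicholsMk_surjective _ _)).symm (πB t) = Submodule.Quotient.mk t := by
    rw [LinearEquiv.symm_apply_eq]
    rfl
  rw [uB, LinearMap.comp_apply, LinearEquiv.coe_coe, this]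
  rfl

variable (hR : IsQuasitriangular R) [Module.Finite k (NicholsV k R V)] (N : PosMod R b)

namespace PosMod

/-- The inclusion of a module in the induced module. -/
def emb : N.carrier →ₗ[k] N.ind hR := tm R V N.carrier 1

theorem ofH_smul (h : H) (x : N.ind hR) : ofH k R V h • x = indG R V N.g h x :=
  LinearMap.congr_fun ((N.isPosRep.isURep hR).lift_ofH hR h) x

theorem ofV_smul (j : ι) (x : N.ind hR) : ofV k R V (b j) • x = indX b N.carrier j x :=
  LinearMap.congr_fun ((N.isPosRep.isURep hR).lift_ofV hR j) x

theorem ofVbar_smul (i : ι) (x : N.ind hR) :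
    ofVbar k R V (b.dualBasis i) • x = indV R b N.g N.y i x :=
  LinearMap.congr_fun ((N.isPosRep.isURep hR).lift_ofVbar hR i) x

theorem ofH_smul_emb (h : H) (m : N.carrier) :
    ofH k R V h • N.emb hR m = N.emb hR (N.g h m) :=
  (N.ofH_smul hR h _).trans (indG_one_tmul N.g h m)

theorem ofVbar_smul_emb (i : ι) (m : N.carrier) :
    ofVbar k R V (b.dualBasis i) • N.emb hR m = N.emb hR (N.y i m) :=
  (N.ofVbar_smul hR i _).trans (indV_one_tmul N.g N.y hR i m)

theorem emb_mem {n : ℤ} {m : N.carrier} (hm : m ∈ N.deg n) : N.emb hR m ∈ (N.ind hR).deg n :=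
  tm_mem_indDeg one_mem_nicholsDeg hm (by simp)

theorem induction {P : N.ind hR → Prop} (add : ∀ x z, P x → P z → P (x + z))
    (smul : ∀ (c : k) x, P x → P (c • x)) (one : ∀ m, P (N.emb hR m))
    (mul : ∀ j x, P x → P (ofV k R V (b j) • x)) (x : N.ind hR) : P x :=
  ind_induction (P := P) b add smul one (fun j x hx => N.ofV_smul hR j x ▸ mul j x hx) x

theorem uV_smul_emb (t : 𝐓) (m : N.carrier) :
    uV k R V t • N.emb hR m = (tm R V N.carrier (πB t) m : IndSpace R V N.carrier) := by
  induction t using tensorAlgebra_induction b with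
  | one => rw [map_one, map_one, one_smul]; rfl
  | add s t hs ht => rw [map_add, map_add, map_add, add_smul, hs, ht]; rfl
  | smul c t ht => rw [map_smul, map_smul, map_smul, smul_assoc, ht]; rfl
  | mul i t ht =>
    rw [map_mul, mul_smul, ht, uV_ι]
    refine (N.ofV_smul hR i _).trans ?_
    rw [indX, opB_tm, nicholsX_mk]

theorem finrank_ind : Module.finrank k (N.ind hR) =
    Module.finrank k (NicholsV k R V) * Module.finrank k N.carrier :=
  Module.finrank_tensorProduct (R := k) (S := k)

variable {N}

/-- Frobenius reciprocity. The map x ⊗ m ↦ x·f(m) commutes with V by construction. Linearity over H,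
and then over V̄, spreads from 1 ⊗ N by moving the generators past xⱼ with the same relations in
source and target. H comes first because the cross relation contains z. -/
theorem exists_desc_linear {Y : Type*} [AddCommGroup Y] [Module k Y] [Module (SmallU k R V) Y]
    [IsScalarTower k (SmallU k R V) Y] (f : N.carrier →ₗ[k] Y)
    (hH : ∀ h m, f (N.g h m) = ofH k R V h • f m)
    (hy : ∀ i m, f (N.y i m) = ofVbar k R V (b.dualBasis i) • f m) :
    ∃ F : N.ind hR →ₗ[SmallU k R V] Y, ∀ m, F (N.emb hR m) = f m := by
  obtain ⟨F, h1, hV⟩ : ∃ F : N.ind hR →ₗ[k] Y, (∀ m, F (N.emb hR m) = f m) ∧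
      ∀ j x, F (ofV k R V (b j) • x) = ofV k R V (b j) • F x := by
    let F : IndSpace R V N.carrier →ₗ[k] Y := TensorProduct.lift
      (((Algebra.lsmul k k Y).toLinearMap.compl₁₂ (uB k R V) LinearMap.id).compl₂ f)
    have hF : ∀ x m, F (tm R V N.carrier x m) = uB k R V x • f m := fun x m => rfl
    refine ⟨F, fun m => (hF 1 m).trans ?_, fun j x => ?_⟩
    · rw [← map_one πB, uB_mk, map_one, one_smul]
    · rw [N.ofV_smul hR]
      refine LinearMap.congr_fun (f := F ∘ₗ indX b N.carrier j)
        (g := Algebra.lsmul k k Y (ofV k R V (b j)) ∘ₗ F) (indSpace_hom_ext fun x m => ?_) x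
      obtain ⟨t, rfl⟩ := nicholsMk_surjective _ _ x
      rw [LinearMap.comp_apply, LinearMap.comp_apply, indX, opB_tm, hF, hF, nicholsX_mk, uB_mk,
        uB_mk, map_mul, uV_ι, mul_smul]
      rfl
  have hU := isURep_ofH (R := R) (V := V) b hR
  have hHF : ∀ (x : N.ind hR) h, F (ofH k R V h • x) = ofH k R V h • F x := by
    intro x
    induction x using N.induction hR with
    | add x z hx hz => intro h; simp only [smul_add, map_add, hx, hz]
    | smul c x hx => intro h; simp only [smul_comm _ c, map_smul, hx]
    | one m => intro h; rw [ofH_smul_emb, h1, h1, hH]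
    | mul j x hx =>
      intro h
      rw [← mul_smul, hU.mul_x, Finset.sum_smul, map_sum, hV, ← mul_smul, hU.mul_x,
        Finset.sum_smul]
      simp only [mul_smul, hV, hx]
  have hVF : ∀ (x : N.ind hR) i, F (ofVbar k R V (b.dualBasis i) • x) =
      ofVbar k R V (b.dualBasis i) • F x := by
    intro x
    induction x using N.induction hR with
    | add x z hx hz => intro h; simp only [smul_add, map_add, hx, hz]
    | smul c x hx => intro h; simp only [smul_comm _ c, map_smul, hx]
    | one m => intro i; rw [ofVbar_smul_emb, h1, h1, hy]
    | mul j x hx =>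
      intro i
      rw [← mul_smul, hU.cross, hV, ← mul_smul, hU.cross]
      simp only [sub_smul, add_smul, Finset.sum_smul, map_sub, map_add, map_sum, smul_assoc,
        map_smul, mul_smul, hV, hx, hHF]
      congr 2
      split_ifs <;> simp
  have hu := smallU_map_smul b F (fun h x => hHF x h) hV fun i x => hVF x i
  exact ⟨{ toFun := F, map_add' := map_add F, map_smul' := hu }, h1⟩

theorem lin_mem_of_emb {Y : SmallGrMod k R V} (F : N.ind hR →ₗ[SmallU k R V] Y)
    (hF : ∀ n, ∀ m ∈ N.deg n, F (N.emb hR m) ∈ Y.deg n) (n : ℤ) :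
    ∀ x ∈ (N.ind hR).deg n, F x ∈ Y.deg n := by
  intro x hx
  have : indDeg N n ≤ (Y.deg n).comap (F.restrictScalars k) := by
    refine Submodule.span_le.2 ?_
    rintro _ ⟨j, i, _, m, ⟨t, ht, rfl⟩, hm, rfl, rfl⟩
    change F _ ∈ Y.deg _
    rw [AlgHom.toLinearMap_apply, ← N.uV_smul_emb hR, map_smul, sub_eq_neg_add]
    exact Y.smul_mem _ _ _ _ (uV_mem_smallGrading ht) (hF i m hm)
  exact this hx

theorem exists_desc {Y : SmallGrMod k R V} (f : N.carrier →ₗ[k] Y)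
    (hH : ∀ h m, f (N.g h m) = ofH k R V h • f m)
    (hy : ∀ i m, f (N.y i m) = ofVbar k R V (b.dualBasis i) • f m)
    (hdeg : ∀ n, ∀ m ∈ N.deg n, f m ∈ Y.deg n) :
    ∃ F : N.ind hR ⟶ Y, ∀ m, GrMod.Hom.lin F (N.emb hR m) = f m := by
  obtain ⟨F, hF⟩ := exists_desc_linear hR f hH hy
  exact ⟨GrMod.homMk F (lin_mem_of_emb hR F fun n m hm => (hF m).symm ▸ hdeg n m hm), hF⟩

theorem hom_ext {Y : Type*} [AddCommGroup Y] [Module k Y] [Module (SmallU k R V) Y]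
    [IsScalarTower k (SmallU k R V) Y] {F G : N.ind hR →ₗ[SmallU k R V] Y}
    (h : ∀ m, F (N.emb hR m) = G (N.emb hR m)) (x : N.ind hR) : F x = G x := by
  induction x using N.induction hR with
  | add x z hx hz => rw [map_add, map_add, hx, hz]
  | smul c x hx => rw [LinearMap.map_smul_of_tower, LinearMap.map_smul_of_tower, hx]
  | one m => exact h m
  | mul j x hx => rw [map_smul, map_smul, hx]

end PosMod

end InducedUniversal

/-! ### Nakayama's lemma for V, and proper standard modules. -/

section StandardModules

variable {k : Type u} {H : Type u} [Field k] [Ring H] [HopfAlgebra k H] {R : H ⊗[k] H}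
  {V : Type u} [AddCommGroup V] [Module k V] [Module H V] [IsScalarTower k H V]
  {ι : Type} [Fintype ι] [DecidableEq ι] {b : Module.Basis ι k V}

local notation "ε" => Coalgebra.counit (R := k) (A := H)
local notation "𝒮" => HopfAlgebra.antipode k (A := H)
local notation "𝛒" => matCoeff (H := H) b
local notation "𝐓" => TensorAlgebra k V
local notation "𝐓'" => TensorAlgebra k (Module.Dual k V)
local notation "𝐁" => NicholsV k R V
local notation "πB" => nicholsMk (repV k V) (coactV k R V)
local notation "aB" => nicholsAct (repV k V) (coactV k R V)
local notation "gr" => LinearMap.range (TensorAlgebra.ι k (M := V))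

/-- The subspace `V X` of a graded module `X`. -/
def vSub (X : SmallGrMod k R V) : Submodule k X :=
  Submodule.span k {z | ∃ (v : V) (x : X), ofV k R V v • x = z}

theorem ofV_smul_mem_vSub {X : SmallGrMod k R V} (v : V) (x : X) : ofV k R V v • x ∈ vSub X :=
  Submodule.subset_span ⟨v, x, rfl⟩

theorem vSub_le {X : SmallGrMod k R V} {P : Submodule k X}
    (h : ∀ (v : V) (x : X), ofV k R V v • x ∈ P) : vSub X ≤ P := by
  refine Submodule.span_le.2 ?_
  rintro _ ⟨v, x, rfl⟩
  exact h v x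

/-- Nakayama's lemma for the nilpotent action of `V`. -/
theorem eq_top_of_sup_vSub_eq_top [Module.Finite k (NicholsV k R V)] {X : SmallGrMod k R V}
    {P : Submodule k X} (hP : ∀ (v : V), ∀ x ∈ P, ofV k R V v • x ∈ P) (h : P ⊔ vSub X = ⊤) :
    P = ⊤ := by
  obtain ⟨B, hB⟩ := exists_nicholsProj_eq_zero (repV k V) (coactV k R V)
  have hP' : ∀ t : 𝐓, ∀ x ∈ P, uV k R V t • x ∈ P := by
    intro t
    induction t using TensorAlgebra.induction with
    | algebraMap r => intro x hx; rw [AlgHom.commutes, algebraMap_smul]; exact P.smul_mem r hx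
    | ι v => exact hP v
    | mul s t hs ht => intro x hx; rw [map_mul, mul_smul]; exact hs _ (ht x hx)
    | add s t hs ht => intro x hx; rw [map_add, add_smul]; exact P.add_mem (hs x hx) (ht x hx)
  have h0 : ∀ t ∈ gr ^ B, uV k R V t = 0 := by
    intro t ht
    refine uV_eq_zero ((nicholsMk_eq_zero _ _).1 ?_)
    have := nicholsProj_mk_of_mem (repV k V) (coactV k R V) ht B
    rwa [if_pos rfl, hB B le_rfl, LinearMap.zero_apply, eq_comm] at this
  -- Descending induction on n, from degree B where 𝔅(V) vanishes. Splitting x along X = P + VX, the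
  -- first part stays in P, and a product of n vectors applied to the second part is a product of n
  -- + 1 vectors.
  have key : ∀ n ≤ B, ∀ t ∈ gr ^ n, ∀ x : X, uV k R V t • x ∈ P := by
    intro n hn
    induction hn using Nat.decreasingInduction with
    | self => intro t ht x; rw [h0 t ht, zero_smul]; exact P.zero_mem
    | of_succ n hn ih =>
      intro t ht x
      obtain ⟨p, hp, w, hw, rfl⟩ := Submodule.mem_sup.1 (h.ge (Submodule.mem_top (x := x)))
      rw [smul_add]
      refine P.add_mem (hP' t p hp) ?_
      have : vSub X ≤ P.comap (Algebra.lsmul k k X (uV k R V t)) := vSub_le fun v x => by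
        change uV k R V t • ofV k R V v • x ∈ P
        rw [← uV_ι, ← mul_smul, ← map_mul]
        refine ih _ ?_ x
        rw [pow_succ]
        exact Submodule.mul_mem_mul ht ⟨v, rfl⟩
      exact this hw
  refine eq_top_iff.2 fun x _ => ?_
  simpa using key 0 (Nat.zero_le _) 1 (Submodule.one_le.1 (pow_zero (gr)).ge) x

/-- By Nakayama a complement of VX generates X over 𝔅(V), so 𝔅(V) ⊗ X/VX maps onto X. Equality of
the dimensions will serve as freeness over 𝔅(V). -/
theorem finrank_le_mul_finrank_quotient [Module.Finite k (NicholsV k R V)]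
    (X : SmallGrMod k R V) : Module.finrank k X ≤
      Module.finrank k (NicholsV k R V) * Module.finrank k (X ⧸ vSub X) := by
  obtain ⟨C, hC⟩ := (vSub X).exists_isCompl
  let F : 𝐁 ⊗[k] C →ₗ[k] X := TensorProduct.lift
    (((Algebra.lsmul k k X).toLinearMap.compl₁₂ (uB k R V) LinearMap.id).compl₂ C.subtype)
  have hF : ∀ t c, F (πB t ⊗ₜ c) = uV k R V t • (c : X) := fun t c => by
    rw [← uB_mk]; rfl
  have hrange : LinearMap.range F = ⊤ := by
    refine eq_top_of_sup_vSub_eq_top (fun v => ?_) (eq_top_iff.2 (hC.symm.sup_eq_top.ge.trans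
      (sup_le_sup_right (fun c hc => ⟨πB 1 ⊗ₜ ⟨c, hc⟩, by rw [hF, map_one, one_smul]⟩) _)))
    rintro _ ⟨z, rfl⟩
    induction z using TensorProduct.induction_on with
    | zero => rw [map_zero, smul_zero]; exact Submodule.zero_mem _
    | add x y hx hy => rw [map_add, smul_add]; exact Submodule.add_mem _ hx hy
    | tmul x c =>
      obtain ⟨t, rfl⟩ := nicholsMk_surjective _ _ x
      exact ⟨πB (TensorAlgebra.ι k v * t) ⊗ₜ c, by rw [hF, hF, map_mul, mul_smul, uV_ι]⟩
  calc Module.finrank k X = Module.finrank k (LinearMap.range F) := by rw [hrange, finrank_top]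
    _ ≤ Module.finrank k (𝐁 ⊗[k] C) := LinearMap.finrank_range_le F
    _ = _ := by
      rw [Module.finrank_tensorProduct (R := k) (S := k),
        (Submodule.quotientEquivOfIsCompl _ _ hC).finrank_eq]

namespace PosMod

variable (hR : IsQuasitriangular R) [Module.Finite k (NicholsV k R V)] (N : PosMod R b)

theorem range_emb_sup_vSub : LinearMap.range (N.emb hR) ⊔ vSub (N.ind hR) = ⊤ := by
  refine eq_top_iff.2 fun x _ => ?_
  induction x using N.induction hR with
  | add x z hx hz => exact Submodule.add_mem _ (hx trivial) (hz trivial)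
  | smul c x hx => exact Submodule.smul_mem _ c (hx trivial)
  | one m => exact Submodule.mem_sup_left ⟨m, rfl⟩
  | mul j x _ => exact Submodule.mem_sup_right (ofV_smul_mem_vSub _ _)

theorem deg_le_vSub {n : ℤ} (hn : N.deg n = ⊥) : (N.ind hR).deg n ≤ vSub (N.ind hR) := by
  refine Submodule.span_le.2 ?_
  rintro _ ⟨j, i, _, m, ⟨t, ht, rfl⟩, hm, hij, rfl⟩
  change tm R V N.carrier (πB t) m ∈ vSub (N.ind hR)
  cases j with
  | zero =>
    obtain rfl : i = n := by simpa using hij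
    rw [hn, Submodule.mem_bot] at hm
    rw [hm, map_zero]
    exact Submodule.zero_mem _
  | succ j =>
    rw [← N.uV_smul_emb hR]
    rw [pow_succ'] at ht
    induction ht using Submodule.mul_induction_on' with
    | mem_mul_mem w hw s hs =>
      obtain ⟨v, rfl⟩ := hw
      rw [map_mul, mul_smul, uV_ι]
      exact ofV_smul_mem_vSub _ _
    | add x _ y _ hx hy => rw [map_add, add_smul]; exact Submodule.add_mem _ hx hy

theorem finrank_quotient_vSub_le :
    Module.finrank k (N.ind hR ⧸ vSub (N.ind hR)) ≤ Module.finrank k N.carrier := by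
  refine LinearMap.finrank_le_finrank_of_surjective (f := (vSub (N.ind hR)).mkQ ∘ₗ N.emb hR) ?_
  intro z
  obtain ⟨x, rfl⟩ := (vSub (N.ind hR)).mkQ_surjective z
  obtain ⟨_, ⟨m, rfl⟩, w, hw, rfl⟩ := Submodule.mem_sup.1
    ((N.range_emb_sup_vSub hR).ge (Submodule.mem_top (x := x)))
  refine ⟨m, ?_⟩
  rw [LinearMap.comp_apply, map_add, Submodule.mkQ_apply _ w,
    (Submodule.Quotient.mk_eq_zero _).2 hw, add_zero]

theorem deg_eq_bot {n : ℤ} (hn : ∀ i, n ≤ i → N.deg i = ⊥) : (N.ind hR).deg n = ⊥ := by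
  refine eq_bot_iff.2 (Submodule.span_le.2 ?_)
  rintro _ ⟨j, i, x, m, -, hm, rfl, rfl⟩
  rw [hn i (by omega), Submodule.mem_bot] at hm
  rw [hm, map_zero]
  exact Submodule.zero_mem _

end PosMod

section Simple

variable (S : Type u) [AddCommGroup S] [Module k S] [Module H S] [IsScalarTower k H S]
  [Module.Finite k S]

variable (R b) in
/-- An `H`-module, with trivial action of `V̄`, in degree zero. -/
def trivPos : PosMod R b where
  carrier := S
  g := Algebra.lsmul k k S
  y := 0
  isPosRep :=
    { mul_y := fun h i => by simp
      right := fun t ht => by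
        have h1 : TensorAlgebra.lift k (b.dualBasis.constr k (0 : ι → Module.End k S)) =
            (Algebra.ofId k _).comp TensorAlgebra.algebraMapInv := by
          apply TensorAlgebra.hom_ext
          apply b.dualBasis.ext
          intro i
          simp only [LinearMap.comp_apply, AlgHom.toLinearMap_apply, TensorAlgebra.lift_ι_apply,
            Module.Basis.constr_basis, AlgHom.comp_apply]
          simp [TensorAlgebra.algebraMapInv]
        rw [h1, AlgHom.comp_apply, algebraMapInv_nicholsIdeal _ _ ht, map_zero] }
  deg n := if n = 0 then ⊤ else ⊥
  internal := isInternal_single k S 0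
  g_mem h n x hx := by
    split_ifs at hx ⊢
    · trivial
    · rw [(Submodule.mem_bot k).1 hx, map_zero]; exact Submodule.zero_mem _
  y_mem i n x hx := Submodule.zero_mem _

variable (b) (hR : IsQuasitriangular R) [Module.Finite k (NicholsV k R V)]

/-- The proper standard module of an `H`-module. -/
def stdMod : SmallGrMod k R V := (trivPos R b S).ind hR

/-- The inclusion of an `H`-module in its proper standard module. -/
def stdEmb : S →ₗ[k] stdMod b S hR := (trivPos R b S).emb hR

theorem stdEmb_mem (s : S) : stdEmb b S hR s ∈ (stdMod b S hR).deg 0 :=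
  (trivPos R b S).emb_mem hR (n := 0) (m := s) trivial

theorem ofH_smul_stdEmb (h : H) (s : S) :
    ofH k R V h • stdEmb b S hR s = stdEmb b S hR (h • s) :=
  (trivPos R b S).ofH_smul_emb hR h s

theorem stdMod_deg_of_pos {n : ℤ} (hn : 0 < n) : (stdMod b S hR).deg n = ⊥ :=
  (trivPos R b S).deg_eq_bot hR fun i hi => if_neg (by omega)

theorem stdMod_deg_le_vSub {n : ℤ} (hn : n ≠ 0) :
    (stdMod b S hR).deg n ≤ vSub (stdMod b S hR) :=
  (trivPos R b S).deg_le_vSub hR (if_neg hn)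

theorem exists_stdMod_desc {Y : SmallGrMod k R V} {d : ℤ} (f : S →ₗ[k] Y)
    (hH : ∀ (h : H) s, f (h • s) = ofH k R V h • f s)
    (hy : ∀ (v : Module.Dual k V) s, ofVbar k R V v • f s = 0) (hd : ∀ s, f s ∈ Y.deg d) :
    ∃ F : (stdMod b S hR).shift d ⟶ Y, ∀ s, GrMod.Hom.lin F (stdEmb b S hR s) = f s := by
  obtain ⟨F, hF⟩ := PosMod.exists_desc_linear (N := trivPos R b S) hR f hH
    (fun i m => (map_zero f).trans (hy _ m).symm)
  refine ⟨GrMod.homMk (M := (stdMod b S hR).shift d) F fun n x hx => ?_, hF⟩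
  -- The shift is moved to the target, where the criterion for maps out of the unshifted module
  -- applies.
  have := PosMod.lin_mem_of_emb (N := trivPos R b S) hR (Y := Y.shift (-d)) F
    (fun n m hm => ?_) _ x hx
  · have h2 : F x ∈ Y.deg (n - d - -d) := this
    rwa [show n - d - -d = n by ring] at h2
  · by_cases hn : n = 0
    · subst hn
      have h2 : F ((trivPos R b S).emb hR m) ∈ Y.deg d := (hF m).symm ▸ hd m
      have h3 : d = 0 - -d := by ring
      have h4 : F ((trivPos R b S).emb hR m) ∈ Y.deg (0 - -d) := h3 ▸ h2
      exact h4
    · have h2 : m ∈ (if n = 0 then (⊤ : Submodule k S) else ⊥) := hm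
      rw [if_neg hn] at h2
      obtain rfl : m = 0 := (Submodule.mem_bot k).1 h2
      have h3 : F ((trivPos R b S).emb hR 0) = 0 := by rw [map_zero, map_zero]
      have h4 : F ((trivPos R b S).emb hR 0) ∈ Y.deg (n - -d) := h3 ▸ Submodule.zero_mem _
      exact h4

/-- The explicit module and 𝔲 ⊗_{B⁺} S have the same universal property: a ⊗ s ↦ a·s respects the
defining relations, and a map in the other direction exists by Frobenius reciprocity. They are
inverse to each other because both composites fix generators. -/
theorem isProperStandard_stdMod : IsProperStandard k R V S (stdMod b S hR) := by
  let G₀ : SmallU k R V ⊗[k] S →ₗ[k] stdMod b S hR := TensorProduct.lift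
    ((Algebra.lsmul k k (stdMod b S hR)).toLinearMap.compl₂ (stdEmb b S hR))
  let G₁ : SmallU k R V ⊗[k] S →ₗ[SmallU k R V] stdMod b S hR :=
    { toFun := G₀
      map_add' := map_add G₀
      map_smul' := fun a z => by
        induction z using TensorProduct.induction_on with
        | zero => simp
        | tmul c s => exact mul_smul a c (stdEmb b S hR s)
        | add z w hz hw => rw [smul_add, map_add, map_add, smul_add, hz, hw] }
  have hG₁ : ∀ a s, G₁ (a ⊗ₜ s) = a • stdEmb b S hR s := fun a s => rfl
  have hker : stdRel k R V S ≤ LinearMap.ker G₁ := by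
    refine Submodule.span_le.2 ?_
    rintro _ (⟨a, h, v, rfl⟩ | ⟨a, c, n, v, -, hc, hn, rfl⟩)
    · change G₁ _ = 0
      rw [map_sub, hG₁, hG₁, mul_smul, ofH_smul_stdEmb, sub_self]
    · change G₁ _ = 0
      -- An element of positive degree sends S into a component of positive degree, and the explicit
      -- module has none.
      have h0 := (stdMod b S hR).smul_mem n 0 c _ hc (stdEmb_mem b S hR v)
      rw [add_zero, stdMod_deg_of_pos b S hR hn, Submodule.mem_bot] at h0
      rw [hG₁, mul_smul, h0, smul_zero]
  let G := (stdRel k R V S).liftQ G₁ hker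
  obtain ⟨F, hF⟩ : ∃ F : stdMod b S hR →ₗ[SmallU k R V] ProperStandard k R V S,
      ∀ s, F (stdEmb b S hR s) = (stdRel k R V S).mkQ (1 ⊗ₜ s) := by
    refine PosMod.exists_desc_linear (N := trivPos R b S) hR
      (((stdRel k R V S).mkQ.restrictScalars k) ∘ₗ TensorProduct.mk k _ S 1)
      (fun h (s : S) => ?_) (fun i (s : S) => ?_)
    · have : (stdRel k R V S).mkQ ((1 * ofH k R V h) ⊗ₜ[k] s - 1 ⊗ₜ[k] (h • s)) = 0 :=
        (Submodule.Quotient.mk_eq_zero _).2 (Submodule.subset_span (Or.inl ⟨1, h, s, rfl⟩))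
      rw [map_sub, sub_eq_zero, one_mul] at this
      refine this.symm.trans ?_
      nth_rw 1 [← mul_one (ofH k R V h)]
      exact map_smul (stdRel k R V S).mkQ (ofH k R V h) (1 ⊗ₜ[k] s)
    · have : (stdRel k R V S).mkQ ((1 * ofVbar k R V (b.dualBasis i)) ⊗ₜ[k] s) = 0 :=
        (Submodule.Quotient.mk_eq_zero _).2 (Submodule.subset_span (Or.inr
          ⟨1, _, 1, s, Algebra.subset_adjoin (Or.inl ⟨_, rfl⟩), ofVbar_mem_smallGrading _,
            one_pos, rfl⟩))
      refine (map_zero _).trans (this.symm.trans ?_)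
      rw [one_mul]
      nth_rw 1 [← mul_one (ofVbar k R V _)]
      exact map_smul (stdRel k R V S).mkQ (ofVbar k R V (b.dualBasis i)) (1 ⊗ₜ[k] s)
  have hG : ∀ a s, G ((stdRel k R V S).mkQ (a ⊗ₜ s)) = a • stdEmb b S hR s := fun a s => rfl
  have hFG : F ∘ₗ G = LinearMap.id := by
    refine LinearMap.ext fun z => ?_
    obtain ⟨z, rfl⟩ := (stdRel k R V S).mkQ_surjective z
    induction z using TensorProduct.induction_on with
    | zero => simp
    | tmul a s =>
      rw [LinearMap.comp_apply, hG, map_smul, hF, ← map_smul, TensorProduct.smul_tmul', smul_eq_mul,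
        mul_one]
      rfl
    | add z w hz hw => rw [map_add, map_add, hz, hw, map_add]
  have hGF : G ∘ₗ F = LinearMap.id := LinearMap.ext <|
    PosMod.hom_ext (N := trivPos R b S) hR fun s => by
      have := hF s
      exact (congrArg G this).trans ((hG 1 s).trans (one_smul _ _))
  refine ⟨LinearEquiv.ofLinearMap G F hGF hFG, fun n => le_antisymm ?_ ?_⟩
  · refine Submodule.span_le.2 ?_
    rintro _ ⟨j, i, _, m, ⟨t, ht, rfl⟩, hm, hn, rfl⟩
    change tm R V (trivPos R b S).carrier (πB t) m ∈ _
    by_cases hi : i = 0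
    · rw [← (trivPos R b S).uV_smul_emb hR]
      refine ⟨(stdRel k R V S).mkQ (uV k R V t ⊗ₜ m), Submodule.subset_span
        ⟨uV k R V t, ?_, m, rfl⟩, rfl⟩
      rw [← hn, hi, zero_sub]
      exact uV_mem_smallGrading ht
    · have h2 : m ∈ (if i = 0 then (⊤ : Submodule k S) else ⊥) := hm
      rw [if_neg hi] at h2
      rw [show m = 0 from (Submodule.mem_bot k).1 h2, map_zero]
      exact Submodule.zero_mem _
  · rw [Submodule.map_le_iff_le_comap]
    refine Submodule.span_le.2 ?_
    rintro _ ⟨a, ha, s, rfl⟩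
    have := (stdMod b S hR).smul_mem n 0 a _ ha (stdEmb_mem b S hR s)
    rwa [add_zero] at this

end Simple

end StandardModules

/-! ### Simplicity, shifts and top degrees of graded modules. -/

namespace GrMod

variable {k : Type u} [Field k] {A : Type u} [Ring A] [Algebra k A] {𝒜 : ℤ → Submodule k A}

theorem simple_of_isSimpleModule (X : GrMod k 𝒜) [IsSimpleModule A X] : Simple X where
  mono_isIso_iff_nonzero {Y} f hf := by
    have hinj := (mono_iff_injective f).1 hf
    constructor
    · rintro h rfl
      have hs := (epi_iff_surjective (0 : Y ⟶ X)).1 inferInstance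
      obtain ⟨x, hx⟩ := @exists_ne X (IsSimpleModule.nontrivial A X) 0
      obtain ⟨y, rfl⟩ := hs x
      exact hx rfl
    · intro h
      rcases eq_bot_or_eq_top (LinearMap.range (Hom.lin f)) with h0 | h1
      · exact absurd (hom_ext fun x => (Submodule.mem_bot A).1 (h0.le ⟨x, rfl⟩)) h
      · exact (isoOfBijective f ⟨hinj, LinearMap.range_eq_top.1 h1⟩).isIso_hom

theorem nontrivial_of_simple (X : GrMod k 𝒜) [Simple X] : Nontrivial X := by
  by_contra h
  have : Subsingleton X := not_nontrivial_iff_subsingleton.1 h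
  exact Simple.not_isZero X (isZero_of_subsingleton X)

/-- The shift of a morphism. -/
def shiftHom {M N : GrMod k 𝒜} (f : M ⟶ N) (d : ℤ) : M.shift d ⟶ N.shift d :=
  homMk (M := M.shift d) (N := N.shift d) (Hom.lin f : M →ₗ[A] N) fun _ _ hm => lin_mem f hm

theorem ker_shiftHom {M N : GrMod k 𝒜} (f : M ⟶ N) (d : ℤ) :
    LinearMap.ker (Hom.lin (shiftHom f d)) = LinearMap.ker (Hom.lin f) := rfl

/-- The linear map of a morphism between shifts. -/
def unshift {M N : GrMod k 𝒜} {d e : ℤ} (f : M.shift d ⟶ N.shift e) : M →ₗ[A] N :=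
  Hom.lin (M := M.shift d) (N := N.shift e) f

theorem unshift_mem {M N : GrMod k 𝒜} {d e : ℤ} (f : M.shift d ⟶ N.shift e) {n : ℤ} {x : M}
    (hx : x ∈ M.deg n) : unshift f x ∈ N.deg (n + d - e) := by
  have h1 : x ∈ M.deg (n + d - d) := (add_sub_cancel_right n d).symm ▸ hx
  have h2 : unshift f x ∈ (N.shift e).deg (n + d) := lin_mem (M := M.shift d) f h1
  exact h2

theorem exists_top_degree (X : GrMod k 𝒜) [Nontrivial X] :
    ∃ d, X.deg d ≠ ⊥ ∧ ∀ n, d < n → X.deg n = ⊥ := by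
  obtain ⟨s, hs, hsum⟩ := exists_sum_gradedProj X.internal
  classical
  have hne : (s.filter fun n => X.deg n ≠ ⊥).Nonempty := by
    by_contra h
    rw [Finset.not_nonempty_iff_eq_empty, Finset.filter_eq_empty_iff] at h
    obtain ⟨x, hx⟩ := exists_ne (0 : X)
    refine hx ?_
    rw [← hsum x]
    refine Finset.sum_eq_zero fun n hn => ?_
    have := gradedProj_mem X.internal n x
    rwa [not_not.1 (h hn), Submodule.mem_bot] at this
  refine ⟨_, (Finset.mem_filter.1 (Finset.max'_mem _ hne)).2, fun n hn => ?_⟩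
  by_contra h
  by_cases hns : n ∈ s
  · exact absurd (Finset.le_max' _ n (Finset.mem_filter.2 ⟨hns, h⟩)) (not_le.2 hn)
  · exact h (hs n hns)

end GrMod

/-! ### Heads of proper standard modules. -/

section Heads

variable {k : Type u} {H : Type u} [Field k] [Ring H] [HopfAlgebra k H] {R : H ⊗[k] H}
  {V : Type u} [AddCommGroup V] [Module k V] [Module H V] [IsScalarTower k H V]

/-- The restriction of a graded module to `H`. -/
instance moduleH (X : SmallGrMod k R V) : Module H X :=
  Module.compHom X.carrier (ofH k R V).toRingHom

theorem H_smul_def (X : SmallGrMod k R V) (h : H) (x : X) : h • x = ofH k R V h • x := rfl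

instance isScalarTowerH (X : SmallGrMod k R V) : IsScalarTower k H X where
  smul_assoc c h x := by rw [H_smul_def, H_smul_def, map_smul, smul_assoc]

theorem H_smul_mem (X : SmallGrMod k R V) {n : ℤ} (h : H) {x : X} (hx : x ∈ X.deg n) :
    h • x ∈ X.deg n := by
  have := X.smul_mem 0 n _ x (ofH_mem_smallGrading h) hx
  rwa [zero_add] at this

/-- The component of degree `n`, as a module over `H`. -/
def degH (X : SmallGrMod k R V) (n : ℤ) : Submodule H X where
  carrier := X.deg n
  add_mem' := (X.deg n).add_mem
  zero_mem' := (X.deg n).zero_mem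
  smul_mem' h _ hx := H_smul_mem X h hx

/-- A linear map of graded modules, as a map of `H`-modules. -/
def linH {X Y : SmallGrMod k R V} (f : X →ₗ[SmallU k R V] Y) : X →ₗ[H] Y where
  toFun := f
  map_add' := map_add _
  map_smul' h x := map_smul f (ofH k R V h) x

theorem gproj_H_smul (X : SmallGrMod k R V) (n : ℤ) (h : H) (x : X) :
    X.gproj n (h • x) = h • X.gproj n x := by
  have := GrMod.smul_gproj (ofH_mem_smallGrading (R := R) (V := V) h) n x
  rw [zero_add] at this
  exact this.symm

/-- The largest submodule that vanishes in degree `d`. -/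
def coreSub (X : SmallGrMod k R V) (d : ℤ) : Submodule (SmallU k R V) X where
  carrier := {x | ∀ a : SmallU k R V, X.gproj d (a • x) = 0}
  add_mem' hx hy a := by rw [smul_add, map_add, hx, hy, add_zero]
  zero_mem' a := by rw [smul_zero, map_zero]
  smul_mem' c x hx a := by rw [← mul_smul]; exact hx _

/-- For homogeneous a, the degree-d part of a·xₙ is either the degree-d part of a·x or zero; both
vanish. -/
theorem gproj_mem_coreSub (X : SmallGrMod k R V) (d : ℤ) : ∀ x ∈ coreSub X d, ∀ n,
    X.gproj n x ∈ coreSub X d := by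
  intro x hx n a
  induction a using smallU_hom_induction with
  | add a c ha hc => rw [add_smul, map_add, ha, hc, add_zero]
  | hom i a ha =>
    rw [GrMod.smul_gproj ha, gradedProj_gradedProj]
    split_ifs with h
    · rw [h]; exact hx a
    · rfl

variable {ι : Type} [Fintype ι] [DecidableEq ι] (b : Module.Basis ι k V)
  (S : Type u) [AddCommGroup S] [Module k S] [Module H S] [IsScalarTower k H S]
  [Module.Finite k S] (hR : IsQuasitriangular R) [Module.Finite k (NicholsV k R V)]

instance : Nontrivial (NicholsV k R V) := by
  refine nontrivial_of_ne (nicholsMk (repV k V) (coactV k R V) 1) 0 fun h => ?_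
  have := algebraMapInv_nicholsIdeal _ _ ((nicholsMk_eq_zero _ _).1 h)
  rw [map_one] at this
  exact one_ne_zero this

/-- The inclusion of an `H`-module in its proper standard module, as a map of `H`-modules. -/
def stdEmbH : S →ₗ[H] stdMod b S hR where
  toFun := stdEmb b S hR
  map_add' := map_add _
  map_smul' h s := (ofH_smul_stdEmb b S hR h s).symm

theorem stdMod_deg_zero_le : (stdMod b S hR).deg 0 ≤ LinearMap.range (stdEmb b S hR) := by
  refine Submodule.span_le.2 ?_
  rintro _ ⟨j, i, _, m, ⟨t, ht, rfl⟩, hm, hn, rfl⟩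
  change tm R V (trivPos R b S).carrier (nicholsMk (repV k V) (coactV k R V) t) m ∈ _
  by_cases hi : i = 0
  · obtain rfl : j = 0 := by omega
    rw [pow_zero] at ht
    obtain ⟨c, rfl⟩ := Submodule.mem_one.1 ht
    rw [← (trivPos R b S).uV_smul_emb hR, AlgHom.commutes, algebraMap_smul]
    exact Submodule.smul_mem _ c ⟨m, rfl⟩
  · have h2 : m ∈ (if i = 0 then (⊤ : Submodule k S) else ⊥) := hm
    rw [if_neg hi] at h2
    rw [show m = 0 from (Submodule.mem_bot k).1 h2, map_zero]
    exact Submodule.zero_mem _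

theorem finrank_stdMod : Module.finrank k (stdMod b S hR) =
    Module.finrank k (NicholsV k R V) * Module.finrank k S :=
  (trivPos R b S).finrank_ind hR

theorem gproj_stdEmb (s : S) : (stdMod b S hR).gproj 0 (stdEmb b S hR s) = stdEmb b S hR s :=
  (gradedProj_of_mem _ (stdEmb_mem b S hR s) 0).trans (if_pos rfl)

/-- The head of the proper standard module of a simple `H`-module. -/
def stdHead : SmallGrMod k R V :=
  (stdMod b S hR).quot (coreSub (stdMod b S hR) 0) (gproj_mem_coreSub _ 0)

/-- The projection of the proper standard module to its head. -/
def stdHeadπ : stdMod b S hR ⟶ stdHead b S hR := GrMod.quotπ _ _ _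

theorem stdHeadπ_surjective : Function.Surjective (GrMod.Hom.lin (stdHeadπ b S hR)) :=
  Submodule.mkQ_surjective _

theorem ker_stdHeadπ :
    LinearMap.ker (GrMod.Hom.lin (stdHeadπ b S hR)) = coreSub (stdMod b S hR) 0 :=
  Submodule.ker_mkQ _

variable [IsSimpleModule H S]

/-- S is simple, so otherwise the embedding is zero; then the module it generates is zero, against
its dimension dim 𝔅(V) · dim S. -/
theorem stdEmb_injective : Function.Injective (stdEmb b S hR) := by
  change Function.Injective (stdEmbH b S hR)
  refine LinearMap.injective_of_ne_zero fun h0 => ?_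
  have h1 : ∀ x : stdMod b S hR, x = 0 := fun x =>
    PosMod.hom_ext (N := trivPos R b S) hR (F := LinearMap.id) (G := 0)
      (fun m => LinearMap.congr_fun h0 m) x
  have h2 : Module.finrank k (stdMod b S hR) = 0 :=
    have : Subsingleton (stdMod b S hR) := ⟨fun x y => by rw [h1 x, h1 y]⟩
    Module.finrank_zero_of_subsingleton
  have := IsSimpleModule.nontrivial H S
  rw [finrank_stdMod, mul_eq_zero] at h2
  rcases h2 with h2 | h2
  · exact Module.finrank_pos.ne' h2
  · exact Module.finrank_pos.ne' h2

/-- P need not be graded. The degree-zero components of elements of P form an H-submodule of S,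
which is nonzero since P is not in the core; hence it is S. An element of P with degree-zero
component s differs from s by components of nonzero degree, which lie in VM for M the standard
module. So P + VM = M and Nakayama's lemma applies. -/
theorem eq_top_of_not_le_coreSub {P : Submodule (SmallU k R V) (stdMod b S hR)}
    (hP : ¬ P ≤ coreSub (stdMod b S hR) 0) : P = ⊤ := by
  obtain ⟨p, hp, hpN⟩ := Set.not_subset.1 hP
  obtain ⟨a, ha⟩ : ∃ a : SmallU k R V, (stdMod b S hR).gproj 0 (a • p) ≠ 0 := by
    by_contra! h
    exact hpN h
  let T : Submodule H S :=
    { carrier := {s | ∃ q ∈ P, (stdMod b S hR).gproj 0 q = stdEmb b S hR s}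
      add_mem' := by
        rintro s t ⟨q, hq, hs⟩ ⟨r, hr, ht⟩
        exact ⟨q + r, P.add_mem hq hr, by rw [map_add, map_add, hs, ht]⟩
      zero_mem' := ⟨0, P.zero_mem, by rw [map_zero, map_zero]⟩
      smul_mem' := by
        rintro h s ⟨q, hq, hs⟩
        refine ⟨ofH k R V h • q, P.smul_mem _ hq, ?_⟩
        rw [← ofH_smul_stdEmb, ← hs]
        exact gproj_H_smul _ 0 h q }
  have hT : T = ⊤ := by
    refine (eq_bot_or_eq_top T).resolve_left fun hT => ?_
    obtain ⟨s, hs⟩ := stdMod_deg_zero_le b S hR (gradedProj_mem (stdMod b S hR).internal 0 (a • p))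
    have hsT : s ∈ T := ⟨a • p, P.smul_mem _ hp, hs.symm⟩
    rw [hT, Submodule.mem_bot] at hsT
    rw [hsT, map_zero] at hs
    exact ha hs.symm
  have hle : LinearMap.range (stdEmb b S hR) ≤
      P.restrictScalars k ⊔ vSub (stdMod b S hR) := by
    rintro _ ⟨s, rfl⟩
    obtain ⟨q, hq, hs⟩ := (hT.ge (Submodule.mem_top (x := s)) : s ∈ T)
    obtain ⟨I, hI, hsum⟩ := exists_sum_gradedProj (stdMod b S hR).internal
    have h1 : stdEmb b S hR s = q - ∑ n ∈ I.erase 0, (stdMod b S hR).gproj n q := by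
      rw [← hs, eq_sub_iff_add_eq]
      conv_rhs => rw [← hsum q]
      by_cases h0 : 0 ∈ I
      · exact Finset.add_sum_erase I _ h0
      · rw [Finset.erase_eq_of_notMem h0]
        have := gradedProj_mem (stdMod b S hR).internal 0 q
        rw [hI 0 h0, Submodule.mem_bot] at this
        rw [this, zero_add]
    rw [h1]
    refine Submodule.sub_mem _ (Submodule.mem_sup_left hq) (Submodule.mem_sup_right
      (Submodule.sum_mem _ fun n hn => ?_))
    exact stdMod_deg_le_vSub b S hR (Finset.ne_of_mem_erase hn) (gradedProj_mem _ n q)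
  have := eq_top_of_sup_vSub_eq_top (P := P.restrictScalars k)
    (fun v x hx => P.smul_mem (ofV k R V v) hx) (eq_top_iff.2
      (((trivPos R b S).range_emb_sup_vSub hR).ge.trans (sup_le hle le_sup_right)))
  exact (Submodule.restrictScalars_eq_top_iff k _ _).1 this

theorem isCoatom_coreSub : IsCoatom (coreSub (stdMod b S hR) 0) := by
  refine ⟨fun h => ?_, fun P hP => eq_top_of_not_le_coreSub b S hR fun h => hP.not_ge h⟩
  have := IsSimpleModule.nontrivial H S
  obtain ⟨s, hs⟩ := exists_ne (0 : S)
  have h1 : stdEmb b S hR s ∈ coreSub (stdMod b S hR) 0 := h ▸ Submodule.mem_top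
  have h2 := h1 1
  rw [one_smul, gproj_stdEmb] at h2
  exact hs (stdEmb_injective b S hR (h2.trans (map_zero _).symm))

/-- The core is maximal and contains every proper submodule, so it is the only maximal submodule. -/
theorem jacobson_stdMod :
    Module.jacobson (SmallU k R V) (stdMod b S hR) = coreSub (stdMod b S hR) 0 := by
  refine le_antisymm (sInf_le (isCoatom_coreSub b S hR)) (le_sInf fun P hP => ?_)
  by_cases h : P ≤ coreSub (stdMod b S hR) 0
  · exact (((hP : IsCoatom P).le_iff.1 h).resolve_left (isCoatom_coreSub b S hR).1).le
  · exact absurd (eq_top_of_not_le_coreSub b S hR h) (hP : IsCoatom P).1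

theorem isHead_stdHead : GrMod.IsHead (stdMod b S hR) (stdHead b S hR) :=
  ⟨stdHeadπ b S hR, stdHeadπ_surjective b S hR, by rw [ker_stdHeadπ, jacobson_stdMod]⟩

instance : IsSimpleModule (SmallU k R V) (stdHead b S hR) :=
  isSimpleModule_iff_isCoatom.2 (isCoatom_coreSub b S hR)

instance (d : ℤ) : IsSimpleModule (SmallU k R V) ((stdHead b S hR).shift d) :=
  inferInstanceAs (IsSimpleModule (SmallU k R V) (stdHead b S hR))

instance (d : ℤ) : Simple ((stdHead b S hR).shift d) := GrMod.simple_of_isSimpleModule _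

end Heads

/-! ### Classification of the simple graded modules. -/

section Classification

variable {k : Type u} {H : Type u} [Field k] [Ring H] [HopfAlgebra k H] {R : H ⊗[k] H}
  {V : Type u} [AddCommGroup V] [Module k V] [Module H V] [IsScalarTower k H V]
  {ι : Type} [Fintype ι] [DecidableEq ι] (b : Module.Basis ι k V)
  (S : Type u) [AddCommGroup S] [Module k S] [Module H S] [IsScalarTower k H S]
  [Module.Finite k S] (hR : IsQuasitriangular R) [Module.Finite k (NicholsV k R V)]

theorem stdHead_deg_of_pos {n : ℤ} (hn : 0 < n) : (stdHead b S hR).deg n = ⊥ := by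
  refine eq_bot_iff.2 ?_
  rintro _ ⟨x, hx, rfl⟩
  have h2 : x ∈ (stdMod b S hR).deg n := hx
  rw [stdMod_deg_of_pos b S hR hn, Submodule.mem_bot] at h2
  rw [h2, map_zero]
  exact Submodule.zero_mem _

/-- The inclusion of an `H`-module in the top degree of the head of its standard module. -/
def headEmb : S →ₗ[H] stdHead b S hR := linH (GrMod.Hom.lin (stdHeadπ b S hR)) ∘ₗ stdEmbH b S hR

theorem headEmb_mem (s : S) : headEmb b S hR s ∈ (stdHead b S hR).deg 0 :=
  GrMod.lin_mem (stdHeadπ b S hR) (stdEmb_mem b S hR s)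

theorem exists_headEmb_eq {x : stdHead b S hR} (hx : x ∈ (stdHead b S hR).deg 0) :
    ∃ s, headEmb b S hR s = x := by
  obtain ⟨y, hy, rfl⟩ := hx
  obtain ⟨s, rfl⟩ := stdMod_deg_zero_le b S hR hy
  exact ⟨s, rfl⟩

variable [IsSimpleModule H S]

theorem headEmb_injective : Function.Injective (headEmb b S hR) := by
  refine (injective_iff_map_eq_zero _).2 fun s hs => ?_
  have h1 : stdEmb b S hR s ∈ LinearMap.ker (GrMod.Hom.lin (stdHeadπ b S hR)) := hs
  rw [ker_stdHeadπ] at h1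
  have h2 := h1 1
  rw [one_smul, gproj_stdEmb] at h2
  exact stdEmb_injective b S hR (h2.trans (map_zero _).symm)

theorem stdHead_deg_zero_ne_bot : (stdHead b S hR).deg 0 ≠ ⊥ := by
  intro h
  have := IsSimpleModule.nontrivial H S
  obtain ⟨s, hs⟩ := exists_ne (0 : S)
  have h1 := headEmb_mem b S hR s
  rw [h, Submodule.mem_bot] at h1
  exact hs (headEmb_injective b S hR (h1.trans (map_zero _).symm))

/-- A simple graded module with a simple `H`-submodule of vectors of degree `d` that are killed by
`V̄` is the shift by `d` of the head of a standard module. -/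
theorem nonempty_iso_stdHead {X : SmallGrMod k R V} [Simple X] {d : ℤ} (f : S →ₗ[H] X)
    (hf : f ≠ 0) (hd : ∀ s, f s ∈ X.deg d)
    (hy : ∀ (v : Module.Dual k V) s, ofVbar k R V v • f s = 0) :
    Nonempty (X ≅ (stdHead b S hR).shift d) := by
  obtain ⟨F, hF⟩ := exists_stdMod_desc b S hR (f.restrictScalars k) (fun h s => map_smul f h s)
    hy hd
  have hF0 : F ≠ 0 := by
    rintro rfl
    exact hf (LinearMap.ext fun s => (hF s).symm)
  have hFs : Function.Surjective (GrMod.Hom.lin F) :=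
    (GrMod.epi_iff_surjective F).1 (epi_of_nonzero_to_simple hF0)
  let π : (stdMod b S hR).shift d ⟶ (stdHead b S hR).shift d :=
    GrMod.shiftHom (stdHeadπ b S hR) d
  -- A kernel outside the core would be the whole module and F would be zero.
  have hker : LinearMap.ker (GrMod.Hom.lin F) ≤ LinearMap.ker (GrMod.Hom.lin π) := by
    have h0 : LinearMap.ker (GrMod.Hom.lin π) = coreSub (stdMod b S hR) 0 :=
      (GrMod.ker_shiftHom (stdHeadπ b S hR) d).trans (ker_stdHeadπ b S hR)
    rw [h0]
    by_contra h
    have h1 := eq_top_of_not_le_coreSub b S hR h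
    exact hF0 (GrMod.hom_ext fun x => h1.ge (Submodule.mem_top (x := x)))
  obtain ⟨l, hl⟩ := GrMod.exists_desc hFs π hker
  have hl0 : l ≠ 0 := by
    rintro rfl
    rw [Limits.comp_zero] at hl
    have := IsSimpleModule.nontrivial (SmallU k R V) (stdHead b S hR)
    obtain ⟨x, hx⟩ := exists_ne (0 : stdHead b S hR)
    obtain ⟨y, rfl⟩ := stdHeadπ_surjective b S hR x
    have : GrMod.Hom.lin π y = 0 := hl ▸ rfl
    exact hx this
  have := isIso_of_hom_simple hl0
  exact ⟨asIso l⟩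

/-- The top degree of the source is d and that of the target is at most e, and an injective graded
map cannot raise it. -/
theorem le_of_hom_stdHead_shift (S' : Type u) [AddCommGroup S'] [Module k S'] [Module H S']
    [IsScalarTower k H S'] [Module.Finite k S'] {d e : ℤ}
    (f : (stdHead b S hR).shift d ⟶ (stdHead b S' hR).shift e)
    (hf : Function.Injective (GrMod.Hom.lin f)) : d ≤ e := by
  by_contra! h
  refine stdHead_deg_zero_ne_bot b S hR (eq_bot_iff.2 fun x hx => ?_)
  have h2 := GrMod.unshift_mem f hx
  rw [stdHead_deg_of_pos b S' hR (by omega), Submodule.mem_bot] at h2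
  exact hf (h2.trans (map_zero _).symm)

theorem nonempty_equiv_of_iso (S' : Type u) [AddCommGroup S'] [Module k S'] [Module H S']
    [IsScalarTower k H S'] [Module.Finite k S'] [IsSimpleModule H S'] {d e : ℤ}
    (i : (stdHead b S hR).shift d ≅ (stdHead b S' hR).shift e) :
    d = e ∧ Nonempty (S ≃ₗ[H] S') := by
  have hinj := (GrMod.mono_iff_injective i.hom).1 inferInstance
  obtain rfl : d = e := le_antisymm (le_of_hom_stdHead_shift b S hR S' i.hom hinj)
    (le_of_hom_stdHead_shift b S' hR S i.inv ((GrMod.mono_iff_injective i.inv).1 inferInstance))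
  refine ⟨rfl, ?_⟩
  let g : S →ₗ[H] stdHead b S' hR := linH (GrMod.unshift i.hom) ∘ₗ headEmb b S hR
  have hg : ∀ s, g s ∈ LinearMap.range (headEmb b S' hR) := fun s => by
    have h2 := GrMod.unshift_mem i.hom (headEmb_mem b S hR s)
    rw [add_sub_cancel_right] at h2
    exact exists_headEmb_eq b S' hR h2
  let e := LinearEquiv.ofInjective (headEmb b S' hR) (headEmb_injective b S' hR)
  let φ : S →ₗ[H] S' := e.symm.toLinearMap ∘ₗ g.codRestrict _ hg
  have hφ : Function.Injective φ := e.symm.injective.comp fun s t h => headEmb_injective b S hR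
    (hinj (congrArg Subtype.val h))
  refine ⟨LinearEquiv.ofBijective φ (LinearMap.bijective_of_ne_zero fun h0 => ?_)⟩
  have := IsSimpleModule.nontrivial H S
  obtain ⟨s, hs⟩ := exists_ne (0 : S)
  exact hs (hφ (by rw [h0]; rfl))

theorem finite_of_isSimpleModule [Module.Finite k H] (S : Type u) [AddCommGroup S] [Module k S]
    [Module H S] [IsScalarTower k H S] [IsSimpleModule H S] : Module.Finite k S := by
  have := IsSimpleModule.nontrivial H S
  obtain ⟨s, hs⟩ := exists_ne (0 : S)
  exact Module.Finite.of_surjective ((LinearMap.toSpanSingleton H S s).restrictScalars k)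
    (IsSimpleModule.toSpanSingleton_surjective H hs)

/-- The heads of the standard modules are a complete set of simple graded modules. -/
theorem isCompleteSimple_stdHead [Module.Finite k H] {Λ : Type v} (S : Λ → Type u)
    [∀ l, AddCommGroup (S l)] [∀ l, Module k (S l)] [∀ l, Module H (S l)]
    [∀ l, IsScalarTower k H (S l)] [∀ l, IsSimpleModule H (S l)] [∀ l, Module.Finite k (S l)]
    (hnoniso : ∀ l m, Nonempty (S l ≃ₗ[H] S m) → l = m)
    (hcomplete : ∀ (N : Type u) [AddCommGroup N] [Module H N], IsSimpleModule H N →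
      ∃ l, Nonempty (N ≃ₗ[H] S l)) :
    IsCompleteSimple fun w : Weight Λ => (stdHead b (S w.wt) hR).shift w.deg where
  simple w := inferInstance
  eq_of_iso w w' := fun ⟨i⟩ => by
    obtain ⟨h1, h2⟩ := nonempty_equiv_of_iso b (S w.wt) hR (S w'.wt) i
    exact Weight.ext (hnoniso _ _ h2) h1
  exists_iso X hX := by
    have := X.nontrivial_of_simple
    -- V̄ raises the degree, so it kills the top component. That component contains a simple
    -- H-submodule, which maps a standard module onto X.
    obtain ⟨d, hd, hd'⟩ := X.exists_top_degree
    have : IsArtinian H X := isArtinian_of_tower k inferInstance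
    obtain ⟨T, hT, hTd⟩ := (eq_bot_or_exists_atom_le (degH X d)).resolve_left fun h => hd <|
      eq_bot_iff.2 fun x hx => h.le (show x ∈ degH X d from hx)
    have hTs : IsSimpleModule H T := isSimpleModule_iff_isAtom.2 hT
    obtain ⟨l, ⟨e⟩⟩ := hcomplete T hTs
    refine ⟨⟨l, d⟩, nonempty_iso_stdHead b (S l) hR (T.subtype ∘ₗ e.symm.toLinearMap) ?_
      (fun s => hTd (e.symm s).2) fun v s => ?_⟩
    · intro h
      have := IsSimpleModule.nontrivial H (S l)
      obtain ⟨s, hs⟩ := exists_ne (0 : S l)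
      refine hs (e.symm.injective (Subtype.ext ?_))
      rw [map_zero]
      exact LinearMap.congr_fun h s
    · have := X.smul_mem 1 d _ _ (ofVbar_mem_smallGrading v) (hTd (e.symm s).2)
      rw [hd' _ (by omega), Submodule.mem_bot] at this
      exact this

end Classification

/-! ### The modules 𝔅(V̄) ⊗ W over H and V̄. -/

section Free

variable {k : Type u} {H : Type u} [Field k] [Ring H] [HopfAlgebra k H] {R : H ⊗[k] H}
  {V : Type u} [AddCommGroup V] [Module k V] [Module H V] [IsScalarTower k H V]
  {ι : Type} [Fintype ι] [DecidableEq ι] {b : Module.Basis ι k V}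

local notation "𝒮" => HopfAlgebra.antipode k (A := H)
local notation "𝛒" => matCoeff (H := H) b
local notation "𝐓'" => TensorAlgebra k (Module.Dual k V)
local notation "𝐁'" => Nichols (repVbar k V) (coactVbar k R V)
local notation "π'" => nicholsMk (repVbar k V) (coactVbar k R V)
local notation "aB'" => nicholsAct (repVbar k V) (coactVbar k R V)
local notation "gr'" => LinearMap.range (TensorAlgebra.ι k (M := Module.Dual k V))

theorem tensorAct_mem_range_pow {X : Type u} [AddCommGroup X] [Module k X]
    (ρ : H →ₐ[k] Module.End k X) (h : H) {n : ℕ} {s : TensorAlgebra k X}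
    (hs : s ∈ LinearMap.range (TensorAlgebra.ι k (M := X)) ^ n) :
    tensorAct ρ h s ∈ LinearMap.range (TensorAlgebra.ι k (M := X)) ^ n := by
  induction n generalizing h s with
  | zero =>
    rw [pow_zero] at hs ⊢
    obtain ⟨r, rfl⟩ := Submodule.mem_one.1 hs
    rw [Algebra.algebraMap_eq_smul_one, map_smul, tensorAct_one]
    exact Submodule.smul_mem _ _ (Submodule.smul_mem _ _ (Submodule.one_le.1 le_rfl))
  | succ n ih =>
    rw [pow_succ'] at hs ⊢
    induction hs using Submodule.mul_induction_on' with
    | mem_mul_mem m hm s hs =>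
      obtain ⟨w, rfl⟩ := hm
      rw [tensorAct, (tensorModuleAlgebra ρ).act_mul]
      induction Coalgebra.comul (R := k) h using TensorProduct.induction_on with
      | zero => simp
      | tmul c d =>
        refine Submodule.mul_mem_mul ?_ (ih d hs)
        exact ⟨_, (tensorAct_ι ρ c w).symm⟩
      | add c d hc hd => rw [map_add, map_add]; exact Submodule.add_mem _ hc hd
    | add x _ y _ hx hy => rw [map_add]; exact Submodule.add_mem _ hx hy

variable (W : Type u) [AddCommGroup W] [Module k W] [Module H W] [IsScalarTower k H W]

variable (R V) in
/-- The diagonal action of `H` on `B(V̄) ⊗ W`. -/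
def freeG : H →ₐ[k] Module.End k (𝐁' ⊗[k] W) :=
  (Module.endTensorEndAlgHom (R := k) (S := k) (A := k) (M := 𝐁') (N := W)).comp
    ((Algebra.TensorProduct.map aB' (Algebra.lsmul k k W)).comp (Bialgebra.comulAlgHom k H))

variable (R b) in
/-- The action of `V̄` on `B(V̄) ⊗ W`. -/
def freeY (i : ι) : Module.End k (𝐁' ⊗[k] W) :=
  LinearMap.rTensor W (LinearMap.mulLeft k (π' (TensorAlgebra.ι k (b.dualBasis i))))

omit [Module H W] [IsScalarTower k H W] in
theorem freeY_tmul (i : ι) (t : 𝐓') (w : W) :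
    freeY R b W i (π' t ⊗ₜ w) = π' (TensorAlgebra.ι k (b.dualBasis i) * t) ⊗ₜ w := by
  rw [freeY, LinearMap.rTensor_tmul, LinearMap.mulLeft_apply, map_mul]

theorem freeG_apply (h : H) (x : 𝐁') (w : W) : freeG R V W h (x ⊗ₜ w) =
    TensorProduct.map ((aB').toLinearMap.flip x)
      ((Algebra.lsmul k k W).toLinearMap.flip w) (Coalgebra.comul (R := k) h) := by
  simp only [freeG, AlgHom.comp_apply, Bialgebra.comulAlgHom_apply]
  induction (Coalgebra.comul (R := k) h) using TensorProduct.induction_on with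
  | zero => simp
  | tmul c d =>
    rw [Algebra.TensorProduct.map_tmul, Module.endTensorEndAlgHom_apply]
    simp
  | add c d hc hd => simp only [map_add, LinearMap.add_apply, hc, hd]

theorem freeG_one_tmul (h : H) (w : W) : freeG R V W h (1 ⊗ₜ w) = 1 ⊗ₜ (h • w) := by
  rw [freeG_apply]
  conv_rhs => rw [← hitL_counit (k := k) h, hitL, LinearMap.comp_apply]
  induction (Coalgebra.comul (R := k) h) using TensorProduct.induction_on with
  | zero => simp
  | tmul c d =>
    have : aB' c 1 = Coalgebra.counit (R := k) c • (1 : 𝐁') := by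
      rw [← map_one π', nicholsAct_mk, tensorAct_one, map_smul]
    simp [this, TensorProduct.smul_tmul, smul_assoc]
  | add c d hc hd => simp only [map_add, add_smul, TensorProduct.tmul_add, hc, hd]

theorem freeG_mul_freeY (h : H) (i : ι) : freeG R V W h * freeY R b W i =
    ∑ p, freeY R b W p * freeG R V W (hitL (𝛒 i p ∘ₗ 𝒮) h) := by
  refine TensorProduct.ext' fun x w => ?_
  obtain ⟨t, rfl⟩ := nicholsMk_surjective _ _ x
  simp only [Module.End.mul_apply, LinearMap.sum_apply, freeY_tmul, freeG_apply, comul_hitL]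
  induction (Coalgebra.comul (R := k) h) using TensorProduct.induction_on with
  | zero => simp
  | tmul c d =>
    simp only [TensorProduct.map_tmul, LinearMap.rTensor_tmul, LinearMap.flip_apply,
      AlgHom.toLinearMap_apply, nicholsAct_mk, freeY_tmul]
    rw [tensorAct_ι_mul_of_matrix (repVbar k V) b.dualBasis (fun p i => 𝛒 i p ∘ₗ 𝒮)
      (fun h j => repVbar_basis b h j), map_sum, TensorProduct.sum_tmul]
  | add c d hc hd => simp only [map_add, Finset.sum_add_distrib, hc, hd]

omit [Module H W] [IsScalarTower k H W] in
theorem lift_freeY (t : 𝐓') : TensorAlgebra.lift k (b.dualBasis.constr k (freeY R b W)) t =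
    LinearMap.rTensor W (LinearMap.mulLeft k (π' t)) := by
  induction t using tensorAlgebra_induction b.dualBasis with
  | one =>
    rw [map_one, map_one]
    exact TensorProduct.ext' fun x w => by simp
  | add s t hs ht =>
    rw [map_add, hs, ht, map_add]
    exact TensorProduct.ext' fun x w => by simp [add_mul, TensorProduct.add_tmul]
  | smul c t ht =>
    rw [map_smul, ht, map_smul]
    exact TensorProduct.ext' fun x w => by simp [TensorProduct.smul_tmul']
  | mul i t ht =>
    rw [map_mul, ht, TensorAlgebra.lift_ι_apply, Module.Basis.constr_basis, map_mul]
    exact TensorProduct.ext' fun x w => by simp [freeY]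

theorem isPosRep_free : IsPosRep R b (freeG R V W) (freeY R b W) where
  mul_y := freeG_mul_freeY W
  right t ht := by
    rw [lift_freeY, (nicholsMk_eq_zero _ _).2 ht]
    exact TensorProduct.ext' fun x w => by simp

omit [Module H W] [IsScalarTower k H W] in
theorem free_induction {P : 𝐁' ⊗[k] W → Prop} (b : Module.Basis ι k V)
    (add : ∀ x z, P x → P z → P (x + z)) (smul : ∀ (c : k) x, P x → P (c • x))
    (one : ∀ w : W, P (1 ⊗ₜ w)) (mul : ∀ j x, P x → P (freeY R b W j x))
    (x : 𝐁' ⊗[k] W) : P x := by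
  induction x using TensorProduct.induction_on with
  | zero =>
    have h0 := one 0
    rwa [TensorProduct.tmul_zero] at h0
  | add x z hx hz => exact add x z hx hz
  | tmul x w =>
    obtain ⟨t, rfl⟩ := nicholsMk_surjective _ _ x
    induction t using tensorAlgebra_induction b.dualBasis with
    | one => rw [map_one]; exact one w
    | add s t hs ht => rw [map_add, TensorProduct.add_tmul]; exact add _ _ hs ht
    | smul c t ht => rw [map_smul, ← TensorProduct.smul_tmul']; exact smul _ _ ht
    | mul i t ht =>
      have := mul i _ ht
      rwa [freeY_tmul] at this

/-! #### The grading -/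

variable {W} (D : ℤ → Submodule k W)

variable (R V) in
/-- The component of degree `n` of `B(V̄) ⊗ W`. -/
def freeDeg (n : ℤ) : Submodule k (𝐁' ⊗[k] W) :=
  Submodule.span k {z | ∃ (j : ℕ) (i : ℤ) (t : 𝐓') (w : W),
    t ∈ gr' ^ j ∧ w ∈ D i ∧ i + j = n ∧ π' t ⊗ₜ w = z}

variable {D}

omit [Module H W] [IsScalarTower k H W] in
theorem tmul_mem_freeDeg {j : ℕ} {i n : ℤ} {t : 𝐓'} {w : W} (ht : t ∈ gr' ^ j) (hw : w ∈ D i)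
    (hn : i + j = n) : π' t ⊗ₜ w ∈ freeDeg R V D n :=
  Submodule.subset_span ⟨j, i, t, w, ht, hw, hn, rfl⟩

omit [Module H W] [IsScalarTower k H W] in
theorem one_tmul_mem_freeDeg {n : ℤ} {w : W} (hw : w ∈ D n) :
    (1 : 𝐁') ⊗ₜ w ∈ freeDeg R V D n := by
  rw [← map_one π']
  exact tmul_mem_freeDeg (Submodule.one_le.1 (pow_zero (gr')).ge) hw (by simp)

omit [Module H W] [IsScalarTower k H W] in
theorem freeY_mem (i : ι) (n : ℤ) : ∀ x ∈ freeDeg R V D n,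
    freeY R b W i x ∈ freeDeg R V D (1 + n) := by
  intro x hx
  have : freeDeg R V D n ≤ (freeDeg R V D (1 + n)).comap (freeY R b W i) := by
    refine Submodule.span_le.2 ?_
    rintro _ ⟨j, l, t, w, ht, hw, rfl, rfl⟩
    change freeY R b W i _ ∈ freeDeg R V D _
    rw [freeY_tmul]
    refine tmul_mem_freeDeg (j := j + 1) ?_ hw (by push_cast; ring)
    rw [pow_succ']
    exact Submodule.mul_mem_mul ⟨_, rfl⟩ ht
  exact this hx

theorem freeG_mem (hH : ∀ (h : H) n, ∀ w ∈ D n, h • w ∈ D n) (h : H) (n : ℤ) :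
    ∀ x ∈ freeDeg R V D n, freeG R V W h x ∈ freeDeg R V D n := by
  intro x hx
  have : freeDeg R V D n ≤ (freeDeg R V D n).comap (freeG R V W h) := by
    refine Submodule.span_le.2 ?_
    rintro _ ⟨j, l, t, w, ht, hw, rfl, rfl⟩
    change freeG R V W h _ ∈ freeDeg R V D _
    rw [freeG_apply]
    induction (Coalgebra.comul (R := k) h) using TensorProduct.induction_on with
    | zero => simp
    | tmul c d =>
      have := tmul_mem_freeDeg (R := R) (tensorAct_mem_range_pow (repVbar k V) c ht) (hH d l w hw)
        rfl
      rw [← nicholsAct_mk] at this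
      exact this
    | add c d hc hd => rw [map_add]; exact Submodule.add_mem _ hc hd
  exact this hx

omit [Module H W] [IsScalarTower k H W] in
theorem isInternal_freeDeg (b : Module.Basis ι k V) [Module.Finite k 𝐁'] [Module.Finite k W]
    (hD : DirectSum.IsInternal D) : DirectSum.IsInternal (freeDeg R V D) := by
  obtain ⟨B, hB⟩ := exists_nicholsProj_eq_zero (repVbar k V) (coactVbar k R V)
  let p : ℤ → Module.End k (𝐁' ⊗[k] W) := fun n => ∑ l ∈ Finset.range B,
    TensorProduct.map (nicholsProj _ _ l) (gradedProj hD (n - l))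
  have key : ∀ n m : ℤ, ∀ z ∈ freeDeg R V D m, p n z = if m = n then z else 0 := by
    intro n m z hz
    induction hz using Submodule.span_induction with
    | zero => simp
    | add x y _ _ hx hy => rw [map_add, hx, hy]; split_ifs <;> simp
    | smul c x _ hx => rw [map_smul, hx]; split_ifs <;> simp
    | mem z hz =>
      obtain ⟨j, i, t, w, ht, hw, rfl, rfl⟩ := hz
      simp only [p, LinearMap.sum_apply, TensorProduct.map_tmul, gradedProj_of_mem hD hw,
        nicholsProj_mk_of_mem _ _ ht]
      by_cases hj : j < B
      · rw [Finset.sum_eq_single_of_mem j (Finset.mem_range.2 hj)]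
        · have : i = n - j ↔ i + j = n := by omega
          simp only [this, if_true]
          split_ifs <;> simp
        · intro l _ hl
          rw [if_neg hl, TensorProduct.zero_tmul]
      · have h0 : π' t = 0 := by
          have h1 := nicholsProj_mk_of_mem (repVbar k V) (coactVbar k R V) ht j
          rwa [if_pos rfl, hB j (not_lt.1 hj), LinearMap.zero_apply, eq_comm] at h1
        simp [h0]
  refine isInternal_of_proj p (fun n z hz => (key n n z hz).trans (if_pos rfl))
    (fun n m hmn z hz => (key n m z hz).trans (if_neg hmn)) ?_
  refine eq_top_iff.2 fun z _ => ?_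
  induction z using free_induction W b with
  | add x z hx hz => exact Submodule.add_mem _ (hx trivial) (hz trivial)
  | smul c x hx => exact Submodule.smul_mem _ c (hx trivial)
  | one w =>
    induction w using graded_induction hD with
    | add x y hx hy => rw [TensorProduct.tmul_add]; exact Submodule.add_mem _ (hx trivial) (hy trivial)
    | hom n x hx => exact Submodule.mem_iSup_of_mem n (one_tmul_mem_freeDeg hx)
  | mul j x hx =>
    have : ⨆ n, freeDeg R V D n ≤ (⨆ n, freeDeg R V D n).comap (freeY R b W j) :=
      iSup_le fun n x hx => Submodule.mem_iSup_of_mem _ (freeY_mem j n x hx)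
    exact this (hx trivial)

variable (R b) in
/-- The graded module `B(V̄) ⊗ W` over `H` and `V̄`. -/
def freePos [Module.Finite k W] [Module.Finite k 𝐁'] (hD : DirectSum.IsInternal D)
    (hH : ∀ (h : H) n, ∀ w ∈ D n, h • w ∈ D n) : PosMod R b where
  carrier := 𝐁' ⊗[k] W
  g := freeG R V W
  y := freeY R b W
  isPosRep := isPosRep_free W
  deg := freeDeg R V D
  internal := isInternal_freeDeg b hD
  g_mem := freeG_mem hH
  y_mem := freeY_mem

end Free

/-! ### Free graded modules and enough projectives. -/

section Projectives

variable {k : Type u} {H : Type u} [Field k] [Ring H] [HopfAlgebra k H] {R : H ⊗[k] H}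
  {V : Type u} [AddCommGroup V] [Module k V] [Module H V] [IsScalarTower k H V]
  {ι : Type} [Fintype ι] [DecidableEq ι] {b : Module.Basis ι k V}

local notation "𝒮" => HopfAlgebra.antipode k (A := H)
local notation "𝛒" => matCoeff (H := H) b
local notation "𝐓'" => TensorAlgebra k (Module.Dual k V)
local notation "𝐁'" => Nichols (repVbar k V) (coactVbar k R V)
local notation "π'" => nicholsMk (repVbar k V) (coactVbar k R V)
local notation "gr'" => LinearMap.range (TensorAlgebra.ι k (M := Module.Dual k V))

theorem uVbar_ι (v : Module.Dual k V) : uVbar k R V (TensorAlgebra.ι k v) = ofVbar k R V v := rfl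

theorem uVbar_mem_smallGrading {n : ℕ} {t : 𝐓'} (ht : t ∈ gr' ^ n) :
    uVbar k R V t ∈ smallGrading k R V n := by
  induction n generalizing t with
  | zero =>
    rw [pow_zero] at ht
    obtain ⟨r, rfl⟩ := Submodule.mem_one.1 ht
    rw [AlgHom.commutes, Algebra.algebraMap_eq_smul_one]
    exact Submodule.smul_mem _ _ (Submodule.subset_span ⟨[], by simp, by simp⟩)
  | succ n ih =>
    rw [pow_succ'] at ht
    induction ht using Submodule.mul_induction_on' with
    | mem_mul_mem m hm s hs =>
      obtain ⟨w, rfl⟩ := hm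
      rw [map_mul, show ((n + 1 : ℕ) : ℤ) = 1 + n by push_cast; ring]
      exact mul_mem_smallGrading (ofVbar_mem_smallGrading w) (ih hs)
    | add x _ y _ hx hy => rw [map_add]; exact Submodule.add_mem _ hx hy

variable (k R V) in
/-- The map `B(V̄) → u_(H,R)(V)`. -/
def uBbar : 𝐁' →ₗ[k] SmallU k R V :=
  (LinearMap.ker (π').toLinearMap).liftQ (uVbar k R V).toLinearMap
    (fun _ ht => uVbar_eq_zero ((nicholsMk_eq_zero _ _).1 ht)) ∘ₗ
  ((π').toLinearMap.quotKerEquivOfSurjective (nicholsMk_surjective _ _)).symm.toLinearMap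

theorem uBbar_mk (t : 𝐓') : uBbar k R V (π' t) = uVbar k R V t := by
  have : ((π').toLinearMap.quotKerEquivOfSurjective
      (nicholsMk_surjective _ _)).symm (π' t) = Submodule.Quotient.mk t := by
    rw [LinearEquiv.symm_apply_eq]
    rfl
  rw [uBbar, LinearMap.comp_apply, LinearEquiv.coe_coe, this]
  rfl

variable {W : Type u} [AddCommGroup W] [Module k W] [Module H W] [IsScalarTower k H W]
  [Module.Finite k W] {D : ℤ → Submodule k W} (hD : DirectSum.IsInternal D)
  (hH : ∀ (h : H) n, ∀ w ∈ D n, h • w ∈ D n)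
  (hR : IsQuasitriangular R) [Module.Finite k (NicholsV k R V)]
  [Module.Finite k (Nichols (repVbar k V) (coactVbar k R V))]

variable (b) in
/-- The graded module generated freely by a graded `H`-module. -/
def freeMod : SmallGrMod k R V := (freePos R b hD hH).ind hR

variable (b) in
/-- The inclusion of `B(V̄) ⊗ W`. -/
def freeEmb : 𝐁' ⊗[k] W →ₗ[k] freeMod b hD hH hR := (freePos R b hD hH).emb hR

theorem freeEmb_freeY (j : ι) (x : 𝐁' ⊗[k] W) : freeEmb b hD hH hR (freeY R b W j x) =
    ofVbar k R V (b.dualBasis j) • freeEmb b hD hH hR x :=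
  ((freePos R b hD hH).ofVbar_smul_emb hR j x).symm

variable (b) in
/-- The inclusion of the generators. -/
def freeGen : W →ₗ[k] freeMod b hD hH hR := freeEmb b hD hH hR ∘ₗ TensorProduct.mk k 𝐁' W 1

theorem freeGen_mem {n : ℤ} {w : W} (hw : w ∈ D n) :
    freeGen b hD hH hR w ∈ (freeMod b hD hH hR).deg n :=
  (freePos R b hD hH).emb_mem hR (one_tmul_mem_freeDeg hw)

theorem freeGen_smul (h : H) (w : W) :
    freeGen b hD hH hR (h • w) = h • freeGen b hD hH hR w := by
  refine Eq.trans ?_ ((freePos R b hD hH).ofH_smul_emb hR h (1 ⊗ₜ w)).symm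
  exact congrArg ((freePos R b hD hH).emb hR) (freeG_one_tmul W h w).symm

theorem freeMod_hom_ext {Y : SmallGrMod k R V} {F G : freeMod b hD hH hR ⟶ Y}
    (h : ∀ w, GrMod.Hom.lin F (freeGen b hD hH hR w) = GrMod.Hom.lin G (freeGen b hD hH hR w)) :
    F = G := by
  refine GrMod.hom_ext (PosMod.hom_ext (N := freePos R b hD hH) hR fun m => ?_)
  change 𝐁' ⊗[k] W at m
  change GrMod.Hom.lin F (freeEmb b hD hH hR m) = GrMod.Hom.lin G (freeEmb b hD hH hR m)
  induction m using free_induction W b with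
  | add x z hx hz => rw [map_add, map_add, map_add, hx, hz]
  | smul c x hx =>
    rw [map_smul, LinearMap.map_smul_of_tower, LinearMap.map_smul_of_tower, hx]
  | one w => exact h w
  | mul j x hx => rw [freeEmb_freeY, map_smul, map_smul, hx]

/-- Together with `freeMod_hom_ext` this makes the free module left adjoint to restriction to graded
H-modules: f is extended first over 𝔅(V̄) and then, by Frobenius reciprocity, over 𝔅(V). -/
theorem exists_freeMod_desc {Y : SmallGrMod k R V} (f : W →ₗ[H] Y)
    (hf : ∀ n, ∀ w ∈ D n, f w ∈ Y.deg n) :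
    ∃ F : freeMod b hD hH hR ⟶ Y, ∀ w, GrMod.Hom.lin F (freeGen b hD hH hR w) = f w := by
  let F : 𝐁' ⊗[k] W →ₗ[k] Y := TensorProduct.lift
    (((Algebra.lsmul k k Y).toLinearMap.compl₁₂ (uBbar k R V) LinearMap.id).compl₂
      (f.restrictScalars k))
  have hF : ∀ t w, F (π' t ⊗ₜ w) = uVbar k R V t • f w := fun t w => by rw [← uBbar_mk]; rfl
  have hF1 : ∀ w, F (1 ⊗ₜ w) = f w := fun w => by rw [← map_one π', hF, map_one, one_smul]
  have hFy : ∀ i x, F (freeY R b W i x) = ofVbar k R V (b.dualBasis i) • F x := by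
    intro i x
    induction x using TensorProduct.induction_on with
    | zero => simp
    | add x z hx hz => simp only [map_add, smul_add, hx, hz]
    | tmul x w =>
      obtain ⟨t, rfl⟩ := nicholsMk_surjective _ _ x
      rw [freeY_tmul, hF, hF, map_mul, mul_smul, uVbar_ι]
  have hFh : ∀ (x : 𝐁' ⊗[k] W) h, F (freeG R V W h x) = ofH k R V h • F x := by
    intro x
    induction x using free_induction W b with
    | add x z hx hz => intro h; simp only [map_add, smul_add, hx, hz]
    | smul c x hx => intro h; simp only [map_smul, smul_comm _ c, hx]
    | one w => intro h; rw [freeG_one_tmul, hF1, hF1, map_smul]; rfl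
    | mul j x hx =>
      intro h
      have := LinearMap.congr_fun (freeG_mul_freeY (R := R) (b := b) W h j) x
      simp only [Module.End.mul_apply, LinearMap.sum_apply] at this
      rw [this, hFy, ← mul_smul, (isURep_ofH (R := R) (V := V) b hR).mul_y, Finset.sum_smul,
        map_sum]
      simp only [hFy, hx, mul_smul]
  obtain ⟨G, hG⟩ := PosMod.exists_desc (N := freePos R b hD hH) hR F (fun h m => hFh m h) hFy
    fun n m hm => by
      have : freeDeg R V D n ≤ (Y.deg n).comap F := by
        refine Submodule.span_le.2 ?_
        rintro _ ⟨j, i, t, w, ht, hw, rfl, rfl⟩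
        change F _ ∈ Y.deg _
        rw [hF, add_comm]
        exact Y.smul_mem _ _ _ _ (uVbar_mem_smallGrading ht) (hf i w hw)
      exact this hm
  exact ⟨G, fun w => (hG _).trans (hF1 w)⟩

omit [Module.Finite k (NicholsV k R V)]
  [Module.Finite k (Nichols (repVbar k V) (coactVbar k R V))] in
/-- Over a semisimple Hopf algebra, an epimorphism of graded modules has an `H`-linear section of
degree zero. -/
theorem exists_graded_section [IsSemisimpleRing H] {X Y : SmallGrMod k R V} (e : X ⟶ Y)
    (he : Function.Surjective (GrMod.Hom.lin e)) :
    ∃ σ : Y →ₗ[H] X, (∀ y, GrMod.Hom.lin e (σ y) = y) ∧ ∀ n, ∀ y ∈ Y.deg n, σ y ∈ X.deg n := by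
  have := Module.projective_of_isSemisimpleRing H Y
  obtain ⟨τ, hτ⟩ := Module.projective_lifting_property (linH (GrMod.Hom.lin e)) LinearMap.id he
  obtain ⟨s, -, hs⟩ := exists_sum_gradedProj Y.internal
  -- The section τ need not be homogeneous. Its part of degree zero is again H-linear and still a
  -- section.
  let σ : Y →ₗ[H] X :=
    { toFun := fun y => ∑ n ∈ s, X.gproj n (τ (Y.gproj n y))
      map_add' := fun x y => by simp only [map_add, Finset.sum_add_distrib]
      map_smul' := fun h y => by
        simp only [gproj_H_smul, map_smul, RingHom.id_apply, Finset.smul_sum] }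
  refine ⟨σ, fun y => ?_, fun n y hy => ?_⟩
  · conv_rhs => rw [← hs y]
    change GrMod.Hom.lin e (∑ n ∈ s, X.gproj n (τ (Y.gproj n y))) = _
    rw [map_sum]
    refine Finset.sum_congr rfl fun n _ => ?_
    have h1 : GrMod.Hom.lin e (τ (Y.gproj n y)) = Y.gproj n y := LinearMap.congr_fun hτ _
    rw [GrMod.lin_gproj, h1, gradedProj_gradedProj, if_pos rfl]
  · refine Submodule.sum_mem _ fun m _ => ?_
    rw [gradedProj_of_mem Y.internal hy]
    split_ifs with h
    · rw [h]; exact gradedProj_mem _ _ _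
    · rw [map_zero, map_zero]; exact Submodule.zero_mem _

/-- By the adjunction it is enough to lift an H-linear map of degree zero on W, and the graded
section of the epimorphism does this. -/
theorem projective_freeMod [IsSemisimpleRing H] : Projective (freeMod b hD hH hR) where
  factors {X Y} f e he := by
    obtain ⟨σ, h1, h2⟩ := exists_graded_section e ((GrMod.epi_iff_surjective e).1 he)
    let g : W →ₗ[H] X := σ ∘ₗ
      { toFun := fun w => GrMod.Hom.lin f (freeGen b hD hH hR w)
        map_add' := fun x y => by rw [map_add, map_add]
        map_smul' := fun h w => by
          rw [freeGen_smul]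
          exact map_smul (GrMod.Hom.lin f) (ofH k R V h) _ }
    obtain ⟨F, hF⟩ := exists_freeMod_desc (b := b) hD hH hR g fun n w hw =>
      h2 n _ (GrMod.lin_mem f (freeGen_mem hD hH hR hw))
    refine ⟨F, freeMod_hom_ext hD hH hR fun w => ?_⟩
    rw [GrMod.lin_comp, hF]
    exact h1 _

include b in
theorem enoughProjectives [IsSemisimpleRing H] (hR : IsQuasitriangular R) :
    EnoughProjectives (SmallGrMod k R V) where
  presentation X := by
    obtain ⟨F, hF⟩ := exists_freeMod_desc (b := b) X.internal (fun h n w hw => H_smul_mem X h hw)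
      hR (LinearMap.id : X →ₗ[H] X) fun n w hw => hw
    exact ⟨{ p := freeMod b X.internal (fun h n w hw => H_smul_mem X h hw) hR
             projective := projective_freeMod _ _ hR
             f := F
             epi := (GrMod.epi_iff_surjective F).2 fun x => ⟨_, hF x⟩ }⟩

end Projectives

theorem GrMod.finrank_add_finrank_ker {k : Type u} [Field k] {A : Type u} [Ring A] [Algebra k A]
    {𝒜 : ℤ → Submodule k A} {M N : GrMod k 𝒜} (f : M ⟶ N)
    (hf : Function.Surjective (GrMod.Hom.lin f)) :
    Module.finrank k N + Module.finrank k (M.sub _ (GrMod.gproj_mem_ker f)) =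
      Module.finrank k M := by
  have h := LinearMap.finrank_range_add_finrank_ker ((GrMod.Hom.lin f).restrictScalars k)
  have h2 : LinearMap.range ((GrMod.Hom.lin f).restrictScalars k) = ⊤ :=
    LinearMap.range_eq_top.2 hf
  rw [h2, finrank_top] at h
  exact h

/-! ### Freeness over 𝔅(V) by dimension count. -/

section Freeness

variable {k : Type u} {H : Type u} [Field k] [Ring H] [HopfAlgebra k H] {R : H ⊗[k] H}
  {V : Type u} [AddCommGroup V] [Module k V] [Module H V] [IsScalarTower k H V]
  {ι : Type} [Fintype ι] [DecidableEq ι]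

theorem map_mem_vSub {X Y : SmallGrMod k R V} (f : X →ₗ[SmallU k R V] Y) {x : X}
    (hx : x ∈ vSub X) : f x ∈ vSub Y := by
  have : vSub X ≤ (vSub Y).comap (f.restrictScalars k) := vSub_le fun v x => by
    change f (ofV k R V v • x) ∈ vSub Y
    rw [map_smul]
    exact ofV_smul_mem_vSub v (f x)
  exact this hx

theorem gproj_mem_vSub {X : SmallGrMod k R V} {x : X} (hx : x ∈ vSub X) (n : ℤ) :
    X.gproj n x ∈ vSub X := by
  have : vSub X ≤ (vSub X).comap (X.gproj n) := vSub_le fun v x => by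
    change X.gproj n (ofV k R V v • x) ∈ vSub X
    have := GrMod.smul_gproj (ofV_mem_smallGrading (R := R) v) (n + 1) x
    rw [neg_add_cancel_comm_assoc] at this
    rw [← this]
    exact ofV_smul_mem_vSub v _
  exact this hx

theorem H_smul_mem_vSub (b : Module.Basis ι k V) (hR : IsQuasitriangular R) {X : SmallGrMod k R V} (h : H) {x : X}
    (hx : x ∈ vSub X) : h • x ∈ vSub X := by
  have : vSub X ≤ (vSub X).comap (Algebra.lsmul k k X h) := vSub_le fun v x => by
    change ofH k R V h • ofV k R V v • x ∈ vSub X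
    rw [← b.sum_repr v, map_sum, Finset.sum_smul, Finset.smul_sum]
    refine Submodule.sum_mem _ fun j _ => ?_
    rw [map_smul, smul_assoc, smul_comm]
    refine Submodule.smul_mem _ _ ?_
    rw [← mul_smul, (isURep_ofH (R := R) (V := V) b hR).mul_x, Finset.sum_smul]
    exact Submodule.sum_mem _ fun i _ => by rw [mul_smul]; exact ofV_smul_mem_vSub _ _
  exact this hx

/-- The subspace `V P` of a graded module. -/
def vSpan {X : SmallGrMod k R V} (P : Submodule k X) : Submodule k X :=
  Submodule.span k {z | ∃ (v : V), ∃ x ∈ P, ofV k R V v • x = z}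

theorem ofV_smul_mem_vSpan {X : SmallGrMod k R V} {P : Submodule k X} (v : V) {x : X}
    (hx : x ∈ P) : ofV k R V v • x ∈ vSpan P :=
  Submodule.subset_span ⟨v, x, hx, rfl⟩

theorem vSpan_le {X : SmallGrMod k R V} {P Q : Submodule k X}
    (h : ∀ (v : V), ∀ x ∈ P, ofV k R V v • x ∈ Q) : vSpan P ≤ Q := by
  refine Submodule.span_le.2 ?_
  rintro _ ⟨v, x, hx, rfl⟩
  exact h v x hx

theorem gproj_mem_span {X : SmallGrMod k R V} {s : Set X}
    (hs : ∀ x ∈ s, ∀ n, X.gproj n x ∈ Submodule.span (SmallU k R V) s) :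
    ∀ x ∈ Submodule.span (SmallU k R V) s, ∀ n, X.gproj n x ∈ Submodule.span (SmallU k R V) s := by
  intro x hx
  induction hx using Submodule.span_induction with
  | mem x hx => exact hs x hx
  | zero => intro n; rw [map_zero]; exact Submodule.zero_mem _
  | add x y _ _ hx hy => intro n; rw [map_add]; exact Submodule.add_mem _ (hx n) (hy n)
  | smul a x _ hx =>
    intro n
    induction a using smallU_hom_induction with
    | add a c ha hc => rw [add_smul, map_add]; exact Submodule.add_mem _ ha hc
    | hom i a ha =>
      have := GrMod.smul_gproj ha (n - i) x
      rw [add_sub_cancel] at this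
      rw [← this]
      exact Submodule.smul_mem _ _ (hx _)

/-- The submodule generated by a subspace that is stable under `H` and `V̄`. -/
theorem span_le_sup_vSpan (b : Module.Basis ι k V) (hR : IsQuasitriangular R)
    {X : SmallGrMod k R V} (P : Submodule k X) (hH : ∀ h, ∀ x ∈ P, ofH k R V h • x ∈ P)
    (hy : ∀ v, ∀ x ∈ P, ofVbar k R V v • x ∈ P) :
    (Submodule.span (SmallU k R V) (P : Set X)).restrictScalars k ≤
      P ⊔ vSpan ((Submodule.span (SmallU k R V) (P : Set X)).restrictScalars k) := by
  set N := (Submodule.span (SmallU k R V) (P : Set X)).restrictScalars k with hN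
  -- Z is the closure of P under V alone. The commutation relations make it stable under H and V̄,
  -- so it contains the submodule generated by P.
  let Z : Submodule k X := sInf {Q | P ≤ Q ∧ ∀ j, ∀ x ∈ Q, ofV k R V (b j) • x ∈ Q}
  have hPZ : P ≤ Z := le_sInf fun Q hQ => hQ.1
  have hZV : ∀ j, ∀ x ∈ Z, ofV k R V (b j) • x ∈ Z := fun j x hx =>
    Submodule.mem_sInf.2 fun Q hQ => hQ.2 j x (Submodule.mem_sInf.1 hx Q hQ)
  have hind : ∀ Q : Submodule k X, P ≤ Q → (∀ j, ∀ x ∈ Q, ofV k R V (b j) • x ∈ Q) → Z ≤ Q :=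
    fun Q h1 h2 => sInf_le ⟨h1, h2⟩
  have hU := isURep_ofH (R := R) (V := V) b hR
  have hZH : ∀ h, ∀ x ∈ Z, ofH k R V h • x ∈ Z := by
    have : Z ≤ ⨅ h, Z.comap (Algebra.lsmul k k X (ofH k R V h)) := by
      refine hind _ (le_iInf fun h x hx => hPZ (hH h x hx)) fun j x hx => ?_
      rw [Submodule.mem_iInf] at hx ⊢
      intro h
      change ofH k R V h • ofV k R V (b j) • x ∈ Z
      rw [← mul_smul, hU.mul_x, Finset.sum_smul]
      refine Submodule.sum_mem _ fun i _ => ?_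
      rw [mul_smul]
      exact hZV i _ (hx _)
    exact fun h x hx => (Submodule.mem_iInf _).1 (this hx) h
  have hZy : ∀ i, ∀ x ∈ Z, ofVbar k R V (b.dualBasis i) • x ∈ Z := by
    -- The intersection with Z keeps x itself in Z, as the terms δᵢⱼ and zᵢⱼ of the cross relation
    -- require.
    have : Z ≤ Z ⊓ ⨅ i, Z.comap (Algebra.lsmul k k X (ofVbar k R V (b.dualBasis i))) := by
      refine hind _ (le_inf hPZ (le_iInf fun i x hx => hPZ (hy _ x hx))) fun j x hx => ?_
      refine ⟨hZV j x hx.1, ?_⟩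
      have hx' := (Submodule.mem_iInf _).1 hx.2
      refine (Submodule.mem_iInf _).2 fun i => ?_
      change ofVbar k R V (b.dualBasis i) • ofV k R V (b j) • x ∈ Z
      rw [← mul_smul, hU.cross, sub_smul, add_smul, Finset.sum_smul]
      refine Submodule.sub_mem _ (Submodule.add_mem _ (Submodule.sum_mem _ fun p _ => ?_) ?_)
        (hZH _ x hx.1)
      · rw [Finset.sum_smul]
        refine Submodule.sum_mem _ fun q _ => ?_
        rw [smul_assoc, mul_smul]
        exact Submodule.smul_mem _ _ (hZV p _ (hx' q))
      · split_ifs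
        · rw [one_smul]; exact hx.1
        · rw [zero_smul]; exact Submodule.zero_mem _
    exact fun i x hx => (Submodule.mem_iInf _).1 (this hx).2 i
  have hNZ : N ≤ Z := by
    let Z' : Submodule (SmallU k R V) X :=
      { Z with smul_mem' := fun a x hx => smallU_smul_mem b Z hZH hZV hZy a x hx }
    exact fun x hx => (Submodule.span_le (p := Z')).2 hPZ hx
  have hPN : P ≤ N := Submodule.subset_span (R := SmallU k R V)
  have hVN : vSpan N ≤ N := vSpan_le fun v x hx =>
    Submodule.smul_mem (Submodule.span (SmallU k R V) (P : Set X)) _ hx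
  exact hNZ.trans (hind _ le_sup_left fun j x hx =>
    Submodule.mem_sup_right (ofV_smul_mem_vSpan _ (sup_le hPN hVN hx)))

/-! #### Modules that are free over `B(V)` -/

/-- The graded module `X` is free over `B(V)`. -/
def IsVFree (X : SmallGrMod k R V) : Prop :=
  Module.finrank k (NicholsV k R V) * Module.finrank k (X ⧸ vSub X) ≤ Module.finrank k X

variable [Module.Finite k (NicholsV k R V)]

theorem PosMod.isVFree_ind {b : Module.Basis ι k V} (N : PosMod R b) (hR : IsQuasitriangular R) :
    IsVFree (N.ind hR) := by
  rw [IsVFree, N.finrank_ind hR]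
  exact Nat.mul_le_mul_left _ (N.finrank_quotient_vSub_le hR)

/-- A retract of a free module is free. -/
theorem IsVFree.of_retract {X P : SmallGrMod k R V} (hX : IsVFree X) (i : P ⟶ X) (r : X ⟶ P)
    (hir : i ≫ r = 𝟙 P) : IsVFree P := by
  have hri : ∀ x, GrMod.Hom.lin r (GrMod.Hom.lin i x) = x := fun x =>
    congrArg (fun f => GrMod.Hom.lin f x) hir
  let K := X.sub _ (GrMod.gproj_mem_ker r)
  let s : X →ₗ[SmallU k R V] K := (LinearMap.id - GrMod.Hom.lin i ∘ₗ GrMod.Hom.lin r).codRestrict _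
    fun x => by simp [hri]
  have hs : ∀ x : K, s (x : LinearMap.ker (GrMod.Hom.lin r)).1 = x := fun x => Subtype.ext <| by
    have : GrMod.Hom.lin r (x : LinearMap.ker (GrMod.Hom.lin r)).1 = 0 := x.2
    change (x : LinearMap.ker (GrMod.Hom.lin r)).1 - GrMod.Hom.lin i (GrMod.Hom.lin r _) = _
    rw [this, map_zero, sub_zero]
  have hsi : ∀ x, s (GrMod.Hom.lin i x) = 0 := fun x => Subtype.ext <| by
    change GrMod.Hom.lin i x - GrMod.Hom.lin i (GrMod.Hom.lin r _) = 0
    rw [hri, sub_self]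
  let F : X →ₗ[k] (P ⧸ vSub P) × (K ⧸ vSub K) :=
    ((vSub P).mkQ ∘ₗ (GrMod.Hom.lin r).restrictScalars k).prod
      ((vSub K).mkQ ∘ₗ s.restrictScalars k)
  have hF : vSub X ≤ LinearMap.ker F := fun x hx => Prod.ext
    ((Submodule.Quotient.mk_eq_zero _).2 (map_mem_vSub (GrMod.Hom.lin r) hx))
    ((Submodule.Quotient.mk_eq_zero _).2 (map_mem_vSub s hx))
  have hFs : Function.Surjective F := by
    rintro ⟨p, q⟩
    obtain ⟨p, rfl⟩ := (vSub P).mkQ_surjective p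
    obtain ⟨q, rfl⟩ := (vSub K).mkQ_surjective q
    refine ⟨GrMod.Hom.lin i p + (q : LinearMap.ker (GrMod.Hom.lin r)).1, Prod.ext ?_ ?_⟩
    · have : GrMod.Hom.lin r (q : LinearMap.ker (GrMod.Hom.lin r)).1 = 0 := q.2
      change (vSub P).mkQ (GrMod.Hom.lin r (_ + _)) = _
      rw [map_add, this, add_zero, hri]
    · change (vSub K).mkQ (s (_ + _)) = _
      rw [map_add, hsi, zero_add, hs]
  have h1 : Module.finrank k (P ⧸ vSub P) + Module.finrank k (K ⧸ vSub K) ≤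
      Module.finrank k (X ⧸ vSub X) := by
    rw [← Module.finrank_prod]
    refine LinearMap.finrank_le_finrank_of_surjective (f := (vSub X).liftQ F hF) ?_
    intro z
    obtain ⟨x, rfl⟩ := hFs z
    exact ⟨(vSub X).mkQ x, rfl⟩
  have h2 : Module.finrank k P + Module.finrank k K = Module.finrank k X :=
    GrMod.finrank_add_finrank_ker r fun x => ⟨_, hri x⟩
  -- X splits as P ⊕ K, and dim X and dim X/VX split accordingly. The bound that K satisfies in any
  -- case, subtracted from the inequality for X, leaves the one for P.
  have h3 := finrank_le_mul_finrank_quotient K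
  have h4 := Nat.mul_le_mul_left (Module.finrank k (NicholsV k R V)) h1
  rw [mul_add] at h4
  have h5 : _ ≤ _ := hX
  rw [IsVFree]
  omega

end Freeness

theorem GrMod.finrank_quot_add_finrank_sub {k : Type u} [Field k] {A : Type u} [Ring A]
    [Algebra k A] {𝒜 : ℤ → Submodule k A} (M : GrMod k 𝒜) (N : Submodule A M)
    (hN : ∀ x ∈ N, ∀ n, M.gproj n x ∈ N) :
    Module.finrank k (M.quot N hN) + Module.finrank k (M.sub N hN) = Module.finrank k M := by
  have h := LinearMap.finrank_range_add_finrank_ker (N.mkQ.restrictScalars k)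
  have h2 : LinearMap.range (N.mkQ.restrictScalars k) = ⊤ :=
    LinearMap.range_eq_top.2 N.mkQ_surjective
  have h3 : LinearMap.ker (N.mkQ.restrictScalars k) = N.restrictScalars k :=
    Submodule.ext fun x => Submodule.Quotient.mk_eq_zero N
  rw [h2, finrank_top, h3] at h
  exact h

/-! ### Splitting off a standard quotient from a free module. -/

section TopLayer

variable {k : Type u} {H : Type u} [Field k] [Ring H] [HopfAlgebra k H] {R : H ⊗[k] H}
  {V : Type u} [AddCommGroup V] [Module k V] [Module H V] [IsScalarTower k H V]
  {ι : Type} [Fintype ι] [DecidableEq ι]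
  {X : SmallGrMod k R V} {S : Type u} [AddCommGroup S] [Module k S] [Module H S]
  [IsScalarTower k H S] {d : ℤ} {p : X →ₗ[H] S}

theorem vSpan_le_vSub {X : SmallGrMod k R V} (P : Submodule k X) : vSpan P ≤ vSub X :=
  vSpan_le fun v x _ => ofV_smul_mem_vSub v x

theorem gproj_ofVbar_smul (X : SmallGrMod k R V) (n : ℤ) (v : Module.Dual k V) (x : X) :
    X.gproj n (ofVbar k R V v • x) = ofVbar k R V v • X.gproj (n - 1) x := by
  have := GrMod.smul_gproj (ofVbar_mem_smallGrading (R := R) v) (n - 1) x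
  rw [add_sub_cancel] at this
  exact this.symm

theorem gproj_ofV_smul (X : SmallGrMod k R V) (n : ℤ) (v : V) (x : X) :
    X.gproj n (ofV k R V v • x) = ofV k R V v • X.gproj (n + 1) x := by
  have := GrMod.smul_gproj (ofV_mem_smallGrading (R := R) v) (n + 1) x
  rw [neg_add_cancel_comm_assoc] at this
  exact this.symm

variable (d p) in
/-- The kernel of `p`, without the components of degree less than `d`. -/
def topSub : Submodule k X where
  carrier := {x | p x = 0 ∧ ∀ n < d, X.gproj n x = 0}
  add_mem' hx hy := ⟨by rw [map_add, hx.1, hy.1, add_zero],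
    fun n hn => by rw [map_add, hx.2 n hn, hy.2 n hn, add_zero]⟩
  zero_mem' := ⟨map_zero _, fun n _ => map_zero _⟩
  smul_mem' c x hx := ⟨by rw [LinearMap.map_smul_of_tower, hx.1, smul_zero],
    fun n hn => by rw [map_smul, hx.2 n hn, smul_zero]⟩

variable (d p) in
/-- The submodule generated by `topSub d p`. -/
def topSpan : Submodule (SmallU k R V) X := Submodule.span _ (topSub d p : Set X)

theorem topSub_le_topSpan : topSub d p ≤ (topSpan d p).restrictScalars k :=
  Submodule.subset_span (R := SmallU k R V)

variable (hp : ∀ x, p (X.gproj d x) = p x)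
include hp

theorem mem_topSub_of_gproj {x : X} (hx : ∀ n ≤ d, X.gproj n x = 0) : x ∈ topSub d p :=
  ⟨by rw [← hp, hx d le_rfl, map_zero], fun n hn => hx n hn.le⟩

theorem gproj_mem_topSub {x : X} (hx : x ∈ topSub d p) (m : ℤ) : X.gproj m x ∈ topSub d p := by
  refine ⟨?_, fun n hn => ?_⟩
  · rw [← hp, gradedProj_gradedProj]
    split_ifs with h
    · rw [h, hp]; exact hx.1
    · exact map_zero _
  · rw [gradedProj_gradedProj]
    split_ifs with h
    · rw [h]; exact hx.2 n hn
    · rfl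

theorem gproj_mem_topSpan : ∀ x ∈ topSpan d p, ∀ n, X.gproj n x ∈ topSpan d p :=
  gproj_mem_span fun _ hx n => topSub_le_topSpan (gproj_mem_topSub hp hx n)

/-- `topSub` is stable under H because p is H-linear, and under V̄ because V̄ moves it into degrees
above d, where p vanishes. -/
theorem topSpan_le (b : Module.Basis ι k V) (hR : IsQuasitriangular R) :
    (topSpan d p).restrictScalars k ≤ topSub d p ⊔ vSpan ((topSpan d p).restrictScalars k) := by
  refine span_le_sup_vSpan b hR (topSub d p) (fun h x hx => ⟨?_, fun n hn => ?_⟩)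
    (fun v x hx => mem_topSub_of_gproj hp fun n hn => ?_)
  · change p (h • x) = 0
    rw [map_smul, hx.1, smul_zero]
  · change X.gproj n (h • x) = 0
    rw [gproj_H_smul, hx.2 n hn, smul_zero]
  · rw [gproj_ofVbar_smul, hx.2 _ (by omega), smul_zero]

/-- Truncating a sum of terms v·x to degrees n ≥ d replaces x by its components of degree n + 1 > d,
and these lie in `topSub`. -/
theorem mem_vSpan_of_mem_vSub {z : X} (hz : z ∈ vSub X) (h0 : ∀ n < d, X.gproj n z = 0) :
    z ∈ vSpan ((topSpan d p).restrictScalars k) := by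
  obtain ⟨s, -, hs⟩ := exists_sum_gradedProj X.internal
  let τ : X →ₗ[k] X := ∑ n ∈ s with d ≤ n, X.gproj n
  have hτ : τ z = z := by
    conv_rhs => rw [← hs z]
    rw [LinearMap.sum_apply, Finset.sum_filter]
    refine Finset.sum_congr rfl fun n _ => ?_
    split_ifs with h
    · rfl
    · exact (h0 n (not_le.1 h)).symm
  have : vSub X ≤ (vSpan ((topSpan d p).restrictScalars k)).comap τ := vSub_le fun v x => by
    rw [Submodule.mem_comap, LinearMap.sum_apply]
    refine Submodule.sum_mem _ fun n hn => ?_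
    rw [gproj_ofV_smul]
    refine ofV_smul_mem_vSpan v (topSub_le_topSpan (mem_topSub_of_gproj hp fun m hm => ?_))
    rw [gradedProj_gradedProj, if_neg]
    have := (Finset.mem_filter.1 hn).2
    omega
  rw [← hτ]
  exact this hz

/-- The graded submodule generated by `topSub d p`. -/
def topMod : SmallGrMod k R V := X.sub (topSpan d p) (gproj_mem_topSpan hp)

theorem mem_vSub_topMod {x : topMod hp}
    (hx : (x : topSpan d p).1 ∈ vSpan ((topSpan d p).restrictScalars k)) :
    x ∈ vSub (topMod hp) := by
  have : vSpan ((topSpan d p).restrictScalars k) ≤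
      (vSub (topMod hp)).map ((topSpan d p).subtype.restrictScalars k) := vSpan_le fun v y hy =>
    ⟨_, ofV_smul_mem_vSub (X := topMod hp) v (⟨y, hy⟩ : topSpan d p), rfl⟩
  obtain ⟨y, hy, hyx⟩ := this hx
  have h : y = x := Subtype.ext hyx
  exact h ▸ hy

/-- The components of low degree of `topMod`. -/
theorem topMod_deg_le_vSub (b : Module.Basis ι k V) (hR : IsQuasitriangular R) {n : ℤ}
    (hn : n < d ∨ n = d ∧ ∀ x ∈ X.deg d, p x = 0 → x ∈ vSub X) :
    (topMod hp).deg n ≤ vSub (topMod hp) := by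
  intro x hx
  refine mem_vSub_topMod hp ?_
  obtain ⟨y, hy, w, hw, hyw⟩ := Submodule.mem_sup.1 (topSpan_le hp b hR (x : topSpan d p).2)
  have hx' : X.gproj n (x : topSpan d p).1 = (x : topSpan d p).1 :=
    (gradedProj_of_mem X.internal hx n).trans (if_pos rfl)
  rw [← hx', ← hyw, map_add]
  refine Submodule.add_mem _ ?_ ?_
  · rcases hn with hn | ⟨rfl, hn⟩
    · rw [hy.2 n hn]; exact Submodule.zero_mem _
    · have h1 := gproj_mem_topSub hp hy n
      exact mem_vSpan_of_mem_vSub hp (hn _ (gradedProj_mem _ _ _) h1.1) h1.2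
  · have : vSpan ((topSpan d p).restrictScalars k) ≤
        (vSpan ((topSpan d p).restrictScalars k)).comap (X.gproj n) := vSpan_le fun v x hx => by
      rw [Submodule.mem_comap, gproj_ofV_smul]
      exact ofV_smul_mem_vSpan v (gproj_mem_topSpan hp x hx _)
    exact this hw

variable (hps : Function.Surjective p) (hpV : ∀ x ∈ vSub X, p x = 0)

omit [Module k S] [IsScalarTower k H S] in
theorem exists_homogeneous_section [IsSemisimpleRing H] (hps : Function.Surjective p) :
    ∃ f : S →ₗ[H] X, (∀ s, p (f s) = s) ∧ ∀ s, f s ∈ X.deg d := by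
  have := Module.projective_of_isSemisimpleRing H S
  obtain ⟨σ, hσ⟩ := Module.projective_lifting_property p LinearMap.id hps
  refine ⟨{ toFun := fun s => X.gproj d (σ s), map_add' := fun s t => by rw [map_add, map_add],
            map_smul' := fun h s => by rw [map_smul, gproj_H_smul]; rfl }, fun s => ?_,
    fun s => gradedProj_mem _ _ _⟩
  exact (hp _).trans (LinearMap.congr_fun hσ s)

variable [Module.Finite k S]

include hpV in
-- For Y the generated submodule, S ⊕ Y/VY → X/VX is injective: p detects the summand S, and what
-- remains is represented by an element of `topSub` in VX, which lies in VY by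
-- `mem_vSpan_of_mem_vSub`.
theorem finrank_add_finrank_topMod_le (b : Module.Basis ι k V) (hR : IsQuasitriangular R)
    (f : S →ₗ[H] X) (hpf : ∀ s, p (f s) = s) :
    Module.finrank k S + Module.finrank k (topMod hp ⧸ vSub (topMod hp)) ≤
      Module.finrank k (X ⧸ vSub X) := by
  have hι : vSub (topMod hp) ≤ (vSub X).comap ((topSpan d p).subtype.restrictScalars k) :=
    fun x hx => map_mem_vSub (X := topMod hp) (topSpan d p).subtype hx
  let G : S × (topMod hp ⧸ vSub (topMod hp)) →ₗ[k] X ⧸ vSub X :=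
    ((vSub X).mkQ ∘ₗ f.restrictScalars k).coprod ((vSub (topMod hp)).mapQ (vSub X) _ hι)
  rw [← Module.finrank_prod]
  refine LinearMap.finrank_le_finrank_of_injective (f := G) ?_
  refine (injective_iff_map_eq_zero G).2 ?_
  rintro ⟨s, z⟩ h
  obtain ⟨x, rfl⟩ := (vSub (topMod hp)).mkQ_surjective z
  obtain ⟨y, hy, w, hw, hyw⟩ := Submodule.mem_sup.1 (topSpan_le hp b hR (x : topSpan d p).2)
  have h1 : f s + (x : topSpan d p).1 ∈ vSub X := (Submodule.Quotient.mk_eq_zero _).1 h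
  have hwX := vSpan_le_vSub _ hw
  have hs : s = 0 := by
    have := hpV _ h1
    rwa [map_add, hpf, ← hyw, map_add, hy.1, hpV w hwX, add_zero, add_zero] at this
  rw [hs, map_zero, zero_add] at h1
  have hyX : y ∈ vSub X := by
    rw [← hyw] at h1
    simpa using Submodule.sub_mem _ h1 hwX
  have h2 : x ∈ vSub (topMod hp) := mem_vSub_topMod hp <| by
    rw [← hyw]
    exact Submodule.add_mem _ (mem_vSpan_of_mem_vSub hp hyX hy.2) hw
  exact Prod.ext hs ((Submodule.Quotient.mk_eq_zero _).2 h2)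

variable [Module.Finite k (NicholsV k R V)]

/-- V̄ sends f(S) above degree d, hence to zero in the quotient, so f induces a map from the
standard module. It is onto modulo V: components below d lie in VX, components in degree d agree
with their image under f ∘ p up to `topSub`, and higher ones vanish in the quotient. Nakayama's
lemma concludes. -/
theorem exists_surjective_stdMod (b : Module.Basis ι k V) (hR : IsQuasitriangular R)
    (hlow : ∀ n < d, X.deg n ≤ vSub X)
    (f : S →ₗ[H] X) (hpf : ∀ s, p (f s) = s) (hfd : ∀ s, f s ∈ X.deg d) :
    ∃ F : (stdMod b S hR).shift d ⟶ X.quot (topSpan d p) (gproj_mem_topSpan hp),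
      Function.Surjective (GrMod.Hom.lin F) := by
  let Q := X.quot (topSpan d p) (gproj_mem_topSpan hp)
  let π : X ⟶ Q := X.quotπ (topSpan d p) (gproj_mem_topSpan hp)
  have hπ : ∀ x ∈ topSub d p, GrMod.Hom.lin π x = 0 := fun x hx =>
    (Submodule.Quotient.mk_eq_zero _).2 (topSub_le_topSpan hx)
  obtain ⟨F, hF⟩ := exists_stdMod_desc b S hR (Y := Q) (d := d)
    ((linH (GrMod.Hom.lin π) ∘ₗ f).restrictScalars k)
    (fun h s => map_smul (linH (GrMod.Hom.lin π) ∘ₗ f) h s)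
    (fun v s => (map_smul (GrMod.Hom.lin π) _ _).symm.trans (hπ _ (mem_topSub_of_gproj hp
      fun n hn => by
        rw [gproj_ofVbar_smul, gradedProj_of_mem X.internal (hfd s), if_neg (by omega), smul_zero])))
    (fun s => GrMod.lin_mem π (hfd s))
  refine ⟨F, ?_⟩
  have key : ∀ x, GrMod.Hom.lin π x ∈
      (LinearMap.range (GrMod.Hom.lin F)).restrictScalars k ⊔ vSub Q := by
    intro x
    induction x using graded_induction X.internal with
    | add x y hx hy => rw [map_add]; exact Submodule.add_mem _ hx hy
    | hom n x hx =>
      have hx' : ∀ m, m ≠ n → X.gproj m x = 0 := fun m hm =>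
        (gradedProj_of_mem X.internal hx m).trans (if_neg hm.symm)
      rcases lt_trichotomy n d with h | rfl | h
      · exact Submodule.mem_sup_right (map_mem_vSub (GrMod.Hom.lin π) (hlow n h hx))
      · refine Submodule.mem_sup_left ⟨stdEmb b S hR (p x), (hF (p x)).trans ?_⟩
        have h1 : f (p x) - x ∈ topSub n p := by
          refine ⟨by rw [map_sub, hpf, sub_self], fun m hm => ?_⟩
          rw [map_sub, hx' m hm.ne, gradedProj_of_mem X.internal (hfd _), if_neg hm.ne', sub_zero]
        have h2 := hπ _ h1
        rw [map_sub, sub_eq_zero] at h2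
        exact h2
      · rw [hπ x (mem_topSub_of_gproj hp fun m hm => hx' m (by omega))]
        exact Submodule.zero_mem _
  have h := eq_top_of_sup_vSub_eq_top (X := Q)
    (P := (LinearMap.range (GrMod.Hom.lin F)).restrictScalars k)
    (fun v x hx => Submodule.smul_mem (LinearMap.range (GrMod.Hom.lin F)) (ofV k R V v) hx)
    (eq_top_iff.2 fun z _ => by
      obtain ⟨x, rfl⟩ := (topSpan d p).mkQ_surjective z
      exact key x)
  exact LinearMap.range_eq_top.1 ((Submodule.restrictScalars_eq_top_iff k _ _).1 h)

include hpV hps in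
/-- The top layer of a free module is a proper standard module, and the rest is free. -/
theorem isVFree_topMod [IsSemisimpleRing H] (b : Module.Basis ι k V) (hR : IsQuasitriangular R)
    (hX : IsVFree X) (hlow : ∀ n < d, X.deg n ≤ vSub X) :
    IsVFree (topMod hp) ∧ ∃ q : X ⟶ (stdMod b S hR).shift d,
      Function.Surjective (GrMod.Hom.lin q) ∧ LinearMap.ker (GrMod.Hom.lin q) = topSpan d p := by
  obtain ⟨f, hpf, hfd⟩ := exists_homogeneous_section hp hps
  obtain ⟨F, hF⟩ := exists_surjective_stdMod hp b hR hlow f hpf hfd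
  let Q := X.quot (topSpan d p) (gproj_mem_topSpan hp)
  have h1 : Module.finrank k Q + Module.finrank k (topMod hp) = Module.finrank k X :=
    X.finrank_quot_add_finrank_sub _ (gproj_mem_topSpan hp)
  have h2 := Nat.mul_le_mul_left (Module.finrank k (NicholsV k R V))
    (finrank_add_finrank_topMod_le hp hpV b hR f hpf)
  rw [mul_add] at h2
  have h3 : Module.finrank k Q ≤ Module.finrank k ((stdMod b S hR).shift d) :=
    LinearMap.finrank_le_finrank_of_surjective (f := (GrMod.Hom.lin F).restrictScalars k) hF
  have h4 : Module.finrank k ((stdMod b S hR).shift d) = _ := finrank_stdMod b S hR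
  have h5 := finrank_le_mul_finrank_quotient (topMod hp)
  have h6 : _ ≤ _ := hX
  -- With β = dim 𝔅(V) and Y the generated submodule, β·dim S + β·dim Y/VY ≤ β·dim X/VX ≤ dim X =
  -- dim X/Y + dim Y ≤ β·dim S + β·dim Y/VY. Equality throughout gives freeness of Y and dim X/Y =
  -- β·dim S.
  refine ⟨by rw [IsVFree]; omega, ?_⟩
  have h7 : Module.finrank k ((stdMod b S hR).shift d) = Module.finrank k Q := by omega
  have hFi : Function.Injective (GrMod.Hom.lin F) :=
    (LinearMap.injective_iff_surjective_of_finrank_eq_finrank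
      (f := (GrMod.Hom.lin F).restrictScalars k) h7).2 hF
  let e := GrMod.isoOfBijective F ⟨hFi, hF⟩
  have hinv : ∀ z, GrMod.Hom.lin F (GrMod.Hom.lin e.inv z) = z := fun z =>
    congrArg (fun g => GrMod.Hom.lin g z) e.inv_hom_id
  refine ⟨X.quotπ (topSpan d p) (gproj_mem_topSpan hp) ≫ e.inv, fun z => ?_, ?_⟩
  · obtain ⟨x, hx⟩ := (topSpan d p).mkQ_surjective (GrMod.Hom.lin F z)
    exact ⟨x, hFi ((hinv _).trans hx)⟩
  · ext x
    rw [LinearMap.mem_ker, GrMod.lin_comp]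
    constructor
    · intro h
      have := hinv (GrMod.Hom.lin (X.quotπ (topSpan d p) (gproj_mem_topSpan hp)) x)
      rw [h, map_zero] at this
      exact (Submodule.Quotient.mk_eq_zero _).1 this.symm
    · intro h
      have : GrMod.Hom.lin (X.quotπ (topSpan d p) (gproj_mem_topSpan hp)) x = 0 :=
        (Submodule.Quotient.mk_eq_zero _).2 h
      rw [this, map_zero]

end TopLayer

namespace GrMod

variable {k : Type u} [Field k] {A : Type u} [Ring A] [Algebra k A] {𝒜 : ℤ → Submodule k A}

/-- A quotient of a projective module has a projective cover, which is a retract. -/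
theorem exists_isProjectiveCover {P L : GrMod k 𝒜} [Projective P] (π : P ⟶ L)
    (hπ : Function.Surjective (Hom.lin π)) :
    ∃ (Q : GrMod k 𝒜) (i : Q ⟶ P) (r : P ⟶ Q), i ≫ r = 𝟙 Q ∧ r ≫ i ≫ π = π ∧
      IsProjectiveCover (i ≫ π) := by
  have : IsArtinian A P := isArtinian_of_tower k inferInstance
  -- Minimality among the graded submodules that still map onto L makes the restriction of π to N an
  -- essential epimorphism.
  obtain ⟨N, ⟨hN, hNs⟩, hmin⟩ := exists_minimal_of_wellFoundedLT
    (fun N : Submodule A P => (∀ x ∈ N, ∀ n, P.gproj n x ∈ N) ∧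
      ∀ y, ∃ x ∈ N, Hom.lin π x = y)
    ⟨⊤, fun _ _ _ => trivial, fun y => (hπ y).imp fun x hx => ⟨trivial, hx⟩⟩
  let i : P.sub N hN ⟶ P := P.subι N hN
  have hess : ∀ {Y : GrMod k 𝒜} (g : Y ⟶ P.sub N hN),
      Function.Surjective (Hom.lin (g ≫ i ≫ π)) → Function.Surjective (Hom.lin g) := by
    intro Y g hg z
    have h1 : N ≤ LinearMap.range (Hom.lin (g ≫ i)) := by
      refine hmin ⟨gproj_mem_range (g ≫ i), fun y => ?_⟩ ?_
      · obtain ⟨x, hx⟩ := hg y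
        exact ⟨_, ⟨x, rfl⟩, hx⟩
      · rintro _ ⟨x, rfl⟩
        exact (show N from Hom.lin g x).2
    obtain ⟨y, hy⟩ := h1 (z : N).2
    exact ⟨y, Subtype.ext hy⟩
  have hiπ : Function.Surjective (Hom.lin (i ≫ π)) := fun y => by
    obtain ⟨x, hx, rfl⟩ := hNs y
    exact ⟨(⟨x, hx⟩ : N), rfl⟩
  have hepi : Epi (i ≫ π) := (epi_iff_surjective _).2 hiπ
  -- The composite of i with this lift is onto by essentiality, hence bijective by dimension.
  -- Correcting r by its inverse exhibits N as a direct summand of P.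
  let r : P ⟶ P.sub N hN := Projective.factorThru π (i ≫ π)
  have hr : r ≫ i ≫ π = π := Projective.factorThru_comp _ _
  have hφs : Function.Surjective (Hom.lin (i ≫ r)) :=
    hess (i ≫ r) (by rw [Category.assoc, hr]; exact hiπ)
  have hφi : Function.Injective (Hom.lin (i ≫ r)) :=
    LinearMap.injective_iff_surjective (f := (Hom.lin (i ≫ r)).restrictScalars k).2 hφs
  let e := isoOfBijective (i ≫ r) ⟨hφi, hφs⟩
  have he : (i ≫ r) ≫ e.inv = 𝟙 _ := e.hom_inv_id
  have he' : e.inv ≫ i ≫ π = i ≫ π := by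
    rw [Iso.inv_comp_eq]
    change _ = (i ≫ r) ≫ _
    rw [Category.assoc, hr]
  have hir : i ≫ r ≫ e.inv = 𝟙 _ := (Category.assoc _ _ _).symm.trans he
  refine ⟨P.sub N hN, i, r ≫ e.inv, hir, by rw [Category.assoc, he', hr], ?_, hepi, ?_⟩
  · exact (Retract.mk i (r ≫ e.inv) hir).projective
  · exact fun Y g hg => (epi_iff_surjective _).2 (hess g ((epi_iff_surjective _).1 hg))

end GrMod

/-! ### Filtrations by proper standard modules. -/

section Filtration

variable {k : Type u} {H : Type u} [Field k] [Ring H] [HopfAlgebra k H] {R : H ⊗[k] H}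
  {V : Type u} [AddCommGroup V] [Module k V] [Module H V] [IsScalarTower k H V]
  {ι : Type} [Fintype ι] [DecidableEq ι] (b : Module.Basis ι k V) (hR : IsQuasitriangular R)
  {Λ : Type v} (S : Λ → Type u) [∀ l, AddCommGroup (S l)] [∀ l, Module k (S l)]
  [∀ l, Module H (S l)] [∀ l, IsScalarTower k H (S l)]

omit [∀ l, Module k (S l)] [∀ l, IsScalarTower k H (S l)] in
include b hR in
-- The vectors whose degree-n component lies in VX form a proper H-submodule. A simple quotient by a
-- maximal submodule above it sees only degree n and kills VX.
theorem exists_simple_quotient (hcomplete : ∀ (N : Type u) [AddCommGroup N] [Module H N],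
      IsSimpleModule H N → ∃ l, Nonempty (N ≃ₗ[H] S l)) {X : SmallGrMod k R V} {n : ℤ}
    (hn : ¬ X.deg n ≤ vSub X) :
    ∃ (l : Λ) (p : X →ₗ[H] S l), (∀ x, p (X.gproj n x) = p x) ∧ (∀ x ∈ vSub X, p x = 0) ∧
      Function.Surjective p := by
  let K : Submodule H X :=
    { carrier := {x | X.gproj n x ∈ vSub X}
      add_mem' := fun {x y} hx hy => by
        rw [Set.mem_ofPred_eq, map_add]; exact Submodule.add_mem _ hx hy
      zero_mem' := by rw [Set.mem_ofPred_eq, map_zero]; exact Submodule.zero_mem _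
      smul_mem' := fun h x hx => by
        rw [Set.mem_ofPred_eq, gproj_H_smul]; exact H_smul_mem_vSub b hR h hx }
  have hK : K ≠ ⊤ := fun h => hn fun x hx => by
    have h1 : X.gproj n x ∈ vSub X := h.ge (Submodule.mem_top (x := x))
    rwa [gradedProj_of_mem X.internal hx, if_pos rfl] at h1
  have : IsNoetherian H X := isNoetherian_of_tower k inferInstance
  obtain ⟨K', hK', hKK'⟩ := (eq_top_or_exists_le_coatom K).resolve_left hK
  obtain ⟨l, ⟨e⟩⟩ := hcomplete (X ⧸ K') (isSimpleModule_iff_isCoatom.2 hK')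
  have hp : ∀ x ∈ K, e (K'.mkQ x) = 0 := fun x hx => by
    rw [Submodule.mkQ_apply, (Submodule.Quotient.mk_eq_zero _).2 (hKK' hx), map_zero]
  refine ⟨l, e.toLinearMap ∘ₗ K'.mkQ, fun x => ?_, fun x hx => hp x (gproj_mem_vSub hx n),
    e.surjective.comp K'.mkQ_surjective⟩
  rw [← sub_eq_zero, ← map_sub]
  refine hp _ ?_
  change X.gproj n (X.gproj n x - x) ∈ vSub X
  rw [map_sub, gradedProj_gradedProj, if_pos rfl, sub_self]
  exact Submodule.zero_mem _

/-- By Nakayama's lemma a nonzero X differs from VX, and X has finitely many nonzero components. -/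
theorem exists_min_degree [Module.Finite k (NicholsV k R V)] (X : SmallGrMod k R V)
    [Nontrivial X] : ∃ d, ¬ X.deg d ≤ vSub X ∧ ∀ n < d, X.deg n ≤ vSub X := by
  classical
  obtain ⟨s, hs, hsum⟩ := exists_sum_gradedProj X.internal
  have hne : (s.filter fun n => ¬ X.deg n ≤ vSub X).Nonempty := by
    by_contra h
    rw [Finset.not_nonempty_iff_eq_empty, Finset.filter_eq_empty_iff] at h
    have h1 : (⊥ : Submodule k X) = ⊤ := eq_top_of_sup_vSub_eq_top
      (fun v x hx => by rw [(Submodule.mem_bot k).1 hx, smul_zero]; exact Submodule.zero_mem _)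
      (by
        rw [bot_sup_eq, eq_top_iff]
        intro x _
        rw [← hsum x]
        exact Submodule.sum_mem _ fun n hn => not_not.1 (h hn) (gradedProj_mem _ n x))
    exact bot_ne_top h1
  refine ⟨_, (Finset.mem_filter.1 (Finset.min'_mem _ hne)).2, fun n hn => ?_⟩
  by_contra h
  by_cases hns : n ∈ s
  · exact absurd (Finset.min'_le _ n (Finset.mem_filter.2 ⟨hns, h⟩)) (not_le.2 hn)
  · exact h (by rw [hs n hns]; exact bot_le)

/-- Induction on the dimension: at the lowest degree of X/VX a standard quotient splits off, and its
kernel is again free with the components of low degree still in the image of V. -/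
theorem hasFiltration_of_isVFree [IsSemisimpleRing H] [Module.Finite k (NicholsV k R V)]
    [∀ l, Module.Finite k (S l)] [∀ l, IsSimpleModule H (S l)]
    (hcomplete : ∀ (N : Type u) [AddCommGroup N] [Module H N],
      IsSimpleModule H N → ∃ l, Nonempty (N ≃ₗ[H] S l)) {d : ℤ} (X : SmallGrMod k R V)
    (hX : IsVFree X) (hlow : ∀ n ≤ d, X.deg n ≤ vSub X) :
    HasFiltration (fun w : Weight Λ => (stdMod b (S w.wt) hR).shift w.deg) (fun w => d < w.deg)
      X := by
  obtain ⟨m, hm⟩ : ∃ m, Module.finrank k X ≤ m := ⟨_, le_rfl⟩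
  induction m generalizing X with
  | zero =>
    have : Subsingleton X := Module.finrank_zero_iff.1 (Nat.le_zero.1 hm)
    exact HasFiltration.zero X (X.isZero_of_subsingleton)
  | succ m ih =>
    rcases subsingleton_or_nontrivial X with _ | _
    · exact HasFiltration.zero X (X.isZero_of_subsingleton)
    obtain ⟨d₀, hd₀, hlow₀⟩ := exists_min_degree X
    have hdd : d < d₀ := by
      by_contra h
      exact hd₀ (hlow d₀ (not_lt.1 h))
    obtain ⟨l, p, hp, hpV, hps⟩ := exists_simple_quotient b hR S hcomplete hd₀
    obtain ⟨hfree, q, hq, hker⟩ := isVFree_topMod hp hps hpV b hR hX hlow₀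
    -- The standard quotient is nonzero, so the dimension drops.
    have hne : (topSpan d₀ p).restrictScalars k ≠ ⊤ := by
      intro h
      have := IsSimpleModule.nontrivial H (S l)
      obtain ⟨s, hs⟩ := exists_ne (0 : S l)
      obtain ⟨x, hx⟩ := hq (stdEmb b (S l) hR s)
      have hx0 : x ∈ LinearMap.ker (GrMod.Hom.lin q) := by
        rw [hker]; exact h.ge (Submodule.mem_top (x := x))
      have h0 : stdEmb b (S l) hR s = 0 := hx.symm.trans hx0
      exact hs (stdEmb_injective b (S l) hR (h0.trans (map_zero _).symm))
    have hlt : Module.finrank k (topMod hp) < Module.finrank k X := Submodule.finrank_lt hne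
    have hzero : X.subι (topSpan d₀ p) (gproj_mem_topSpan hp) ≫ q = 0 :=
      GrMod.hom_ext fun x => hker.ge (x : topSpan d₀ p).2
    refine HasFiltration.step (ShortComplex.mk (X.subι (topSpan d₀ p) (gproj_mem_topSpan hp)) q
      hzero) (GrMod.shortExact_mk _ _ _ Subtype.val_injective hq
        fun x hx => ⟨(⟨x, hker.le hx⟩ : topSpan d₀ p), rfl⟩)
      (ih (topMod hp) hfree (fun n hn => topMod_deg_le_vSub hp b hR (Or.inl (by omega)))
        (by omega)) ⟨l, d₀⟩ hdd (Iso.refl _)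

end Filtration

/-! ### Projective covers of the heads. -/

section Cover

variable {k : Type u} {H : Type u} [Field k] [Ring H] [HopfAlgebra k H] {R : H ⊗[k] H}
  {V : Type u} [AddCommGroup V] [Module k V] [Module H V] [IsScalarTower k H V]
  {ι : Type} [Fintype ι] [DecidableEq ι] (b : Module.Basis ι k V) (hR : IsQuasitriangular R)
  [Module.Finite k (NicholsV k R V)]

variable {b} in
/-- The components of an induced module modulo `V`. -/
theorem PosMod.deg_le_map_emb_sup_vSub (N : PosMod R b) (n : ℤ) :
    (N.ind hR).deg n ≤ (N.deg n).map (N.emb hR) ⊔ vSub (N.ind hR) := by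
  intro x hx
  obtain ⟨_, ⟨m, rfl⟩, w, hw, hxw⟩ := Submodule.mem_sup.1
    ((N.range_emb_sup_vSub hR).ge (Submodule.mem_top (x := x)))
  have h1 := map_gradedProj N.internal (N.ind hR).internal (N.emb hR) 0
    (fun n m hm => by rw [zero_add]; exact N.emb_mem hR hm) n m
  rw [zero_add] at h1
  have h2 : (N.ind hR).gproj n x = x := (gradedProj_of_mem _ hx n).trans (if_pos rfl)
  rw [← h2, ← hxw, map_add]
  exact Submodule.add_mem_sup ⟨_, gradedProj_mem N.internal n m, h1⟩ (gproj_mem_vSub hw n)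

variable (S : Type u) [AddCommGroup S] [Module k S] [Module H S] [IsScalarTower k H S]
  [Module.Finite k S] [Module.Finite k (Nichols (repVbar k V) (coactVbar k R V))] (d : ℤ)

omit [Module.Finite k (Nichols (repVbar k V) (coactVbar k R V))] in
theorem stdHead_shift_deg_of_lt {d n : ℤ} (hn : d < n) :
    ((stdHead b S hR).shift d).deg n = ⊥ :=
  stdHead_deg_of_pos b S hR (sub_pos.2 hn)

/-- The graded module generated freely by an `H`-module in degree `d`. -/
def freeSingle : SmallGrMod k R V :=
  freeMod (D := fun n => if n = d then (⊤ : Submodule k S) else ⊥) b (isInternal_single k S d)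
    (fun h n w hw => by
      by_cases hn : n = d
      · rw [if_pos hn]; trivial
      · rw [if_neg hn] at hw ⊢
        rw [(Submodule.mem_bot k).1 hw, smul_zero]; exact Submodule.zero_mem _) hR

/-- The inclusion of the generators. -/
def freeSingleGen : S →ₗ[k] freeSingle b hR S d := freeGen b _ _ hR

theorem exists_freeSingle_desc {Y : SmallGrMod k R V} (f : S →ₗ[H] Y) (hf : ∀ s, f s ∈ Y.deg d) :
    ∃ F : freeSingle b hR S d ⟶ Y, ∀ s, GrMod.Hom.lin F (freeSingleGen b hR S d s) = f s :=
  exists_freeMod_desc _ _ hR f fun n w hw => by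
    by_cases hn : n = d
    · exact hn ▸ hf w
    · rw [if_neg hn] at hw
      rw [(Submodule.mem_bot k).1 hw, map_zero]; exact Submodule.zero_mem _

theorem freeSingleGen_mem (s : S) : freeSingleGen b hR S d s ∈ (freeSingle b hR S d).deg d :=
  freeGen_mem _ _ hR (by rw [if_pos rfl]; trivial)

omit [Module H S] [IsScalarTower k H S] [Module.Finite k S] [Module.Finite k (NicholsV k R V)]
  [Module.Finite k (Nichols (repVbar k V) (coactVbar k R V))] in
-- 𝔅(V̄) lives in nonnegative degrees, with the scalars in degree zero, so up to degree d only 1 ⊗ S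
-- in degree d is present.
theorem exists_one_tmul_of_mem_freeDeg {n : ℤ} (hn : n ≤ d)
    {m : Nichols (repVbar k V) (coactVbar k R V) ⊗[k] S}
    (hm : m ∈ freeDeg R V (fun n => if n = d then (⊤ : Submodule k S) else ⊥) n) :
    ∃ s : S, m = 1 ⊗ₜ[k] s ∧ (n < d → s = 0) := by
  induction hm using Submodule.span_induction with
  | zero => exact ⟨0, (TensorProduct.tmul_zero _ _).symm, fun _ => rfl⟩
  | add x y _ _ hx hy =>
    obtain ⟨s, rfl, hs⟩ := hx
    obtain ⟨t, rfl, ht⟩ := hy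
    exact ⟨s + t, (TensorProduct.tmul_add _ _ _).symm, fun h => by rw [hs h, ht h, add_zero]⟩
  | smul c x _ hx =>
    obtain ⟨s, rfl, hs⟩ := hx
    exact ⟨c • s, (TensorProduct.tmul_smul _ _ _).symm, fun h => by rw [hs h, smul_zero]⟩
  | mem z hz =>
    obtain ⟨j, i, t, w, ht, hw, hij, rfl⟩ := hz
    by_cases hi : i = d
    · obtain rfl : j = 0 := by omega
      rw [pow_zero] at ht
      obtain ⟨r, rfl⟩ := Submodule.mem_one.1 ht
      refine ⟨r • w, ?_, fun h => absurd h (by omega)⟩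
      rw [AlgHom.commutes, Algebra.algebraMap_eq_smul_one, TensorProduct.smul_tmul]
    · have hw' : w ∈ (if i = d then (⊤ : Submodule k S) else ⊥) := hw
      rw [if_neg hi] at hw'
      rw [(Submodule.mem_bot k).1 hw']
      exact ⟨0, by rw [TensorProduct.tmul_zero, TensorProduct.tmul_zero], fun _ => rfl⟩

theorem exists_sub_freeSingleGen_mem_vSub {n : ℤ} (hn : n ≤ d) {x : freeSingle b hR S d}
    (hx : x ∈ (freeSingle b hR S d).deg n) :
    ∃ s, x - freeSingleGen b hR S d s ∈ vSub (freeSingle b hR S d) ∧ (n < d → s = 0) := by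
  obtain ⟨_, ⟨m, hm, rfl⟩, w, hw, hxw⟩ := Submodule.mem_sup.1
    (PosMod.deg_le_map_emb_sup_vSub hR (freePos R b _ _) n hx)
  obtain ⟨s, rfl, hs⟩ := exists_one_tmul_of_mem_freeDeg S d hn hm
  exact ⟨s, (sub_eq_of_eq_add' hxw.symm : x - freeSingleGen b hR S d s = w) ▸ hw, hs⟩

/-- The projective cover of the head of a standard module. -/
theorem exists_isProjectiveCover_stdHead [IsSemisimpleRing H] [IsSimpleModule H S] :
    ∃ (P : SmallGrMod k R V) (π : P ⟶ (stdHead b S hR).shift d) (p : P →ₗ[H] S),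
      IsProjectiveCover π ∧ IsVFree P ∧ (∀ n < d, P.deg n ≤ vSub P) ∧
      (∀ x, headEmb b S hR (p x) = GrMod.Hom.lin π (P.gproj d x)) ∧
      Function.Surjective p ∧ (∀ x ∈ vSub P, p x = 0) ∧
      ∀ x ∈ P.deg d, p x = 0 → x ∈ vSub P := by
  have hmem : ∀ s, headEmb b S hR s ∈ ((stdHead b S hR).shift d).deg d := fun s => by
    change _ ∈ (stdHead b S hR).deg (d - d)
    rw [sub_self]
    exact headEmb_mem b S hR s
  -- The free module on S in degree d maps onto the head. The cover is a direct summand of it, which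
  -- makes it free over 𝔅(V).
  obtain ⟨F, hF⟩ := exists_freeSingle_desc b hR S d (Y := (stdHead b S hR).shift d)
    (headEmb b S hR) hmem
  have hinj := headEmb_injective b S hR
  have hFs : Function.Surjective (GrMod.Hom.lin F) := by
    refine LinearMap.surjective_of_ne_zero fun h => ?_
    have := IsSimpleModule.nontrivial H S
    obtain ⟨s, hs⟩ := exists_ne (0 : S)
    have h1 := (hF s).symm
    rw [h] at h1
    exact hs (hinj (h1.trans (map_zero _).symm))
  have : Projective (freeSingle b hR S d) := projective_freeMod _ _ hR
  obtain ⟨P, i, r, hir, hrπ, hcov⟩ := GrMod.exists_isProjectiveCover F hFs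
  have hri : ∀ x, GrMod.Hom.lin r (GrMod.Hom.lin i x) = x := fun x =>
    congrArg (fun f => GrMod.Hom.lin f x) hir
  have hrF : ∀ x, GrMod.Hom.lin (i ≫ F) (GrMod.Hom.lin r x) = GrMod.Hom.lin F x := fun x =>
    congrArg (fun f => GrMod.Hom.lin f x) hrπ
  have hπ : ∀ x, GrMod.Hom.lin (i ≫ F) (P.gproj d x) ∈ LinearMap.range (headEmb b S hR) := by
    intro x
    have h1 := GrMod.lin_mem (i ≫ F) (gradedProj_mem P.internal d x)
    change _ ∈ (stdHead b S hR).deg (d - d) at h1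
    rw [sub_self] at h1
    exact exists_headEmb_eq b S hR h1
  let e := LinearEquiv.ofInjective (headEmb b S hR) hinj
  -- p reads the degree-d component of the image in the head, where that component is S.
  let p : P →ₗ[H] S :=
    { toFun := fun x => e.symm ⟨_, hπ x⟩
      map_add' := fun x y => (congrArg e.symm (Subtype.ext
        ((congrArg (GrMod.Hom.lin (i ≫ F)) (map_add (P.gproj d) x y)).trans
          (map_add (GrMod.Hom.lin (i ≫ F)) _ _)))).trans (map_add e.symm _ _)
      map_smul' := fun h x => (congrArg e.symm (Subtype.ext
        ((congrArg (GrMod.Hom.lin (i ≫ F)) (gproj_H_smul P d h x)).trans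
          (map_smul (GrMod.Hom.lin (i ≫ F)) (ofH k R V h) _)))).trans (map_smul e.symm h _) }
  have hp : ∀ x, headEmb b S hR (p x) = GrMod.Hom.lin (i ≫ F) (P.gproj d x) := fun x =>
    congrArg Subtype.val (e.apply_symm_apply ⟨_, hπ x⟩)
  have hpr : ∀ s, p (GrMod.Hom.lin r (freeSingleGen b hR S d s)) = s := fun s => hinj (by
    rw [hp, ← GrMod.lin_gproj, gradedProj_of_mem _ (freeSingleGen_mem b hR S d s), if_pos rfl, hrF,
      hF]
    rfl)
  -- The degree-d part of v·x comes from the degree d + 1 part of x, and the head vanishes there.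
  have hpV : ∀ x ∈ vSub P, p x = 0 := fun x hx => by
    have : vSub P ≤ LinearMap.ker (p.restrictScalars k) := vSub_le fun v x => hinj (by
      rw [map_zero, LinearMap.restrictScalars_apply, hp, gproj_ofV_smul, map_smul,
        GrMod.lin_gproj]
      have h1 := gradedProj_mem ((stdHead b S hR).shift d).internal (d + 1)
        (GrMod.Hom.lin (i ≫ F) x)
      rw [stdHead_shift_deg_of_lt b hR S (lt_add_one d), Submodule.mem_bot] at h1
      rw [h1, smul_zero]
      rfl)
    exact this hx
  refine ⟨P, i ≫ F, p, hcov, (PosMod.isVFree_ind (freePos R b _ _) hR).of_retract i r hir,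
    fun n hn x hx => ?_, hp, fun s => ⟨_, hpr s⟩, hpV, fun x hx hx0 => ?_⟩
  · obtain ⟨s, hs, hs0⟩ := exists_sub_freeSingleGen_mem_vSub b hR S d hn.le (GrMod.lin_mem i hx)
    rw [hs0 hn, map_zero, sub_zero] at hs
    exact hri x ▸ map_mem_vSub (GrMod.Hom.lin r) hs
  -- In degree d every element is congruent modulo VP to the image of a generator s, and p recovers
  -- s.
  · obtain ⟨s, hs, -⟩ := exists_sub_freeSingleGen_mem_vSub b hR S d le_rfl (GrMod.lin_mem i hx)
    have h1 := map_mem_vSub (GrMod.Hom.lin r) hs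
    have h2 := hpV _ h1
    rw [map_sub, hri, map_sub, hx0, hpr, zero_sub, neg_eq_zero] at h2
    rwa [h2, map_zero, sub_zero, hri] at h1

end Cover

/-! ### The highest weight structure. -/

section HighestWeightStructure

/-- A semisimple ring has finitely many simple modules. -/
theorem finite_of_simple_modules {H : Type u} [Ring H] [IsSemisimpleRing H] {Λ : Type v}
    (S : Λ → Type u) [∀ l, AddCommGroup (S l)] [∀ l, Module H (S l)]
    [∀ l, IsSimpleModule H (S l)] (hnoniso : ∀ l m, Nonempty (S l ≃ₗ[H] S m) → l = m) :
    Finite Λ := by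
  have hT : ∀ l, ∃ T : Submodule H H, Nonempty (S l ≃ₗ[H] T) := fun l => by
    have := IsSimpleModule.nontrivial H (S l)
    have := Module.projective_of_isSemisimpleRing H (S l)
    obtain ⟨s, hs⟩ := exists_ne (0 : S l)
    obtain ⟨σ, hσ⟩ := Module.projective_lifting_property (LinearMap.toSpanSingleton H (S l) s)
      LinearMap.id (IsSimpleModule.toSpanSingleton_surjective H hs)
    exact ⟨_, ⟨LinearEquiv.ofInjective σ
      (Function.LeftInverse.injective (g := LinearMap.toSpanSingleton H (S l) s)
        fun x => LinearMap.congr_fun hσ x)⟩⟩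
  choose T hT using hT
  have e := fun l => (hT l).some
  have hTs : ∀ l, IsSimpleModule H (T l) := fun l => IsSimpleModule.congr (e l).symm
  -- Each simple module is isomorphic to a left ideal by projectivity, and it is determined by the
  -- isotypic component of H that this ideal generates; there are finitely many such components.
  refine Finite.of_injective (β := isotypicComponents H H)
    (fun l => ⟨isotypicComponent H H (T l), T l, hTs l, rfl⟩) fun l m hlm => ?_
  have h1 : isotypicComponent H H (T l) = isotypicComponent H H (T m) := congrArg Subtype.val hlm
  have h2 : T l ≤ isotypicComponent H H (T m) := h1 ▸ Submodule.le_isotypicComponent (T l)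
  obtain ⟨f⟩ := isIsotypicOfType_submodule_iff.1 (.isotypicComponent H H (T m)) (T l) h2
  exact hnoniso l m ⟨(e l).trans (f.trans (e m).symm)⟩

theorem Weight.finite_Icc {Λ : Type v} [Finite Λ] (a b : Weight Λ) : (Set.Icc a b).Finite := by
  have hle : ∀ {a b : Weight Λ}, a ≤ b → a.deg ≤ b.deg := fun h =>
    h.elim (fun h => (congrArg Weight.deg h).le) le_of_lt
  refine Set.Finite.of_finite_image (f := fun w => (w.wt, w.deg))
    ((Set.finite_univ.prod (Set.finite_Icc a.deg b.deg)).subset ?_)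
    fun x _ y _ h => Weight.ext (congrArg Prod.fst h) (congrArg Prod.snd h)
  rintro _ ⟨w, hw, rfl⟩
  exact ⟨trivial, hle hw.1, hle hw.2⟩

variable {k : Type u} {H : Type u} [Field k] [Ring H] [HopfAlgebra k H] {R : H ⊗[k] H}
  {V : Type u} [AddCommGroup V] [Module k V] [Module H V] [IsScalarTower k H V]
  {ι : Type} [Fintype ι] [DecidableEq ι] (b : Module.Basis ι k V) (hR : IsQuasitriangular R)
  [Module.Finite k (NicholsV k R V)]

/-- The map from a standard module to its head is injective on the top degree. -/
theorem eq_zero_of_stdMod_shift (S : Type u) [AddCommGroup S] [Module k S] [Module H S]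
    [IsScalarTower k H S] [Module.Finite k S] [IsSimpleModule H S] {d : ℤ}
    {L : SmallGrMod k R V} (p : (stdMod b S hR).shift d ⟶ L) (hp : p ≠ 0) {n : ℤ} (hn : d ≤ n)
    {z : (stdMod b S hR).shift d} (hz : z ∈ ((stdMod b S hR).shift d).deg n)
    (hpz : GrMod.Hom.lin p z = 0) : z = 0 := by
  change z ∈ (stdMod b S hR).deg (n - d) at hz
  rcases hn.lt_or_eq with hn | rfl
  · rw [stdMod_deg_of_pos b S hR (sub_pos.2 hn)] at hz
    exact (Submodule.mem_bot k).1 hz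
  · rw [sub_self] at hz
    obtain ⟨s, rfl⟩ := stdMod_deg_zero_le b S hR hz
    let F : stdMod b S hR →ₗ[SmallU k R V] L :=
      GrMod.Hom.lin (M := (stdMod b S hR).shift d) p
    let g : S →ₗ[H] L := linH F ∘ₗ stdEmbH b S hR
    have hg : Function.Injective g := g.injective_or_eq_zero.resolve_right fun h0 =>
      hp (GrMod.hom_ext (PosMod.hom_ext (N := trivPos R b S) hR (F := F)
        (G := (0 : stdMod b S hR →ₗ[SmallU k R V] L)) fun s => LinearMap.congr_fun h0 s))
    rw [show s = 0 from hg (hpz.trans (map_zero g).symm)]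
    exact map_zero (stdEmb b S hR)

variable [Module.Finite k (Nichols (repVbar k V) (coactVbar k R V))]
  {Λ : Type v} (S : Λ → Type u) [∀ l, AddCommGroup (S l)] [∀ l, Module k (S l)]
  [∀ l, Module H (S l)] [∀ l, IsScalarTower k H (S l)] [∀ l, Module.Finite k (S l)]
  [∀ l, IsSimpleModule H (S l)] [IsSemisimpleRing H]
  (hcomplete : ∀ (N : Type u) [AddCommGroup N] [Module H N],
      IsSimpleModule H N → ∃ l, Nonempty (N ≃ₗ[H] S l))

include hcomplete in
-- The covering map kills `topSub`: its components below degree d vanish, the one in degree d is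
-- killed by p, and the head is zero above d. So it factors through the standard quotient. In the
-- kernel of that quotient all components up to degree d lie in the image of V, because p is
-- injective in degree d modulo V; this forces the weights of its filtration above w.
theorem exists_standard (w : Weight Λ) :
    ∃ (K P Q : SmallGrMod k R V) (i : K ⟶ (stdMod b (S w.wt) hR).shift w.deg)
      (p : (stdMod b (S w.wt) hR).shift w.deg ⟶ (stdHead b (S w.wt) hR).shift w.deg) (j : Q ⟶ P)
      (q : P ⟶ (stdMod b (S w.wt) hR).shift w.deg) (zero_ip : i ≫ p = 0) (zero_jq : j ≫ q = 0),
      (ShortComplex.mk i p zero_ip).ShortExact ∧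
      (∀ v : Weight Λ, IsSubquotient ((stdHead b (S v.wt) hR).shift v.deg) K → v < w) ∧
      (ShortComplex.mk j q zero_jq).ShortExact ∧
      HasFiltration (fun w : Weight Λ => (stdMod b (S w.wt) hR).shift w.deg) (fun v => w < v) Q ∧
      IsProjectiveCover (q ≫ p) := by
  obtain ⟨P, π, p, hcov, hfree, hlow, hp, hps, hpV, hpd⟩ :=
    exists_isProjectiveCover_stdHead b hR (S w.wt) w.deg
  have hinj := headEmb_injective b (S w.wt) hR
  have hpg : ∀ x, p (P.gproj w.deg x) = p x := fun x => hinj (by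
    rw [hp, hp, gradedProj_gradedProj, if_pos rfl])
  obtain ⟨hfreeQ, q, hq, hker⟩ := isVFree_topMod hpg hps hpV b hR hfree hlow
  have hqπ : LinearMap.ker (GrMod.Hom.lin q) ≤ LinearMap.ker (GrMod.Hom.lin π) := by
    rw [hker]
    refine Submodule.span_le.2 fun x hx => ?_
    obtain ⟨s, -, hs⟩ := exists_sum_gradedProj ((stdHead b (S w.wt) hR).shift w.deg).internal
    refine (hs _).symm.trans (Finset.sum_eq_zero fun n _ => ?_)
    rcases lt_trichotomy n w.deg with h | rfl | h
    · rw [← GrMod.lin_gproj, hx.2 n h, map_zero]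
    · rw [← GrMod.lin_gproj, ← hp, hx.1]
      exact map_zero (headEmb b (S w.wt) hR)
    · have h1 := gradedProj_mem ((stdHead b (S w.wt) hR).shift w.deg).internal n
        (GrMod.Hom.lin π x)
      rw [stdHead_shift_deg_of_lt b hR _ h] at h1
      exact (Submodule.mem_bot k).1 h1
  obtain ⟨p', rfl⟩ := GrMod.exists_desc hq π hqπ
  have hπs := (GrMod.epi_iff_surjective _).1 hcov.epi
  have hp's : Function.Surjective (GrMod.Hom.lin p') := fun y => by
    obtain ⟨x, rfl⟩ := hπs y
    exact ⟨GrMod.Hom.lin q x, rfl⟩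
  have hp'0 : p' ≠ 0 := by
    rintro rfl
    have := IsSimpleModule.nontrivial (SmallU k R V) ((stdHead b (S w.wt) hR).shift w.deg)
    obtain ⟨y, hy⟩ := exists_ne (0 : (stdHead b (S w.wt) hR).shift w.deg)
    obtain ⟨x, rfl⟩ := hp's y
    exact hy rfl
  let K := GrMod.sub _ _ (GrMod.gproj_mem_ker p')
  let i : K ⟶ _ := GrMod.subι _ _ (GrMod.gproj_mem_ker p')
  refine ⟨K, P, topMod hpg, i, p', P.subι _ (gproj_mem_topSpan hpg), q,
    GrMod.hom_ext fun x => (x : LinearMap.ker (GrMod.Hom.lin p')).2,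
    GrMod.hom_ext fun x => hker.ge (x : topSpan w.deg p).2,
    GrMod.shortExact_mk _ _ _ Subtype.val_injective hp's
      fun x hx => ⟨(⟨x, hx⟩ : LinearMap.ker (GrMod.Hom.lin p')), rfl⟩,
    ?_, GrMod.shortExact_mk _ _ _ Subtype.val_injective hq
      fun x hx => ⟨(⟨x, hker.le hx⟩ : topSpan w.deg p), rfl⟩,
    hasFiltration_of_isVFree b hR S hcomplete _ hfreeQ fun n hn => topMod_deg_le_vSub hpg b hR
      (hn.lt_or_eq.imp_right fun h => ⟨h, hpd⟩), hcov⟩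
  rintro v ⟨Y, f, g, hf, hg⟩
  change v.deg < w.deg
  by_contra! hvw
  refine stdHead_deg_zero_ne_bot b (S v.wt) hR (eq_bot_iff.2 fun y hy => ?_)
  have hy' : y ∈ ((stdHead b (S v.wt) hR).shift v.deg).deg v.deg := by
    change y ∈ (stdHead b (S v.wt) hR).deg (v.deg - v.deg)
    rwa [sub_self]
  -- A top-degree vector of L(v) lifts to a homogeneous vector of the kernel of Δ(w) → L(w). That
  -- kernel is zero in degrees ≥ d, where Δ(w) has at most its generating copy of λ.
  obtain ⟨x, hx, rfl⟩ := GrMod.exists_mem_deg_of_surjective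
    ((GrMod.epi_iff_surjective g).1 hg) hy'
  have h1 : GrMod.Hom.lin i (GrMod.Hom.lin f x) = 0 :=
    eq_zero_of_stdMod_shift b hR (S w.wt) p' hp'0 hvw
      (GrMod.lin_mem i (GrMod.lin_mem f hx))
      (show GrMod.Hom.lin p' _ = 0 from (show LinearMap.ker (GrMod.Hom.lin p') from
        GrMod.Hom.lin f x).2)
  have h2 : GrMod.Hom.lin f x = 0 := Subtype.val_injective h1
  rw [show x = 0 from (GrMod.mono_iff_injective f).1 hf (h2.trans (map_zero _).symm), map_zero]
  exact Submodule.zero_mem _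

include hcomplete in
theorem isHighestWeightCategory_stdMod [Module.Finite k H]
    (hnoniso : ∀ l m, Nonempty (S l ≃ₗ[H] S m) → l = m) :
    IsHighestWeightCategory k (fun w : Weight Λ => (stdHead b (S w.wt) hR).shift w.deg)
      (fun w : Weight Λ => (stdMod b (S w.wt) hR).shift w.deg) where
  hasFiniteProducts := inferInstance
  hasKernels := inferInstance
  hasCokernels := inferInstance
  normalMono := inferInstance
  normalEpi := inferInstance
  finiteLength X := ⟨X.isArtinianObject, X.isNoetherianObject⟩
  finiteHom := GrMod.finite_hom
  enoughProjectives := enoughProjectives (b := b) hR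
  intervalFinite :=
    have := finite_of_simple_modules S hnoniso
    Weight.finite_Icc
  completeSimple := isCompleteSimple_stdHead b hR S hnoniso hcomplete
  standard := exists_standard b hR S hcomplete

end HighestWeightStructure

end

end QTDouble

theorem mainTheorem6 {k H : Type u} [Field k] [Ring H] [HopfAlgebra k H]
    (R : H ⊗[k] H) (hR : IsQuasitriangular R)
    (V : Type u) [AddCommGroup V] [Module k V] [Module H V] [IsScalarTower k H V]
    [Module.Finite k V]
    (hH : Module.Finite k H) (hV : Module.Finite k (NicholsV k R V))
    {Λ : Type v} (S : Λ → Type u) [∀ l, AddCommGroup (S l)] [∀ l, Module k (S l)]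
    [∀ l, Module H (S l)] [∀ l, IsScalarTower k H (S l)]
    (hsimple : ∀ l, IsSimpleModule H (S l))
    (hnoniso : ∀ l m, Nonempty (S l ≃ₗ[H] S m) → l = m)
    (hcomplete : ∀ (N : Type u) [AddCommGroup N] [Module H N], IsSimpleModule H N →
      ∃ l, Nonempty (N ≃ₗ[H] S l))
    (hsplit : ∀ (l : Λ) (f : S l →ₗ[H] S l), ∃ c : k, ∀ v, f v = c • v) :
    ∃ M L : Λ → SmallGrMod k R V,
      (∀ l, IsProperStandard k R V (S l) (M l)) ∧
      (∀ l, GrMod.IsHead (M l) (L l)) ∧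
      IsCompleteSimple (fun w : Weight Λ => (L w.wt).shift w.deg) ∧
      (IsSemisimpleRing H →
        IsHighestWeightCategory k (fun w : Weight Λ => (L w.wt).shift w.deg)
          (fun w : Weight Λ => (M w.wt).shift w.deg)) := by
  have (l : Λ) : Module.Finite k (S l) := finite_of_isSimpleModule (H := H) (S l)
  have b := Module.finBasis k V
  have := finite_nichols_Vbar b hR
  exact ⟨fun l => stdMod b (S l) hR, fun l => stdHead b (S l) hR,
    fun l => isProperStandard_stdMod b (S l) hR, fun l => isHead_stdHead b (S l) hR,
    isCompleteSimple_stdHead b hR S hnoniso hcomplete,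
    fun _ => isHighestWeightCategory_stdMod b hR S hcomplete hnoniso⟩
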